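/- **Theorem (asymptotic normality of the local-linear WLATE estimator).** *Data.* Let $(Y_i,X_i,Z_i,W_i)$, $i\ge 1$, be i.i.d., with outcome $Y_i\in\mathbb R$, treatment $X_i\in\{0,1\}$, real running variable $Z_i$ with cutoff $0$, and covariate $W_i$ in a finite set $\{w_1,\dots,w_m\}$. Put $\tilde W_i=(1\{W_i=w_1\},\dots,1\{W_i=w_m\})'$, $\pi_j=P(W_i=w_j)$, and let $\hat\pi_j$ be the sample frequencies. For $U\in\{Y,X\}$ let $\mu_U(z)$ be the vector with entries $E[U\mid Z=z,W=w_j]$, and let $\mu_{\tilde W}(z)=E[\tilde W\mid Z=z]$. Write $\mu_U^{\pm(r)}$ for the limits as $z\to0^\pm$ of the $r$-th derivatives, $\mu_U^\pm=\mu_U^{\pm(0)}$, and $\delta_U=\mu_U^+-\mu_U^-$. *Estimand.* Let $V=(V_1,\dots,V_K)$ be a finite list with each $V_v\in\{Y,X,\tilde W\}$, let $g$ be a known measurable function, and let $c=g(\mu_V^+,\mu_V^-,\pi)\in\mathbb R^m$ with $\mu_V^\pm=(\mu_{V_1}^\pm,\dots,\mu_{V_K}^\pm)$. Put $\tau_Y=c'\delta_Y$,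 $\tau_X=c'\delta_X$. The WLATE with weights $c$ is $\beta_\omega=\tau_Y/\tau_X$. *Estimator.* Let $k$ be a kernel, $h_n$ a bandwidth, $k_h^+(z)=h^{-1}k(z/h)1\{z\ge0\}$, $k_h^-(z)=h^{-1}k(z/h)1\{z<0\}$, and $r_1(z)=(1,z)'$. For $U\in\{Y,X\}$ and $s\in\{+,-\}$ let $\hat\mu_U^s$ be the vector of the $m$ intercepts in a (measurable) minimizer $b$ of $\sum_{i\le n}(U_i-b'(r_1(Z_i)\otimes\tilde W_i))^2k_{h_n}^s(Z_i)$. Let $\hat\mu_{\tilde W}^s$ have as $j$-th entry the intercept of the corresponding weighted regression of $1\{W_i=w_j\}$ on $r_1(Z_i)$ alone. Put $\hat\delta_U=\hat\mu_U^+-\hat\mu_U^-$, $\hat c=g(\hat\mu_V^+,\hat\mu_V^-,\hat\pi)$ and $\hat\beta_\omega=\hat c'\hat\delta_Y/\hat c'\hat\delta_X$. *Bias and variance.* Let $X_1(h)$ and $S_2(h)$ be the matrices with rows $(r_1(Z_i/h)\otimes\tilde W_i)'$ and $(Z_i/h)^2\tilde W_i'$, $i\le n$. Put $K^s(h)=\mathrm{diag}(k_h^s(Z_i))$,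 $\Gamma_s=X_1(h)'K^s(h)X_1(h)/n$ and $\mathcal B^s=e_0'\Gamma_s^{-1}X_1(h)'K^s(h)S_2(h)/n$, where $e_0'=[I_m,0]$ selects the intercepts. For $U,U'\in\{Y,X\}$ let $\Sigma_{UU'}=\mathrm{diag}_i(\mathrm{Cov}[U,U'\mid Z=Z_i,W=W_i])$ and $$b_U^s=\mathcal B^s\frac{\mu_U^{s(2)}}{2},\qquad \mathcal C_{UU'}^s=n^{-2}\,e_0'\Gamma_s^{-1}X_1(h)'K^s(h)\Sigma_{UU'}K^s(h)X_1(h)\Gamma_s^{-1}e_0 .$$ Let $b_{\tilde W}^s=\mathcal B_0^s\,\mu_{\tilde W}^{s(2)}/2$ with $\mathcal B_0^s$ the scalar obtained from the definition of $\mathcal B^s$ with $\tilde W_i$ replaced by $1$. Let $\mathcal C_{\tilde W\tilde W}^s$ have $(j,l)$ entry equal to the expression for $\mathcal C^s$ with $\tilde W_i$ replaced by $1$ and with $\Sigma=\mathrm{diag}_i(\mathrm{Cov}[1\{W=w_j\},1\{W=w_l\}\mid Z=Z_i])$. Let $\mathcal C_{U\tilde W}^s=\mathcal C_{\tilde WU}^s=0$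 for $U\in\{Y,X\}$. Let $G_{s,v}$ be the derivative of $g$ at $(\mu_V^+,\mu_V^-,\pi)$ with respect to $\mu_{V_v}^s$. The bias is $$\mathbf B_{\omega,1,2}(h)=\frac{B_{\tau_Y}}{\tau_X}-\frac{\tau_YB_{\tau_X}}{\tau_X^2},\qquad B_{\tau_U}=c'(b_U^+-b_U^-)+B_C'\delta_U,\qquad B_C=\sum_{s=\pm}\sum_vG_{s,v}b^s_{V_v}.$$ For a family $\mathcal C=(\mathcal C^s_{UU'})$ of $m\times m$ matrices, $s=\pm$, $U,U'\in\{Y,X,\tilde W\}$, define $$Q(\mathcal C)=\frac{T_{YY}}{\tau_X^2}-\frac{2\tau_Y}{\tau_X^3}T_{YX}+\frac{\tau_Y^2}{\tau_X^4}T_{XX},$$ $$T_{UU'}=c'\Big(\sum_s\mathcal C^s_{UU'}\Big)c+c'C_{UC}\,\delta_{U'}+c'C_{U'C}\,\delta_U+\delta_U'V_C\,\delta_{U'},$$ $$C_{UC}=\sum_v\big(\mathcal C^+_{UV_v}G_{+,v}'-\mathcal C^-_{UV_v}G_{-,v}'\big),\qquad V_C=\sum_s\sum_{v,v'}G_{s,v}\,\mathcal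 C^s_{V_vV_{v'}}G_{s,v'}'.$$ The variance is $\mathbf V_{\omega,1}(h)=Q(\mathcal C)$ with the sample matrices $\mathcal C^s_{UU'}$ above. *Assumptions.* 1. $k$ is continuous, symmetric, nonnegative and compactly supported. 2. $Z$ has a density $f$ which, on a neighbourhood of $0$, is continuous, bounded, and bounded away from zero. $E[Y^4\mid Z=z,W=w_j]$ is bounded for $z$ near $0$. 3. On each side of $0$ near $0$, $\mu_Y$ and $\mu_X$ are three times continuously differentiable, and they and their first three derivatives have finite one-sided limits at $0$. The same holds for $\mu_{\tilde W}$ if $\tilde W$ occurs in $V$; otherwise only $\mu_{\tilde W}^\pm$ need exist. 4. For $s=\pm$ the matrices $f(0)\int_0^\infty r_1(su)r_1(su)'k(u)\,du\otimes\mathrm{diag}(\mu_{\tilde W}^s)$ are positive definite, and $\tau_X\ne0$. 5. $nh_n^7\to0$ and $nh_n\to\infty$. 6. $g$ is continuously differentiable at $(\mu_V^+,\mu_V^-,\pi)$, and either its derivative is Lipschitz near that point or $nh_n^5$ is bounded above. 7. (Nondegeneracy) There are $\eta,\epsilon>0$ with $Q(\mathcal C(z))\ge\eta$ for almost every $z\in(0,\epsilon)$,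 where $\mathcal C^\pm_{UU'}(z)=\mathrm{diag}_j(\mathrm{Cov}[U,U'\mid Z=\pm z,W=w_j])$ for $U,U'\in\{Y,X\}$, $\mathcal C^\pm_{\tilde W\tilde W}(z)=\mathrm{Cov}[\tilde W\mid Z=\pm z]$, and $\mathcal C^\pm_{U\tilde W}(z)=\mathcal C^\pm_{\tilde WU}(z)=0$. *Conclusion.* $$\mathbf V_{\omega,1}(h_n)^{-1/2}\big(\hat\beta_\omega-\beta_\omega-h_n^2\,\mathbf B_{\omega,1,2}(h_n)\big)\ \xrightarrow{d}\ N(0,1).$$ -/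

import Mathlib

open MeasureTheory ProbabilityTheory Filter Topology
open scoped Matrix Kronecker

namespace WLATE

noncomputable section

/-! Fuzzy regression discontinuity design with cutoff `0` and a covariate taking values in a
finite set `𝓦`. Vectors indexed by covariate cells are functions `𝓦 → ℝ`; a Kronecker product
`r ⊗ W̃` of a vector `r` of powers with a vector of cell dummies is indexed by `Fin (p + 1) × J`. -/

/-- The two sides of the cutoff. -/
inductive Side where
  | right
  | left

/-- The right side is summed first. -/
def sumSides {M : Type*} [Add M] (F : Side → M) : M := F .right + F .left

/-- The sign `+1` on the right of the cutoff and `-1` on the left. -/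
def Side.sgn : Side → ℝ
  | .right => 1
  | .left => -1

/-- The open half line on the given side of the cutoff. -/
def Side.halfLine : Side → Set ℝ
  | .right => Set.Ioi 0
  | .left => Set.Iio 0

/-- The punctured one-sided window `(0, ε)` or `(-ε, 0)`. -/
def Side.window (ε : ℝ) : Side → Set ℝ
  | .right => Set.Ioo 0 ε
  | .left => Set.Ioo (-ε) 0

/-- The one-sided limit of `F` at the cutoff (used only where the limit is assumed to exist). -/
def sideLim (s : Side) (F : ℝ → ℝ) : ℝ := limUnder (𝓝[s.halfLine] (0 : ℝ)) F

/-- `F` has a finite one-sided limit at the cutoff. -/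
def HasSideLim (s : Side) (F : ℝ → ℝ) : Prop :=
  ∃ l : ℝ, Tendsto F (𝓝[s.halfLine] (0 : ℝ)) (𝓝 l)

/-! ### Local polynomial regression with cell dummies, on a realized sample

`z i`, `w i` are the realized running variable and cell label of observation `i`; the sample of
size `n` consists of the observations `i < n`. -/

section Sample

variable {J : Type*} [Fintype J] [DecidableEq J]

/-- One-sided kernel weight `k_h^+(z) = h⁻¹ k(z/h) 1(z ≥ 0)` or `k_h^-(z) = h⁻¹ k(z/h) 1(z < 0)`. -/
def sideKernel (k : ℝ → ℝ) (h : ℝ) : Side → ℝ → ℝ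
  | .right, z => if 0 ≤ z then h⁻¹ * k (z / h) else 0
  | .left, z => if z < 0 then h⁻¹ * k (z / h) else 0

/-- The regressor `r_p(z/h) ⊗ W̃`, with `r_p(u) = (1, u, …, u^p)` and `W̃` the cell dummies. -/
def polyRow (p : ℕ) (h z : ℝ) (w : J) : Fin (p + 1) × J → ℝ :=
  fun a => (z / h) ^ (a.1 : ℕ) * (if w = a.2 then 1 else 0)

/-- `b` minimizes the one-sided kernel-weighted least squares criterion
`∑_{i<n} (v_i - b'(r_p(z_i) ⊗ W̃_i))² k_h^s(z_i)`. -/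
def IsLocalPolyFit (p : ℕ) (k : ℝ → ℝ) (h : ℝ) (s : Side) (n : ℕ) (z : ℕ → ℝ) (w : ℕ → J)
    (v : ℕ → ℝ) (b : Fin (p + 1) × J → ℝ) : Prop :=
  ∀ b' : Fin (p + 1) × J → ℝ,
    ∑ i ∈ Finset.range n, (v i - b ⬝ᵥ polyRow p 1 (z i) (w i)) ^ 2 * sideKernel k h s (z i) ≤
    ∑ i ∈ Finset.range n, (v i - b' ⬝ᵥ polyRow p 1 (z i) (w i)) ^ 2 * sideKernel k h s (z i)

/-- The design matrix `X_p(h)` with rows `r_p(z_i/h) ⊗ W̃_i`. -/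
def designMat (p : ℕ) (h : ℝ) (n : ℕ) (z : ℕ → ℝ) (w : ℕ → J) :
    Matrix (Fin n) (Fin (p + 1) × J) ℝ :=
  Matrix.of fun i => polyRow p h (z i) (w i)

/-- The matrix `S_q(h)` with rows `(z_i/h)^q W̃_i`. -/
def powerMat (q : ℕ) (h : ℝ) (n : ℕ) (z : ℕ → ℝ) (w : ℕ → J) : Matrix (Fin n) J ℝ :=
  Matrix.of fun i j => (z i / h) ^ q * (if w i = j then 1 else 0)

/-- The diagonal matrix `K^s(h)` of kernel weights. -/
def kernelMat (k : ℝ → ℝ) (h : ℝ) (s : Side) (n : ℕ) (z : ℕ → ℝ) : Matrix (Fin n) (Fin n) ℝ :=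
  Matrix.diagonal fun i => sideKernel k h s (z i)

/-- `Γ_{s,p}(h) = X_p(h)' K^s(h) X_p(h) / n`. -/
def gammaHat (p : ℕ) (k : ℝ → ℝ) (h : ℝ) (s : Side) (n : ℕ) (z : ℕ → ℝ) (w : ℕ → J) :
    Matrix (Fin (p + 1) × J) (Fin (p + 1) × J) ℝ :=
  (n : ℝ)⁻¹ • ((designMat p h n z w)ᵀ * kernelMat k h s n z * designMat p h n z w)

/-- `ϑ^s_{p,q}(h) = X_p(h)' K^s(h) S_q(h) / n`. -/
def thetaHat (p q : ℕ) (k : ℝ → ℝ) (h : ℝ) (s : Side) (n : ℕ) (z : ℕ → ℝ) (w : ℕ → J) :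
    Matrix (Fin (p + 1) × J) J ℝ :=
  (n : ℝ)⁻¹ • ((designMat p h n z w)ᵀ * kernelMat k h s n z * powerMat q h n z w)

/-- `Ψ^s_p(h) = X_p(h)' K^s(h) Σ K^s(h) X_p(h) / n` with `Σ = diag(σ_i)`. -/
def psiHat (p : ℕ) (k : ℝ → ℝ) (h : ℝ) (s : Side) (n : ℕ) (z : ℕ → ℝ) (w : ℕ → J)
    (σ : ℕ → ℝ) : Matrix (Fin (p + 1) × J) (Fin (p + 1) × J) ℝ :=
  (n : ℝ)⁻¹ • ((designMat p h n z w)ᵀ * kernelMat k h s n z *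
    Matrix.diagonal (fun i : Fin n => σ i) * kernelMat k h s n z * designMat p h n z w)

/-- `e_0' = [I, 0, …, 0]`, selecting the intercepts. -/
def selIntercept (p : ℕ) (J : Type*) [DecidableEq J] : Matrix J (Fin (p + 1) × J) ℝ :=
  Matrix.of fun j a => if a = (0, j) then 1 else 0

/-- The bias factor `e_0' Γ_{s,p}(h)⁻¹ ϑ^s_{p,q}(h)`. -/
def biasFactor (p q : ℕ) (k : ℝ → ℝ) (h : ℝ) (s : Side) (n : ℕ) (z : ℕ → ℝ) (w : ℕ → J) :
    Matrix J J ℝ :=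
  selIntercept p J * (gammaHat p k h s n z w)⁻¹ * thetaHat p q k h s n z w

/-- The sandwich `n⁻¹ e_0' Γ_{s,p}(h)⁻¹ Ψ^s_p(h) Γ_{s,p}(h)⁻¹ e_0`: the conditional covariance
matrix of two vectors of intercept estimates whose error covariances are `σ_i`. -/
def sandwich (p : ℕ) (k : ℝ → ℝ) (h : ℝ) (s : Side) (n : ℕ) (z : ℕ → ℝ) (w : ℕ → J)
    (σ : ℕ → ℝ) : Matrix J J ℝ :=
  (n : ℝ)⁻¹ • (selIntercept p J * (gammaHat p k h s n z w)⁻¹ * psiHat p k h s n z w σ *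
    (gammaHat p k h s n z w)⁻¹ * (selIntercept p J)ᵀ)

end Sample

/-- `Γ_p^+ = ∫_0^∞ r_p(u) r_p(u)' k(u) du` and `Γ_p^- = ∫_0^∞ r_p(-u) r_p(-u)' k(u) du`. -/
def kernelMoments (p : ℕ) (k : ℝ → ℝ) (s : Side) : Matrix (Fin (p + 1)) (Fin (p + 1)) ℝ :=
  Matrix.of fun a b => ∫ u in Set.Ioi (0 : ℝ),
    (s.sgn * u) ^ (a : ℕ) * (s.sgn * u) ^ (b : ℕ) * k u

/-! ### The population -/

/-- The regressands: the outcome `Y`, the treatment `X`, and the vector `W̃` of cell dummies. -/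
inductive Regressand where
  | outcome
  | treatment
  | dummies

/-- A sequence of observations `(Y_i, X_i, Z_i, W_i)`. -/
structure Data (Ω 𝓦 : Type*) where
  Y : ℕ → Ω → ℝ
  X : ℕ → Ω → ℝ
  Z : ℕ → Ω → ℝ
  W : ℕ → Ω → 𝓦

section Population

variable {Ω 𝓦 : Type*} [MeasurableSpace Ω] [Fintype 𝓦] [DecidableEq 𝓦] [Nonempty 𝓦]
  [MeasurableSpace 𝓦] [DiscreteMeasurableSpace 𝓦]

/-- The observations are independent and identically distributed. -/
def IsIID (P : Measure Ω) (D : Data Ω 𝓦) : Prop :=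
  (∀ i, Measurable (D.Y i) ∧ Measurable (D.X i) ∧ Measurable (D.Z i) ∧ Measurable (D.W i)) ∧
  iIndepFun (fun i ω => (D.Y i ω, D.X i ω, D.Z i ω, D.W i ω)) P ∧
  ∀ i, IdentDistrib (fun ω => (D.Y i ω, D.X i ω, D.Z i ω, D.W i ω))
    (fun ω => (D.Y 0 ω, D.X 0 ω, D.Z 0 ω, D.W 0 ω)) P P

/-- The conditional law of `(Y, X)` given `(Z, W)`. -/
def lawYX (P : Measure Ω) [IsFiniteMeasure P] (D : Data Ω 𝓦) : Kernel (ℝ × 𝓦) (ℝ × ℝ) :=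
  condDistrib (fun ω => (D.Y 0 ω, D.X 0 ω)) (fun ω => (D.Z 0 ω, D.W 0 ω)) P

/-- The conditional law of `W` given `Z`. -/
def lawW (P : Measure Ω) [IsFiniteMeasure P] (D : Data Ω 𝓦) : Kernel ℝ 𝓦 :=
  condDistrib (D.W 0) (D.Z 0) P

/-- The coordinates of `(Y, X)`; the value at `dummies` is never used. -/
def Regressand.coord : Regressand → ℝ × ℝ → ℝ
  | .outcome, q => q.1
  | .treatment, q => q.2
  | .dummies, _ => 0

/-- `σ²_{UV}(z, w) = Cov[U, V | Z = z, W = w]` for `U, V ∈ {Y, X}`. -/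
def condCov (P : Measure Ω) [IsFiniteMeasure P] (D : Data Ω 𝓦) (U V : Regressand) (z : ℝ)
    (w : 𝓦) : ℝ :=
  cov[U.coord, V.coord; lawYX P D (z, w)]

/-- `Cov[1(W = j), 1(W = l) | Z = z]`. -/
def condCovW (P : Measure Ω) [IsFiniteMeasure P] (D : Data Ω 𝓦) (j l : 𝓦) (z : ℝ) : ℝ :=
  cov[fun w => if w = j then (1 : ℝ) else 0, fun w => if w = l then (1 : ℝ) else 0; lawW P D z]

/-- `μ U j z` is, for `z` in `(-ε, ε)`, a version of `E[Y | Z = z, W = j]` for `U = outcome`, of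
`E[X | Z = z, W = j]` for `U = treatment`, and of `E[1(W = j) | Z = z]` for `U = dummies`. -/
structure IsRegressionFunction (P : Measure Ω) [IsFiniteMeasure P] (D : Data Ω 𝓦) (ε : ℝ)
    (μ : Regressand → 𝓦 → ℝ → ℝ) : Prop where
  outcome : ∀ᵐ ω ∂P, D.Z 0 ω ∈ Set.Ioo (-ε) ε →
    ∫ q, q.1 ∂(lawYX P D (D.Z 0 ω, D.W 0 ω)) = μ .outcome (D.W 0 ω) (D.Z 0 ω)
  treatment : ∀ᵐ ω ∂P, D.Z 0 ω ∈ Set.Ioo (-ε) ε →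
    ∫ q, q.2 ∂(lawYX P D (D.Z 0 ω, D.W 0 ω)) = μ .treatment (D.W 0 ω) (D.Z 0 ω)
  dummies : ∀ᵐ ω ∂P, D.Z 0 ω ∈ Set.Ioo (-ε) ε →
    ∀ j, (lawW P D (D.Z 0 ω)).real {j} = μ .dummies j (D.Z 0 ω)

/-- The one-sided limit `μ_U^{s(r)}` of the `r`-th derivative of the regression functions. -/
def sideDeriv (μ : Regressand → 𝓦 → ℝ → ℝ) (s : Side) (U : Regressand) (r : ℕ) : 𝓦 → ℝ :=
  fun j => sideLim s (iteratedDeriv r (μ U j))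

/-- The one-sided limits `μ_U^s`. -/
def muSide (μ : Regressand → 𝓦 → ℝ → ℝ) (s : Side) (U : Regressand) : 𝓦 → ℝ :=
  sideDeriv μ s U 0

/-- The discontinuity `δ_U = μ_U^+ - μ_U^-`. -/
def delta (μ : Regressand → 𝓦 → ℝ → ℝ) (U : Regressand) : 𝓦 → ℝ :=
  muSide μ .right U - muSide μ .left U

/-- The cell probabilities `π_j = P(W = j)`. -/
def cellProb (P : Measure Ω) (D : Data Ω 𝓦) : 𝓦 → ℝ := fun j => P.real (D.W 0 ⁻¹' {j})

/-- `σ_W^{2,s}`, the one-sided limit of `E[W̃ W̃' | Z = z]`, which is diagonal. -/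
def sigmaW (μ : Regressand → 𝓦 → ℝ → ℝ) (s : Side) : Matrix 𝓦 𝓦 ℝ :=
  Matrix.diagonal (muSide μ s .dummies)

/-- `U`'s regression functions are three times continuously differentiable on each side of the
cutoff, and they and their first three derivatives have finite one-sided limits there. -/
def SmoothSides (ε : ℝ) (μ : Regressand → 𝓦 → ℝ → ℝ) (U : Regressand) : Prop :=
  ∀ s : Side, ∀ j : 𝓦, ContDiffOn ℝ 3 (μ U j) (s.window ε) ∧
    ∀ r ≤ 3, HasSideLim s (iteratedDeriv r (μ U j))

/-- Regularity of the joint law of `(Y, X, Z, W)` near the cutoff, for local linear estimation. -/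
structure Regular (P : Measure Ω) [IsFiniteMeasure P] (D : Data Ω 𝓦) (k f : ℝ → ℝ) (ε : ℝ)
    (μ : Regressand → 𝓦 → ℝ → ℝ) : Prop where
  window_pos : 0 < ε
  treatment_binary : ∀ᵐ ω ∂P, D.X 0 ω = 0 ∨ D.X 0 ω = 1
  density_measurable : Measurable f
  density : P.map (D.Z 0) = volume.withDensity fun z => ENNReal.ofReal (f z)
  density_continuous : ContinuousOn f (Set.Ioo (-ε) ε)
  density_bounds : ∃ a A : ℝ, 0 < a ∧ ∀ z ∈ Set.Ioo (-ε) ε, a ≤ f z ∧ f z ≤ A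
  fourth_moment : ∃ C : NNReal, ∀ᵐ ω ∂P, D.Z 0 ω ∈ Set.Ioo (-ε) ε →
    ∫⁻ q, ‖q.1‖ₑ ^ 4 ∂(lawYX P D (D.Z 0 ω, D.W 0 ω)) ≤ C
  regression : IsRegressionFunction P D ε μ
  smooth_outcome : SmoothSides ε μ .outcome
  smooth_treatment : SmoothSides ε μ .treatment
  dummies_limit : ∀ s j, HasSideLim s (μ .dummies j)
  gamma_posDef : ∀ s, (f 0 • (kernelMoments 1 k s ⊗ₖ sigmaW μ s)).PosDef

end Population

/-- A kernel: continuous, symmetric, nonnegative, with compact support. -/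
structure IsKernel (k : ℝ → ℝ) : Prop where
  continuous : Continuous k
  symmetric : ∀ u, k (-u) = k u
  nonneg : ∀ u, 0 ≤ k u
  compact_support : HasCompactSupport k

/-! ### The estimand and the estimator

The weights are `c = g(μ_V^+, μ_V^-, π)`, where `V = (V_κ)` is a finite list of regressands. -/

section Estimand

variable {Ω 𝓦 κ : Type*} [MeasurableSpace Ω] [Fintype 𝓦] [DecidableEq 𝓦] [Nonempty 𝓦]
  [MeasurableSpace 𝓦] [DiscreteMeasurableSpace 𝓦] [Fintype κ] [DecidableEq κ]

/-- Arguments `(μ_V^+, μ_V^-, π)` of the weight function. -/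
abbrev WeightArg (κ 𝓦 : Type*) := (κ → 𝓦 → ℝ) × (κ → 𝓦 → ℝ) × (𝓦 → ℝ)

/-- The true value of `(μ_V^+, μ_V^-, π)`. -/
def trueArg (P : Measure Ω) (D : Data Ω 𝓦) (μ : Regressand → 𝓦 → ℝ → ℝ) (V : κ → Regressand) :
    WeightArg κ 𝓦 :=
  (fun v => muSide μ .right (V v), fun v => muSide μ .left (V v), cellProb P D)

/-- The Wald ratio `c'δ_Y / c'δ_X`. -/
def waldRatio (c δY δX : 𝓦 → ℝ) : ℝ := (c ⬝ᵥ δY) / (c ⬝ᵥ δX)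

/-- Coefficients of the one-sided polynomial regressions for every sample size: of `Y` and of `X`
on `r_p(Z) ⊗ W̃`, and of each dummy `1(W = j)` on `r_p(Z)` alone. -/
structure Fits (Ω 𝓦 : Type*) (p : ℕ) where
  outcome : Side → ℕ → Ω → Fin (p + 1) × 𝓦 → ℝ
  treatment : Side → ℕ → Ω → Fin (p + 1) × 𝓦 → ℝ
  dummies : Side → ℕ → 𝓦 → Ω → Fin (p + 1) × Unit → ℝ

/-- The coefficients are (measurable) minimizers of the weighted least squares criteria. -/
structure Fits.AreLocalPoly {p : ℕ} (B : Fits Ω 𝓦 p) (D : Data Ω 𝓦) (k : ℝ → ℝ) (h : ℕ → ℝ) :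
    Prop where
  measurable_outcome : ∀ s n, Measurable (B.outcome s n)
  measurable_treatment : ∀ s n, Measurable (B.treatment s n)
  measurable_dummies : ∀ s n j, Measurable (B.dummies s n j)
  outcome : ∀ s n ω, IsLocalPolyFit p k (h n) s n (fun i => D.Z i ω) (fun i => D.W i ω)
    (fun i => D.Y i ω) (B.outcome s n ω)
  treatment : ∀ s n ω, IsLocalPolyFit p k (h n) s n (fun i => D.Z i ω) (fun i => D.W i ω)
    (fun i => D.X i ω) (B.treatment s n ω)
  dummies : ∀ s n j ω, IsLocalPolyFit p k (h n) s n (fun i => D.Z i ω) (fun _ => ())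
    (fun i => if D.W i ω = j then 1 else 0) (B.dummies s n j ω)

/-- The estimated one-sided limits `μ̂_U^s`: the intercepts of the regressions. -/
def Fits.muHat {p : ℕ} (B : Fits Ω 𝓦 p) (s : Side) (n : ℕ) (ω : Ω) : Regressand → 𝓦 → ℝ
  | .outcome, j => B.outcome s n ω (0, j)
  | .treatment, j => B.treatment s n ω (0, j)
  | .dummies, j => B.dummies s n j ω (0, ())

/-- `δ̂_U = μ̂_U^+ - μ̂_U^-`. -/
def Fits.deltaHat {p : ℕ} (B : Fits Ω 𝓦 p) (n : ℕ) (ω : Ω) (U : Regressand) : 𝓦 → ℝ :=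
  B.muHat .right n ω U - B.muHat .left n ω U

/-- The sample cell frequencies `π̂_j`. -/
def cellFreq (D : Data Ω 𝓦) (n : ℕ) (ω : Ω) : 𝓦 → ℝ :=
  fun j => (n : ℝ)⁻¹ * ∑ i ∈ Finset.range n, if D.W i ω = j then 1 else 0

/-- `ĉ = g(μ̂_V^+, μ̂_V^-, π̂)`. -/
def weightHat {p : ℕ} (B : Fits Ω 𝓦 p) (D : Data Ω 𝓦) (V : κ → Regressand)
    (g : WeightArg κ 𝓦 → 𝓦 → ℝ) (n : ℕ) (ω : Ω) : 𝓦 → ℝ :=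
  g (fun v => B.muHat .right n ω (V v), fun v => B.muHat .left n ω (V v), cellFreq D n ω)

/-- The plug-in estimator `β̂_ω = ĉ'δ̂_Y / ĉ'δ̂_X`. -/
def wlateHat {p : ℕ} (B : Fits Ω 𝓦 p) (D : Data Ω 𝓦) (V : κ → Regressand)
    (g : WeightArg κ 𝓦 → 𝓦 → ℝ) (n : ℕ) (ω : Ω) : ℝ :=
  waldRatio (weightHat B D V g n ω) (B.deltaHat n ω .outcome) (B.deltaHat n ω .treatment)

/-! ### Bias and variance -/

/-- The derivative `G_s` of `g` at `x` with respect to the `v`-th block of `μ_V^s`. -/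
def gradSide (g : WeightArg κ 𝓦 → 𝓦 → ℝ) (x : WeightArg κ 𝓦) (s : Side) (v : κ) :
    Matrix 𝓦 𝓦 ℝ :=
  Matrix.of fun i j =>
    match s with
    | .right => fderiv ℝ g x (Pi.single v (Pi.single j 1), 0, 0) i
    | .left => fderiv ℝ g x (0, Pi.single v (Pi.single j 1), 0) i

/-- The coefficient of `h^q` in the conditional bias of `μ̂_U^s`, namely `𝓑^s_{p,q} μ_U^{s(q)}/q!`.
For the dummies, the design has a single cell. -/
def biasSide (p q : ℕ) (k : ℝ → ℝ) (h : ℝ) (n : ℕ) (z : ℕ → ℝ) (w : ℕ → 𝓦)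
    (μ : Regressand → 𝓦 → ℝ → ℝ) (s : Side) (U : Regressand) : 𝓦 → ℝ :=
  match U with
  | .dummies => (biasFactor p q k h s n z (fun _ => ()) () () / (q.factorial : ℝ)) •
      sideDeriv μ s .dummies q
  | U => (q.factorial : ℝ)⁻¹ • (biasFactor p q k h s n z w *ᵥ sideDeriv μ s U q)

/-- The bias constant `B_{ω,p,q} = B_{τ_Y}/τ_X - τ_Y B_{τ_X}/τ_X²` for weights `c` with derivatives
`G`, where `B_{τ_U} = c'B_U + B_C'δ_U`, `B_U = b_U^+ - b_U^-`,
`B_C = ∑_v (G_{+,v} b_{V_v}^+ + G_{-,v} b_{V_v}^-)`, and `b` are the one-sided biases. -/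
def wlateBias (c : 𝓦 → ℝ) (δ : Regressand → 𝓦 → ℝ) (V : κ → Regressand)
    (G : Side → κ → Matrix 𝓦 𝓦 ℝ) (b : Side → Regressand → 𝓦 → ℝ) : ℝ :=
  let τ : Regressand → ℝ := fun U => c ⬝ᵥ δ U
  let bC : 𝓦 → ℝ := sumSides fun s => ∑ v, G s v *ᵥ b s (V v)
  let bτ : Regressand → ℝ := fun U => c ⬝ᵥ (b .right U - b .left U) + bC ⬝ᵥ δ U
  bτ .outcome / τ .treatment - τ .outcome * bτ .treatment / τ .treatment ^ 2

/-- The variance of the linearized estimator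
`(τ̂_Y - τ_Y)/τ_X - τ_Y (τ̂_X - τ_X)/τ_X²`, with `τ̂_U - τ_U = c'(δ̂_U - δ_U) + (ĉ - c)'δ_U` and
`ĉ - c = ∑_v (G_{+,v}(μ̂_{V_v}^+ - μ_{V_v}^+) + G_{-,v}(μ̂_{V_v}^- - μ_{V_v}^-))`, when
`C s U U'` is the covariance matrix of `μ̂_U^s` and `μ̂_{U'}^s` and the two sides are
uncorrelated. -/
def wlateVar (c : 𝓦 → ℝ) (δ : Regressand → 𝓦 → ℝ) (V : κ → Regressand)
    (G : Side → κ → Matrix 𝓦 𝓦 ℝ) (C : Side → Regressand → Regressand → Matrix 𝓦 𝓦 ℝ) : ℝ :=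
  let τ : Regressand → ℝ := fun U => c ⬝ᵥ δ U
  -- `Cov(δ̂_U, δ̂_{U'})`, `Cov(δ̂_U, ĉ)`, `Var(ĉ)`, `Cov(τ̂_U, τ̂_{U'})`
  let covδ : Regressand → Regressand → Matrix 𝓦 𝓦 ℝ := fun U U' => sumSides fun s => C s U U'
  let covδc : Regressand → Matrix 𝓦 𝓦 ℝ := fun U =>
    sumSides fun s => s.sgn • ∑ v, C s U (V v) * (G s v)ᵀ
  let varC : Matrix 𝓦 𝓦 ℝ :=
    sumSides fun s => ∑ v, ∑ v', G s v * C s (V v) (V v') * (G s v')ᵀ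
  let covτ : Regressand → Regressand → ℝ := fun U U' =>
    c ⬝ᵥ (covδ U U' *ᵥ c) + c ⬝ᵥ (covδc U *ᵥ δ U') + c ⬝ᵥ (covδc U' *ᵥ δ U) +
      δ U ⬝ᵥ (varC *ᵥ δ U')
  covτ .outcome .outcome / τ .treatment ^ 2
    - 2 * τ .outcome / τ .treatment ^ 3 * covτ .outcome .treatment
    + τ .outcome ^ 2 / τ .treatment ^ 4 * covτ .treatment .treatment

/-- The finite-sample conditional covariance matrices of `μ̂_U^s` and `μ̂_{U'}^s`: given all the
`Z_i, W_i` for `U, U' ∈ {Y, X}`, and given all the `Z_i` for the dummies. Regression errors of the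
dummies are conditionally uncorrelated with those of `Y` and `X`. -/
def covSide (p : ℕ) (k : ℝ → ℝ) (h : ℝ) (P : Measure Ω) [IsFiniteMeasure P] (D : Data Ω 𝓦)
    (n : ℕ) (ω : Ω) (s : Side) (U U' : Regressand) : Matrix 𝓦 𝓦 ℝ :=
  match U, U' with
  | .dummies, .dummies => Matrix.of fun j l =>
      sandwich p k h s n (fun i => D.Z i ω) (fun _ => ()) (fun i => condCovW P D j l (D.Z i ω)) () ()
  | .dummies, _ => 0
  | _, .dummies => 0
  | U, U' => sandwich p k h s n (fun i => D.Z i ω) (fun i => D.W i ω)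
      (fun i => condCov P D U U' (D.Z i ω) (D.W i ω))

/-- The population covariance matrices at distance `z` from the cutoff: `diag_j Cov[U, U' | Z, W = j]`
for `U, U' ∈ {Y, X}` and `Cov[W̃ | Z]` for the dummies, at `Z = z` (right) or `Z = -z` (left). -/
def covPop (P : Measure Ω) [IsFiniteMeasure P] (D : Data Ω 𝓦) (z : ℝ) (s : Side)
    (U U' : Regressand) : Matrix 𝓦 𝓦 ℝ :=
  match U, U' with
  | .dummies, .dummies => Matrix.of fun j l => condCovW P D j l (s.sgn * z)
  | .dummies, _ => 0
  | _, .dummies => 0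
  | U, U' => Matrix.diagonal fun j => condCov P D U U' (s.sgn * z) j

/-- The true weights `c = g(μ_V^+, μ_V^-, π)`. -/
def weight (P : Measure Ω) (D : Data Ω 𝓦) (μ : Regressand → 𝓦 → ℝ → ℝ) (V : κ → Regressand)
    (g : WeightArg κ 𝓦 → 𝓦 → ℝ) : 𝓦 → ℝ :=
  g (trueArg P D μ V)

/-- The estimand `β_ω = c'δ_Y / c'δ_X = τ_Y / τ_X`. -/
def wlate (P : Measure Ω) (D : Data Ω 𝓦) (μ : Regressand → 𝓦 → ℝ → ℝ) (V : κ → Regressand)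
    (g : WeightArg κ 𝓦 → 𝓦 → ℝ) : ℝ :=
  waldRatio (weight P D μ V g) (delta μ .outcome) (delta μ .treatment)

/-- The bias constant `B_{ω,p,q}(h)` on the sample of size `n`. -/
def biasω (p q : ℕ) (k : ℝ → ℝ) (h : ℝ) (P : Measure Ω) (D : Data Ω 𝓦)
    (μ : Regressand → 𝓦 → ℝ → ℝ) (V : κ → Regressand) (g : WeightArg κ 𝓦 → 𝓦 → ℝ)
    (n : ℕ) (ω : Ω) : ℝ :=
  wlateBias (weight P D μ V g) (delta μ) V (gradSide g (trueArg P D μ V))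
    (biasSide p q k h n (fun i => D.Z i ω) (fun i => D.W i ω) μ)

/-- The conditional variance `V_{ω,p}(h)` on the sample of size `n`. -/
def varω (p : ℕ) (k : ℝ → ℝ) (h : ℝ) (P : Measure Ω) [IsFiniteMeasure P] (D : Data Ω 𝓦)
    (μ : Regressand → 𝓦 → ℝ → ℝ) (V : κ → Regressand) (g : WeightArg κ 𝓦 → 𝓦 → ℝ)
    (n : ℕ) (ω : Ω) : ℝ :=
  wlateVar (weight P D μ V g) (delta μ) V (gradSide g (trueArg P D μ V))
    (covSide p k h P D n ω)

/-- Nondegeneracy: the variance formula, evaluated at the conditional covariances of the data, is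
bounded away from zero near the cutoff. -/
def Nondegenerate (P : Measure Ω) [IsFiniteMeasure P] (D : Data Ω 𝓦)
    (μ : Regressand → 𝓦 → ℝ → ℝ) (V : κ → Regressand) (g : WeightArg κ 𝓦 → 𝓦 → ℝ) : Prop :=
  ∃ η > 0, ∃ ε > 0, ∀ᵐ z : ℝ, z ∈ Set.Ioo 0 ε →
    η ≤ wlateVar (weight P D μ V g) (delta μ) V (gradSide g (trueArg P D μ V)) (covPop P D z)

end Estimand

end

end WLATE

set_option linter.unusedSectionVars false

/-! The estimator is a smooth function of finitely many one-sided intercepts and of the cell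
frequencies. It is therefore asymptotically a linear form in regression errors near the cutoff, and
this form obeys a central limit theorem for triangular arrays.

Intercepts. The normal equations make the intercepts of a local linear fit a linear map of the
regressand. This map reproduces intercept and slope exactly, sends the quadratic term of the Taylor
expansion to the bias factor times `h ^ 2`, and sends the cubic remainder to a term of order `h ^
3`, negligible at rate `√(n * h)` because `n * h ^ 7 → 0`. The error part has mean zero and order
`(n * h)^(-1/2)`, so there the inverse of the sample design matrix may be replaced by its limit.
What remains is a sample mean of the equivalent kernel times the error (`Regular.fit_expansion`). A
map from cells to groups treats the saturated design of `Y`, `X` and the one-group design of the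
dummies together.

Delta method. Each intercept errs by order `ρ = h ^ 2 + (n * h)^(-1/2)`. Quadratic remainders of the
ratio and of `g` vanish because `√(n * h) * ρ ^ 2 → 0`. If the derivative of `g` is only continuous,
the remainder is of smaller order than `ρ`, and boundedness of `n * h ^ 5` makes that enough. The
cell frequencies converge faster and drop out (`Regular.wlate_linearization`).

Algebra. With the coefficients `linCoef` of the linearized estimator, the bias formula is the same
linear form applied to the one-sided biases (`wlateBias_eq`), and the variance formula is a
quadratic form at these coefficients (`wlateVar_eq`). Two orthogonality facts make the covariances
block diagonal: the kernels of the two sides have disjoint supports, and the errors of `Y`, `X` have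
mean zero given `(Z, W)`, of which the dummy errors are functions.

Variance. The conditional covariances are not assumed to have limits at the cutoff, so the scaled
variance need not converge. It is instead compared with the deterministic sequence `h * E[linErr ^
2]` (`Regular.covForm_expansion`), which nondegeneracy bounds away from zero
(`Regular.exists_le_integral_linErr_sq`). That bound supplies the Lyapunov condition in
`LocalFamily.clt` and lets `tendsto_studentized` exchange the two normalizations. -/

namespace WLATE

/-! ### Convergence and boundedness in probability. -/

section Stochastic

variable {Ω : Type*} [MeasurableSpace Ω]

/-- The filter of events, indexed by the sample size, whose probability tends to one. Convergence in
probability to a constant is convergence along this filter. -/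
def wpa (P : Measure Ω) : Filter (ℕ × Ω) where
  sets := {S | Tendsto (fun n => P {ω | (n, ω) ∉ S}) atTop (𝓝 0)}
  univ_sets := by simp
  sets_of_superset := by
    intro S T hS hST
    exact tendsto_of_tendsto_of_tendsto_of_le_of_le tendsto_const_nhds hS (fun _ => zero_le)
      fun n => measure_mono fun ω h h' => h (hST h')
  inter_sets := by
    intro S T hS hT
    have hadd : Tendsto (fun n => P {ω | (n, ω) ∉ S} + P {ω | (n, ω) ∉ T}) atTop (𝓝 0) := by
      simpa using hS.add hT
    refine tendsto_of_tendsto_of_tendsto_of_le_of_le tendsto_const_nhds hadd (fun _ => zero_le)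
      fun n => (measure_mono ?_).trans (measure_union_le _ _)
    intro ω hω
    by_contra hcon
    simp only [Set.mem_union, Set.mem_ofPred_eq, not_or, not_not] at hcon
    exact hω hcon

variable {P : Measure Ω}

theorem mem_wpa {S : Set (ℕ × Ω)} :
    S ∈ wpa P ↔ Tendsto (fun n => P {ω | (n, ω) ∉ S}) atTop (𝓝 0) := Iff.rfl

theorem eventually_wpa_of_ae {p : ℕ × Ω → Prop} (hp : ∀ᶠ n in atTop, ∀ᵐ ω ∂P, p (n, ω)) :
    ∀ᶠ x in wpa P, p x := by
  rw [Filter.Eventually, mem_wpa]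
  exact tendsto_const_nhds.congr' (hp.mono fun n hn => (ae_iff.1 hn).symm)

theorem tendsto_fst_wpa : Tendsto Prod.fst (wpa P) atTop := by
  intro S hS
  exact eventually_wpa_of_ae (p := fun x => x.1 ∈ S)
    ((show ∀ᶠ n in atTop, n ∈ S from hS).mono fun n hn => ae_of_all _ fun _ => hn)

theorem tendstoInMeasure_of_tendsto_wpa {X : ℕ → Ω → ℝ} {c : ℝ}
    (hX : Tendsto (fun x : ℕ × Ω => X x.1 x.2) (wpa P) (𝓝 c)) :
    TendstoInMeasure P X atTop (fun _ => c) := by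
  rw [tendstoInMeasure_iff_norm]
  intro e he
  have h1 := (Metric.tendsto_nhds.1 hX) e he
  rw [Filter.Eventually, mem_wpa] at h1
  simpa [dist_eq_norm] using h1

/-- Bounded in probability: products with sequences converging to zero in probability converge to
zero in probability. -/
def StochBdd (P : Measure Ω) (X : ℕ × Ω → ℝ) : Prop :=
  ∀ Y : ℕ × Ω → ℝ, Tendsto Y (wpa P) (𝓝 0) → Tendsto (fun x => Y x * X x) (wpa P) (𝓝 0)

namespace StochBdd

variable {X Y : ℕ × Ω → ℝ}

theorem add (hX : StochBdd P X) (hY : StochBdd P Y) : StochBdd P (fun x => X x + Y x) := by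
  intro U hU
  simpa [mul_add] using (hX U hU).add (hY U hU)

theorem mul (hX : StochBdd P X) (hY : StochBdd P Y) : StochBdd P (fun x => X x * Y x) := by
  intro U hU
  simpa [mul_assoc] using hY _ (hX U hU)

theorem of_tendsto {c : ℝ} (hX : Tendsto X (wpa P) (𝓝 c)) : StochBdd P X := by
  intro U hU
  simpa using hU.mul hX

theorem const (c : ℝ) : StochBdd P (fun _ => c) := of_tendsto tendsto_const_nhds

theorem const_mul (hX : StochBdd P X) (c : ℝ) : StochBdd P (fun x => c * X x) := (const c).mul hX

theorem neg (hX : StochBdd P X) : StochBdd P (fun x => -X x) := by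
  simpa using hX.const_mul (-1)

theorem sub (hX : StochBdd P X) (hY : StochBdd P Y) : StochBdd P (fun x => X x - Y x) := by
  simpa [sub_eq_add_neg] using hX.add hY.neg

theorem sum {ι : Type*} (s : Finset ι) {X : ι → ℕ × Ω → ℝ} (hX : ∀ i ∈ s, StochBdd P (X i)) :
    StochBdd P (fun x => ∑ i ∈ s, X i x) := by
  intro U hU
  simpa [Finset.mul_sum] using tendsto_finsetSum s fun i hi => hX i hi U hU

theorem mono (hX : StochBdd P X) (h : ∀ᶠ x in wpa P, |Y x| ≤ |X x|) : StochBdd P Y := by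
  intro U hU
  refine squeeze_zero_norm' (a := fun x => |U x * X x|) ?_ (by simpa using (hX U hU).abs)
  filter_upwards [h] with x hx
  simp only [Real.norm_eq_abs, abs_mul]
  exact mul_le_mul_of_nonneg_left hx (abs_nonneg _)

theorem congr (hX : StochBdd P X) (h : ∀ᶠ x in wpa P, Y x = X x) : StochBdd P Y :=
  hX.mono (h.mono fun _ hx => by rw [hx])

theorem of_deterministic {a : ℕ → ℝ} {M : ℝ} (ha : ∀ᶠ n in atTop, |a n| ≤ M) :
    StochBdd P (fun x => a x.1) :=
  (const M).mono ((tendsto_fst_wpa.eventually ha).mono fun _ hx => hx.trans (le_abs_self M))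

theorem tendsto_zero (hX : StochBdd P X) (hY : Tendsto Y (wpa P) (𝓝 0)) :
    Tendsto (fun x => Y x * X x) (wpa P) (𝓝 0) := hX Y hY

/-- Markov's inequality: outside an event of small probability `|X| < M`, and there `|U| < e / M`
forces `|U * X| < e`. -/
theorem of_lintegral_le {X : ℕ → Ω → ℝ} {C : NNReal}
    (hm : ∀ n, Measurable (X n)) (h : ∀ᶠ n in atTop, ∫⁻ ω, ‖X n ω‖ₑ ∂P ≤ C) :
    StochBdd P (fun x => X x.1 x.2) := by
  intro U hU
  rw [Metric.tendsto_nhds]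
  intro e he
  rw [Filter.Eventually, mem_wpa, ENNReal.tendsto_nhds_zero]
  intro d hd
  -- Half of the allowed probability `d` goes to the event that `X` is large, the other half to the
  -- event that `U` is not small.
  obtain ⟨M, hM0, hM⟩ : ∃ M : ℝ, 0 < M ∧ (C : ENNReal) / ENNReal.ofReal M ≤ d / 2 := by
    have ht : Tendsto (fun M : ℝ => (C : ENNReal) / ENNReal.ofReal M) atTop (𝓝 0) := by
      have := ENNReal.Tendsto.const_div (a := (C : ENNReal))
        ENNReal.tendsto_ofReal_atTop (Or.inr ENNReal.coe_ne_top)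
      simpa using this
    have h2 : ∀ᶠ M in atTop, (C : ENNReal) / ENNReal.ofReal M ≤ d / 2 :=
      ENNReal.tendsto_nhds_zero.1 ht _ (ENNReal.half_pos hd.ne')
    exact (((eventually_gt_atTop (0 : ℝ)).and h2)).exists
  have hU' := (Metric.tendsto_nhds.1 hU) (e / M) (by positivity)
  rw [Filter.Eventually, mem_wpa, ENNReal.tendsto_nhds_zero] at hU'
  filter_upwards [h, hU' (d / 2) (ENNReal.half_pos hd.ne')] with n hn hUn
  have hmark : P {ω | M ≤ |X n ω|} ≤ d / 2 := by
    have := meas_ge_le_lintegral_div (μ := P) (f := fun ω => ‖X n ω‖ₑ)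
      (hm n).enorm.aemeasurable (ε := ENNReal.ofReal M) (by simpa using hM0) ENNReal.ofReal_ne_top
    refine le_trans (measure_mono ?_) (this.trans ((ENNReal.div_le_div_right hn _).trans hM))
    intro ω hω
    simp only [Set.mem_ofPred_eq] at hω ⊢
    rw [← ofReal_norm]
    exact ENNReal.ofReal_le_ofReal hω
  refine (measure_mono (t := {ω | (n, ω) ∉ {x | dist (U x) 0 < e / M}} ∪ {ω | M ≤ |X n ω|})
    ?_).trans ((measure_union_le _ _).trans ((add_le_add hUn hmark).trans (ENNReal.add_halves d).le))
  intro ω hω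
  by_contra hcon
  simp only [Set.mem_union, Set.mem_ofPred_eq, not_or, not_not, not_le, dist_zero_right,
    Real.norm_eq_abs] at hcon hω
  refine hω ?_
  rw [abs_mul]
  have := mul_lt_mul'' hcon.1 hcon.2 (abs_nonneg _) (abs_nonneg _)
  rwa [div_mul_cancel₀ _ hM0.ne'] at this

/-- Reduces to first moments through `x ≤ 1 + x ^ 2`; the total mass one accounts for the summand
`1` in the constant. -/
theorem of_lintegral_sq_le [IsProbabilityMeasure P] {X : ℕ → Ω → ℝ} {C : NNReal}
    (hm : ∀ n, Measurable (X n)) (h : ∀ᶠ n in atTop, ∫⁻ ω, ‖X n ω‖ₑ ^ 2 ∂P ≤ C) :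
    StochBdd P (fun x => X x.1 x.2) := by
  refine of_lintegral_le (C := 1 + C) hm (h.mono fun n hn => ?_)
  calc ∫⁻ ω, ‖X n ω‖ₑ ∂P ≤ ∫⁻ ω, (1 + ‖X n ω‖ₑ ^ 2) ∂P := by
        refine lintegral_mono fun ω => ?_
        rcases le_total ‖X n ω‖ₑ 1 with h1 | h1
        · exact h1.trans le_self_add
        · exact (le_self_pow₀ h1 two_ne_zero).trans le_add_self
    _ ≤ _ := by
        rw [lintegral_add_left measurable_const]
        simpa using hn

end StochBdd

/-- Chebyshev's inequality. -/
theorem tendsto_wpa_zero_of_lintegral_sq {X : ℕ → Ω → ℝ}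
    (hm : ∀ n, Measurable (X n))
    (h : Tendsto (fun n => ∫⁻ ω, ‖X n ω‖ₑ ^ 2 ∂P) atTop (𝓝 0)) :
    Tendsto (fun x : ℕ × Ω => X x.1 x.2) (wpa P) (𝓝 0) := by
  rw [Metric.tendsto_nhds]
  intro e he
  rw [Filter.Eventually, mem_wpa]
  have hd : Tendsto (fun n => (∫⁻ ω, ‖X n ω‖ₑ ^ 2 ∂P) / ENNReal.ofReal (e ^ 2)) atTop (𝓝 0) := by
    have := ENNReal.Tendsto.div_const h (b := ENNReal.ofReal (e ^ 2))
      (Or.inr (by simpa using he.ne'))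
    simpa using this
  refine tendsto_of_tendsto_of_tendsto_of_le_of_le tendsto_const_nhds hd (fun _ => zero_le) ?_
  intro n
  have := meas_ge_le_lintegral_div (μ := P) (f := fun ω => ‖X n ω‖ₑ ^ 2)
    ((hm n).enorm.pow_const 2).aemeasurable (ε := ENNReal.ofReal (e ^ 2))
    (by simpa using he.ne') ENNReal.ofReal_ne_top
  refine le_trans (measure_mono ?_) this
  intro ω hω
  simp only [Set.mem_ofPred_eq, dist_zero_right, not_lt] at hω ⊢
  rw [← ofReal_norm, ← ENNReal.ofReal_pow (norm_nonneg _)]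
  exact ENNReal.ofReal_le_ofReal (pow_le_pow_left₀ he.le hω 2)

end Stochastic

/-- For `|x| ≤ 1` this is the exponential series remainder. For `|x| ≥ 1` the triangle inequality
bounds the left side by `2 + |x| + |x| ^ 2 / 2`, each term of which is dominated by a multiple of
`|x| ^ 3`; the constant 4 covers both cases. -/
theorem norm_cexp_mul_I_sub_taylor_two_le (x : ℝ) :
    ‖Complex.exp (x * Complex.I) - (1 + x * Complex.I - x ^ 2 / 2)‖ ≤ 4 * |x| ^ 3 := by
  have hnI : ‖(x : ℂ) * Complex.I‖ = |x| := by simp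
  rcases le_total |x| 1 with h | h
  · have := Complex.exp_bound (x := (x : ℂ) * Complex.I) (by rwa [hnI]) (n := 3) (by norm_num)
    rw [hnI] at this
    simp only [Finset.sum_range_succ, Finset.range_zero, Finset.sum_empty] at this
    have he : Complex.exp (x * Complex.I) - (1 + x * Complex.I - x ^ 2 / 2) =
        Complex.exp (↑x * Complex.I) - (0 + (↑x * Complex.I) ^ 0 / ↑(Nat.factorial 0) +
        (↑x * Complex.I) ^ 1 / ↑(Nat.factorial 1) + (↑x * Complex.I) ^ 2 / ↑(Nat.factorial 2)) := by
      simp [mul_pow, Complex.I_sq, Nat.factorial]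
      ring
    rw [he]
    refine this.trans ?_
    rw [mul_comm]
    gcongr
    norm_num [Nat.factorial]
  · have h1 : ‖Complex.exp (x * Complex.I)‖ = 1 := Complex.norm_exp_ofReal_mul_I x
    have h2 : ‖(1 + x * Complex.I - x ^ 2 / 2 : ℂ)‖ ≤ 1 + |x| + |x| ^ 2 / 2 := by
      refine (norm_sub_le _ _).trans (add_le_add ((norm_add_le _ _).trans ?_) ?_)
      · simp
      · simp
    refine (norm_sub_le _ _).trans ?_
    rw [h1]
    have h3 : |x| ≤ |x| ^ 3 := le_self_pow₀ h (by norm_num)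
    have h4 : |x| ^ 2 ≤ |x| ^ 3 := pow_le_pow_right₀ h (by norm_num)
    have h5 : 1 ≤ |x| ^ 3 := one_le_pow₀ h
    linarith

/-! ### Lyapunov's central limit theorem and the variance of sample means. -/

section IID

variable {Ω E : Type*} [MeasurableSpace Ω] [MeasurableSpace E] {P : Measure Ω}
  [IsProbabilityMeasure P] {O : ℕ → Ω → E}

/-- The Taylor error is governed by the third absolute moment. Cauchy–Schwarz, applied to `|ξ| * ξ ^
2`, trades it for second and fourth moments, the ones available later. -/
theorem norm_charFun_sub_le {ξ : Ω → ℝ} (hξ : Measurable ξ) (h4 : MemLp ξ 4 P)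
    (h0 : ∫ ω, ξ ω ∂P = 0) (t : ℝ) :
    ‖charFun (P.map ξ) t - (1 - t ^ 2 / 2 * (∫ ω, ξ ω ^ 2 ∂P : ℝ))‖ ≤
      4 * |t| ^ 3 * (√(∫ ω, ξ ω ^ 2 ∂P) * √(∫ ω, ξ ω ^ 4 ∂P)) := by
  have h2 : MemLp ξ 2 P := h4.mono_exponent (by norm_num)
  have h3 : MemLp ξ 3 P := h4.mono_exponent (by norm_num)
  have i1 : Integrable ξ P := (h4.mono_exponent (by norm_num : (1 : ENNReal) ≤ 4)).integrable le_rfl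
  have i2 : Integrable (fun ω => ξ ω ^ 2) P := h2.integrable_sq
  have i3 : Integrable (fun ω => |ξ ω| ^ 3) P := by
    simpa using h3.integrable_norm_pow (p := 3) (by norm_num)
  have i4 : Integrable (fun ω => ξ ω ^ 4) P := by
    have := h4.integrable_norm_pow (p := 4) (by norm_num)
    refine this.congr (ae_of_all _ fun ω => ?_)
    simp only [Real.norm_eq_abs]
    exact Even.pow_abs (by decide) _
  have iexp : Integrable (fun ω => Complex.exp ((t * ξ ω : ℝ) * Complex.I)) P := by
    refine (integrable_const (1 : ℝ)).mono' (by fun_prop) (ae_of_all _ fun ω => ?_)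
    exact (Complex.norm_exp_ofReal_mul_I _).le
  have e1 : charFun (P.map ξ) t = ∫ ω, Complex.exp ((t * ξ ω : ℝ) * Complex.I) ∂P := by
    rw [charFun_apply_real, integral_map hξ.aemeasurable (by fun_prop)]
    simp
  have e2 : (1 - t ^ 2 / 2 * (∫ ω, ξ ω ^ 2 ∂P : ℝ) : ℂ) =
      ∫ ω, (1 + (t * ξ ω : ℝ) * Complex.I - ((t * ξ ω : ℝ) : ℂ) ^ 2 / 2) ∂P := by
    have a1 : Integrable (fun ω => ((t * ξ ω : ℝ) : ℂ) * Complex.I) P :=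
      ((i1.const_mul t).ofReal).mul_const _
    have a2 : Integrable (fun ω => ((t * ξ ω : ℝ) : ℂ) ^ 2 / 2) P := by
      have : Integrable (fun ω => ((t ^ 2 / 2 * ξ ω ^ 2 : ℝ) : ℂ)) P :=
        (i2.const_mul (t ^ 2 / 2)).ofReal
      refine this.congr (ae_of_all _ fun ω => ?_)
      push_cast; ring
    have b1 : ∫ ω, ((t * ξ ω : ℝ) : ℂ) * Complex.I ∂P = 0 := by
      rw [integral_mul_const, integral_complex_ofReal, integral_const_mul, h0]; simp
    have b2 : ∫ ω, ((t * ξ ω : ℝ) : ℂ) ^ 2 / 2 ∂P = t ^ 2 / 2 * ((∫ ω, ξ ω ^ 2 ∂P : ℝ) : ℂ) := by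
      have : ∀ ω, ((t * ξ ω : ℝ) : ℂ) ^ 2 / 2 = ((t ^ 2 / 2 * ξ ω ^ 2 : ℝ) : ℂ) := fun ω => by
        push_cast; ring
      simp_rw [this]
      rw [integral_complex_ofReal, integral_const_mul]; push_cast; ring
    have a0 : Integrable (fun ω => (1 : ℂ) + ((t * ξ ω : ℝ) : ℂ) * Complex.I) P :=
      (integrable_const _).add a1
    rw [integral_sub a0 a2, integral_add (integrable_const _) a1, b1, b2]
    simp
  rw [e1, e2, ← integral_sub iexp]
  swap
  · have a1 : Integrable (fun ω => ((t * ξ ω : ℝ) : ℂ) * Complex.I) P :=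
      ((i1.const_mul t).ofReal).mul_const _
    have a2 : Integrable (fun ω => ((t * ξ ω : ℝ) : ℂ) ^ 2 / 2) P := by
      have : Integrable (fun ω => ((t ^ 2 / 2 * ξ ω ^ 2 : ℝ) : ℂ)) P :=
        (i2.const_mul (t ^ 2 / 2)).ofReal
      refine this.congr (ae_of_all _ fun ω => ?_)
      push_cast; ring
    exact ((integrable_const _).add a1).sub a2
  refine (norm_integral_le_of_norm_le (g := fun ω => 4 * |t| ^ 3 * |ξ ω| ^ 3)
    (i3.const_mul _) (ae_of_all _ fun ω => ?_)).trans ?_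
  · refine (norm_cexp_mul_I_sub_taylor_two_le _).trans (le_of_eq ?_)
    rw [abs_mul, mul_pow, mul_assoc]
  · rw [integral_const_mul]
    refine mul_le_mul_of_nonneg_left ?_ (by positivity)
    have := integral_mul_le_Lp_mul_Lq_of_nonneg (μ := P) (p := 2) (q := 2)
      (Real.HolderConjugate.two_two) (f := fun ω => |ξ ω|) (g := fun ω => ξ ω ^ 2)
      (ae_of_all _ fun _ => abs_nonneg _) (ae_of_all _ fun _ => sq_nonneg _)
      (by simpa using! h2.abs) (by
        rw [show ENNReal.ofReal 2 = 2 by simp]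
        rw [memLp_two_iff_integrable_sq (by fun_prop)]
        refine i4.congr (ae_of_all _ fun ω => ?_)
        simp only; ring)
    rw [Real.sqrt_eq_rpow, Real.sqrt_eq_rpow]
    refine le_of_eq_of_le ?_ (this.trans (le_of_eq ?_))
    · refine integral_congr_ae (ae_of_all _ fun ω => ?_)
      simp only
      rw [← sq_abs]; ring
    · congr 3 <;> ext ω
      · simp
      · simp only [Real.rpow_two]; ring

/-- Lyapunov's central limit theorem for sums over rows of identically distributed variables. -/
theorem tendstoInDistribution_sum_of_lyapunov (hm : ∀ i, Measurable (O i)) (hind : iIndepFun O P)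
    (hid : ∀ i, IdentDistrib (O i) (O 0) P P) {F : ℕ → E → ℝ} (hF : ∀ n, Measurable (F n))
    (h0 : ∀ᶠ n in atTop, ∫ ω, F n (O 0 ω) ∂P = 0)
    (h4 : ∀ᶠ n in atTop, MemLp (fun ω => F n (O 0 ω)) 4 P)
    (hv : ∀ᶠ n : ℕ in atTop, (n : ℝ) * ∫ ω, F n (O 0 ω) ^ 2 ∂P = 1)
    (hl : Tendsto (fun n : ℕ => (n : ℝ) * ∫ ω, F n (O 0 ω) ^ 4 ∂P) atTop (𝓝 0)) :
    TendstoInDistribution (fun (n : ℕ) ω => ∑ i ∈ Finset.range n, F n (O i ω)) atTop (id : ℝ → ℝ)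
      (fun _ => P) (gaussianReal 0 1) where
  forall_aemeasurable n :=
    (Finset.measurable_fun_sum _ fun i _ => (hF n).comp (hm i)).aemeasurable
  tendsto := by
    refine ProbabilityMeasure.tendsto_iff_tendsto_charFun.2 fun t => ?_
    have hcf : ∀ n : ℕ, charFun (P.map (fun ω => ∑ i ∈ Finset.range n, F n (O i ω))) t =
        (charFun (P.map (fun ω => F n (O 0 ω))) t) ^ n := by
      intro n
      have hind' : iIndepFun (fun i ω => F n (O i ω)) P := hind.comp (fun _ => F n) fun _ => hF n
      rw [(hind'.restrict _).charFun_map_fun_finsetSum_eq_prod (X := fun i ω => F n (O i ω))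
        (fun _ _ => ((hF n).comp (hm _)).aemeasurable)]
      have : ∀ i, P.map (fun ω => F n (O i ω)) = P.map (fun ω => F n (O 0 ω)) := fun i =>
        ((hid i).comp (hF n)).map_eq
      simp [this]
    simp only [ProbabilityMeasure.coe_mk, hcf, Measure.map_id, charFun_gaussianReal]
    have hexp : Tendsto (fun n : ℕ => (charFun (P.map (fun ω => F n (O 0 ω))) t) ^ n) atTop
        (𝓝 (Complex.exp (-(t : ℂ) ^ 2 / 2))) := by
      -- The power of the characteristic function is treated as `(1 + z / n + o(1 / n)) ^ n → exp z`
      -- with `z = -t ^ 2 / 2`.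
      apply Complex.tendsto_pow_exp_of_isLittleO_sub_add_div
      rw [Asymptotics.isLittleO_iff]
      intro c hc
      have hsm : Tendsto (fun n : ℕ => 4 * |t| ^ 3 * √((n : ℝ) * ∫ ω, F n (O 0 ω) ^ 4 ∂P)) atTop
          (𝓝 0) := by
        simpa using ((Real.continuous_sqrt.tendsto _).comp hl).const_mul (4 * |t| ^ 3)
      filter_upwards [h0, h4, hv, hsm.eventually (gt_mem_nhds hc), eventually_gt_atTop 0]
        with n e0 e4 ev es hn
      have hn' : (0 : ℝ) < n := by exact_mod_cast hn
      have hv' : ∫ ω, F n (O 0 ω) ^ 2 ∂P = 1 / n := by field_simp; linarith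
      have := norm_charFun_sub_le ((hF n).comp (hm 0)) e4 e0 t
      simp only [Function.comp_def, hv'] at this
      have hrw : (1 - (t : ℂ) ^ 2 / 2 * ((1 / n : ℝ) : ℂ)) = 1 + -(t : ℂ) ^ 2 / 2 / n := by
        push_cast; ring
      rw [hrw] at this
      refine this.trans ?_
      -- Since the second moment is `1 / n`, the third-order error equals `1 / n` times the square
      -- root of the Lyapunov sum, which tends to zero.
      have e3 : √(1 / (n : ℝ)) * √(∫ ω, F n (O 0 ω) ^ 4 ∂P) =
          √((n : ℝ) * ∫ ω, F n (O 0 ω) ^ 4 ∂P) * (1 / n) := by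
        rw [Real.sqrt_mul hn'.le, Real.sqrt_div zero_le_one, Real.sqrt_one]
        have := Real.mul_self_sqrt hn'.le
        have h5 : √(n : ℝ) ≠ 0 := (Real.sqrt_pos.2 hn').ne'
        field_simp
        rw [sq, this, mul_comm]
      rw [e3, ← mul_assoc]
      have : ‖(1 / (n : ℂ))‖ = 1 / n := by simp
      rw [this]
      exact mul_le_mul_of_nonneg_right es.le (by positivity)
    convert hexp using 3
    simp
    ring

/-- Sample means of square integrable functions have variance of order `1/n`. -/
theorem lintegral_sq_mean_sub_le (hm : ∀ i, Measurable (O i)) (hind : iIndepFun O P)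
    (hid : ∀ i, IdentDistrib (O i) (O 0) P P) {F : E → ℝ} (hF : Measurable F)
    (h2 : MemLp (fun ω => F (O 0 ω)) 2 P) (n : ℕ) (hn : 0 < n) :
    ∫⁻ ω, ‖(n : ℝ)⁻¹ * ∑ i ∈ Finset.range n, F (O i ω) - ∫ ω, F (O 0 ω) ∂P‖ₑ ^ 2 ∂P ≤
      ENNReal.ofReal ((n : ℝ)⁻¹ * ∫ ω, F (O 0 ω) ^ 2 ∂P) := by
  have hn' : (0 : ℝ) < n := by exact_mod_cast hn
  have hid' : ∀ i, IdentDistrib (fun ω => F (O i ω)) (fun ω => F (O 0 ω)) P P := fun i =>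
    (hid i).comp hF
  have hL : ∀ i, MemLp (fun ω => F (O i ω)) 2 P := fun i => (hid' i).memLp_iff.2 h2
  have hmean : ∫ ω, (n : ℝ)⁻¹ * ∑ i ∈ Finset.range n, F (O i ω) ∂P = ∫ ω, F (O 0 ω) ∂P := by
    rw [integral_const_mul, integral_finsetSum _ fun i _ => (hL i).integrable (by norm_num)]
    simp_rw [fun i => (hid' i).integral_eq]
    simp; field_simp
  have hLs : MemLp (fun ω => (n : ℝ)⁻¹ * ∑ i ∈ Finset.range n, F (O i ω)) 2 P :=
    (memLp_finsetSum _ fun i _ => hL i).const_mul _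
  have hvar : Var[fun ω => (n : ℝ)⁻¹ * ∑ i ∈ Finset.range n, F (O i ω); P] =
      (n : ℝ)⁻¹ * Var[fun ω => F (O 0 ω); P] := by
    rw [variance_const_mul]
    have : (fun ω => ∑ i ∈ Finset.range n, F (O i ω)) =
        ∑ i ∈ Finset.range n, fun ω => F (O i ω) := by ext; simp
    rw [this, IndepFun.variance_sum (fun i _ => hL i) ?_]
    · simp_rw [fun i => (hid' i).variance_eq]
      simp; field_simp
    · intro i _ j _ hij
      exact (hind.indepFun hij).comp hF hF
  have hle : Var[fun ω => F (O 0 ω); P] ≤ ∫ ω, F (O 0 ω) ^ 2 ∂P :=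
    variance_le_expectation_sq (hF.comp (hm 0)).aestronglyMeasurable
  have hev := evariance_eq_lintegral_ofReal (fun ω => (n : ℝ)⁻¹ * ∑ i ∈ Finset.range n, F (O i ω)) P
  rw [hmean] at hev
  have : ∫⁻ ω, ‖(n : ℝ)⁻¹ * ∑ i ∈ Finset.range n, F (O i ω) - ∫ ω, F (O 0 ω) ∂P‖ₑ ^ 2 ∂P =
      eVar[fun ω => (n : ℝ)⁻¹ * ∑ i ∈ Finset.range n, F (O i ω); P] := by
    rw [evariance, hmean]
  rw [this, ← hLs.ofReal_variance_eq, hvar]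
  exact ENNReal.ofReal_le_ofReal (mul_le_mul_of_nonneg_left hle (by positivity))

end IID

/-! ### Algebra of the kernel-weighted least squares problem. -/

section LeastSquares

variable {J : Type*} [Fintype J] [DecidableEq J] {p q : ℕ} {k : ℝ → ℝ} {h : ℝ} {s : Side} {n : ℕ}
  {z : ℕ → ℝ} {w : ℕ → J}

theorem gammaHat_apply (a b : Fin (p + 1) × J) :
    gammaHat p k h s n z w a b = (n : ℝ)⁻¹ * ∑ i ∈ Finset.range n,
      sideKernel k h s (z i) * polyRow p h (z i) (w i) a * polyRow p h (z i) (w i) b := by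
  rw [gammaHat, Matrix.smul_apply, Matrix.mul_apply, smul_eq_mul, Finset.sum_range]
  congr 1
  refine Finset.sum_congr rfl fun i _ => ?_
  rw [kernelMat, Matrix.mul_diagonal]
  simp only [designMat, Matrix.transpose_apply, Matrix.of_apply]
  ring

theorem thetaHat_apply (a : Fin (p + 1) × J) (j : J) :
    thetaHat p q k h s n z w a j = (n : ℝ)⁻¹ * ∑ i ∈ Finset.range n,
      sideKernel k h s (z i) * polyRow p h (z i) (w i) a *
        ((z i / h) ^ q * (if w i = j then 1 else 0)) := by
  rw [thetaHat, Matrix.smul_apply, Matrix.mul_apply, smul_eq_mul, Finset.sum_range]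
  congr 1
  refine Finset.sum_congr rfl fun i _ => ?_
  rw [kernelMat, Matrix.mul_diagonal]
  simp only [designMat, powerMat, Matrix.transpose_apply, Matrix.of_apply]
  ring

theorem psiHat_apply (σ : ℕ → ℝ) (a b : Fin (p + 1) × J) :
    psiHat p k h s n z w σ a b = (n : ℝ)⁻¹ * ∑ i ∈ Finset.range n,
      sideKernel k h s (z i) ^ 2 * σ i * polyRow p h (z i) (w i) a *
        polyRow p h (z i) (w i) b := by
  rw [psiHat, Matrix.smul_apply, Matrix.mul_apply, smul_eq_mul, Finset.sum_range]
  congr 1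
  refine Finset.sum_congr rfl fun i _ => ?_
  rw [kernelMat, Matrix.mul_diagonal, Matrix.mul_diagonal, Matrix.mul_diagonal]
  simp only [designMat, Matrix.transpose_apply, Matrix.of_apply]
  ring

/-- The vector `X_p(h)' K^s(h) v / n`. -/
noncomputable def score (p : ℕ) (k : ℝ → ℝ) (h : ℝ) (s : Side) (n : ℕ) (z : ℕ → ℝ) (w : ℕ → J) (v : ℕ → ℝ) :
    Fin (p + 1) × J → ℝ :=
  fun a => (n : ℝ)⁻¹ * ∑ i ∈ Finset.range n,
    sideKernel k h s (z i) * polyRow p h (z i) (w i) a * v i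

/-- The intercepts `e_0' Γ⁻¹ X_p(h)' K^s(h) v / n`. -/
noncomputable def interceptMap (p : ℕ) (k : ℝ → ℝ) (h : ℝ) (s : Side) (n : ℕ) (z : ℕ → ℝ)
    (w : ℕ → J) (v : ℕ → ℝ) : J → ℝ :=
  selIntercept p J *ᵥ ((gammaHat p k h s n z w)⁻¹ *ᵥ score p k h s n z w v)

theorem selIntercept_mulVec (b : Fin (p + 1) × J → ℝ) :
    selIntercept p J *ᵥ b = fun j => b (0, j) := by
  ext j
  simp [selIntercept, Matrix.mulVec, dotProduct]

theorem score_congr {v v' : ℕ → ℝ}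
    (hv : ∀ i < n, sideKernel k h s (z i) ≠ 0 → v i = v' i) :
    score p k h s n z w v = score p k h s n z w v' := by
  ext a
  refine congrArg _ (Finset.sum_congr rfl fun i hi => ?_)
  by_cases h0 : sideKernel k h s (z i) = 0
  · simp [h0]
  · rw [hv i (Finset.mem_range.1 hi) h0]

theorem score_add (v v' : ℕ → ℝ) :
    score p k h s n z w (fun i => v i + v' i) =
      score p k h s n z w v + score p k h s n z w v' := by
  ext a
  simp only [score, Pi.add_apply, mul_add, Finset.sum_add_distrib]

theorem score_const_mul (c : ℝ) (v : ℕ → ℝ) :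
    score p k h s n z w (fun i => c * v i) = c • score p k h s n z w v := by
  ext a
  simp only [score, Pi.smul_apply, smul_eq_mul, Finset.mul_sum]
  exact Finset.sum_congr rfl fun i _ => by ring

theorem score_polyRow (b : Fin (p + 1) × J → ℝ) :
    score p k h s n z w (fun i => b ⬝ᵥ polyRow p h (z i) (w i)) =
      gammaHat p k h s n z w *ᵥ b := by
  ext a
  simp only [score, Matrix.mulVec, dotProduct, gammaHat_apply, Finset.mul_sum, Finset.sum_mul]
  rw [Finset.sum_comm]
  refine Finset.sum_congr rfl fun i _ => Finset.sum_congr rfl fun c _ => by ring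

theorem score_power (θ : J → ℝ) :
    score p k h s n z w (fun i => (z i / h) ^ q * θ (w i)) =
      thetaHat p q k h s n z w *ᵥ θ := by
  ext a
  simp only [score, Matrix.mulVec, dotProduct, thetaHat_apply, Finset.mul_sum, Finset.sum_mul]
  rw [Finset.sum_comm]
  refine Finset.sum_congr rfl fun i _ => ?_
  rw [Finset.sum_eq_single (w i)]
  · simp; ring
  · intro j _ hj
    simp [hj.symm]
  · simp

/-- Moving one coefficient by `t` changes the criterion by `-2 * t * A + t ^ 2 * C`. This is
nonnegative for every `t` only if `A = 0`. -/
theorem IsLocalPolyFit.normal_equations {v : ℕ → ℝ} {b : Fin (p + 1) × J → ℝ}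
    (hk : ∀ u, 0 ≤ sideKernel k h s u)
    (hb : IsLocalPolyFit p k h s n z w v b) (a : Fin (p + 1) × J) :
    ∑ i ∈ Finset.range n, sideKernel k h s (z i) * polyRow p 1 (z i) (w i) a *
      (v i - b ⬝ᵥ polyRow p 1 (z i) (w i)) = 0 := by
  set A := ∑ i ∈ Finset.range n, sideKernel k h s (z i) * polyRow p 1 (z i) (w i) a *
      (v i - b ⬝ᵥ polyRow p 1 (z i) (w i)) with hA
  set C := ∑ i ∈ Finset.range n, sideKernel k h s (z i) * polyRow p 1 (z i) (w i) a ^ 2 with hC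
  have hC0 : 0 ≤ C := Finset.sum_nonneg fun i _ => mul_nonneg (hk _) (sq_nonneg _)
  have key : ∀ t : ℝ, 0 ≤ -2 * t * A + t ^ 2 * C := by
    intro t
    have h1 := hb (b + Pi.single a t)
    have h2 : ∑ i ∈ Finset.range n, (v i - (b + Pi.single a t) ⬝ᵥ polyRow p 1 (z i) (w i)) ^ 2 *
        sideKernel k h s (z i) = ∑ i ∈ Finset.range n, (v i - b ⬝ᵥ polyRow p 1 (z i) (w i)) ^ 2 *
        sideKernel k h s (z i) + (-2 * t * A + t ^ 2 * C) := by
      rw [hA, hC, Finset.mul_sum, Finset.mul_sum, ← Finset.sum_add_distrib,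
        ← Finset.sum_add_distrib]
      refine Finset.sum_congr rfl fun i _ => ?_
      rw [add_dotProduct, single_dotProduct]
      ring
    linarith
  -- The minimizing `t` would be `A / C`; adding one to the denominator covers the case `C = 0`.
  have := key (A / (C + 1))
  have h3 : -2 * (A / (C + 1)) * A + (A / (C + 1)) ^ 2 * C = -(A ^ 2 * (C + 2)) / (C + 1) ^ 2 := by
    field_simp; ring
  rw [h3] at this
  have h4 : 0 ≤ -(A ^ 2 * (C + 2)) := by
    by_contra hcon
    push Not at hcon
    have := div_neg_of_neg_of_pos hcon (by positivity : 0 < (C + 1) ^ 2)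
    linarith
  have h5 : A ^ 2 ≤ 0 := by nlinarith [sq_nonneg A]
  exact pow_eq_zero_iff two_ne_zero |>.1 (le_antisymm h5 (sq_nonneg A))

theorem sideKernel_nonneg (hk : ∀ u, 0 ≤ k u) (hh : 0 ≤ h) (u : ℝ) : 0 ≤ sideKernel k h s u := by
  cases s <;> simp only [sideKernel] <;> split_ifs <;> first | exact le_rfl | skip
  all_goals exact mul_nonneg (inv_nonneg.2 hh) (hk _)

/-- The criterion uses powers of `z`, the design matrix powers of `z / h`. Rescaling the coefficient
of degree `a` by `h ^ a` passes from one to the other and leaves the intercept, of degree zero,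
unchanged. Invertibility of the design matrix then determines the solution. -/
theorem IsLocalPolyFit.intercept_eq {v : ℕ → ℝ} {b : Fin (p + 1) × J → ℝ}
    (hk : ∀ u, 0 ≤ k u) (hh : 0 < h)
    (hb : IsLocalPolyFit p k h s n z w v b) (hΓ : IsUnit (gammaHat p k h s n z w).det) :
    (fun j => b (0, j)) = interceptMap p k h s n z w v := by
  set b' : Fin (p + 1) × J → ℝ := fun a => b a * h ^ (a.1 : ℕ) with hb'
  have hrow : ∀ (x : ℝ) (j : J) (a : Fin (p + 1) × J),
      polyRow p h x j a = (h ^ (a.1 : ℕ))⁻¹ * polyRow p 1 x j a := by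
    intro x j a
    simp only [polyRow, div_pow, div_one]
    ring
  have hdot : ∀ (x : ℝ) (j : J), b' ⬝ᵥ polyRow p h x j = b ⬝ᵥ polyRow p 1 x j := by
    intro x j
    refine Finset.sum_congr rfl fun a _ => ?_
    rw [hrow, hb']
    have : h ^ (a.1 : ℕ) ≠ 0 := by positivity
    field_simp
  have hs : score p k h s n z w v = gammaHat p k h s n z w *ᵥ b' := by
    rw [← score_polyRow]
    ext a
    have := hb.normal_equations (sideKernel_nonneg hk hh.le) a
    simp only [score]
    congr 1
    rw [← sub_eq_zero, ← Finset.sum_sub_distrib]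
    have h2 := congrArg (fun x => (h ^ (a.1 : ℕ))⁻¹ * x) this
    simp only [mul_zero, Finset.mul_sum] at h2
    rw [← h2]
    refine Finset.sum_congr rfl fun i _ => ?_
    rw [hdot, hrow]
    ring
  rw [interceptMap, hs, Matrix.mulVec_mulVec _ _ (gammaHat p k h s n z w), Matrix.nonsing_inv_mul _ hΓ, Matrix.one_mulVec,
    selIntercept_mulVec]
  ext j
  simp [hb']

/-- The intercepts of a local linear fit to a quadratic function plus an error. -/
theorem interceptMap_quadratic {v r : ℕ → ℝ} {m₀ m₁ m₂ : J → ℝ} (hh : h ≠ 0)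
    (hΓ : IsUnit (gammaHat 1 k h s n z w).det)
    (hv : ∀ i < n, sideKernel k h s (z i) ≠ 0 →
      v i = m₀ (w i) + m₁ (w i) * z i + m₂ (w i) * z i ^ 2 / 2 + r i) :
    interceptMap 1 k h s n z w v =
      m₀ + h ^ 2 • ((Nat.factorial 2 : ℝ)⁻¹ • (biasFactor 1 2 k h s n z w *ᵥ m₂)) +
        interceptMap 1 k h s n z w r := by
  set b : Fin (1 + 1) × J → ℝ := fun a => if a.1 = 0 then m₀ a.2 else h * m₁ a.2 with hb
  have hv' : ∀ i < n, sideKernel k h s (z i) ≠ 0 →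
      v i = b ⬝ᵥ polyRow 1 h (z i) (w i) + (h ^ 2 / 2 * ((z i / h) ^ 2 * m₂ (w i)) + r i) := by
    intro i hi h0
    rw [hv i hi h0]
    have : b ⬝ᵥ polyRow 1 h (z i) (w i) = m₀ (w i) + m₁ (w i) * z i := by
      simp only [dotProduct, polyRow, Fintype.sum_prod_type, Fin.sum_univ_succ (n := 1), hb]
      simp
      field_simp
    rw [this]
    field_simp
    ring
  rw [interceptMap, score_congr hv', score_add, score_add, score_const_mul, score_polyRow,
    score_power, Matrix.mulVec_add, Matrix.mulVec_add, Matrix.mulVec_add, Matrix.mulVec_add,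
    Matrix.mulVec_mulVec _ _ (gammaHat 1 k h s n z w), Matrix.nonsing_inv_mul _ hΓ,
    Matrix.one_mulVec, selIntercept_mulVec, ← interceptMap, ← add_assoc]
  congr 2
  rw [Matrix.mulVec_smul, Matrix.mulVec_smul, biasFactor, ← Matrix.mulVec_mulVec,
    ← Matrix.mulVec_mulVec, smul_smul]
  congr 1

end LeastSquares

/-! ### The limiting design matrix and its equivalent kernel. -/

section Limit

variable {J : Type*} [Fintype J] [DecidableEq J] {k : ℝ → ℝ} {s : Side}

/-- The factor `e_0' (Γ_1^s)⁻¹ r_1(u)` of the equivalent kernel of local linear regression. -/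
noncomputable def equivFactor (k : ℝ → ℝ) (s : Side) (u : ℝ) : ℝ :=
  (kernelMoments 1 k s)⁻¹ 0 0 + (kernelMoments 1 k s)⁻¹ 0 1 * u

/-- The limit of `Γ_{s,1}(h)` when the density is `c` and the cell probabilities are `π`. -/
noncomputable def gammaLim (k : ℝ → ℝ) (s : Side) (c : ℝ) (π : J → ℝ) :
    Matrix (Fin (1 + 1) × J) (Fin (1 + 1) × J) ℝ :=
  c • (kernelMoments 1 k s ⊗ₖ Matrix.diagonal π)

theorem gammaLim_inv {c : ℝ} {π : J → ℝ} (hc : c ≠ 0) (hπ : ∀ j, π j ≠ 0)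
    (hK : IsUnit (kernelMoments 1 k s).det) :
    IsUnit (gammaLim k s c π).det ∧ (gammaLim k s c π)⁻¹ =
      c⁻¹ • ((kernelMoments 1 k s)⁻¹ ⊗ₖ Matrix.diagonal fun j => (π j)⁻¹) := by
  have hmul : gammaLim k s c π *
      (c⁻¹ • ((kernelMoments 1 k s)⁻¹ ⊗ₖ Matrix.diagonal fun j => (π j)⁻¹)) = 1 := by
    rw [gammaLim, Matrix.smul_mul, Matrix.mul_smul, smul_smul, mul_inv_cancel₀ hc, one_smul,
      ← Matrix.mul_kronecker_mul, Matrix.mul_nonsing_inv _ hK, Matrix.diagonal_mul_diagonal]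
    have : (fun j => π j * (π j)⁻¹) = fun _ => 1 := by ext j; exact mul_inv_cancel₀ (hπ j)
    rw [this, Matrix.diagonal_one, Matrix.one_kronecker_one]
  exact ⟨Matrix.isUnit_det_of_right_inverse hmul, Matrix.inv_eq_right_inv hmul⟩

/-- The inverse of the limit is a Kronecker product with a diagonal factor, so cells do not mix: an
observation reaches only the intercept of its own cell, with weight `equivFactor` over density times
cell probability. -/
theorem gammaLim_inv_mulVec_polyRow {c : ℝ} {π : J → ℝ} (hc : c ≠ 0) (hπ : ∀ j, π j ≠ 0)
    (hK : IsUnit (kernelMoments 1 k s).det) (h x : ℝ) (w j : J) :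
    (selIntercept 1 J *ᵥ ((gammaLim k s c π)⁻¹ *ᵥ polyRow 1 h x w)) j =
      if w = j then equivFactor k s (x / h) / (c * π j) else 0 := by
  rw [(gammaLim_inv hc hπ hK).2, selIntercept_mulVec]
  have hin : ∀ a : Fin (1 + 1), ∑ l : J,
      (c⁻¹ • ((kernelMoments 1 k s)⁻¹ ⊗ₖ Matrix.diagonal fun j => (π j)⁻¹)) (0, j) (a, l) *
        polyRow 1 h x w (a, l) =
      if w = j then (kernelMoments 1 k s)⁻¹ 0 a * (x / h) ^ (a : ℕ) / (c * π j) else 0 := by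
    intro a
    rw [Finset.sum_eq_single j]
    · rw [Matrix.smul_apply, Matrix.kroneckerMap_apply, Matrix.diagonal_apply_eq, smul_eq_mul,
        polyRow]
      split_ifs
      · have := hπ j
        field_simp
      · simp
    · intro l _ hl
      rw [Matrix.smul_apply, Matrix.kroneckerMap_apply, Matrix.diagonal_apply_ne' _ hl]
      simp
    · simp
  change ∑ a, (c⁻¹ • ((kernelMoments 1 k s)⁻¹ ⊗ₖ Matrix.diagonal fun j => (π j)⁻¹)) (0, j) a *
    polyRow 1 h x w a = _
  rw [Fintype.sum_prod_type]
  simp only [hin]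
  rw [Fin.sum_univ_succ]
  split_ifs
  · simp [equivFactor]
    ring
  · simp

end Limit

instance : DecidableEq Regressand
  | .outcome, .outcome => isTrue rfl
  | .treatment, .treatment => isTrue rfl
  | .dummies, .dummies => isTrue rfl
  | .outcome, .treatment => isFalse nofun
  | .outcome, .dummies => isFalse nofun
  | .treatment, .outcome => isFalse nofun
  | .treatment, .dummies => isFalse nofun
  | .dummies, .outcome => isFalse nofun
  | .dummies, .treatment => isFalse nofun

instance : Fintype Regressand where
  elems := {.outcome, .treatment, .dummies}
  complete := by rintro (_ | _ | _) <;> decide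

theorem sum_regressand {M : Type*} [AddCommMonoid M] (F : Regressand → M) :
    ∑ U, F U = F .outcome + F .treatment + F .dummies := by
  have : (Finset.univ : Finset Regressand) = {.outcome, .treatment, .dummies} := rfl
  rw [this, Finset.sum_insert (by decide), Finset.sum_insert (by decide), Finset.sum_singleton,
    add_assoc]

/-! ### The linearized estimator, its bias as a linear form and its variance as a quadratic form. -/

section Forms

variable {𝓦 κ : Type*} [Fintype 𝓦] [DecidableEq 𝓦] [Fintype κ] [DecidableEq κ]

/-- The derivative of the Wald ratio with respect to `τ_U`. -/
noncomputable def ratioGrad (c : 𝓦 → ℝ) (δ : Regressand → 𝓦 → ℝ) : Regressand → ℝ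
  | .outcome => 1 / (c ⬝ᵥ δ .treatment)
  | .treatment => -(c ⬝ᵥ δ .outcome) / (c ⬝ᵥ δ .treatment) ^ 2
  | .dummies => 0

/-- The derivative of the Wald ratio with respect to the weights `c`. -/
noncomputable def weightGrad (c : 𝓦 → ℝ) (δ : Regressand → 𝓦 → ℝ) : 𝓦 → ℝ :=
  ratioGrad c δ .outcome • δ .outcome + ratioGrad c δ .treatment • δ .treatment

/-- The coefficients of `μ̂_U^s` in the linearized estimator. -/
noncomputable def linCoef (c : 𝓦 → ℝ) (δ : Regressand → 𝓦 → ℝ) (V : κ → Regressand)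
    (G : Side → κ → Matrix 𝓦 𝓦 ℝ) (s : Side) : Regressand → 𝓦 → ℝ :=
  s.sgn • (Pi.single .outcome (ratioGrad c δ .outcome • c) +
    Pi.single .treatment (ratioGrad c δ .treatment • c)) +
  ∑ v, Pi.single (V v) (weightGrad c δ ᵥ* G s v)

/-- The bilinear form of a family of cross covariance matrices. -/
def covForm (C : Regressand → Regressand → Matrix 𝓦 𝓦 ℝ) (x y : Regressand → 𝓦 → ℝ) : ℝ :=
  ∑ U, ∑ U', x U ⬝ᵥ (C U U' *ᵥ y U')

theorem covForm_add_left (C : Regressand → Regressand → Matrix 𝓦 𝓦 ℝ)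
    (x x' y : Regressand → 𝓦 → ℝ) : covForm C (x + x') y = covForm C x y + covForm C x' y := by
  simp only [covForm, Pi.add_apply, add_dotProduct, Finset.sum_add_distrib]

theorem covForm_add_right (C : Regressand → Regressand → Matrix 𝓦 𝓦 ℝ)
    (x y y' : Regressand → 𝓦 → ℝ) : covForm C x (y + y') = covForm C x y + covForm C x y' := by
  simp only [covForm, Pi.add_apply, Matrix.mulVec_add, dotProduct_add, Finset.sum_add_distrib]

theorem covForm_smul_left (C : Regressand → Regressand → Matrix 𝓦 𝓦 ℝ) (t : ℝ)
    (x y : Regressand → 𝓦 → ℝ) : covForm C (t • x) y = t * covForm C x y := by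
  simp only [covForm, Pi.smul_apply, smul_dotProduct, smul_eq_mul, Finset.mul_sum]

theorem covForm_smul_right (C : Regressand → Regressand → Matrix 𝓦 𝓦 ℝ) (t : ℝ)
    (x y : Regressand → 𝓦 → ℝ) : covForm C x (t • y) = t * covForm C x y := by
  simp only [covForm, Pi.smul_apply, Matrix.mulVec_smul, dotProduct_smul, smul_eq_mul,
    Finset.mul_sum]

theorem covForm_sum_left {ι : Type*} (S : Finset ι) (C : Regressand → Regressand → Matrix 𝓦 𝓦 ℝ)
    (x : ι → Regressand → 𝓦 → ℝ) (y : Regressand → 𝓦 → ℝ) :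
    covForm C (∑ i ∈ S, x i) y = ∑ i ∈ S, covForm C (x i) y := by
  classical
  induction S using Finset.induction_on with
  | empty => simp [covForm]
  | insert i S hi ih => rw [Finset.sum_insert hi, Finset.sum_insert hi, covForm_add_left, ih]

theorem covForm_sum_right {ι : Type*} (S : Finset ι) (C : Regressand → Regressand → Matrix 𝓦 𝓦 ℝ)
    (x : Regressand → 𝓦 → ℝ) (y : ι → Regressand → 𝓦 → ℝ) :
    covForm C x (∑ i ∈ S, y i) = ∑ i ∈ S, covForm C x (y i) := by
  classical
  induction S using Finset.induction_on with
  | empty => simp [covForm]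
  | insert i S hi ih => rw [Finset.sum_insert hi, Finset.sum_insert hi, covForm_add_right, ih]

theorem covForm_single (C : Regressand → Regressand → Matrix 𝓦 𝓦 ℝ) (U U' : Regressand)
    (x y : 𝓦 → ℝ) :
    covForm C (Pi.single U x) (Pi.single U' y) = x ⬝ᵥ (C U U' *ᵥ y) := by
  rw [covForm, Finset.sum_eq_single U, Finset.sum_eq_single U']
  · simp
  · intro b _ hb; simp [hb]
  · simp
  · intro b _ hb; simp [hb]
  · simp

theorem covForm_comm {C : Regressand → Regressand → Matrix 𝓦 𝓦 ℝ}
    (hC : ∀ U U', C U' U = (C U U')ᵀ) (x y : Regressand → 𝓦 → ℝ) :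
    covForm C x y = covForm C y x := by
  rw [covForm, covForm, Finset.sum_comm]
  refine Finset.sum_congr rfl fun U' _ => Finset.sum_congr rfl fun U _ => ?_
  rw [hC U U', Matrix.mulVec_transpose, Matrix.dotProduct_mulVec, dotProduct_comm]

/-- Both sides are expanded into the same three families of scalars: `p` (covariances of
intercepts), `e` (intercepts against weights) and `r` (weights). Symmetry of the covariances
identifies the two outcome–treatment cross terms, and the signs of the sides disappear from `p`
because their squares are one. -/
theorem wlateVar_eq {c : 𝓦 → ℝ} {δ : Regressand → 𝓦 → ℝ} {V : κ → Regressand}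
    {G : Side → κ → Matrix 𝓦 𝓦 ℝ} {C : Side → Regressand → Regressand → Matrix 𝓦 𝓦 ℝ}
    (hC : ∀ s U U', C s U' U = (C s U U')ᵀ) :
    wlateVar c δ V G C =
      sumSides fun s => covForm (C s) (linCoef c δ V G s) (linCoef c δ V G s) := by
  set e : Side → Regressand → Regressand → ℝ := fun s U U' =>
    ∑ v, c ⬝ᵥ (C s U (V v) *ᵥ (δ U' ᵥ* G s v)) with he
  set r : Side → Regressand → Regressand → ℝ := fun s U U' =>
    ∑ v, ∑ v', (δ U ᵥ* G s v) ⬝ᵥ (C s (V v) (V v') *ᵥ (δ U' ᵥ* G s v')) with hr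
  set p : Side → Regressand → Regressand → ℝ := fun s U U' => c ⬝ᵥ (C s U U' *ᵥ c) with hp
  have hpX : ∀ s, p s .treatment .outcome = p s .outcome .treatment := fun s => by
    have := covForm_comm (hC s) (Pi.single .treatment c) (Pi.single .outcome c)
    simpa only [covForm_single] using this
  have hrX : ∀ s, r s .treatment .outcome = r s .outcome .treatment := fun s => by
    have := covForm_comm (hC s) (∑ v, Pi.single (V v) (δ .treatment ᵥ* G s v))
      (∑ v, Pi.single (V v) (δ .outcome ᵥ* G s v))
    simp only [covForm_sum_left, covForm_sum_right, covForm_single] at this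
    simp only [hr]
    rw [Finset.sum_comm, this, Finset.sum_comm]
  have hT : ∀ U U', c ⬝ᵥ ((sumSides fun s => C s U U') *ᵥ c) +
      c ⬝ᵥ ((sumSides fun s => s.sgn • ∑ v, C s U (V v) * (G s v)ᵀ) *ᵥ δ U') +
      c ⬝ᵥ ((sumSides fun s => s.sgn • ∑ v, C s U' (V v) * (G s v)ᵀ) *ᵥ δ U) +
      δ U ⬝ᵥ ((sumSides fun s => ∑ v, ∑ v', G s v * C s (V v) (V v') * (G s v')ᵀ) *ᵥ δ U') =
      sumSides fun s => p s U U' + s.sgn * e s U U' + s.sgn * e s U' U + r s U U' := by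
    intro U U'
    simp only [sumSides, hp, he, hr, Matrix.add_mulVec, dotProduct_add, Matrix.smul_mulVec,
      dotProduct_smul, Matrix.sum_mulVec, dotProduct_sum, ← Matrix.mulVec_mulVec,
      Matrix.mulVec_transpose, smul_eq_mul, Matrix.dotProduct_mulVec (δ U) (G _ _)]
    ring
  have hQ : ∀ s, covForm (C s) (linCoef c δ V G s) (linCoef c δ V G s) =
      s.sgn ^ 2 * (ratioGrad c δ .outcome ^ 2 * p s .outcome .outcome +
        2 * ratioGrad c δ .outcome * ratioGrad c δ .treatment * p s .outcome .treatment +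
        ratioGrad c δ .treatment ^ 2 * p s .treatment .treatment) +
      2 * s.sgn * (ratioGrad c δ .outcome ^ 2 * e s .outcome .outcome +
        ratioGrad c δ .outcome * ratioGrad c δ .treatment *
          (e s .outcome .treatment + e s .treatment .outcome) +
        ratioGrad c δ .treatment ^ 2 * e s .treatment .treatment) +
      (ratioGrad c δ .outcome ^ 2 * r s .outcome .outcome +
        2 * ratioGrad c δ .outcome * ratioGrad c δ .treatment * r s .outcome .treatment +
        ratioGrad c δ .treatment ^ 2 * r s .treatment .treatment) := by
    intro s
    have hsum : ∑ v, (Pi.single (V v) (weightGrad c δ ᵥ* G s v) : Regressand → 𝓦 → ℝ) =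
        ratioGrad c δ .outcome •
          ∑ v, (Pi.single (V v) (δ .outcome ᵥ* G s v) : Regressand → 𝓦 → ℝ) +
        ratioGrad c δ .treatment •
          ∑ v, (Pi.single (V v) (δ .treatment ᵥ* G s v) : Regressand → 𝓦 → ℝ) := by
      rw [Finset.smul_sum, Finset.smul_sum, ← Finset.sum_add_distrib]
      refine Finset.sum_congr rfl fun v _ => ?_
      rw [weightGrad, Matrix.add_vecMul, Matrix.smul_vecMul, Matrix.smul_vecMul, Pi.single_add,
        Pi.single_smul, Pi.single_smul]
    have e1 : ∀ U U', covForm (C s) (Pi.single U c) (∑ v, Pi.single (V v) (δ U' ᵥ* G s v)) =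
        e s U U' := fun U U' => by simp only [covForm_sum_right, covForm_single, he]
    have e2 : ∀ U U', covForm (C s) (∑ v, Pi.single (V v) (δ U' ᵥ* G s v)) (Pi.single U c) =
        e s U U' := fun U U' => by rw [covForm_comm (hC s), e1]
    have e3 : ∀ U U', covForm (C s) (∑ v, Pi.single (V v) (δ U ᵥ* G s v))
        (∑ v, Pi.single (V v) (δ U' ᵥ* G s v)) = r s U U' := fun U U' => by
      simp only [covForm_sum_right, covForm_sum_left, covForm_single, hr]
      rw [Finset.sum_comm]
    have e4 : ∀ U U', covForm (C s) (Pi.single U c) (Pi.single U' c) = p s U U' := fun U U' => by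
      simp only [covForm_single, hp]
    rw [linCoef, hsum, Pi.single_smul, Pi.single_smul]
    simp only [covForm_add_left, covForm_add_right, covForm_smul_left, covForm_smul_right, e1, e2,
      e3, e4, hpX, hrX]
    ring
  simp only [wlateVar, hT, hQ]
  simp only [sumSides, Side.sgn, ratioGrad]
  ring

/-- Used twice: with the one-sided biases it expresses the bias constant, and with the estimation
errors of the intercepts it expresses the first-order term of the delta method. -/
theorem wlateBias_eq (c : 𝓦 → ℝ) (δ : Regressand → 𝓦 → ℝ) (V : κ → Regressand)
    (G : Side → κ → Matrix 𝓦 𝓦 ℝ) (b : Side → Regressand → 𝓦 → ℝ) :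
    wlateBias c δ V G b = sumSides fun s => ∑ U, linCoef c δ V G s U ⬝ᵥ b s U := by
  have hsingle : ∀ (s : Side) (W : Regressand) (x : 𝓦 → ℝ),
      ∑ U, (Pi.single W x : Regressand → 𝓦 → ℝ) U ⬝ᵥ b s U = x ⬝ᵥ b s W := by
    intro s W x
    rw [Finset.sum_eq_single W]
    · simp
    · intro U _ hU; simp [hU]
    · simp
  have hL : ∀ s, ∑ U, linCoef c δ V G s U ⬝ᵥ b s U =
      s.sgn * (ratioGrad c δ .outcome * (c ⬝ᵥ b s .outcome) +
        ratioGrad c δ .treatment * (c ⬝ᵥ b s .treatment)) +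
      (ratioGrad c δ .outcome * ((∑ v, G s v *ᵥ b s (V v)) ⬝ᵥ δ .outcome) +
        ratioGrad c δ .treatment * ((∑ v, G s v *ᵥ b s (V v)) ⬝ᵥ δ .treatment)) := by
    intro s
    simp only [linCoef, Pi.add_apply, Pi.smul_apply, Finset.sum_apply, add_dotProduct,
      smul_dotProduct, sum_dotProduct, Finset.sum_add_distrib, smul_eq_mul]
    rw [← Finset.mul_sum, Finset.sum_add_distrib, Finset.sum_comm]
    simp only [hsingle, weightGrad, ← Matrix.dotProduct_mulVec, add_dotProduct, smul_dotProduct,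
      Finset.sum_add_distrib, smul_eq_mul, Finset.mul_sum, dotProduct_comm _ (δ _)]
  simp only [wlateBias, sumSides, hL, Side.sgn, ratioGrad, dotProduct_sub, add_dotProduct]
  ring

end Forms

/-! ### Conditional laws, regression errors and the tower property. -/

section Disintegration

variable {Ω 𝓦 : Type*} [MeasurableSpace Ω] [Fintype 𝓦] [DecidableEq 𝓦] [Nonempty 𝓦]
  [MeasurableSpace 𝓦] [DiscreteMeasurableSpace 𝓦]

/-- The `i`-th observation. -/
def Data.obs (D : Data Ω 𝓦) (i : ℕ) (ω : Ω) : ℝ × ℝ × ℝ × 𝓦 :=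
  (D.Y i ω, D.X i ω, D.Z i ω, D.W i ω)

variable {P : Measure Ω} [IsProbabilityMeasure P] {D : Data Ω 𝓦}

/-- The conditional mean of `Y` or `X` given `(Z, W)`. -/
noncomputable def meanYX (P : Measure Ω) [IsFiniteMeasure P] (D : Data Ω 𝓦) (U : Regressand)
    (a : ℝ × 𝓦) : ℝ := ∫ q, U.coord q ∂lawYX P D a

/-- The conditional probability of a cell given `Z`. -/
noncomputable def meanW (P : Measure Ω) [IsFiniteMeasure P] (D : Data Ω 𝓦) (j : 𝓦) (z : ℝ) : ℝ :=
  (lawW P D z).real {j}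

/-- The regression error of `Y` or `X`. -/
noncomputable def errYX (P : Measure Ω) [IsFiniteMeasure P] (D : Data Ω 𝓦) (U : Regressand)
    (o : ℝ × ℝ × ℝ × 𝓦) : ℝ := U.coord (o.1, o.2.1) - meanYX P D U o.2.2

/-- The regression error of a cell dummy. -/
noncomputable def errW (P : Measure Ω) [IsFiniteMeasure P] (D : Data Ω 𝓦) (j : 𝓦)
    (o : ℝ × ℝ × ℝ × 𝓦) : ℝ := (if o.2.2.2 = j then 1 else 0) - meanW P D j o.2.2.1

instance : IsMarkovKernel (lawYX P D) := by unfold lawYX; infer_instance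

instance : IsMarkovKernel (lawW P D) := by unfold lawW; infer_instance

theorem Regressand.measurable_coord (U : Regressand) : Measurable U.coord := by
  cases U
  · exact measurable_fst
  · exact measurable_snd
  · exact measurable_const

theorem measurable_meanYX (U : Regressand) : Measurable (meanYX P D U) :=
  (U.measurable_coord.stronglyMeasurable.integral_kernel (κ := lawYX P D)).measurable

theorem measurable_meanW (j : 𝓦) : Measurable (meanW P D j) :=
  ((lawW P D).measurable_coe (measurableSet_singleton j)).ennreal_toReal

theorem measurable_errW (j : 𝓦) : Measurable (errW P D j) := by
  refine Measurable.sub ?_ ((measurable_meanW j).comp (by fun_prop))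
  exact Measurable.ite ((measurableSet_singleton j).preimage (by fun_prop)) measurable_const
    measurable_const

theorem measurable_condCov (U U' : Regressand) :
    Measurable (fun a : ℝ × 𝓦 => condCov P D U U' a.1 a.2) := by
  have h : Measurable (fun x : (ℝ × 𝓦) × (ℝ × ℝ) =>
      (U.coord x.2 - meanYX P D U x.1) * (U'.coord x.2 - meanYX P D U' x.1)) :=
    ((U.measurable_coord.comp measurable_snd).sub ((measurable_meanYX U).comp measurable_fst)).mul
      ((U'.measurable_coord.comp measurable_snd).sub ((measurable_meanYX U').comp measurable_fst))
  exact (h.stronglyMeasurable.integral_kernel_prod_right' (κ := lawYX P D)).measurable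

theorem measurable_condCovW (j l : 𝓦) : Measurable (condCovW P D j l) := by
  have hd : ∀ j : 𝓦, Measurable (fun w : 𝓦 => if w = j then (1 : ℝ) else 0) := fun j =>
    measurable_of_countable _
  have hi : ∀ j : 𝓦, Measurable (fun z => ∫ w, (if w = j then (1 : ℝ) else 0) ∂lawW P D z) :=
    fun j => ((hd j).stronglyMeasurable.integral_kernel (κ := lawW P D)).measurable
  have h : Measurable (fun x : ℝ × 𝓦 =>
      ((if x.2 = j then (1 : ℝ) else 0) - ∫ w, (if w = j then (1 : ℝ) else 0) ∂lawW P D x.1) *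
      ((if x.2 = l then (1 : ℝ) else 0) - ∫ w, (if w = l then (1 : ℝ) else 0) ∂lawW P D x.1)) :=
    (((hd j).comp measurable_snd).sub ((hi j).comp measurable_fst)).mul
      (((hd l).comp measurable_snd).sub ((hi l).comp measurable_fst))
  exact (h.stronglyMeasurable.integral_kernel_prod_right' (κ := lawW P D)).measurable

theorem IsIID.measurable_obs (hD : IsIID P D) (i : ℕ) : Measurable (D.obs i) :=
  (hD.1 i).1.prodMk ((hD.1 i).2.1.prodMk ((hD.1 i).2.2.1.prodMk (hD.1 i).2.2.2))

theorem IsIID.iIndepFun_obs (hD : IsIID P D) : iIndepFun D.obs P := hD.2.1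

theorem IsIID.identDistrib_obs (hD : IsIID P D) (i : ℕ) : IdentDistrib (D.obs i) (D.obs 0) P P :=
  hD.2.2 i

theorem IsIID.measurable_ZW (hD : IsIID P D) (i : ℕ) : Measurable fun ω => (D.Z i ω, D.W i ω) :=
  (hD.1 i).2.2.1.prodMk (hD.1 i).2.2.2

/-- The disintegration behind every conditioning on `(Z, W)` below; `IsIID.compProd_lawW` plays the
same role for conditioning on `Z`. -/
theorem IsIID.compProd_lawYX (hD : IsIID P D) :
    (P.map fun ω => (D.Z 0 ω, D.W 0 ω)) ⊗ₘ lawYX P D =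
      P.map fun ω => ((D.Z 0 ω, D.W 0 ω), (D.Y 0 ω, D.X 0 ω)) :=
  compProd_map_condDistrib ((hD.1 0).1.prodMk (hD.1 0).2.1).aemeasurable

theorem IsIID.compProd_lawW (hD : IsIID P D) :
    (P.map (D.Z 0)) ⊗ₘ lawW P D = P.map fun ω => (D.Z 0 ω, D.W 0 ω) :=
  compProd_map_condDistrib (hD.1 0).2.2.2.aemeasurable

theorem IsIID.lintegral_obs (hD : IsIID P D) {F : (ℝ × 𝓦) × (ℝ × ℝ) → ENNReal}
    (hF : Measurable F) :
    ∫⁻ ω, F ((D.Z 0 ω, D.W 0 ω), (D.Y 0 ω, D.X 0 ω)) ∂P =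
      ∫⁻ ω, ∫⁻ q, F ((D.Z 0 ω, D.W 0 ω), q) ∂lawYX P D (D.Z 0 ω, D.W 0 ω) ∂P := by
  have hm : Measurable fun ω => ((D.Z 0 ω, D.W 0 ω), (D.Y 0 ω, D.X 0 ω)) :=
    (hD.measurable_ZW 0).prodMk ((hD.1 0).1.prodMk (hD.1 0).2.1)
  rw [← lintegral_map hF hm, ← hD.compProd_lawYX, Measure.lintegral_compProd hF,
    lintegral_map (hF.lintegral_kernel_prod_right') (hD.measurable_ZW 0)]

theorem IsIID.integral_obs (hD : IsIID P D) {F : (ℝ × 𝓦) × (ℝ × ℝ) → ℝ}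
    (hF : Measurable F)
    (hi : Integrable (fun ω => F ((D.Z 0 ω, D.W 0 ω), (D.Y 0 ω, D.X 0 ω))) P) :
    ∫ ω, F ((D.Z 0 ω, D.W 0 ω), (D.Y 0 ω, D.X 0 ω)) ∂P =
      ∫ ω, ∫ q, F ((D.Z 0 ω, D.W 0 ω), q) ∂lawYX P D (D.Z 0 ω, D.W 0 ω) ∂P := by
  have hm : Measurable fun ω => ((D.Z 0 ω, D.W 0 ω), (D.Y 0 ω, D.X 0 ω)) :=
    (hD.measurable_ZW 0).prodMk ((hD.1 0).1.prodMk (hD.1 0).2.1)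
  have hi' : Integrable F ((P.map fun ω => (D.Z 0 ω, D.W 0 ω)) ⊗ₘ lawYX P D) := by
    rw [hD.compProd_lawYX]
    exact (integrable_map_measure hF.aestronglyMeasurable hm.aemeasurable).2 hi
  rw [← integral_map hm.aemeasurable hF.aestronglyMeasurable, ← hD.compProd_lawYX,
    Measure.integral_compProd hi', integral_map (hD.measurable_ZW 0).aemeasurable]
  exact (hF.stronglyMeasurable.integral_kernel_prod_right' (κ := lawYX P D)).aestronglyMeasurable

theorem integral_lawW (z : ℝ) (F : 𝓦 → ℝ) : ∫ w, F w ∂lawW P D z = ∑ j, meanW P D j z * F j := by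
  rw [integral_fintype Integrable.of_finite]
  rfl

theorem sum_meanW (z : ℝ) : ∑ j, meanW P D j z = 1 := by
  have := integral_lawW (P := P) (D := D) z fun _ => 1
  simpa using this.symm

theorem meanW_nonneg (j : 𝓦) (z : ℝ) : 0 ≤ meanW P D j z := measureReal_nonneg

theorem meanW_le_one (j : 𝓦) (z : ℝ) : meanW P D j z ≤ 1 := measureReal_le_one

theorem IsIID.integral_ZW (hD : IsIID P D) {F : ℝ × 𝓦 → ℝ} (hF : Measurable F)
    (hi : Integrable (fun ω => F (D.Z 0 ω, D.W 0 ω)) P) :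
    ∫ ω, F (D.Z 0 ω, D.W 0 ω) ∂P = ∫ ω, ∑ j, meanW P D j (D.Z 0 ω) * F (D.Z 0 ω, j) ∂P := by
  have hi' : Integrable F (P.map (D.Z 0) ⊗ₘ lawW P D) := by
    rw [hD.compProd_lawW]
    exact (integrable_map_measure hF.aestronglyMeasurable (hD.measurable_ZW 0).aemeasurable).2 hi
  rw [← integral_map (hD.measurable_ZW 0).aemeasurable hF.aestronglyMeasurable,
    ← hD.compProd_lawW, Measure.integral_compProd hi', integral_map (hD.1 0).2.2.1.aemeasurable]
  · simp only [integral_lawW]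
  · exact (hF.stronglyMeasurable.integral_kernel_prod_right' (κ := lawW P D)).aestronglyMeasurable

theorem IsIID.lintegral_ZW (hD : IsIID P D) {F : ℝ × 𝓦 → ENNReal} (hF : Measurable F) :
    ∫⁻ ω, F (D.Z 0 ω, D.W 0 ω) ∂P =
      ∫⁻ ω, ∑ j, ENNReal.ofReal (meanW P D j (D.Z 0 ω)) * F (D.Z 0 ω, j) ∂P := by
  rw [← lintegral_map hF (hD.measurable_ZW 0), ← hD.compProd_lawW, Measure.lintegral_compProd hF,
    lintegral_map (hF.lintegral_kernel_prod_right') (hD.1 0).2.2.1]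
  refine lintegral_congr fun ω => ?_
  rw [lintegral_fintype]
  refine Finset.sum_congr rfl fun j _ => ?_
  rw [mul_comm, meanW, measureReal_def, ENNReal.ofReal_toReal (measure_ne_top _ _)]

/-- A property of `(z, w)` that holds almost surely holds for almost every `z` and every cell of
positive conditional probability. -/
theorem IsIID.ae_cells (hD : IsIID P D) {p : ℝ × 𝓦 → Prop} (hp : MeasurableSet {a | p a})
    (h : ∀ᵐ ω ∂P, p (D.Z 0 ω, D.W 0 ω)) :
    ∀ᵐ z ∂(P.map (D.Z 0)), ∀ j, meanW P D j z ≠ 0 → p (z, j) := by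
  have h1 : ∀ᵐ a ∂(P.map (D.Z 0) ⊗ₘ lawW P D), p a := by
    rw [hD.compProd_lawW]
    exact (ae_map_iff (hD.measurable_ZW 0).aemeasurable hp).2 h
  filter_upwards [Measure.ae_ae_of_ae_compProd h1] with z hz j hj
  by_contra hcon
  have : (lawW P D z) {j} = 0 :=
    measure_mono_null (fun w hw => by simpa [Set.mem_singleton_iff.1 hw] using hcon) (ae_iff.1 hz)
  exact hj (by rw [meanW, measureReal_def, this]; rfl)

theorem IsIID.ae_all_obs (hD : IsIID P D) {p : ℝ × ℝ × ℝ × 𝓦 → Prop} (hp : MeasurableSet {a | p a})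
    (h : ∀ᵐ ω ∂P, p (D.obs 0 ω)) : ∀ᵐ ω ∂P, ∀ i, p (D.obs i ω) :=
  ae_all_iff.2 fun i => (hD.identDistrib_obs i).symm.ae_snd hp h

end Disintegration

/-! ### Kernel-localized functions: moments, law of large numbers, central limit theorem. -/

section LocalFamilies

theorem memLp_and_integral_le_of_lintegral {Ω : Type*} [MeasurableSpace Ω] {P : Measure Ω}
    {g : Ω → ℝ} (hg : Measurable g) {r : ℕ} (hr : r ≠ 0) {B : ℝ} (hB : 0 ≤ B)
    (h : ∫⁻ ω, ‖g ω‖ₑ ^ r ∂P ≤ ENNReal.ofReal B) : MemLp g r P ∧ ∫ ω, |g ω| ^ r ∂P ≤ B := by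
  constructor
  · refine ⟨hg.aestronglyMeasurable, ?_⟩
    rw [eLpNorm_lt_top_iff_lintegral_rpow_enorm_lt_top (by exact_mod_cast hr) (by simp)]
    simpa using h.trans_lt ENNReal.ofReal_lt_top
  · rw [integral_eq_lintegral_of_nonneg_ae (f := fun ω => |g ω| ^ r)
      (ae_of_all _ fun _ => by positivity) (hg.norm.pow_const r).aestronglyMeasurable]
    refine ENNReal.toReal_le_of_le_ofReal hB (le_trans (le_of_eq ?_) h)
    refine lintegral_congr fun ω => ?_
    rw [ENNReal.ofReal_pow (abs_nonneg _), ← Real.norm_eq_abs, ofReal_norm]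

/-- Bounded measurable functions with bounded support. -/
def LocalKernel (κ : ℝ → ℝ) : Prop :=
  Measurable κ ∧ ∃ M R : ℝ, (∀ u, |κ u| ≤ M) ∧ ∀ u, R < |u| → κ u = 0

theorem LocalKernel.mul_bdd {κ l : ℝ → ℝ} (hκ : LocalKernel κ) (hl : Measurable l)
    (hb : ∀ R : ℝ, ∃ M, ∀ u, |u| ≤ R → |l u| ≤ M) : LocalKernel (fun u => κ u * l u) := by
  obtain ⟨hm, M, R, hM, hR⟩ := hκ
  obtain ⟨M', hM'⟩ := hb R
  have hM0 : 0 ≤ M := (abs_nonneg _).trans (hM 0)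
  refine ⟨hm.mul hl, M * |M'|, R, fun u => ?_, fun u hu => by simp [hR u hu]⟩
  by_cases hu : R < |u|
  · simp only [hR u hu, zero_mul, abs_zero]
    positivity
  · rw [abs_mul]
    exact mul_le_mul (hM u) ((hM' u (not_lt.1 hu)).trans (le_abs_self _)) (abs_nonneg _) hM0

theorem LocalKernel.integrable {κ : ℝ → ℝ} (hκ : LocalKernel κ) : Integrable κ := by
  obtain ⟨hm, M, R, hM, hR⟩ := hκ
  have hi : Integrable (Set.indicator (Set.Icc (-R) R) fun _ : ℝ => M) :=
    (integrable_indicator_iff measurableSet_Icc).2 (integrableOn_const (by simp))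
  refine hi.mono' hm.aestronglyMeasurable (ae_of_all _ fun u => ?_)
  by_cases hu : u ∈ Set.Icc (-R) R
  · rw [Set.indicator_of_mem hu]
    exact hM u
  · rw [Set.indicator_of_notMem hu, hR u, norm_zero]
    by_contra hcon
    exact hu (abs_le.1 (not_lt.1 hcon))

variable {Ω 𝓦 : Type*} [MeasurableSpace Ω] [Fintype 𝓦] [DecidableEq 𝓦] [Nonempty 𝓦]
  [MeasurableSpace 𝓦] [DiscreteMeasurableSpace 𝓦]

variable {P : Measure Ω} [IsProbabilityMeasure P] {D : Data Ω 𝓦}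

/-- The conditional fourth moment given `Z` is bounded on the window `(-δ, δ)`. -/
def LocMoment (P : Measure Ω) (D : Data Ω 𝓦) (δ : ℝ) (φ : ℝ × ℝ × ℝ × 𝓦 → ℝ) : Prop :=
  Measurable φ ∧ ∃ C : NNReal, ∀ G : ℝ → ENNReal, Measurable G →
    (∀ z ∉ Set.Ioo (-δ) δ, G z = 0) →
    ∫⁻ ω, G (D.Z 0 ω) * ‖φ (D.obs 0 ω)‖ₑ ^ 4 ∂P ≤ C * ∫⁻ ω, G (D.Z 0 ω) ∂P

theorem LocMoment.of_bounded {δ : ℝ} {φ : ℝ × ℝ × ℝ × 𝓦 → ℝ} (hφ : Measurable φ) {C : ℝ}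
    (h : ∀ᵐ ω ∂P, D.Z 0 ω ∈ Set.Ioo (-δ) δ → |φ (D.obs 0 ω)| ≤ C) : LocMoment P D δ φ := by
  refine ⟨hφ, (|C|.toNNReal) ^ 4, fun G hG hG0 => ?_⟩
  rw [← lintegral_const_mul' _ _ ENNReal.coe_ne_top]
  refine lintegral_mono_ae (h.mono fun ω hω => ?_)
  by_cases hz : D.Z 0 ω ∈ Set.Ioo (-δ) δ
  · rw [mul_comm]
    gcongr
    push_cast
    gcongr
    rw [← ofReal_norm]
    exact ENNReal.ofReal_le_ofReal ((hω hz).trans (le_abs_self C))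
  · simp [hG0 _ hz]

theorem LocMoment.add (hD : IsIID P D) {δ : ℝ} {φ ψ : ℝ × ℝ × ℝ × 𝓦 → ℝ} (hφ : LocMoment P D δ φ)
    (hψ : LocMoment P D δ ψ) : LocMoment P D δ (fun o => φ o + ψ o) := by
  obtain ⟨hm, C, hC⟩ := hφ
  obtain ⟨hm', C', hC'⟩ := hψ
  refine ⟨hm.add hm', 2 ^ 3 * (C + C'), fun G hG hG0 => ?_⟩
  have hGm : Measurable fun ω => G (D.Z 0 ω) := hG.comp (hD.1 0).2.2.1
  calc ∫⁻ ω, G (D.Z 0 ω) * ‖φ (D.obs 0 ω) + ψ (D.obs 0 ω)‖ₑ ^ 4 ∂P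
      ≤ ∫⁻ ω, 2 ^ 3 * (G (D.Z 0 ω) * ‖φ (D.obs 0 ω)‖ₑ ^ 4 +
          G (D.Z 0 ω) * ‖ψ (D.obs 0 ω)‖ₑ ^ 4) ∂P := by
        refine lintegral_mono fun ω => ?_
        rw [← mul_add, mul_left_comm]
        gcongr
        have h1 := ENNReal.rpow_add_le_mul_rpow_add_rpow ‖φ (D.obs 0 ω)‖ₑ ‖ψ (D.obs 0 ω)‖ₑ
          (p := 4) (by norm_num)
        have h2 : ((4 : ℝ) - 1) = (3 : ℕ) := by norm_num
        have h3 : (4 : ℝ) = (4 : ℕ) := by norm_num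
        rw [h2, h3] at h1
        simp only [ENNReal.rpow_natCast] at h1
        exact (pow_le_pow_left' (enorm_add_le _ _) 4).trans h1
    _ = 2 ^ 3 * (∫⁻ ω, G (D.Z 0 ω) * ‖φ (D.obs 0 ω)‖ₑ ^ 4 ∂P +
          ∫⁻ ω, G (D.Z 0 ω) * ‖ψ (D.obs 0 ω)‖ₑ ^ 4 ∂P) := by
        rw [lintegral_const_mul' _ _ (by norm_num), lintegral_add_left]
        exact hGm.mul ((hm.comp (hD.measurable_obs 0)).enorm.pow_const 4)
    _ ≤ 2 ^ 3 * (C * ∫⁻ ω, G (D.Z 0 ω) ∂P + C' * ∫⁻ ω, G (D.Z 0 ω) ∂P) := by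
        gcongr
        · exact hC G hG hG0
        · exact hC' G hG hG0
    _ = _ := by push_cast; ring

theorem LocMoment.bdd_mul {δ : ℝ} {φ b : ℝ × ℝ × ℝ × 𝓦 → ℝ} (hφ : LocMoment P D δ φ)
    (hb : Measurable b) {M : ℝ} (h : ∀ᵐ ω ∂P, D.Z 0 ω ∈ Set.Ioo (-δ) δ → |b (D.obs 0 ω)| ≤ M) :
    LocMoment P D δ (fun o => b o * φ o) := by
  obtain ⟨hm, C, hC⟩ := hφ
  refine ⟨hb.mul hm, |M|.toNNReal ^ 4 * C, fun G hG hG0 => ?_⟩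
  calc ∫⁻ ω, G (D.Z 0 ω) * ‖b (D.obs 0 ω) * φ (D.obs 0 ω)‖ₑ ^ 4 ∂P
      ≤ ∫⁻ ω, (|M|.toNNReal : ENNReal) ^ 4 * (G (D.Z 0 ω) * ‖φ (D.obs 0 ω)‖ₑ ^ 4) ∂P := by
        refine lintegral_mono_ae (h.mono fun ω hω => ?_)
        by_cases hz : D.Z 0 ω ∈ Set.Ioo (-δ) δ
        · rw [enorm_mul, mul_pow, mul_left_comm]
          gcongr
          rw [← ofReal_norm]
          exact ENNReal.ofReal_le_ofReal ((hω hz).trans (le_abs_self M))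
        · simp [hG0 _ hz]
    _ ≤ _ := by
        rw [lintegral_const_mul' _ _ (ENNReal.pow_ne_top ENNReal.coe_ne_top)]
        push_cast
        rw [mul_assoc]
        gcongr
        exact hC G hG hG0

theorem LocMoment.sum (hD : IsIID P D) {δ : ℝ} {ι : Type*} (S : Finset ι)
    {φ : ι → ℝ × ℝ × ℝ × 𝓦 → ℝ} (hφ : ∀ i ∈ S, LocMoment P D δ (φ i)) :
    LocMoment P D δ (fun o => ∑ i ∈ S, φ i o) := by
  classical
  induction S using Finset.induction_on with
  | empty => exact LocMoment.of_bounded (C := 0) (by simp) (by simp)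
  | insert i S hi ih =>
    simp only [Finset.sum_insert hi]
    exact (hφ i (Finset.mem_insert_self _ _)).add hD
      (ih fun j hj => hφ j (Finset.mem_insert_of_mem hj))

/-- Functions of an observation, indexed by the bandwidth, that are of order `h⁻¹` on an event of
probability of order `h`, in the sense of moments up to the fourth. -/
def LocalFamily (P : Measure Ω) (D : Data Ω 𝓦) (F : ℝ → ℝ × ℝ × ℝ × 𝓦 → ℝ) : Prop :=
  (∀ h, Measurable (F h)) ∧ ∃ K h₀ : ℝ, 0 ≤ K ∧ 0 < h₀ ∧ ∀ h, 0 < h → h < h₀ → ∀ r, 1 ≤ r → r ≤ 4 →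
    ∫⁻ ω, ‖F h (D.obs 0 ω)‖ₑ ^ r ∂P ≤ ENNReal.ofReal (K * h * h⁻¹ ^ r)

theorem LocalFamily.add (hD : IsIID P D) {F F' : ℝ → ℝ × ℝ × ℝ × 𝓦 → ℝ} (hF : LocalFamily P D F)
    (hF' : LocalFamily P D F') : LocalFamily P D (fun h o => F h o + F' h o) := by
  obtain ⟨hm, K, h₀, hK, hh₀, hb⟩ := hF
  obtain ⟨hm', K', h₀', hK', hh₀', hb'⟩ := hF'
  refine ⟨fun h => (hm h).add (hm' h), 2 ^ 3 * (K + K'), min h₀ h₀', by positivity,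
    lt_min hh₀ hh₀', fun h h0 hlt r h1 h4 => ?_⟩
  calc ∫⁻ ω, ‖F h (D.obs 0 ω) + F' h (D.obs 0 ω)‖ₑ ^ r ∂P
      ≤ ∫⁻ ω, 2 ^ 3 * (‖F h (D.obs 0 ω)‖ₑ ^ r + ‖F' h (D.obs 0 ω)‖ₑ ^ r) ∂P := by
        refine lintegral_mono fun ω => ?_
        have h1 := ENNReal.rpow_add_le_mul_rpow_add_rpow ‖F h (D.obs 0 ω)‖ₑ ‖F' h (D.obs 0 ω)‖ₑ
          (p := (r : ℝ)) (by exact_mod_cast h1)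
        have h2 : ((r : ℝ) - 1) = ((r - 1 : ℕ) : ℝ) := by push_cast [*]; ring
        rw [h2] at h1
        simp only [ENNReal.rpow_natCast] at h1
        refine (pow_le_pow_left' (enorm_add_le _ _) r).trans (h1.trans ?_)
        gcongr
        · norm_num
        · omega
    _ = 2 ^ 3 * (∫⁻ ω, ‖F h (D.obs 0 ω)‖ₑ ^ r ∂P + ∫⁻ ω, ‖F' h (D.obs 0 ω)‖ₑ ^ r ∂P) := by
        rw [lintegral_const_mul' _ _ (by norm_num), lintegral_add_left]
        exact ((hm h).comp (hD.measurable_obs 0)).enorm.pow_const r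
    _ ≤ 2 ^ 3 * (ENNReal.ofReal (K * h * h⁻¹ ^ r) + ENNReal.ofReal (K' * h * h⁻¹ ^ r)) := by
        gcongr
        · exact hb h h0 (hlt.trans_le (min_le_left _ _)) r h1 h4
        · exact hb' h h0 (hlt.trans_le (min_le_right _ _)) r h1 h4
    _ = _ := by
        rw [← ENNReal.ofReal_add (by positivity) (by positivity)]
        rw [show (2 : ENNReal) ^ 3 = ENNReal.ofReal (2 ^ 3) by
          rw [ENNReal.ofReal_pow (by norm_num)]; norm_num]
        rw [← ENNReal.ofReal_mul (by positivity)]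
        congr 1
        ring

theorem LocalFamily.zero : LocalFamily P D (fun _ _ => 0) := by
  refine ⟨fun _ => measurable_const, 0, 1, le_rfl, one_pos, fun h _ _ r h1 _ => ?_⟩
  simp [show r ≠ 0 by omega]

theorem LocalFamily.sum (hD : IsIID P D) {ι : Type*} (S : Finset ι)
    {F : ι → ℝ → ℝ × ℝ × ℝ × 𝓦 → ℝ} (hF : ∀ i ∈ S, LocalFamily P D (F i)) :
    LocalFamily P D (fun h o => ∑ i ∈ S, F i h o) := by
  classical
  induction S using Finset.induction_on with
  | empty => simpa using LocalFamily.zero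
  | insert i S hi ih =>
    simp only [Finset.sum_insert hi]
    exact (hF i (Finset.mem_insert_self _ _)).add hD
      (ih fun j hj => hF j (Finset.mem_insert_of_mem hj))

variable {k f : ℝ → ℝ} {ε : ℝ} {μ : Regressand → 𝓦 → ℝ → ℝ}

theorem Regular.lintegral_Z (hreg : Regular P D k f ε μ) (hD : IsIID P D) {G : ℝ → ENNReal}
    (hG : Measurable G) :
    ∫⁻ ω, G (D.Z 0 ω) ∂P = ∫⁻ z, ENNReal.ofReal (f z) * G z := by
  rw [← lintegral_map hG (hD.1 0).2.2.1, hreg.density,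
    lintegral_withDensity_eq_lintegral_mul _ hreg.density_measurable.ennreal_ofReal hG]
  rfl

/-- The weight is of size `h⁻¹` on a window of length proportional to `h`. The density is bounded
there, and the moments of `φ` of order `r ≤ 4` are controlled by one plus its conditional fourth
moment. Hence the `r`-th moment is of order `h * h⁻¹ ^ r`. -/
theorem Regular.localFamily (hreg : Regular P D k f ε μ) (hD : IsIID P D) {κ : ℝ → ℝ}
    (hκ : LocalKernel κ) {δ : ℝ} (hδ : 0 < δ) {φ : ℝ × ℝ × ℝ × 𝓦 → ℝ} (hφ : LocMoment P D δ φ) :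
    LocalFamily P D (fun h o => h⁻¹ * κ (o.2.2.1 / h) * φ o) := by
  obtain ⟨hm, M, R, hM, hR⟩ := hκ
  obtain ⟨hφm, C, hC⟩ := hφ
  obtain ⟨a, A, ha, hA⟩ := hreg.density_bounds
  have hε := hreg.window_pos
  have hA0 : 0 < A := ha.trans_le ((hA 0 ⟨by linarith, hε⟩).1.trans (hA 0 ⟨by linarith, hε⟩).2)
  set M' := max M 1 with hM'
  have hM'1 : 1 ≤ M' := le_max_right _ _
  set R' := max R 1 with hR'
  have hR'1 : 1 ≤ R' := le_max_right _ _
  have hR'0 : 0 < R' := by linarith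
  -- Below the threshold `min δ ε / R'` the support of the rescaled kernel lies in the window of the
  -- moment bound and in that of the density bound. Taking `M' ≥ 1` lets `M' ^ 4` dominate all
  -- powers `r ≤ 4`.
  refine ⟨fun h => (measurable_const.mul (hm.comp (by fun_prop))).mul hφm,
    M' ^ 4 * (1 + C) * (A * (2 * R')), min δ ε / R', by positivity, by positivity,
    fun h h0 hlt r h1 h4 => ?_⟩
  rw [lt_div_iff₀ hR'0] at hlt
  have hlδ : h * R' < δ := hlt.trans_le (min_le_left _ _)
  have hlε : h * R' < ε := hlt.trans_le (min_le_right _ _)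
  set B : ENNReal := ENNReal.ofReal (h⁻¹ ^ r * M' ^ 4) with hB
  set G : ℝ → ENNReal := Set.indicator (Set.Icc (-(h * R')) (h * R')) fun _ => B with hG
  have hGm : Measurable G := measurable_const.indicator measurableSet_Icc
  have hG0 : ∀ c, h * R' < c → ∀ z ∉ Set.Ioo (-c) c, G z = 0 := by
    intro c hc z hz
    refine Set.indicator_of_notMem (fun hz' => hz ⟨?_, ?_⟩) _
    · linarith [hz'.1]
    · linarith [hz'.2]
  have hpt : ∀ ω, ‖h⁻¹ * κ (D.Z 0 ω / h) * φ (D.obs 0 ω)‖ₑ ^ r ≤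
      G (D.Z 0 ω) + G (D.Z 0 ω) * ‖φ (D.obs 0 ω)‖ₑ ^ 4 := by
    intro ω
    by_cases hz : D.Z 0 ω ∈ Set.Icc (-(h * R')) (h * R')
    · rw [hG, Set.indicator_of_mem hz, enorm_mul, mul_pow]
      have e1 : ‖h⁻¹ * κ (D.Z 0 ω / h)‖ₑ ^ r ≤ B := by
        rw [← ofReal_norm, ← ENNReal.ofReal_pow (norm_nonneg _), hB]
        refine ENNReal.ofReal_le_ofReal ?_
        rw [norm_mul, mul_pow, Real.norm_eq_abs, Real.norm_eq_abs, abs_of_pos (inv_pos.2 h0)]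
        gcongr
        calc |κ (D.Z 0 ω / h)| ^ r ≤ M' ^ r :=
              pow_le_pow_left₀ (abs_nonneg _) ((hM _).trans (le_max_left _ _)) r
          _ ≤ M' ^ 4 := pow_le_pow_right₀ hM'1 h4
      have e2 : ‖φ (D.obs 0 ω)‖ₑ ^ r ≤ 1 + ‖φ (D.obs 0 ω)‖ₑ ^ 4 := by
        rcases le_total ‖φ (D.obs 0 ω)‖ₑ 1 with h1' | h1'
        · exact (pow_le_one₀ zero_le h1').trans le_self_add
        · exact (pow_le_pow_right₀ h1' h4).trans le_add_self
      calc _ ≤ B * (1 + ‖φ (D.obs 0 ω)‖ₑ ^ 4) := mul_le_mul' e1 e2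
        _ = _ := by rw [mul_add, mul_one]
    · have : κ (D.Z 0 ω / h) = 0 := by
        refine hR _ ?_
        rw [abs_div, abs_of_pos h0, lt_div_iff₀ h0]
        by_contra hcon
        refine hz (abs_le.1 ((not_lt.1 hcon).trans ?_))
        rw [mul_comm]
        gcongr
        exact le_max_left _ _
      rw [this]
      simp [show r ≠ 0 by omega]
  have hGi : ∫⁻ ω, G (D.Z 0 ω) ∂P ≤ ENNReal.ofReal (h⁻¹ ^ r * M' ^ 4 * (A * (2 * (h * R')))) := by
    rw [hreg.lintegral_Z hD hGm]
    calc ∫⁻ z, ENNReal.ofReal (f z) * G z ≤ ∫⁻ z, ENNReal.ofReal A * G z := by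
          refine lintegral_mono fun z => ?_
          by_cases hz : z ∈ Set.Ioo (-ε) ε
          · gcongr
            exact (hA z hz).2
          · simp [hG0 ε hlε z hz]
      _ = ENNReal.ofReal A * (B * volume (Set.Icc (-(h * R')) (h * R'))) := by
          rw [lintegral_const_mul _ hGm, hG, lintegral_indicator_const measurableSet_Icc]
      _ = _ := by
          rw [Real.volume_Icc, hB, ← ENNReal.ofReal_mul (by positivity),
            ← ENNReal.ofReal_mul (by positivity)]
          congr 1
          ring
  calc ∫⁻ ω, ‖h⁻¹ * κ (D.Z 0 ω / h) * φ (D.obs 0 ω)‖ₑ ^ r ∂P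
      ≤ ∫⁻ ω, (G (D.Z 0 ω) + G (D.Z 0 ω) * ‖φ (D.obs 0 ω)‖ₑ ^ 4) ∂P := lintegral_mono hpt
    _ ≤ ∫⁻ ω, G (D.Z 0 ω) ∂P + C * ∫⁻ ω, G (D.Z 0 ω) ∂P := by
        rw [lintegral_add_left (f := fun ω => G (D.Z 0 ω)) (hGm.comp (hD.1 0).2.2.1)]
        gcongr
        exact hC G hGm (hG0 δ hlδ)
    _ = (1 + C) * ∫⁻ ω, G (D.Z 0 ω) ∂P := by ring
    _ ≤ (1 + C) * ENNReal.ofReal (h⁻¹ ^ r * M' ^ 4 * (A * (2 * (h * R')))) := by gcongr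
    _ = _ := by
        rw [show (1 + C : ENNReal) = ENNReal.ofReal (1 + C) by
          rw [ENNReal.ofReal_add zero_le_one C.coe_nonneg]; simp]
        rw [← ENNReal.ofReal_mul (by positivity)]
        congr 1
        ring

/-- The sample mean of a function of the observations. -/
noncomputable def sampleMean (D : Data Ω 𝓦) (F : ℝ × ℝ × ℝ × 𝓦 → ℝ) (n : ℕ) (ω : Ω) : ℝ :=
  (n : ℝ)⁻¹ * ∑ i ∈ Finset.range n, F (D.obs i ω)

theorem measurable_sampleMean (hD : IsIID P D) {F : ℝ × ℝ × ℝ × 𝓦 → ℝ} (hF : Measurable F)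
    (n : ℕ) : Measurable (sampleMean D F n) :=
  measurable_const.mul (Finset.measurable_fun_sum _ fun i _ => hF.comp (hD.measurable_obs i))

variable {h : ℕ → ℝ} {F : ℝ → ℝ × ℝ × ℝ × 𝓦 → ℝ}

/-- Positivity of the bandwidth is not assumed; it follows because `n` is nonnegative and the
product is eventually positive. -/
theorem eventually_pos_of_mul_tendsto (hvar : Tendsto (fun n : ℕ => (n : ℝ) * h n) atTop atTop) :
    ∀ᶠ n in atTop, 0 < h n :=
  (hvar.eventually_gt_atTop 0).mono fun n hn =>
    by_contra fun hc => absurd hn (not_lt.2 (mul_nonpos_of_nonneg_of_nonpos (Nat.cast_nonneg n)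
      (not_lt.1 hc)))

theorem LocalFamily.eventually_moments (hF : LocalFamily P D F) (hD : IsIID P D)
    (hh : Tendsto h atTop (𝓝 0)) (hvar : Tendsto (fun n : ℕ => (n : ℝ) * h n) atTop atTop) :
    ∃ K : ℝ, 0 ≤ K ∧ ∀ᶠ n in atTop, ∀ r : ℕ, 1 ≤ r → r ≤ 4 →
      MemLp (fun ω => F (h n) (D.obs 0 ω)) r P ∧
      ∫ ω, |F (h n) (D.obs 0 ω)| ^ r ∂P ≤ K * h n * (h n)⁻¹ ^ r := by
  obtain ⟨hm, K, h₀, hK, hh₀, hb⟩ := hF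
  refine ⟨K, hK, ?_⟩
  filter_upwards [eventually_pos_of_mul_tendsto hvar, hh.eventually (gt_mem_nhds hh₀)]
    with n hn hn' r h1 h4
  exact memLp_and_integral_le_of_lintegral ((hm _).comp (hD.measurable_obs 0)) (by omega)
    (by positivity) (hb _ hn hn' r h1 h4)

/-- For `r = 1` the moment bound `K * h * h⁻¹` is free of `h`. -/
theorem LocalFamily.stochBdd_mean (hF : LocalFamily P D F) (hD : IsIID P D)
    (hh : Tendsto h atTop (𝓝 0)) (hvar : Tendsto (fun n : ℕ => (n : ℝ) * h n) atTop atTop) :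
    StochBdd P (fun x => sampleMean D (F (h x.1)) x.1 x.2) := by
  obtain ⟨hm, K, h₀, hK, hh₀, hb⟩ := hF
  refine StochBdd.of_lintegral_le (X := fun n ω => sampleMean D (F (h n)) n ω) (C := K.toNNReal)
    (fun n => measurable_sampleMean hD (hm _) n) ?_
  filter_upwards [eventually_pos_of_mul_tendsto hvar, hh.eventually (gt_mem_nhds hh₀),
    eventually_gt_atTop 0] with n hn hn' hn0
  have hn0' : (0 : ℝ) < n := by exact_mod_cast hn0
  have h1 := hb _ hn hn' 1 le_rfl (by norm_num)
  simp only [pow_one, mul_assoc, mul_inv_cancel₀ hn.ne', mul_one] at h1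
  have h2 : ∀ i, ∫⁻ ω, ‖F (h n) (D.obs i ω)‖ₑ ∂P = ∫⁻ ω, ‖F (h n) (D.obs 0 ω)‖ₑ ∂P := fun i =>
    ((hD.identDistrib_obs i).comp (hm (h n)).enorm).lintegral_eq
  calc ∫⁻ ω, ‖sampleMean D (F (h n)) n ω‖ₑ ∂P
      ≤ ∫⁻ ω, ENNReal.ofReal ((n : ℝ)⁻¹) *
          ∑ i ∈ Finset.range n, ‖F (h n) (D.obs i ω)‖ₑ ∂P := by
        refine lintegral_mono fun ω => ?_
        rw [sampleMean, enorm_mul, Real.enorm_of_nonneg (by positivity)]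
        gcongr
        exact enorm_sum_le _ _
    _ = ENNReal.ofReal ((n : ℝ)⁻¹) * (n * ∫⁻ ω, ‖F (h n) (D.obs 0 ω)‖ₑ ∂P) := by
        rw [lintegral_const_mul' _ _ ENNReal.ofReal_ne_top, lintegral_finsetSum]
        · simp [h2]
        · exact fun i _ => ((hm _).comp (hD.measurable_obs i)).enorm
    _ ≤ ENNReal.ofReal ((n : ℝ)⁻¹) * (ENNReal.ofReal n * ENNReal.ofReal K) := by
        rw [ENNReal.ofReal_natCast]
        gcongr
    _ = K.toNNReal := by
        rw [← ENNReal.ofReal_mul (by positivity), ← ENNReal.ofReal_mul (by positivity),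
          ← mul_assoc, inv_mul_cancel₀ hn0'.ne', one_mul]
        rfl

/-- The variance of the mean is at most `n⁻¹` times a second moment of order `h⁻¹`. The law of large
numbers and the rate `√(n * h)` both come from here. -/
theorem LocalFamily.lintegral_sq_le (hF : LocalFamily P D F) (hD : IsIID P D)
    (hh : Tendsto h atTop (𝓝 0)) (hvar : Tendsto (fun n : ℕ => (n : ℝ) * h n) atTop atTop) :
    ∃ K : ℝ, 0 ≤ K ∧ ∀ᶠ n in atTop,
      ∫⁻ ω, ‖sampleMean D (F (h n)) n ω - ∫ ω', F (h n) (D.obs 0 ω') ∂P‖ₑ ^ 2 ∂P ≤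
        ENNReal.ofReal (K * (n * h n)⁻¹) := by
  obtain ⟨K, hK, hmom⟩ := hF.eventually_moments hD hh hvar
  refine ⟨K, hK, ?_⟩
  filter_upwards [hmom, eventually_pos_of_mul_tendsto hvar, eventually_gt_atTop 0]
    with n hn hpos hn0
  obtain ⟨hL, hle⟩ := hn 2 (by norm_num) (by norm_num)
  refine (lintegral_sq_mean_sub_le hD.measurable_obs hD.iIndepFun_obs hD.identDistrib_obs
    (hF.1 (h n)) hL n hn0).trans (ENNReal.ofReal_le_ofReal ?_)
  simp only [sq_abs] at hle
  calc (n : ℝ)⁻¹ * ∫ ω, F (h n) (D.obs 0 ω) ^ 2 ∂P ≤ (n : ℝ)⁻¹ * (K * h n * (h n)⁻¹ ^ 2) := by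
        gcongr
    _ = _ := by field_simp

theorem LocalFamily.lln (hF : LocalFamily P D F) (hD : IsIID P D)
    (hh : Tendsto h atTop (𝓝 0)) (hvar : Tendsto (fun n : ℕ => (n : ℝ) * h n) atTop atTop) :
    Tendsto (fun x => sampleMean D (F (h x.1)) x.1 x.2 - ∫ ω, F (h x.1) (D.obs 0 ω) ∂P)
      (wpa P) (𝓝 0) := by
  obtain ⟨K, hK, hle⟩ := hF.lintegral_sq_le hD hh hvar
  refine tendsto_wpa_zero_of_lintegral_sq
    (X := fun n ω => sampleMean D (F (h n)) n ω - ∫ ω', F (h n) (D.obs 0 ω') ∂P)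
    (fun n => (measurable_sampleMean hD (hF.1 _) n).sub measurable_const) ?_
  have hlim : Tendsto (fun n : ℕ => ENNReal.ofReal (K * (n * h n)⁻¹)) atTop (𝓝 0) := by
    have := (tendsto_inv_atTop_zero.comp hvar).const_mul K
    simpa using ENNReal.tendsto_ofReal this
  exact tendsto_of_tendsto_of_tendsto_of_le_of_le' tendsto_const_nhds hlim
    (Eventually.of_forall fun _ => zero_le) hle

theorem LocalFamily.stochBdd_scaled_mean (hF : LocalFamily P D F) (hD : IsIID P D)
    (hh : Tendsto h atTop (𝓝 0)) (hvar : Tendsto (fun n : ℕ => (n : ℝ) * h n) atTop atTop)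
    (h0 : ∀ᶠ n in atTop, ∫ ω, F (h n) (D.obs 0 ω) ∂P = 0) :
    StochBdd P (fun x => √(x.1 * h x.1) * sampleMean D (F (h x.1)) x.1 x.2) := by
  obtain ⟨K, hK, hle⟩ := hF.lintegral_sq_le hD hh hvar
  refine StochBdd.of_lintegral_sq_le (X := fun n ω => √(n * h n) * sampleMean D (F (h n)) n ω)
    (C := K.toNNReal) (fun n => measurable_const.mul (measurable_sampleMean hD (hF.1 _) n)) ?_
  filter_upwards [hle, h0, hvar.eventually_gt_atTop 0] with n hn hn0 hpos
  simp only [hn0, sub_zero] at hn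
  calc ∫⁻ ω, ‖√(n * h n) * sampleMean D (F (h n)) n ω‖ₑ ^ 2 ∂P
      = ENNReal.ofReal (n * h n) * ∫⁻ ω, ‖sampleMean D (F (h n)) n ω‖ₑ ^ 2 ∂P := by
        rw [← lintegral_const_mul' _ _ ENNReal.ofReal_ne_top]
        refine lintegral_congr fun ω => ?_
        rw [enorm_mul, mul_pow, Real.enorm_of_nonneg (Real.sqrt_nonneg _),
          ← ENNReal.ofReal_pow (Real.sqrt_nonneg _), Real.sq_sqrt hpos.le]
    _ ≤ ENNReal.ofReal (n * h n) * ENNReal.ofReal (K * (n * h n)⁻¹) := by gcongr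
    _ = K.toNNReal := by
        rw [← ENNReal.ofReal_mul hpos.le, mul_comm K, ← mul_assoc, mul_inv_cancel₀ hpos.ne',
          one_mul]
        rfl

/-- Write `I` for the second moment. The summands are scaled so that the variances add to one, and
the lower bound `I ≥ c / h` makes the Lyapunov sum at most `K / (c ^ 2 * n * h)`, which vanishes.
Convergence of `h * I` is not needed. -/
theorem LocalFamily.clt (hF : LocalFamily P D F) (hD : IsIID P D)
    (hh : Tendsto h atTop (𝓝 0)) (hvar : Tendsto (fun n : ℕ => (n : ℝ) * h n) atTop atTop)
    (h0 : ∀ᶠ n in atTop, ∫ ω, F (h n) (D.obs 0 ω) ∂P = 0) {c : ℝ} (hc : 0 < c)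
    (hv : ∀ᶠ n in atTop, c ≤ h n * ∫ ω, F (h n) (D.obs 0 ω) ^ 2 ∂P) :
    TendstoInDistribution (fun (n : ℕ) ω => (√(h n * ∫ ω', F (h n) (D.obs 0 ω') ^ 2 ∂P))⁻¹ *
        (√(n * h n) * sampleMean D (F (h n)) n ω)) atTop (id : ℝ → ℝ)
      (fun _ => P) (gaussianReal 0 1) := by
  obtain ⟨K, hK, hmom⟩ := hF.eventually_moments hD hh hvar
  set b : ℕ → ℝ := fun n => (√(h n * ∫ ω', F (h n) (D.obs 0 ω') ^ 2 ∂P))⁻¹ * √(n * h n) *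
    (n : ℝ)⁻¹ with hb
  -- The factor `b n` collects the standardization, `√(n * h n)` and the `1 / n` of the sample mean;
  -- the bandwidth cancels from its square.
  have hb2 : ∀ᶠ n in atTop, b n ^ 2 = ((n : ℝ) * ∫ ω', F (h n) (D.obs 0 ω') ^ 2 ∂P)⁻¹ := by
    filter_upwards [hv, eventually_pos_of_mul_tendsto hvar, eventually_gt_atTop 0]
      with n hn hpos hn0
    have hn0' : (0 : ℝ) < n := by exact_mod_cast hn0
    have hI : 0 < h n * ∫ ω', F (h n) (D.obs 0 ω') ^ 2 ∂P := hc.trans_le hn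
    have hI' : 0 < ∫ ω', F (h n) (D.obs 0 ω') ^ 2 ∂P := (mul_pos_iff_of_pos_left hpos).1 hI
    rw [hb]
    simp only [mul_pow, inv_pow]
    rw [Real.sq_sqrt hI.le, Real.sq_sqrt (by positivity)]
    field_simp
  have key := tendstoInDistribution_sum_of_lyapunov hD.measurable_obs hD.iIndepFun_obs
    hD.identDistrib_obs (F := fun n o => b n * F (h n) o)
    (fun n => measurable_const.mul (hF.1 (h n))) ?_ ?_ ?_ ?_
  · refine key.congr (fun n => ae_of_all _ fun ω => ?_) (ae_of_all _ fun _ => rfl)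
    simp only [sampleMean, hb, ← Finset.mul_sum]
    ring
  · filter_upwards [h0] with n hn
    rw [integral_const_mul, hn, mul_zero]
  · filter_upwards [hmom] with n hn
    exact ((hn 4 (by norm_num) le_rfl).1).const_mul (b n)
  · filter_upwards [hb2, hv, eventually_pos_of_mul_tendsto hvar, eventually_gt_atTop 0]
      with n hn hvn hpos hn0
    have hn0' : (0 : ℝ) < n := by exact_mod_cast hn0
    have hI' : 0 < ∫ ω', F (h n) (D.obs 0 ω') ^ 2 ∂P :=
      (mul_pos_iff_of_pos_left hpos).1 (hc.trans_le hvn)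
    simp only [mul_pow]
    rw [integral_const_mul, hn]
    field_simp
  · have hlim : Tendsto (fun n : ℕ => K * (c ^ 2)⁻¹ * (n * h n)⁻¹) atTop (𝓝 0) := by
      simpa using (tendsto_inv_atTop_zero.comp hvar).const_mul (K * (c ^ 2)⁻¹)
    refine squeeze_zero' (Eventually.of_forall fun n => ?_) ?_ hlim
    · exact mul_nonneg (Nat.cast_nonneg n) (integral_nonneg fun ω => by positivity)
    · filter_upwards [hb2, hmom, hv, eventually_pos_of_mul_tendsto hvar, eventually_gt_atTop 0]
        with n hn hm4 hvn hpos hn0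
      have hn0' : (0 : ℝ) < n := by exact_mod_cast hn0
      have h4 := (hm4 4 (by norm_num) le_rfl).2
      simp only [Even.pow_abs (show Even 4 by decide)] at h4
      have hI' : 0 < ∫ ω', F (h n) (D.obs 0 ω') ^ 2 ∂P :=
        (mul_pos_iff_of_pos_left hpos).1 (hc.trans_le hvn)
      set I := ∫ ω', F (h n) (D.obs 0 ω') ^ 2 ∂P with hIdef
      simp only [mul_pow]
      rw [integral_const_mul, show b n ^ 4 = (b n ^ 2) ^ 2 by ring, hn]
      have hcI : (c / h n) ^ 2 ≤ I ^ 2 := by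
        refine pow_le_pow_left₀ (by positivity) ?_ 2
        rw [div_le_iff₀ hpos]
        linarith
      calc (n : ℝ) * (((n : ℝ) * I)⁻¹ ^ 2 * ∫ ω, F (h n) (D.obs 0 ω) ^ 4 ∂P)
          ≤ (n : ℝ) * (((n : ℝ) * I)⁻¹ ^ 2 * (K * h n * (h n)⁻¹ ^ 4)) := by gcongr
        _ = (n : ℝ)⁻¹ * (I ^ 2)⁻¹ * (K * h n * (h n)⁻¹ ^ 4) := by field_simp
        _ ≤ (n : ℝ)⁻¹ * ((c / h n) ^ 2)⁻¹ * (K * h n * (h n)⁻¹ ^ 4) := by gcongr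
        _ = _ := by field_simp

end LocalFamilies

/-! ### One-sided Taylor expansions at the cutoff. -/

section Taylor

theorem Side.window_subset (s : Side) {δ ε : ℝ} (h : δ ≤ ε) : s.window δ ⊆ s.window ε := by
  cases s
  · exact Set.Ioo_subset_Ioo_right h
  · exact Set.Ioo_subset_Ioo_left (by linarith)

theorem Side.isOpen_window (s : Side) (δ : ℝ) : IsOpen (s.window δ) := by
  cases s <;> exact isOpen_Ioo

theorem Side.mem_window {s : Side} {δ z : ℝ} : z ∈ s.window δ ↔ z ∈ s.halfLine ∧ |z| < δ := by
  cases s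
  · simp only [Side.window, Side.halfLine, Set.mem_Ioo, Set.mem_Ioi]
    refine and_congr_right fun h => by rw [abs_of_pos h]
  · simp only [Side.window, Side.halfLine, Set.mem_Ioo, Set.mem_Iio]
    rw [and_comm]
    refine and_congr_right fun h => ?_
    rw [abs_of_neg h]
    constructor <;> intro <;> linarith

theorem Side.window_subset_Ioo (s : Side) (δ : ℝ) : s.window δ ⊆ Set.Ioo (-δ) δ := by
  intro z hz
  exact abs_lt.1 (Side.mem_window.1 hz).2

instance (s : Side) : (𝓝[s.halfLine] (0 : ℝ)).NeBot := by
  cases s <;> simp only [Side.halfLine] <;> infer_instance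

theorem Side.eventually_nhdsWithin (s : Side) {p : ℝ → Prop} :
    (∀ᶠ z in 𝓝[s.halfLine] (0 : ℝ), p z) ↔ ∃ δ > 0, ∀ z ∈ s.window δ, p z := by
  rw [eventually_nhdsWithin_iff, Metric.eventually_nhds_iff]
  refine exists_congr fun δ => and_congr_right fun _ => forall_congr' fun z => ?_
  rw [Side.mem_window, dist_zero_right, Real.norm_eq_abs]
  tauto

theorem HasSideLim.tendsto {s : Side} {F : ℝ → ℝ} (h : HasSideLim s F) :
    Tendsto F (𝓝[s.halfLine] (0 : ℝ)) (𝓝 (sideLim s F)) := tendsto_nhds_limUnder h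

/-- Integrates a derivative bound outward from the cutoff. As `F` has only a one-sided limit at `0`,
the mean value inequality is applied between `z` and a point `x` on the same side, and then `x → 0`.
-/
theorem abs_le_pow_succ_of_abs_deriv_le {s : Side} {F : ℝ → ℝ} {δ C : ℝ} {m : ℕ}
    (hd : ∀ z ∈ s.window δ, DifferentiableAt ℝ F z)
    (h0 : Tendsto F (𝓝[s.halfLine] (0 : ℝ)) (𝓝 0))
    (hC : ∀ z ∈ s.window δ, |deriv F z| ≤ C * |z| ^ m) (z : ℝ) (hz : z ∈ s.window δ) :
    |F z| ≤ C * |z| ^ (m + 1) := by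
  obtain ⟨hzs, hzδ⟩ := Side.mem_window.1 hz
  have hz0 : 0 < |z| := by
    refine abs_pos.2 fun h => ?_
    subst h
    cases s <;> simp [Side.halfLine] at hzs
  have hC0 : 0 ≤ C := by
    have := (abs_nonneg _).trans (hC z hz)
    exact le_of_mul_le_mul_right (by simpa using this) (pow_pos hz0 m)
  set S : Set ℝ := s.halfLine ∩ Set.Icc (-|z|) |z| with hS
  have hconv : Convex ℝ S := by
    refine Convex.inter ?_ (convex_Icc _ _)
    cases s
    · exact convex_Ioi 0
    · exact convex_Iio 0
  have hSw : ∀ y ∈ S, y ∈ s.window δ ∧ |y| ≤ |z| := fun y hy => by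
    have := abs_le.2 hy.2
    exact ⟨Side.mem_window.2 ⟨hy.1, this.trans_lt hzδ⟩, this⟩
  have hev : ∀ᶠ x in 𝓝[s.halfLine] (0 : ℝ), |F z - F x| ≤ C * |z| ^ (m + 1) := by
    rw [Side.eventually_nhdsWithin]
    refine ⟨|z|, hz0, fun x hx => ?_⟩
    obtain ⟨hxs, hxz⟩ := Side.mem_window.1 hx
    have hxS : x ∈ S := ⟨hxs, abs_le.1 hxz.le⟩
    have hzS : z ∈ S := ⟨hzs, abs_le.1 le_rfl⟩
    have := hconv.norm_image_sub_le_of_norm_deriv_le (f := F) (C := C * |z| ^ m)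
      (fun y hy => hd y (hSw y hy).1)
      (fun y hy => (hC y (hSw y hy).1).trans 
        (mul_le_mul_of_nonneg_left (pow_le_pow_left₀ (abs_nonneg _) (hSw y hy).2 m) hC0)) hxS hzS
    refine this.trans ?_
    rw [pow_succ, ← mul_assoc]
    gcongr
    rw [Real.norm_eq_abs]
    cases s
    · simp only [Side.halfLine, Set.mem_Ioi] at hxs hzs
      rw [abs_of_pos hzs] at hxz ⊢
      rw [abs_of_pos hxs] at hxz
      rw [abs_of_pos (by linarith)]
      linarith
    · simp only [Side.halfLine, Set.mem_Iio] at hxs hzs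
      rw [abs_of_neg hzs] at hxz ⊢
      rw [abs_of_neg hxs] at hxz
      rw [abs_of_neg (by linarith)]
      linarith
  refine le_of_tendsto ?_ hev
  simpa using (tendsto_const_nhds.sub h0).abs

variable {𝓦 : Type*} [Fintype 𝓦]

/-- The third derivative is bounded near the cutoff, having a limit there. Integrating three times
from the cutoff, each time after subtracting the Taylor polynomial of the derivative in question,
gives the cubic bound. -/
theorem SmoothSides.taylor_cell {ε : ℝ} {μ : Regressand → 𝓦 → ℝ → ℝ} {U : Regressand}
    (hε : 0 < ε) (hμ : SmoothSides ε μ U) (s : Side) (j : 𝓦) :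
    ∃ C δ : ℝ, 0 < δ ∧ δ ≤ ε ∧ ∀ z ∈ s.window δ,
      |μ U j z - (sideDeriv μ s U 0 j + sideDeriv μ s U 1 j * z +
        sideDeriv μ s U 2 j * z ^ 2 / 2)| ≤ C * |z| ^ 3 := by
  obtain ⟨hcd, hlim⟩ := hμ s j
  have hl : ∀ r ≤ 3, Tendsto (iteratedDeriv r (μ U j)) (𝓝[s.halfLine] (0 : ℝ))
      (𝓝 (sideDeriv μ s U r j)) := fun r hr => (hlim r hr).tendsto
  have hdiff : ∀ r : ℕ, r < 3 → ∀ z ∈ s.window ε, DifferentiableAt ℝ (iteratedDeriv r (μ U j)) z := by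
    intro r hr z hz
    have ho := s.isOpen_window ε
    have h1 := hcd.differentiableOn_iteratedDerivWithin (m := r) (by exact_mod_cast hr)
      ho.uniqueDiffOn
    exact (h1.congr fun x hx => (iteratedDerivWithin_of_isOpen ho hx).symm).differentiableAt
      (ho.mem_nhds hz)
  have hid : Tendsto (fun z : ℝ => z) (𝓝[s.halfLine] (0 : ℝ)) (𝓝 0) :=
    tendsto_nhdsWithin_of_tendsto_nhds tendsto_id
  -- The constant is the limit of the third derivative in absolute value plus one, so the bound
  -- holds on a whole one-sided window.
  obtain ⟨δ', hδ', hb⟩ := (s.eventually_nhdsWithin).1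
    ((hl 3 le_rfl).abs.eventually (gt_mem_nhds (lt_add_one _)))
  set C := |sideDeriv μ s U 3 j| + 1 with hC
  refine ⟨C, min δ' ε, lt_min hδ' hε, min_le_right _ _, ?_⟩
  have hw : ∀ z ∈ s.window (min δ' ε), z ∈ s.window δ' ∧ z ∈ s.window ε := fun z hz =>
    ⟨s.window_subset (min_le_left _ _) hz, s.window_subset (min_le_right _ _) hz⟩
  have hder : ∀ r : ℕ, r < 3 → ∀ z ∈ s.window ε, HasDerivAt (iteratedDeriv r (μ U j))
      (iteratedDeriv (r + 1) (μ U j) z) z := fun r hr z hz => by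
    rw [iteratedDeriv_succ]
    exact (hdiff r hr z hz).hasDerivAt
  have d2 : ∀ z ∈ s.window ε, HasDerivAt
      (fun z => iteratedDeriv 2 (μ U j) z - sideDeriv μ s U 2 j)
      (iteratedDeriv 3 (μ U j) z) z := fun z hz => (hder 2 (by norm_num) z hz).sub_const _
  have d1 : ∀ z ∈ s.window ε, HasDerivAt
      (fun z => iteratedDeriv 1 (μ U j) z - (sideDeriv μ s U 1 j + sideDeriv μ s U 2 j * z))
      (iteratedDeriv 2 (μ U j) z - sideDeriv μ s U 2 j) z := fun z hz => by
    have := (hder 1 (by norm_num) z hz).sub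
      (((hasDerivAt_id z).const_mul (sideDeriv μ s U 2 j)).const_add (sideDeriv μ s U 1 j))
    refine this.congr_deriv ?_
    simp
  have d0 : ∀ z ∈ s.window ε, HasDerivAt
      (fun z => iteratedDeriv 0 (μ U j) z - (sideDeriv μ s U 0 j + sideDeriv μ s U 1 j * z +
        sideDeriv μ s U 2 j * z ^ 2 / 2))
      (iteratedDeriv 1 (μ U j) z - (sideDeriv μ s U 1 j + sideDeriv μ s U 2 j * z)) z :=
    fun z hz => by
    have := (hder 0 (by norm_num) z hz).sub
      ((((hasDerivAt_id z).const_mul (sideDeriv μ s U 1 j)).const_add (sideDeriv μ s U 0 j)).add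
      ((((hasDerivAt_id z).pow 2).const_mul (sideDeriv μ s U 2 j)).div_const 2))
    refine this.congr_deriv ?_
    simp only [id, zero_add, mul_one]
    ring
  have b2 := abs_le_pow_succ_of_abs_deriv_le (s := s) (δ := min δ' ε) (C := C) (m := 0)
    (fun z hz => (d2 z (hw z hz).2).differentiableAt)
    (by simpa using (hl 2 (by norm_num)).sub_const (sideDeriv μ s U 2 j))
    (fun z hz => by
      rw [(d2 z (hw z hz).2).deriv]
      simpa using (hb z (hw z hz).1).le)
  have b1 := abs_le_pow_succ_of_abs_deriv_le (s := s) (δ := min δ' ε) (C := C) (m := 1)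
    (fun z hz => (d1 z (hw z hz).2).differentiableAt)
    (by simpa using (hl 1 (by norm_num)).sub
          ((hid.const_mul (sideDeriv μ s U 2 j)).const_add (sideDeriv μ s U 1 j)))
    (fun z hz => by
      rw [(d1 z (hw z hz).2).deriv]
      simpa using b2 z hz)
  have b0 := abs_le_pow_succ_of_abs_deriv_le (s := s) (δ := min δ' ε) (C := C) (m := 2)
    (fun z hz => (d0 z (hw z hz).2).differentiableAt)
    (by simpa using (hl 0 (by norm_num)).sub
          (((hid.const_mul (sideDeriv μ s U 1 j)).const_add (sideDeriv μ s U 0 j)).add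
            (((hid.pow 2).const_mul (sideDeriv μ s U 2 j)).div_const 2)))
    (fun z hz => by
      rw [(d0 z (hw z hz).2).deriv]
      simpa using b1 z hz)
  simpa only [iteratedDeriv_zero] using b0

theorem SmoothSides.taylor {ε : ℝ} {μ : Regressand → 𝓦 → ℝ → ℝ} {U : Regressand}
    (hε : 0 < ε) (hμ : SmoothSides ε μ U) :
    ∃ C δ : ℝ, 0 ≤ C ∧ 0 < δ ∧ δ ≤ ε ∧ ∀ (s : Side) (j : 𝓦), ∀ z ∈ s.window δ,
      |μ U j z - (sideDeriv μ s U 0 j + sideDeriv μ s U 1 j * z +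
        sideDeriv μ s U 2 j * z ^ 2 / 2)| ≤ C * |z| ^ 3 := by
  choose C δ h0 hle h using hμ.taylor_cell hε
  have hex : ∀ s, ∃ c d : ℝ, 0 ≤ c ∧ 0 < d ∧ d ≤ ε ∧ ∀ (j : 𝓦), ∀ z ∈ s.window d,
      |μ U j z - (sideDeriv μ s U 0 j + sideDeriv μ s U 1 j * z +
        sideDeriv μ s U 2 j * z ^ 2 / 2)| ≤ c * |z| ^ 3 := by
    intro s
    obtain ⟨d, hd, hd'⟩ : ∃ d : ℝ, 0 < d ∧ ∀ j, d ≤ δ s j := by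
      have : ∀ᶠ d in 𝓝[>] (0 : ℝ), ∀ j, d ≤ δ s j := eventually_all.2 fun j =>
        (eventually_nhdsWithin_of_eventually_nhds (ge_mem_nhds (h0 s j)))
      obtain ⟨d, hd⟩ := (this.and self_mem_nhdsWithin).exists
      exact ⟨d, hd.2, hd.1⟩
    refine ⟨∑ j, |C s j|, min d ε, Finset.sum_nonneg fun _ _ => abs_nonneg _, lt_min hd hε,
      min_le_right _ _, fun j z hz => ?_⟩
    refine (h s j z (s.window_subset ((min_le_left _ _).trans (hd' j)) hz)).trans ?_
    gcongr
    exact (le_abs_self _).trans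
      (Finset.single_le_sum (f := fun j => |C s j|) (fun _ _ => abs_nonneg _) (Finset.mem_univ j))
  obtain ⟨c₁, d₁, hc₁, hd₁, he₁, h₁⟩ := hex .right
  obtain ⟨c₂, d₂, hc₂, hd₂, he₂, h₂⟩ := hex .left
  refine ⟨c₁ + c₂, min d₁ d₂, by positivity, lt_min hd₁ hd₂, (min_le_left _ _).trans he₁, ?_⟩
  intro s j z hz
  cases s
  · refine (h₁ j z (Side.window_subset _ (min_le_left _ _) hz)).trans ?_
    gcongr
    linarith
  · refine (h₂ j z (Side.window_subset _ (min_le_right _ _) hz)).trans ?_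
    gcongr
    linarith

end Taylor

/-! ### Consequences of the regularity assumptions for the conditional moments. -/

section Population

theorem abs_integral_le_of_lintegral_fourth {Ω : Type*} [MeasurableSpace Ω] {ν : Measure Ω}
    [IsProbabilityMeasure ν] {g : Ω → ℝ} (hg : Measurable g) {C : NNReal}
    (h : ∫⁻ ω, ‖g ω‖ₑ ^ 4 ∂ν ≤ C) :
    MemLp g 2 ν ∧ |∫ ω, g ω ∂ν| ≤ 1 + C ∧ ∫ ω, g ω ^ 2 ∂ν ≤ 1 + C := by
  obtain ⟨hL, hi⟩ := memLp_and_integral_le_of_lintegral hg (r := 4) (by norm_num) C.2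
    (by simpa using! h)
  have hL2 : MemLp g 2 ν := hL.mono_exponent (by norm_num)
  have i4 : Integrable (fun ω => |g ω| ^ 4) ν := by
    simpa using! hL.integrable_norm_pow (p := 4) (by norm_num)
  have hb : ∀ r ≤ 4, ∫ ω, |g ω| ^ r ∂ν ≤ 1 + C := by
    intro r hr
    calc ∫ ω, |g ω| ^ r ∂ν ≤ ∫ ω, (1 + |g ω| ^ 4) ∂ν := by
          refine integral_mono_of_nonneg (ae_of_all _ fun _ => by positivity)
            ((integrable_const _).add i4) (ae_of_all _ fun ω => ?_)
          simp only
          rcases le_total |g ω| 1 with h1 | h1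
          · exact (pow_le_one₀ (abs_nonneg _) h1).trans (le_add_of_nonneg_right (by positivity))
          · exact (pow_le_pow_right₀ h1 hr).trans (le_add_of_nonneg_left zero_le_one)
      _ = 1 + ∫ ω, |g ω| ^ 4 ∂ν := by
          rw [integral_add (integrable_const _) i4]; simp
      _ ≤ _ := by gcongr; exact hi
  refine ⟨hL2, (abs_integral_le_integral_abs).trans ?_, ?_⟩
  · simpa using hb 1 (by norm_num)
  · simpa using hb 2 (by norm_num)

/-- Nonnegativity of the variances of the sum and of the difference bounds the covariance by the
mean of the two variances. -/
theorem abs_covariance_le_of_lintegral_fourth {Ω : Type*} [MeasurableSpace Ω] {ν : Measure Ω}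
    [IsProbabilityMeasure ν] {g g' : Ω → ℝ} (hg : Measurable g) (hg' : Measurable g') {C : NNReal}
    (h : ∫⁻ ω, ‖g ω‖ₑ ^ 4 ∂ν ≤ C) (h' : ∫⁻ ω, ‖g' ω‖ₑ ^ 4 ∂ν ≤ C) :
    |cov[g, g'; ν]| ≤ 1 + C := by
  obtain ⟨hL, -, hi⟩ := abs_integral_le_of_lintegral_fourth hg h
  obtain ⟨hL', -, hi'⟩ := abs_integral_le_of_lintegral_fourth hg' h'
  have v1 : Var[g; ν] ≤ 1 + C :=
    (variance_le_expectation_sq hg.aestronglyMeasurable).trans hi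
  have v2 : Var[g'; ν] ≤ 1 + C :=
    (variance_le_expectation_sq hg'.aestronglyMeasurable).trans hi'
  have s1 : 0 ≤ Var[g; ν] + 2 * cov[g, g'; ν] + Var[g'; ν] := by
    rw [← variance_add hL hL']; exact variance_nonneg _ _
  have s2 : 0 ≤ Var[g; ν] - 2 * cov[g, g'; ν] + Var[g'; ν] := by
    rw [← variance_sub hL hL']; exact variance_nonneg _ _
  rw [abs_le]
  constructor <;> linarith

variable {Ω 𝓦 : Type*} [MeasurableSpace Ω] [Fintype 𝓦] [DecidableEq 𝓦] [Nonempty 𝓦]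
  [MeasurableSpace 𝓦] [DiscreteMeasurableSpace 𝓦]
  {P : Measure Ω} [IsProbabilityMeasure P] {D : Data Ω 𝓦}
  {k f : ℝ → ℝ} {ε : ℝ} {μ : Regressand → 𝓦 → ℝ → ℝ}

/-- The density is positive on the window, so there null sets of the law of `Z` are Lebesgue null.
This turns statements about the sample into statements for almost every `z`. -/
theorem Regular.ae_volume (hreg : Regular P D k f ε μ) {p : ℝ → Prop}
    (h : ∀ᵐ z ∂(P.map (D.Z 0)), p z) : ∀ᵐ z, z ∈ Set.Ioo (-ε) ε → p z := by
  rw [hreg.density, ae_withDensity_iff hreg.density_measurable.ennreal_ofReal] at h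
  obtain ⟨a, A, ha, hA⟩ := hreg.density_bounds
  filter_upwards [h] with z hz hzε
  exact hz (by simpa using ha.trans_le (hA z hzε).1)

theorem Regular.ae_Z_ne_zero (hreg : Regular P D k f ε μ) (hD : IsIID P D) :
    ∀ᵐ ω ∂P, D.Z 0 ω ≠ 0 := by
  have h : ∀ᵐ z ∂(P.map (D.Z 0)), z ≠ 0 := by
    rw [hreg.density]
    exact (withDensity_absolutelyContinuous _ _).ae_le (Measure.ae_ne volume 0)
  exact ae_of_ae_map (hD.1 0).2.2.1.aemeasurable h

theorem Regular.exists_lintegral_coord_le (hreg : Regular P D k f ε μ) (hD : IsIID P D) :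
    ∃ C : NNReal, ∀ᵐ ω ∂P, D.Z 0 ω ∈ Set.Ioo (-ε) ε → ∀ U : Regressand,
      ∫⁻ q, ‖U.coord q‖ₑ ^ 4 ∂lawYX P D (D.Z 0 ω, D.W 0 ω) ≤ C := by
  obtain ⟨C, hC⟩ := hreg.fourth_moment
  have hX : ∀ᵐ ω ∂P, ∀ᵐ q ∂lawYX P D (D.Z 0 ω, D.W 0 ω), |q.2| ≤ 1 := by
    have h1 : ∀ᵐ a ∂((P.map fun ω => (D.Z 0 ω, D.W 0 ω)) ⊗ₘ lawYX P D), |a.2.2| ≤ 1 := by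
      rw [hD.compProd_lawYX, ae_map_iff]
      · filter_upwards [hreg.treatment_binary] with ω hω
        rcases hω with h | h <;> simp [h]
      · exact ((hD.measurable_ZW 0).prodMk ((hD.1 0).1.prodMk (hD.1 0).2.1)).aemeasurable
      · exact measurableSet_le (by fun_prop) measurable_const
    exact ae_of_ae_map (hD.measurable_ZW 0).aemeasurable (Measure.ae_ae_of_ae_compProd h1)
  refine ⟨C + 1, ?_⟩
  filter_upwards [hC, hX] with ω h1 h2 hz U
  cases U
  · exact (h1 hz).trans (by push_cast; exact le_self_add)
  · calc ∫⁻ q, ‖Regressand.treatment.coord q‖ₑ ^ 4 ∂lawYX P D (D.Z 0 ω, D.W 0 ω)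
        ≤ ∫⁻ q, 1 ∂lawYX P D (D.Z 0 ω, D.W 0 ω) := by
          refine lintegral_mono_ae (h2.mono fun q hq => pow_le_one₀ zero_le ?_)
          rw [← ofReal_norm]
          exact ENNReal.ofReal_le_one.2 hq
      _ ≤ _ := by simp
  · simp [Regressand.coord]

theorem Regular.exists_bounds (hreg : Regular P D k f ε μ) (hD : IsIID P D) :
    ∃ C : ℝ, ∀ᵐ ω ∂P, D.Z 0 ω ∈ Set.Ioo (-ε) ε → ∀ U U' : Regressand,
      MemLp U.coord 2 (lawYX P D (D.Z 0 ω, D.W 0 ω)) ∧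
      |meanYX P D U (D.Z 0 ω, D.W 0 ω)| ≤ C ∧ |condCov P D U U' (D.Z 0 ω) (D.W 0 ω)| ≤ C := by
  obtain ⟨C, hC⟩ := hreg.exists_lintegral_coord_le hD
  refine ⟨1 + C, hC.mono fun ω hω hz U U' => ?_⟩
  obtain ⟨h1, h2, -⟩ := abs_integral_le_of_lintegral_fourth U.measurable_coord (hω hz U)
  exact ⟨h1, h2, abs_covariance_le_of_lintegral_fourth U.measurable_coord U'.measurable_coord
    (hω hz U) (hω hz U')⟩

theorem Regular.locMoment_errYX (hreg : Regular P D k f ε μ) (hD : IsIID P D) (U : Regressand) :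
    LocMoment P D ε (errYX P D U) := by
  obtain ⟨C, hC⟩ := hreg.exists_lintegral_coord_le hD
  obtain ⟨C', hC'⟩ := hreg.exists_bounds hD
  have h1 : LocMoment P D ε (fun o => U.coord (o.1, o.2.1)) := by
    refine ⟨U.measurable_coord.comp (by fun_prop), C, fun G hG hG0 => ?_⟩
    have := hD.lintegral_obs (F := fun a => G a.1.1 * ‖U.coord a.2‖ₑ ^ 4)
      ((hG.comp (by fun_prop)).mul ((U.measurable_coord.comp measurable_snd).enorm.pow_const 4))
    simp only at this
    refine le_of_eq_of_le this ?_
    rw [← lintegral_const_mul' _ _ ENNReal.coe_ne_top]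
    refine lintegral_mono_ae (hC.mono fun ω hω => ?_)
    rw [lintegral_const_mul _ (U.measurable_coord.enorm.pow_const 4)]
    by_cases hz : D.Z 0 ω ∈ Set.Ioo (-ε) ε
    · rw [mul_comm]
      gcongr
      exact hω hz U
    · simp [hG0 _ hz]
  have h2 : LocMoment P D ε (fun o => -meanYX P D U o.2.2) :=
    LocMoment.of_bounded ((measurable_meanYX U).comp (by fun_prop)).neg (C := C')
      (hC'.mono fun ω hω hz => by rw [abs_neg]; exact (hω hz U U).2.1)
  have h3 := h1.add hD h2
  simp only [← sub_eq_add_neg] at h3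
  exact h3

theorem abs_errW_le (j : 𝓦) (o : ℝ × ℝ × ℝ × 𝓦) : |errW P D j o| ≤ 1 := by
  have h0 := meanW_nonneg (P := P) (D := D) j o.2.2.1
  have h1 := meanW_le_one (P := P) (D := D) j o.2.2.1
  rw [errW, abs_le]
  split_ifs <;> constructor <;> linarith

theorem locMoment_errW (δ : ℝ) (j : 𝓦) : LocMoment P D δ (errW P D j) :=
  LocMoment.of_bounded (measurable_errW j) (C := 1) (ae_of_all _ fun _ _ => abs_errW_le j _)

theorem Regular.density_pos (hreg : Regular P D k f ε μ) : 0 < f 0 := by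
  obtain ⟨a, A, ha, hA⟩ := hreg.density_bounds
  exact ha.trans_le (hA 0 ⟨by linarith [hreg.window_pos], hreg.window_pos⟩).1

/-- The determinant of a Kronecker product is a product of powers of the two determinants, so
neither factor of a positive definite one can be singular. -/
theorem Regular.isUnit_kernelMoments (hreg : Regular P D k f ε μ) (s : Side) :
    IsUnit (kernelMoments 1 k s).det := by
  have h := (hreg.gamma_posDef s).det_pos
  rw [Matrix.det_smul, Matrix.det_kronecker] at h
  refine isUnit_iff_ne_zero.2 fun h0 => ?_
  rw [h0, zero_pow Fintype.card_ne_zero] at h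
  simp at h

/-- A diagonal entry of the positive definite matrix is a product of the density, the zeroth kernel
moment and the cell probability; the first two are positive and nonnegative, so the third is
positive. -/
theorem Regular.muSide_dummies_pos (hreg : Regular P D k f ε μ) (hk : IsKernel k) (s : Side)
    (j : 𝓦) : 0 < muSide μ s .dummies j := by
  have h := (hreg.gamma_posDef s).diag_pos (i := ((0 : Fin (1 + 1)), j))
  rw [Matrix.smul_apply, Matrix.kroneckerMap_apply, sigmaW, Matrix.diagonal_apply_eq,
    smul_eq_mul] at h
  have hK : 0 ≤ kernelMoments 1 k s 0 0 := by
    refine integral_nonneg fun u => ?_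
    simpa using hk.nonneg u
  have h1 := (mul_pos_iff_of_pos_left hreg.density_pos).1 h
  by_contra hcon
  exact absurd h1 (not_lt.2 (mul_nonpos_of_nonneg_of_nonpos hK (not_lt.1 hcon)))

/-- The one-sided limit belongs to the chosen version `μ`, while `meanW` comes from the conditional
law. The two agree only almost surely, hence the almost sure form. -/
theorem Regular.meanW_near (hreg : Regular P D k f ε μ) {e : ℝ} (he : 0 < e) :
    ∃ δ : ℝ, 0 < δ ∧ δ ≤ ε ∧ ∀ᵐ ω ∂P, ∀ (s : Side) (j : 𝓦), D.Z 0 ω ∈ s.window δ →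
      |meanW P D j (D.Z 0 ω) - muSide μ s .dummies j| ≤ e := by
  have h1 : ∀ (s : Side), ∃ δ > 0, ∀ z ∈ s.window δ, ∀ j,
      |μ .dummies j z - muSide μ s .dummies j| ≤ e := by
    intro s
    rw [← s.eventually_nhdsWithin, eventually_all]
    intro j
    have := (hreg.dummies_limit s j).tendsto
    have h2 := ((this.sub_const (sideLim s (μ .dummies j))).abs).eventually
      (ge_mem_nhds (by simpa using he))
    simpa [muSide, sideDeriv, iteratedDeriv_zero] using h2
  choose δ hδ h using h1
  refine ⟨min ε (min (δ .right) (δ .left)), lt_min hreg.window_pos (lt_min (hδ _) (hδ _)),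
    min_le_left _ _, ?_⟩
  filter_upwards [hreg.regression.dummies] with ω hω s j hz
  have hzε : D.Z 0 ω ∈ Set.Ioo (-ε) ε :=
    s.window_subset_Ioo ε (s.window_subset (min_le_left _ _) hz)
  rw [meanW, hω hzε j]
  refine h s _ (s.window_subset ?_ hz) j
  cases s
  · exact (min_le_right _ _).trans (min_le_left _ _)
  · exact (min_le_right _ _).trans (min_le_right _ _)

theorem Side.measurableSet_window (s : Side) (δ : ℝ) : MeasurableSet (s.window δ) :=
  (s.isOpen_window δ).measurableSet

theorem Regular.meanW_near_volume (hreg : Regular P D k f ε μ) (hD : IsIID P D) {e : ℝ}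
    (he : 0 < e) :
    ∃ δ : ℝ, 0 < δ ∧ δ ≤ ε ∧ ∀ᵐ z, ∀ (s : Side) (j : 𝓦), z ∈ s.window δ →
      |meanW P D j z - muSide μ s .dummies j| ≤ e := by
  obtain ⟨δ, h0, hle, h⟩ := hreg.meanW_near (P := P) (D := D) he
  refine ⟨δ, h0, hle, ?_⟩
  have hms : ∀ s : Side, MeasurableSet {z : ℝ | ∀ (j : 𝓦), z ∈ s.window δ →
      |meanW P D j z - muSide μ s .dummies j| ≤ e} := by
    intro s
    simp only [Set.ofPred_forall]
    refine MeasurableSet.iInter fun j => ?_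
    have : {z : ℝ | z ∈ s.window δ → |meanW P D j z - muSide μ s .dummies j| ≤ e} =
        (s.window δ)ᶜ ∪ {z | |meanW P D j z - muSide μ s .dummies j| ≤ e} := by
      ext z; simp [imp_iff_not_or]
    exact this ▸ (s.measurableSet_window δ).compl.union
      (measurableSet_le ((measurable_meanW j).sub_const _).abs measurable_const)
  have hall : ∀ s : Side, ∀ᵐ z, ∀ (j : 𝓦), z ∈ s.window δ →
      |meanW P D j z - muSide μ s .dummies j| ≤ e := by
    intro s
    have h1 := (ae_map_iff (hD.1 0).2.2.1.aemeasurable (hms s)).2 (h.mono fun ω hω => hω s)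
    filter_upwards [hreg.ae_volume h1] with z hz j hzw
    exact hz (s.window_subset_Ioo ε (s.window_subset hle hzw)) j hzw
  filter_upwards [hall .right, hall .left] with z h1 h2 s
  cases s
  · exact h1
  · exact h2

theorem Regular.muSide_dummies_le_one (hreg : Regular P D k f ε μ) (hD : IsIID P D) (s : Side)
    (j : 𝓦) : muSide μ s .dummies j ≤ 1 := by
  refine le_of_forall_pos_le_add fun e he => ?_
  obtain ⟨δ, h0, hle, h⟩ := hreg.meanW_near_volume hD he
  -- An almost everywhere statement yields an actual point once the window has positive measure.
  have hpos : volume (s.window δ) ≠ 0 := by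
    cases s <;> simp [Side.window, h0]
  obtain ⟨z, hz, hzw⟩ : ∃ z, (∀ (s : Side) (j : 𝓦), z ∈ s.window δ →
      |meanW P D j z - muSide μ s .dummies j| ≤ e) ∧ z ∈ s.window δ := by
    by_contra hcon
    push Not at hcon
    exact hpos (measure_mono_null (fun z hz hz' => hcon z hz' hz) (ae_iff.1 h))
  have h1 := (abs_le.1 (hz s j hzw)).1
  linarith [meanW_le_one (P := P) (D := D) j z]

/-- Almost surely, the conditional means differ from their Taylor polynomials at the cutoff by a
term of third order. -/
theorem Regular.taylor_meanYX (hreg : Regular P D k f ε μ) (U : Regressand)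
    (hU : U ≠ .dummies) :
    ∃ C δ : ℝ, 0 ≤ C ∧ 0 < δ ∧ ∀ᵐ ω ∂P, ∀ s : Side, D.Z 0 ω ∈ s.window δ →
      |meanYX P D U (D.Z 0 ω, D.W 0 ω) - (sideDeriv μ s U 0 (D.W 0 ω) +
        sideDeriv μ s U 1 (D.W 0 ω) * D.Z 0 ω + sideDeriv μ s U 2 (D.W 0 ω) * D.Z 0 ω ^ 2 / 2)| ≤
        C * |D.Z 0 ω| ^ 3 := by
  have hs : SmoothSides ε μ U := by
    cases U
    · exact hreg.smooth_outcome
    · exact hreg.smooth_treatment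
    · exact absurd rfl hU
  have hr : ∀ᵐ ω ∂P, D.Z 0 ω ∈ Set.Ioo (-ε) ε →
      meanYX P D U (D.Z 0 ω, D.W 0 ω) = μ U (D.W 0 ω) (D.Z 0 ω) := by
    cases U
    · exact hreg.regression.outcome
    · exact hreg.regression.treatment
    · exact absurd rfl hU
  obtain ⟨C, δ, hC, hδ, hle, h⟩ := hs.taylor hreg.window_pos
  refine ⟨C, δ, hC, hδ, hr.mono fun ω hω s hz => ?_⟩
  rw [hω (s.window_subset_Ioo ε (s.window_subset hle hz))]
  exact h s _ _ hz

theorem Regular.taylor_meanW (hreg : Regular P D k f ε μ) (hs : SmoothSides ε μ .dummies) :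
    ∃ C δ : ℝ, 0 ≤ C ∧ 0 < δ ∧ ∀ᵐ ω ∂P, ∀ (j : 𝓦) (s : Side), D.Z 0 ω ∈ s.window δ →
      |meanW P D j (D.Z 0 ω) - (sideDeriv μ s .dummies 0 j +
        sideDeriv μ s .dummies 1 j * D.Z 0 ω + sideDeriv μ s .dummies 2 j * D.Z 0 ω ^ 2 / 2)| ≤
        C * |D.Z 0 ω| ^ 3 := by
  obtain ⟨C, δ, hC, hδ, hle, h⟩ := hs.taylor hreg.window_pos
  refine ⟨C, δ, hC, hδ, hreg.regression.dummies.mono fun ω hω j s hz => ?_⟩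
  rw [meanW, hω (s.window_subset_Ioo ε (s.window_subset hle hz))]
  exact h s _ _ hz

end Population

/-! ### First and second moments of the regression errors. -/

section Moments

variable {Ω 𝓦 : Type*} [MeasurableSpace Ω] [Fintype 𝓦] [DecidableEq 𝓦] [Nonempty 𝓦]
  [MeasurableSpace 𝓦] [DiscreteMeasurableSpace 𝓦]
  {P : Measure Ω} [IsProbabilityMeasure P] {D : Data Ω 𝓦}
  {k f : ℝ → ℝ} {ε : ℝ} {μ : Regressand → 𝓦 → ℝ → ℝ}

theorem abs_one_sub_meanW_le (j w : 𝓦) (z : ℝ) :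
    |(if w = j then (1 : ℝ) else 0) - meanW P D j z| ≤ 1 :=
  abs_errW_le (P := P) (D := D) j (0, 0, z, w)

theorem condCovW_eq_sum (j l : 𝓦) (z : ℝ) :
    condCovW P D j l z = ∑ w, meanW P D w z * (((if w = j then (1 : ℝ) else 0) - meanW P D j z) *
      ((if w = l then (1 : ℝ) else 0) - meanW P D l z)) := by
  have hm : ∀ j : 𝓦, ∫ w, (if w = j then (1 : ℝ) else 0) ∂lawW P D z = meanW P D j z := by
    intro j
    rw [integral_lawW]
    simp
  rw [condCovW, covariance, hm, hm, integral_lawW]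

theorem abs_condCovW_le (j l : 𝓦) (z : ℝ) : |condCovW P D j l z| ≤ 1 := by
  rw [condCovW_eq_sum]
  refine le_of_le_of_eq ?_ (sum_meanW (P := P) (D := D) z)
  refine (Finset.abs_sum_le_sum_abs _ _).trans (Finset.sum_le_sum fun w _ => ?_)
  rw [abs_mul, abs_mul, abs_of_nonneg (meanW_nonneg w z)]
  exact mul_le_of_le_one_right (meanW_nonneg w z)
    (mul_le_one₀ (abs_one_sub_meanW_le j w z) (abs_nonneg _) (abs_one_sub_meanW_le l w z))

/-- A bounded measurable function of `(z, w)` that vanishes for `z` outside `(-δ, δ)`. -/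
def WindowFun (δ : ℝ) (B : ℝ × 𝓦 → ℝ) : Prop :=
  Measurable B ∧ (∃ M, ∀ a, |B a| ≤ M) ∧ ∀ a : ℝ × 𝓦, a.1 ∉ Set.Ioo (-δ) δ → B a = 0

theorem WindowFun.mul {δ : ℝ} {B b : ℝ × 𝓦 → ℝ} (hB : WindowFun δ B) (hb : Measurable b) {M : ℝ}
    (h : ∀ a, |b a| ≤ M) : WindowFun δ (fun a => B a * b a) := by
  obtain ⟨hm, ⟨M', hM'⟩, h0⟩ := hB
  refine ⟨hm.mul hb, ⟨M' * M, fun a => ?_⟩, fun a ha => by simp [h0 a ha]⟩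
  rw [abs_mul]
  exact mul_le_mul (hM' a) (h a) (abs_nonneg _) ((abs_nonneg _).trans (hM' a))

theorem LocMoment.memLp_indicator {δ : ℝ} {φ : ℝ × ℝ × ℝ × 𝓦 → ℝ} (hφ : LocMoment P D δ φ)
    (hD : IsIID P D) :
    MemLp (fun ω => (Set.Ioo (-δ) δ).indicator 1 (D.Z 0 ω) * φ (D.obs 0 ω)) 2 P := by
  obtain ⟨hm, C, hC⟩ := hφ
  have hI : Measurable ((Set.Ioo (-δ) δ).indicator (1 : ℝ → ℝ)) :=
    measurable_one.indicator measurableSet_Ioo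
  have h4 := memLp_and_integral_le_of_lintegral (P := P) (r := 4) (B := C)
    (g := fun ω => (Set.Ioo (-δ) δ).indicator 1 (D.Z 0 ω) * φ (D.obs 0 ω))
    ((hI.comp (hD.1 0).2.2.1).mul (hm.comp (hD.measurable_obs 0))) (by norm_num) C.2 ?_
  · exact h4.1.mono_exponent (by norm_num)
  · have h1 := hC ((Set.Ioo (-δ) δ).indicator 1) (measurable_one.indicator measurableSet_Ioo)
      (fun z hz => Set.indicator_of_notMem hz _)
    refine (le_of_eq ?_).trans (h1.trans ?_)
    · refine lintegral_congr fun ω => ?_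
      by_cases hz : D.Z 0 ω ∈ Set.Ioo (-δ) δ <;> simp [hz]
    · rw [ENNReal.ofReal_coe_nnreal]
      refine mul_le_of_le_one_right zero_le ?_
      calc ∫⁻ ω, (Set.Ioo (-δ) δ).indicator 1 (D.Z 0 ω) ∂P ≤ ∫⁻ _, 1 ∂P :=
            lintegral_mono fun ω => Set.indicator_le_self' (fun _ _ => zero_le) _
        _ = 1 := by simp

theorem WindowFun.integrable_mul {δ : ℝ} {B : ℝ × 𝓦 → ℝ} (hB : WindowFun δ B)
    {φ ψ : ℝ × ℝ × ℝ × 𝓦 → ℝ} (hφ : LocMoment P D δ φ) (hψ : LocMoment P D δ ψ)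
    (hD : IsIID P D) :
    Integrable (fun ω => B (D.Z 0 ω, D.W 0 ω) * (φ (D.obs 0 ω) * ψ (D.obs 0 ω))) P := by
  obtain ⟨hm, ⟨M, hM⟩, h0⟩ := hB
  refine (((hφ.memLp_indicator hD).integrable_mul (hψ.memLp_indicator hD)).bdd_mul
    (hm.comp (hD.measurable_ZW 0)).aestronglyMeasurable (c := M)
    (ae_of_all _ fun ω => hM _)).congr (ae_of_all _ fun ω => ?_)
  by_cases hz : D.Z 0 ω ∈ Set.Ioo (-δ) δ
  · simp [hz]
  · simp [h0 (D.Z 0 ω, D.W 0 ω) hz]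

theorem locMoment_one (δ : ℝ) : LocMoment P D δ (fun _ => 1) :=
  LocMoment.of_bounded measurable_const (C := 1) (by simp)

theorem WindowFun.integrable_mul_one {δ : ℝ} {B : ℝ × 𝓦 → ℝ} (hB : WindowFun δ B)
    {φ : ℝ × ℝ × ℝ × 𝓦 → ℝ} (hφ : LocMoment P D δ φ) (hD : IsIID P D) :
    Integrable (fun ω => B (D.Z 0 ω, D.W 0 ω) * φ (D.obs 0 ω)) P := by
  simpa using hB.integrable_mul hφ (locMoment_one δ) hD

/-- The error has conditional mean zero given `(Z, W)`, so any window weight in `(Z, W)` is allowed.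
The window supplies the integrability. -/
theorem Regular.integral_errYX (hreg : Regular P D k f ε μ) (hD : IsIID P D) {B : ℝ × 𝓦 → ℝ}
    (hB : WindowFun ε B) (U : Regressand) :
    ∫ ω, B (D.Z 0 ω, D.W 0 ω) * errYX P D U (D.obs 0 ω) ∂P = 0 := by
  obtain ⟨C, hC⟩ := hreg.exists_bounds hD
  have hF : Measurable fun x : (ℝ × 𝓦) × (ℝ × ℝ) => B x.1 * (U.coord x.2 - meanYX P D U x.1) :=
    (hB.1.comp measurable_fst).mul ((U.measurable_coord.comp measurable_snd).sub
      ((measurable_meanYX U).comp measurable_fst))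
  refine (hD.integral_obs hF (hB.integrable_mul_one (hreg.locMoment_errYX hD U) hD)).trans ?_
  refine integral_eq_zero_of_ae (hC.mono fun ω hω => ?_)
  by_cases hz : D.Z 0 ω ∈ Set.Ioo (-ε) ε
  · have hi := (hω hz U U).1.integrable (by norm_num)
    simp only [Pi.zero_apply]
    rw [integral_const_mul, integral_sub hi (integrable_const _)]
    simp [meanYX]
  · simp [hB.2.2 (D.Z 0 ω, D.W 0 ω) hz]

theorem Regular.integral_errYX_mul (hreg : Regular P D k f ε μ) (hD : IsIID P D) {B : ℝ × 𝓦 → ℝ}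
    (hB : WindowFun ε B) (U U' : Regressand) :
    ∫ ω, B (D.Z 0 ω, D.W 0 ω) * (errYX P D U (D.obs 0 ω) * errYX P D U' (D.obs 0 ω)) ∂P =
      ∫ ω, B (D.Z 0 ω, D.W 0 ω) * condCov P D U U' (D.Z 0 ω) (D.W 0 ω) ∂P := by
  have hF : Measurable fun x : (ℝ × 𝓦) × (ℝ × ℝ) => B x.1 *
      ((U.coord x.2 - meanYX P D U x.1) * (U'.coord x.2 - meanYX P D U' x.1)) :=
    (hB.1.comp measurable_fst).mul (((U.measurable_coord.comp measurable_snd).sub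
      ((measurable_meanYX U).comp measurable_fst)).mul
      ((U'.measurable_coord.comp measurable_snd).sub ((measurable_meanYX U').comp measurable_fst)))
  refine (hD.integral_obs hF (hB.integrable_mul (hreg.locMoment_errYX hD U)
    (hreg.locMoment_errYX hD U') hD)).trans ?_
  refine integral_congr_ae (ae_of_all _ fun ω => ?_)
  simp only
  rw [integral_const_mul]
  rfl

theorem WindowFun.of_side {δ : ℝ} {G : ℝ → ℝ} (hG : Measurable G) {M : ℝ} (hM : ∀ z, |G z| ≤ M)
    (h0 : ∀ z ∉ Set.Ioo (-δ) δ, G z = 0) : WindowFun δ (fun a : ℝ × 𝓦 => G a.1) :=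
  ⟨hG.comp measurable_fst, ⟨M, fun a => hM a.1⟩, fun a ha => h0 a.1 ha⟩

theorem integral_errW (hD : IsIID P D) {δ : ℝ} {G : ℝ → ℝ}
    (hG : WindowFun δ (fun a : ℝ × 𝓦 => G a.1)) (j : 𝓦) :
    ∫ ω, G (D.Z 0 ω) * errW P D j (D.obs 0 ω) ∂P = 0 := by
  have hF : Measurable fun a : ℝ × 𝓦 =>
      G a.1 * ((if a.2 = j then 1 else 0) - meanW P D j a.1) :=
    hG.1.mul ((measurable_errW (P := P) (D := D) j).comp
      (g := errW P D j) (f := fun a : ℝ × 𝓦 => ((0 : ℝ), (0 : ℝ), a.1, a.2)) (by fun_prop))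
  refine (hD.integral_ZW hF (hG.integrable_mul_one (locMoment_errW δ j) hD)).trans ?_
  refine integral_eq_zero_of_ae (ae_of_all _ fun ω => ?_)
  have h1 := sum_meanW (P := P) (D := D) (D.Z 0 ω)
  simp only [Pi.zero_apply, mul_left_comm _ (G _), ← Finset.mul_sum, mul_sub,
    Finset.sum_sub_distrib, ← Finset.sum_mul, h1]
  simp

theorem integral_errW_mul (hD : IsIID P D) {δ : ℝ} {G : ℝ → ℝ}
    (hG : WindowFun δ (fun a : ℝ × 𝓦 => G a.1)) (j l : 𝓦) :
    ∫ ω, G (D.Z 0 ω) * (errW P D j (D.obs 0 ω) * errW P D l (D.obs 0 ω)) ∂P =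
      ∫ ω, G (D.Z 0 ω) * condCovW P D j l (D.Z 0 ω) ∂P := by
  have hm : ∀ j, Measurable fun a : ℝ × 𝓦 => (if a.2 = j then (1 : ℝ) else 0) - meanW P D j a.1 :=
    fun j => (measurable_errW (P := P) (D := D) j).comp
      (g := errW P D j) (f := fun a : ℝ × 𝓦 => ((0 : ℝ), (0 : ℝ), a.1, a.2)) (by fun_prop)
  have hF : Measurable fun a : ℝ × 𝓦 =>
      G a.1 * (((if a.2 = j then 1 else 0) - meanW P D j a.1) *
        ((if a.2 = l then 1 else 0) - meanW P D l a.1)) := hG.1.mul ((hm j).mul (hm l))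
  refine (hD.integral_ZW hF
    (hG.integrable_mul (locMoment_errW δ j) (locMoment_errW δ l) hD)).trans ?_
  refine integral_congr_ae (ae_of_all _ fun ω => ?_)
  simp only
  rw [condCovW_eq_sum, Finset.mul_sum]
  exact Finset.sum_congr rfl fun w _ => by ring

/-- The dummy of cell `j`, divided by `p j`. -/
noncomputable def cellInv (p : 𝓦 → ℝ) (j w : 𝓦) : ℝ := if w = j then (p j)⁻¹ else 0

theorem measurable_cellInv (p : 𝓦 → ℝ) (j : 𝓦) : Measurable (cellInv p j) :=
  measurable_of_countable _

theorem abs_cellInv_le (p : 𝓦 → ℝ) (j w : 𝓦) : |cellInv p j w| ≤ |(p j)⁻¹| := by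
  unfold cellInv
  split_ifs <;> simp

/-- The error entering the estimated intercept of `U` in cell `j`, when the cell probabilities at
the cutoff are `p`. -/
noncomputable def unitErr (P : Measure Ω) [IsFiniteMeasure P] (D : Data Ω 𝓦) (p : 𝓦 → ℝ)
    (U : Regressand) (j : 𝓦) (o : ℝ × ℝ × ℝ × 𝓦) : ℝ :=
  if U = .dummies then errW P D j o else
    cellInv p j o.2.2.2 * errYX P D U o

/-- The conditional covariance of two errors `unitErr`. -/
noncomputable def unitCov (P : Measure Ω) [IsFiniteMeasure P] (D : Data Ω 𝓦) (p : 𝓦 → ℝ)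
    (U U' : Regressand) (j l : 𝓦) (a : ℝ × 𝓦) : ℝ :=
  if U = .dummies then (if U' = .dummies then condCovW P D j l a.1 else 0) else
    if U' = .dummies then 0 else
      cellInv p j a.2 * cellInv p l a.2 *
        condCov P D U U' a.1 a.2

theorem Regular.locMoment_unitErr (hreg : Regular P D k f ε μ) (hD : IsIID P D) (p : 𝓦 → ℝ)
    (U : Regressand) (j : 𝓦) : LocMoment P D ε (unitErr P D p U j) := by
  unfold unitErr
  split_ifs
  · exact locMoment_errW ε j
  · exact (hreg.locMoment_errYX hD U).bdd_mul ((measurable_cellInv p j).comp (by fun_prop))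
      (ae_of_all _ fun ω _ => abs_cellInv_le p j _)

theorem Regular.locMoment_unitCov (hreg : Regular P D k f ε μ) (hD : IsIID P D) (p : 𝓦 → ℝ)
    (U U' : Regressand) (j l : 𝓦) : LocMoment P D ε (fun o => unitCov P D p U U' j l o.2.2) := by
  obtain ⟨C, hC⟩ := hreg.exists_bounds hD
  unfold unitCov
  split_ifs
  · exact LocMoment.of_bounded ((measurable_condCovW j l).comp (by fun_prop)) (C := 1)
      (ae_of_all _ fun ω _ => abs_condCovW_le j l _)
  · exact LocMoment.of_bounded measurable_const (C := 0) (by simp)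
  · exact LocMoment.of_bounded measurable_const (C := 0) (by simp)
  · refine LocMoment.bdd_mul (LocMoment.of_bounded
      ((measurable_condCov U U').comp (f := fun o : ℝ × ℝ × ℝ × 𝓦 => o.2.2) (by fun_prop)) (C := C)
      (hC.mono fun ω hω hz => (hω hz U U').2.2)) (((measurable_cellInv p j).comp
      (by fun_prop)).mul ((measurable_cellInv p l).comp (by fun_prop)))
      (M := |(p j)⁻¹| * |(p l)⁻¹|) (ae_of_all _ fun ω _ => ?_)
    rw [abs_mul]
    exact mul_le_mul (abs_cellInv_le p j _) (abs_cellInv_le p l _) (abs_nonneg _)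
      (abs_nonneg _)

theorem Regular.integral_unitErr (hreg : Regular P D k f ε μ) (hD : IsIID P D) {G : ℝ → ℝ}
    (hG : WindowFun ε (fun a : ℝ × 𝓦 => G a.1)) (p : 𝓦 → ℝ) (U : Regressand) (j : 𝓦) :
    ∫ ω, G (D.Z 0 ω) * unitErr P D p U j (D.obs 0 ω) ∂P = 0 := by
  unfold unitErr
  split_ifs
  · exact integral_errW hD hG j
  · have := hreg.integral_errYX hD (hG.mul (b := fun a => cellInv p j a.2)
      ((measurable_cellInv p j).comp measurable_snd) (fun a => abs_cellInv_le p j a.2)) U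
    simp only [mul_assoc] at this
    exact this

/-- Like blocks follow by conditioning. The mixed blocks vanish because the error of a dummy is a
function of `(Z, W)`, given which the errors of `Y` and `X` have mean zero. -/
theorem Regular.integral_unitErr_mul (hreg : Regular P D k f ε μ) (hD : IsIID P D) {G : ℝ → ℝ}
    (hG : WindowFun ε (fun a : ℝ × 𝓦 => G a.1)) (p : 𝓦 → ℝ) (U U' : Regressand) (j l : 𝓦) :
    ∫ ω, G (D.Z 0 ω) * (unitErr P D p U j (D.obs 0 ω) * unitErr P D p U' l (D.obs 0 ω)) ∂P =
      ∫ ω, G (D.Z 0 ω) * unitCov P D p U U' j l (D.Z 0 ω, D.W 0 ω) ∂P := by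
  have hcell : ∀ (j : 𝓦) (U : Regressand) (l : 𝓦), ∫ ω, G (D.Z 0 ω) *
      (cellInv p j (D.W 0 ω) * errYX P D U (D.obs 0 ω) *
        errW P D l (D.obs 0 ω)) ∂P = 0 := by
    intro j U l
    refine Eq.trans ?_ (hreg.integral_errYX hD ((hG.mul (b := fun a => cellInv p j a.2)
      ((measurable_cellInv p j).comp measurable_snd) (fun a => abs_cellInv_le p j a.2)).mul
      (b := fun a => errW P D l (0, 0, a)) ((measurable_errW l).comp (by fun_prop))
      (fun a => abs_errW_le l _)) U)
    refine integral_congr_ae (ae_of_all _ fun ω => ?_)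
    change _ = G (D.Z 0 ω) * cellInv p j (D.W 0 ω) * errW P D l (D.obs 0 ω) * _
    ring
  unfold unitErr unitCov
  split_ifs
  · exact integral_errW_mul hD hG j l
  · simp only [mul_zero, integral_zero]
    refine Eq.trans ?_ (hcell l U' j)
    refine integral_congr_ae (ae_of_all _ fun ω => ?_)
    simp only [Data.obs]
    ring
  · simp only [mul_zero, integral_zero]
    exact hcell j U l
  · have := hreg.integral_errYX_mul hD ((hG.mul (b := fun a => cellInv p j a.2)
      ((measurable_cellInv p j).comp measurable_snd) (fun a => abs_cellInv_le p j a.2)).mul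
      (b := fun a => cellInv p l a.2)
      ((measurable_cellInv p l).comp measurable_snd) (fun a => abs_cellInv_le p l a.2)) U U'
    refine (integral_congr_ae (ae_of_all _ fun ω => ?_)).trans
      (this.trans (integral_congr_ae (ae_of_all _ fun ω => ?_)))
    · simp only [Data.obs]
      ring
    · simp only
      ring

end Moments

/-! ### The one-sided halves of the kernel. -/

section Kernel

/-- The kernel restricted to one side of the cutoff. -/
noncomputable def halfKernel (k : ℝ → ℝ) : Side → ℝ → ℝ
  | .right => (Set.Ici 0).indicator k
  | .left => (Set.Iio 0).indicator k

variable {k : ℝ → ℝ} {s : Side}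

theorem sideKernel_eq {h : ℝ} (hh : 0 < h) (z : ℝ) :
    sideKernel k h s z = h⁻¹ * halfKernel k s (z / h) := by
  cases s
  · by_cases hz : 0 ≤ z
    · have : 0 ≤ z / h := by positivity
      simp [sideKernel, halfKernel, hz, this]
    · have : ¬ 0 ≤ z / h := not_le.2 (div_neg_of_neg_of_pos (not_le.1 hz) hh)
      simp only [sideKernel, halfKernel, hz, if_false, Set.indicator, Set.mem_Ici, this, mul_zero]
  · by_cases hz : z < 0
    · have : z / h < 0 := div_neg_of_neg_of_pos hz hh
      simp [sideKernel, halfKernel, hz, this]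
    · have : ¬ z / h < 0 := not_lt.2 (div_nonneg (not_lt.1 hz) hh.le)
      simp only [sideKernel, halfKernel, hz, if_false, Set.indicator, Set.mem_Iio, this, mul_zero]

theorem halfKernel_eq_zero {u : ℝ} (h0 : u ≠ 0) (hu : u ∉ s.halfLine) : halfKernel k s u = 0 := by
  cases s
  · refine Set.indicator_of_notMem (fun h => hu ?_) _
    exact lt_of_le_of_ne h h0.symm
  · exact Set.indicator_of_notMem hu _

theorem halfKernel_mul_halfKernel (u : ℝ) :
    halfKernel k .right u * halfKernel k .left u = 0 := by
  rcases lt_or_ge u 0 with h | h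
  · simp [halfKernel, Set.indicator, not_le.2 h]
  · simp [halfKernel, Set.indicator, not_lt.2 h]

theorem halfKernel_left_neg (hk : IsKernel k) {u : ℝ} (hu : u ≠ 0) :
    halfKernel k .left (-u) = halfKernel k .right u := by
  rcases lt_or_gt_of_ne hu with h | h
  · simp [halfKernel, Set.indicator, not_le.2 h, h.le]
  · simp [halfKernel, Set.indicator, h.le, h, hk.symmetric]

theorem IsKernel.localKernel_halfKernel (hk : IsKernel k) (s : Side) :
    LocalKernel (halfKernel k s) := by
  obtain ⟨M, hM⟩ := hk.continuous.bounded_above_of_compact_support hk.compact_support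
  obtain ⟨R, hR⟩ := hk.compact_support.isCompact.isBounded.subset_closedBall 0
  have h0 : ∀ u, R < |u| → k u = 0 := fun u hu => by
    by_contra hcon
    have := hR (subset_tsupport k hcon)
    rw [mem_closedBall_zero_iff, Real.norm_eq_abs] at this
    exact absurd this (not_le.2 hu)
  have hM0 : 0 ≤ M := (norm_nonneg _).trans (hM 0)
  have hind : ∀ S : Set ℝ, MeasurableSet S → LocalKernel (S.indicator k) := fun S hS =>
    ⟨hk.continuous.measurable.indicator hS, M, R, fun u => by
      by_cases hu : u ∈ S
      · simpa [hu] using hM u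
      · simpa [hu] using hM0, fun u hu => by simp [Set.indicator, h0 u hu]⟩
  cases s
  · exact hind _ measurableSet_Ici
  · exact hind _ measurableSet_Iio

theorem IsKernel.localKernel_mul (hk : IsKernel k) (s : Side) {l : ℝ → ℝ} (hl : Continuous l) :
    LocalKernel (fun u => halfKernel k s u * l u) := by
  refine (hk.localKernel_halfKernel s).mul_bdd hl.measurable fun R => ?_
  obtain ⟨M, hM⟩ := (isCompact_Icc (a := -R) (b := R)).exists_bound_of_continuousOn hl.continuousOn
  exact ⟨M, fun u hu => hM u (abs_le.1 hu)⟩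

theorem integral_halfKernel_mul (hk : IsKernel k) (s : Side) (l : ℝ → ℝ) :
    ∫ u, halfKernel k s u * l u = ∫ u in Set.Ioi (0 : ℝ), k u * l (s.sgn * u) := by
  cases s
  · have : (fun u => halfKernel k .right u * l u) = (Set.Ici 0).indicator (fun u => k u * l u) := by
      ext u
      simp only [halfKernel, Set.indicator]
      split_ifs <;> simp
    rw [this, integral_indicator measurableSet_Ici, integral_Ici_eq_integral_Ioi]
    simp [Side.sgn]
  · have : (fun u => halfKernel k .left u * l u) = (Set.Iio 0).indicator (fun u => k u * l u) := by
      ext u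
      simp only [halfKernel, Set.indicator]
      split_ifs <;> simp
    rw [this, integral_indicator measurableSet_Iio, ← integral_Iic_eq_integral_Iio]
    have h1 := integral_comp_neg_Ioi 0 (fun u => k u * l u)
    simp only [hk.symmetric, neg_zero] at h1
    simp [Side.sgn, h1]

theorem kernelMoments_apply (hk : IsKernel k) (s : Side) (a b : Fin (1 + 1)) :
    kernelMoments 1 k s a b = ∫ u, halfKernel k s u * (u ^ (a : ℕ) * u ^ (b : ℕ)) := by
  rw [integral_halfKernel_mul hk s fun u => u ^ (a : ℕ) * u ^ (b : ℕ)]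
  exact setIntegral_congr_fun measurableSet_Ioi fun u _ => by ring

theorem integral_comp_div_scaled {h : ℝ} (hh : 0 < h) (κ : ℝ → ℝ) :
    ∫ z, h⁻¹ * κ (z / h) = ∫ u, κ u := by
  rw [integral_const_mul, Measure.integral_comp_div, abs_of_pos hh, smul_eq_mul,
    inv_mul_cancel_left₀ hh.ne']

end Kernel

/-! ### Limits of localized expectations and of localized sample means. -/

section Limits

variable {Ω 𝓦 : Type*} [MeasurableSpace Ω] [Fintype 𝓦] [DecidableEq 𝓦] [Nonempty 𝓦]
  [MeasurableSpace 𝓦] [DiscreteMeasurableSpace 𝓦]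
  {P : Measure Ω} [IsProbabilityMeasure P] {D : Data Ω 𝓦}
  {k f : ℝ → ℝ} {ε : ℝ} {μ : Regressand → 𝓦 → ℝ → ℝ} {h : ℕ → ℝ}

/-- The support radius scales with `h`; the denominator `|R| + 1` keeps the threshold positive
whatever the sign of `R`. -/
theorem LocalKernel.exists_windowFun {κ : ℝ → ℝ}
    (hκ : LocalKernel κ) {δ : ℝ} (hδ : 0 < δ) :
    ∃ h₀ > 0, ∀ h, 0 < h → h < h₀ → WindowFun δ (fun a : ℝ × 𝓦 => h⁻¹ * κ (a.1 / h)) := by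
  obtain ⟨hm, M, R, hM, hR⟩ := hκ
  refine ⟨δ / (|R| + 1), by positivity, fun h hh hlt => ?_⟩
  refine WindowFun.of_side (G := fun z => h⁻¹ * κ (z / h)) (M := h⁻¹ * M)
    (measurable_const.mul (hm.comp (by fun_prop))) (fun z => ?_) (fun z hz => ?_)
  · rw [abs_mul, abs_of_pos (inv_pos.2 hh)]
    exact mul_le_mul_of_nonneg_left (hM _) (inv_pos.2 hh).le
  · rw [hR, mul_zero]
    have hz' : δ ≤ |z| := by
      by_contra hcon
      exact hz (abs_lt.1 (not_le.1 hcon))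
    rw [abs_div, abs_of_pos hh, lt_div_iff₀ hh]
    rw [lt_div_iff₀ (by positivity)] at hlt
    nlinarith [le_abs_self R]

theorem Regular.integral_Z (hreg : Regular P D k f ε μ) (hD : IsIID P D) {G : ℝ → ℝ}
    (hG : Measurable G) (h0 : ∀ z ∉ Set.Ioo (-ε) ε, G z = 0) :
    ∫ ω, G (D.Z 0 ω) ∂P = ∫ z, f z * G z := by
  rw [← integral_map (hD.1 0).2.2.1.aemeasurable hG.aestronglyMeasurable, hreg.density,
    integral_withDensity_eq_integral_toReal_smul hreg.density_measurable.ennreal_ofReal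
      (ae_of_all _ fun _ => ENNReal.ofReal_lt_top)]
  refine integral_congr_ae (ae_of_all _ fun z => ?_)
  obtain ⟨a, A, ha, hA⟩ := hreg.density_bounds
  by_cases hz : z ∈ Set.Ioo (-ε) ε
  · simp [ENNReal.toReal_ofReal (ha.le.trans (hA z hz).1)]
  · simp [h0 z hz]

theorem Regular.tendsto_density (hreg : Regular P D k f ε μ) : Tendsto f (𝓝 0) (𝓝 (f 0)) :=
  (hreg.density_continuous.continuousAt
    (Ioo_mem_nhds (by linarith [hreg.window_pos]) hreg.window_pos)).tendsto

/-- An approximate identity on one side of the cutoff. The function `m` will be a version of a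
conditional probability, so closeness to `L` is required only for almost every `z` in a one-sided
window. -/
theorem Regular.tendsto_integral_local (hreg : Regular P D k f ε μ) (hD : IsIID P D)
    (hh : Tendsto h atTop (𝓝 0)) (hpos : ∀ᶠ n in atTop, 0 < h n) {s : Side} {κ : ℝ → ℝ}
    (hκ : LocalKernel κ) (hs : ∀ u ≠ 0, u ∉ s.halfLine → κ u = 0) {m : ℝ → ℝ} (hm : Measurable m)
    {L : ℝ} (hL : ∀ e > 0, ∃ δ > 0, ∀ᵐ z, z ∈ s.window δ → |m z - L| ≤ e) :
    Tendsto (fun n => ∫ ω, (h n)⁻¹ * κ (D.Z 0 ω / h n) * m (D.Z 0 ω) ∂P) atTop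
      (𝓝 (f 0 * L * ∫ u, κ u)) := by
  obtain ⟨a, A, ha, hA⟩ := hreg.density_bounds
  have hε := hreg.window_pos
  have hA0 : 0 ≤ A := ha.le.trans ((hA 0 ⟨by linarith, hε⟩).1.trans (hA 0 ⟨by linarith, hε⟩).2)
  -- The product with the density inherits the essential one-sided limit, `f` being bounded and
  -- continuous at the cutoff.
  have hfm : ∀ e > 0, ∃ δ > 0, ∀ᵐ z, z ∈ s.window δ → |f z * m z - f 0 * L| ≤ e := by
    intro e he
    set e1 := e / (A + |L| + 1) with he1
    have he1p : 0 < e1 := by positivity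
    obtain ⟨δ, hδ, hz⟩ := hL e1 he1p
    obtain ⟨δ', hδ', hz'⟩ := Metric.tendsto_nhds_nhds.1 hreg.tendsto_density e1 he1p
    refine ⟨min δ (min δ' ε), by positivity, hz.mono fun z h1 hzw => ?_⟩
    have h2 := h1 (s.window_subset (min_le_left _ _) hzw)
    have hab : |z| < min δ (min δ' ε) := (s.mem_window.1 hzw).2
    have h3 : |f z - f 0| < e1 := by
      have := hz' (x := z) (by
        simpa [Real.dist_eq] using hab.trans_le ((min_le_right _ _).trans (min_le_left _ _)))
      simpa [Real.dist_eq] using this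
    have h4 := hA z (abs_lt.1 (hab.trans_le ((min_le_right _ _).trans (min_le_right _ _))))
    calc |f z * m z - f 0 * L| = |f z * (m z - L) + (f z - f 0) * L| := by ring_nf
      _ ≤ |f z| * |m z - L| + |f z - f 0| * |L| := by
        rw [← abs_mul, ← abs_mul]; exact abs_add_le _ _
      _ ≤ A * e1 + e1 * |L| := by
        rw [abs_of_nonneg (ha.le.trans h4.1)]
        exact add_le_add (mul_le_mul h4.2 h2 (abs_nonneg _) hA0)
          (mul_le_mul_of_nonneg_right h3.le (abs_nonneg _))
      _ ≤ (A + |L| + 1) * e1 := by nlinarith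
      _ = e := by rw [he1]; field_simp
  rw [Metric.tendsto_nhds]
  intro e he
  set I := ∫ u, |κ u| with hI
  have hI0 : 0 ≤ I := integral_nonneg fun _ => abs_nonneg _
  obtain ⟨δ, hδ, hz⟩ := hfm (e / (2 * (I + 1))) (by positivity)
  set δ₁ := min δ ε with hδ₁
  obtain ⟨h₀, hh₀, hW⟩ := hκ.exists_windowFun (𝓦 := Unit) (δ := δ₁) (by positivity)
  filter_upwards [hpos, hh.eventually (gt_mem_nhds hh₀)] with n hn hn'
  obtain ⟨hGm, ⟨M, hGM⟩, hG0⟩ := hW (h n) hn hn'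
  set G : ℝ → ℝ := fun z => (h n)⁻¹ * κ (z / h n) with hG
  have hGmeas : Measurable G := measurable_const.mul (hκ.1.comp (by fun_prop))
  have hGz : ∀ z ∉ Set.Ioo (-δ₁) δ₁, G z = 0 := fun z hz => hG0 (z, ()) hz
  have hGi : Integrable G := (hκ.integrable.comp_div hn.ne').const_mul _
  have hGabs : ∀ z, |G z| = (h n)⁻¹ * |κ (z / h n)| := fun z => by
    rw [hG, abs_mul, abs_of_pos (inv_pos.2 hn)]
  have hne : ∀ᵐ z : ℝ, z ≠ 0 := Measure.ae_ne volume 0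
  have hbd : ∀ᵐ z, ‖G z * (f z * m z - f 0 * L)‖ ≤ e / (2 * (I + 1)) * |G z| := by
    filter_upwards [hz, hne] with z h1 h2
    rw [Real.norm_eq_abs, abs_mul, mul_comm]
    by_cases hG' : G z = 0
    · simp [hG']
    · refine mul_le_mul_of_nonneg_right (h1 ?_) (abs_nonneg _)
      have h3 : z ∈ Set.Ioo (-δ₁) δ₁ := by
        by_contra hcon
        exact hG' (hGz z hcon)
      have h4 : z / h n ∈ s.halfLine := by
        by_contra hcon
        exact hG' (by rw [hG]; simp only; rw [hs _ (div_ne_zero h2 hn.ne') hcon, mul_zero])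
      refine s.window_subset (min_le_left δ ε) (s.mem_window.2 ⟨?_, abs_lt.2 h3⟩)
      cases s
      · exact (div_pos_iff_of_pos_right hn).1 h4
      · exact (div_neg_iff.1 h4).elim (fun h => absurd h.2 (not_lt.2 hn.le)) (fun h => h.1)
  have hi2 : Integrable fun z => G z * (f z * m z - f 0 * L) :=
    (hGi.abs.const_mul _).mono' (hGmeas.mul ((hreg.density_measurable.mul hm).sub
      measurable_const)).aestronglyMeasurable hbd
  have heq : ∫ ω, (h n)⁻¹ * κ (D.Z 0 ω / h n) * m (D.Z 0 ω) ∂P =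
      f 0 * L * (∫ u, κ u) + ∫ z, G z * (f z * m z - f 0 * L) := by
    rw [hreg.integral_Z hD (G := fun z => G z * m z) (hGmeas.mul hm) (fun z hz => by
        rw [hGz z fun h => hz ?_, zero_mul]
        exact ⟨by linarith [h.1, min_le_right δ ε], h.2.trans_le (min_le_right δ ε)⟩),
      ← integral_comp_div_scaled hn κ, ← integral_const_mul,
      ← integral_add (hGi.const_mul _) hi2]
    refine integral_congr_ae (ae_of_all _ fun z => ?_)
    simp only [hG]
    ring
  rw [heq, Real.dist_eq, add_sub_cancel_left]
  calc |∫ z, G z * (f z * m z - f 0 * L)| ≤ ∫ z, e / (2 * (I + 1)) * |G z| :=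
        norm_integral_le_of_norm_le (hGi.abs.const_mul _) hbd
    _ = e / (2 * (I + 1)) * I := by
        rw [integral_const_mul]
        congr 1
        simp only [hGabs]
        exact integral_comp_div_scaled hn fun u => |κ u|
    _ < e := by
        rw [div_mul_eq_mul_div, div_lt_iff₀ (by positivity)]
        nlinarith

/-- The law of large numbers reduces the claim to expectations. Conditioning on `Z` replaces the
function of the cell by its conditional mean, whose one-sided limit is the sum over cells. -/
theorem Regular.tendsto_sampleMean_cell (hreg : Regular P D k f ε μ) (hD : IsIID P D)
    (hh : Tendsto h atTop (𝓝 0)) (hvar : Tendsto (fun n : ℕ => (n : ℝ) * h n) atTop atTop)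
    {s : Side} {κ : ℝ → ℝ} (hκ : LocalKernel κ) (hs : ∀ u ≠ 0, u ∉ s.halfLine → κ u = 0)
    (b : 𝓦 → ℝ) :
    Tendsto (fun x : ℕ × Ω => sampleMean D (fun o => (h x.1)⁻¹ * κ (o.2.2.1 / h x.1) *
      b o.2.2.2) x.1 x.2) (wpa P) (𝓝 (f 0 * (∑ j, muSide μ s .dummies j * b j) * ∫ u, κ u)) := by
  have hpos := eventually_pos_of_mul_tendsto hvar
  have hb : Measurable b := measurable_of_countable _
  have hφ : LocMoment P D ε (fun o => b o.2.2.2) :=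
    LocMoment.of_bounded (hb.comp (by fun_prop)) (C := ∑ j, |b j|) (ae_of_all _ fun ω _ =>
      Finset.single_le_sum (f := fun j => |b j|) (fun _ _ => abs_nonneg _) (Finset.mem_univ _))
  have hF := hreg.localFamily hD hκ hreg.window_pos hφ
  obtain ⟨h₀, hh₀, hW⟩ := hκ.exists_windowFun (𝓦 := 𝓦) hreg.window_pos
  have hE : Tendsto (fun n => ∫ ω, (h n)⁻¹ * κ (D.Z 0 ω / h n) * b (D.W 0 ω) ∂P) atTop
      (𝓝 (f 0 * (∑ j, muSide μ s .dummies j * b j) * ∫ u, κ u)) := by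
    refine (hreg.tendsto_integral_local hD hh hpos hκ hs
      (m := fun z => ∑ j, meanW P D j z * b j) (Finset.measurable_fun_sum _ fun j _ =>
        (measurable_meanW j).mul_const _) (L := ∑ j, muSide μ s .dummies j * b j) ?_).congr' ?_
    · intro e he
      obtain ⟨δ, hδ, -, hz⟩ := hreg.meanW_near_volume hD (e := e / (∑ j, |b j| + 1))
        (div_pos he (add_pos_of_nonneg_of_pos (Finset.sum_nonneg fun _ _ => abs_nonneg _) one_pos))
      refine ⟨δ, hδ, hz.mono fun z h1 hzw => ?_⟩
      rw [← Finset.sum_sub_distrib]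
      have hS : 0 ≤ ∑ j, |b j| := Finset.sum_nonneg fun _ _ => abs_nonneg _
      calc |∑ j, (meanW P D j z * b j - muSide μ s .dummies j * b j)|
          ≤ ∑ j, e / (∑ j, |b j| + 1) * |b j| := by
            refine (Finset.abs_sum_le_sum_abs _ _).trans (Finset.sum_le_sum fun j _ => ?_)
            rw [← sub_mul, abs_mul]
            exact mul_le_mul_of_nonneg_right (h1 s j hzw) (abs_nonneg _)
        _ = e * ((∑ j, |b j|) / (∑ j, |b j| + 1)) := by
            rw [← Finset.mul_sum]; ring
        _ ≤ e := mul_le_of_le_one_right he.le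
            (div_le_one_of_le₀ (by linarith) (by linarith))
    · filter_upwards [hpos, hh.eventually (gt_mem_nhds hh₀)] with n hn hn'
      have hw := hW (h n) hn hn'
      rw [hD.integral_ZW (F := fun a => (h n)⁻¹ * κ (a.1 / h n) * b a.2)
        (hw.1.mul (hb.comp measurable_snd)) (hw.integrable_mul_one hφ hD)]
      refine integral_congr_ae (ae_of_all _ fun ω => ?_)
      simp only [Finset.mul_sum]
      exact Finset.sum_congr rfl fun j _ => by ring
  have := (hF.lln hD hh hvar).add (hE.comp tendsto_fst_wpa)
  simp only [zero_add, Function.comp_def] at this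
  refine this.congr fun x => ?_
  simp only [Data.obs]
  ring

end Limits

/-! ### Convergence of the design matrices, for cells merged into groups. -/

section DesignLimit

variable {Ω 𝓦 : Type*} [MeasurableSpace Ω] [Fintype 𝓦] [DecidableEq 𝓦] [Nonempty 𝓦]
  [MeasurableSpace 𝓦] [DiscreteMeasurableSpace 𝓦]
  {P : Measure Ω} [IsProbabilityMeasure P] {D : Data Ω 𝓦}
  {k f : ℝ → ℝ} {ε : ℝ} {μ : Regressand → 𝓦 → ℝ → ℝ} {h : ℕ → ℝ}
  {J : Type*} [Fintype J] [DecidableEq J]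

/-- The indicator of the group `l`. -/
def groupDummy (l j : J) : ℝ := if j = l then 1 else 0

theorem polyRow_apply (p : ℕ) (h z : ℝ) (w : J) (a : Fin (p + 1) × J) :
    polyRow p h z w a = (z / h) ^ (a.1 : ℕ) * groupDummy a.2 w := rfl

theorem groupDummy_mul (l l' j : J) :
    groupDummy l j * groupDummy l' j = if l = l' then groupDummy l j else 0 := by
  unfold groupDummy
  split_ifs with h1 h2 h3 h4 <;> simp_all

/-- The one-sided limits of the probabilities of the groups of cells given by `lab`. -/
noncomputable def labProb (μ : Regressand → 𝓦 → ℝ → ℝ) (s : Side) (lab : 𝓦 → J) (l : J) : ℝ :=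
  ∑ j, muSide μ s .dummies j * groupDummy l (lab j)

/-- Conditional probabilities sum to one at every `z`, and some `z` near the cutoff has all of them
close to their limits. -/
theorem Regular.sum_muSide_dummies (hreg : Regular P D k f ε μ) (hD : IsIID P D) (s : Side) :
    ∑ j, muSide μ s .dummies j = 1 := by
  refine eq_of_forall_dist_le fun e he => ?_
  obtain ⟨δ, h0, hle, h⟩ := hreg.meanW_near_volume hD (e := e / Fintype.card 𝓦) (by positivity)
  have hpos : volume (s.window δ) ≠ 0 := by
    cases s <;> simp [Side.window, h0]
  obtain ⟨z, hz, hzw⟩ : ∃ z, (∀ (s : Side) (j : 𝓦), z ∈ s.window δ →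
      |meanW P D j z - muSide μ s .dummies j| ≤ e / Fintype.card 𝓦) ∧ z ∈ s.window δ := by
    by_contra hcon
    push Not at hcon
    exact hpos (measure_mono_null (fun z hz hz' => hcon z hz' hz) (ae_iff.1 h))
  rw [dist_comm, Real.dist_eq, ← sum_meanW (P := P) (D := D) z, ← Finset.sum_sub_distrib]
  refine (Finset.abs_sum_le_sum_abs _ _).trans ((Finset.sum_le_sum fun j _ => hz s j hzw).trans ?_)
  rw [Finset.sum_const, Finset.card_univ, nsmul_eq_mul, mul_div_cancel₀]
  exact_mod_cast Fintype.card_ne_zero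

theorem labProb_id (s : Side) (j : 𝓦) : labProb μ s (id : 𝓦 → 𝓦) j = muSide μ s .dummies j := by
  simp [labProb, groupDummy]

theorem Regular.labProb_unit (hreg : Regular P D k f ε μ) (hD : IsIID P D) (s : Side) (l : Unit) :
    labProb μ s (fun _ : 𝓦 => ()) l = 1 := by
  simp [labProb, groupDummy, hreg.sum_muSide_dummies hD]

/-- With `lab` the identity this is the saturated design of the regressions of `Y` and `X`; with
`lab` constant it is the one-group design of the dummy regressions. -/
theorem Regular.tendsto_gammaHat (hreg : Regular P D k f ε μ) (hD : IsIID P D) (hk : IsKernel k)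
    (hh : Tendsto h atTop (𝓝 0)) (hvar : Tendsto (fun n : ℕ => (n : ℝ) * h n) atTop atTop)
    (s : Side) (lab : 𝓦 → J) :
    Tendsto (fun x : ℕ × Ω => gammaHat 1 k (h x.1) s x.1 (fun i => D.Z i x.2)
      (fun i => lab (D.W i x.2))) (wpa P) (𝓝 (gammaLim k s (f 0) (labProb μ s lab))) := by
  refine tendsto_pi_nhds.2 fun a => tendsto_pi_nhds.2 fun b => ?_
  have hκ : LocalKernel (fun u => halfKernel k s u * (u ^ (a.1 : ℕ) * u ^ (b.1 : ℕ))) :=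
    hk.localKernel_mul s (by fun_prop)
  have h1 := hreg.tendsto_sampleMean_cell hD hh hvar (s := s) hκ
    (fun u h0 hu => by rw [halfKernel_eq_zero h0 hu, zero_mul])
    (fun w => groupDummy a.2 (lab w) * groupDummy b.2 (lab w))
  rw [← kernelMoments_apply hk] at h1
  have hlim : f 0 * (∑ j, muSide μ s .dummies j *
      (groupDummy a.2 (lab j) * groupDummy b.2 (lab j))) *
      kernelMoments 1 k s a.1 b.1 = gammaLim k s (f 0) (labProb μ s lab) a b := by
    rw [gammaLim, Matrix.smul_apply, Matrix.kroneckerMap_apply, Matrix.diagonal_apply, smul_eq_mul]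
    simp only [groupDummy_mul]
    split_ifs
    · rw [labProb]
      ring
    · simp
  rw [hlim] at h1
  refine h1.congr' ?_
  filter_upwards [tendsto_fst_wpa.eventually (eventually_pos_of_mul_tendsto hvar)] with x hx
  rw [gammaHat_apply, sampleMean]
  congr 1
  refine Finset.sum_congr rfl fun i _ => ?_
  rw [sideKernel_eq hx]
  simp only [Data.obs, polyRow_apply]
  ring

theorem tendsto_matrix_inv {α ι : Type*} [Fintype ι] [DecidableEq ι] {l : Filter α}
    {A : α → Matrix ι ι ℝ} {L : Matrix ι ι ℝ} (hA : Tendsto A l (𝓝 L)) (hL : IsUnit L.det) :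
    Tendsto (fun x => (A x)⁻¹) l (𝓝 L⁻¹) ∧ ∀ᶠ x in l, IsUnit (A x).det := by
  have hdet : Tendsto (fun x => (A x).det) l (𝓝 L.det) :=
    ((continuous_id.matrix_det).tendsto L).comp hA
  have hadj : Tendsto (fun x => (A x).adjugate) l (𝓝 L.adjugate) :=
    ((continuous_id.matrix_adjugate).tendsto L).comp hA
  constructor
  · simp only [Matrix.inv_def, Ring.inverse_eq_inv']
    exact (hdet.inv₀ hL.ne_zero).smul hadj
  · exact (hdet.eventually_ne hL.ne_zero).mono fun x hx => isUnit_iff_ne_zero.2 hx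

end DesignLimit

/-! ### Entrywise formulas for intercepts, bias factors and sandwich matrices. -/

section Algebra

variable {J : Type*} [Fintype J] [DecidableEq J] {p q : ℕ} {k : ℝ → ℝ} {h : ℝ} {s : Side} {n : ℕ}
  {z : ℕ → ℝ} {w : ℕ → J}

theorem interceptMap_apply (v : ℕ → ℝ) (l : J) : interceptMap p k h s n z w v l =
    ∑ b, (gammaHat p k h s n z w)⁻¹ (0, l) b * score p k h s n z w v b := by
  rw [interceptMap, selIntercept_mulVec]
  rfl

theorem interceptMap_add (v v' : ℕ → ℝ) (l : J) :
    interceptMap p k h s n z w (fun i => v i + v' i) l =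
      interceptMap p k h s n z w v l + interceptMap p k h s n z w v' l := by
  rw [interceptMap, score_add, Matrix.mulVec_add, Matrix.mulVec_add]
  rfl

theorem selIntercept_mul_apply {ι : Type*} (A : Matrix (Fin (p + 1) × J) ι ℝ) (l : J) (i : ι) :
    (selIntercept p J * A) l i = A (0, l) i :=
  congrFun (selIntercept_mulVec fun a => A a i) l

theorem mul_selIntercept_transpose_apply {ι : Type*} (A : Matrix ι (Fin (p + 1) × J) ℝ) (i : ι)
    (l : J) : (A * (selIntercept p J)ᵀ) i l = A i (0, l) := by
  simp [Matrix.mul_apply, selIntercept]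

theorem biasFactor_apply (l l' : J) : biasFactor p q k h s n z w l l' =
    ∑ b, (gammaHat p k h s n z w)⁻¹ (0, l) b * thetaHat p q k h s n z w b l' := by
  rw [biasFactor, Matrix.mul_assoc, selIntercept_mul_apply, Matrix.mul_apply]

theorem sandwich_apply (σ : ℕ → ℝ) (l l' : J) : sandwich p k h s n z w σ l l' =
    (n : ℝ)⁻¹ * ∑ a, ∑ b, (gammaHat p k h s n z w)⁻¹ (0, l) a * psiHat p k h s n z w σ a b *
      (gammaHat p k h s n z w)⁻¹ b (0, l') := by
  rw [sandwich, Matrix.smul_apply, smul_eq_mul, mul_selIntercept_transpose_apply, Matrix.mul_assoc,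
    Matrix.mul_assoc, selIntercept_mul_apply, ← Matrix.mul_assoc, Matrix.mul_apply]
  simp only [Matrix.mul_apply, Finset.sum_mul]
  rw [Finset.sum_comm]

theorem gammaLim_inv_transpose (c : ℝ) (π : J → ℝ) :
    ((gammaLim k s c π)⁻¹)ᵀ = (gammaLim k s c π)⁻¹ := by
  rw [Matrix.transpose_nonsing_inv]
  congr 1
  rw [gammaLim, Matrix.transpose_smul, ← Matrix.kroneckerMap_transpose, Matrix.diagonal_transpose]
  congr 2
  ext a b
  simp only [kernelMoments, Matrix.transpose_apply, Matrix.of_apply]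
  refine integral_congr_ae (ae_of_all _ fun u => ?_)
  ring

theorem sum_gammaLim_inv {c : ℝ} {π : J → ℝ} (hc : c ≠ 0) (hπ : ∀ j, π j ≠ 0)
    (hK : IsUnit (kernelMoments 1 k s).det) (u : ℝ) (w l : J) :
    ∑ a : Fin (1 + 1) × J, (gammaLim k s c π)⁻¹ (0, l) a * (u ^ (a.1 : ℕ) * groupDummy a.2 w) =
      equivFactor k s u * (c⁻¹ * ((π l)⁻¹ * groupDummy l w)) := by
  have := gammaLim_inv_mulVec_polyRow hc hπ hK 1 u w l
  rw [selIntercept_mulVec] at this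
  simp only [Matrix.mulVec, dotProduct, polyRow_apply, div_one] at this
  rw [this, groupDummy]
  split_ifs
  · rw [div_eq_mul_inv, mul_inv, mul_one]
  · simp

end Algebra

/-! ### Asymptotic expansion of the intercepts and of the sandwich covariances. -/

section Expansion

variable {Ω 𝓦 : Type*} [MeasurableSpace Ω] [Fintype 𝓦] [DecidableEq 𝓦] [Nonempty 𝓦]
  [MeasurableSpace 𝓦] [DiscreteMeasurableSpace 𝓦]
  {P : Measure Ω} [IsProbabilityMeasure P] {D : Data Ω 𝓦}
  {k f : ℝ → ℝ} {ε : ℝ} {μ : Regressand → 𝓦 → ℝ → ℝ} {h : ℕ → ℝ}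
  {J : Type*} [Fintype J] [DecidableEq J] {s : Side} {lab : 𝓦 → J}

theorem score_eq_sampleMean {t : ℝ} (ht : 0 < t) (φ : ℝ × ℝ × ℝ × 𝓦 → ℝ) (n : ℕ) (ω : Ω)
    (a : Fin (1 + 1) × J) :
    score 1 k t s n (fun i => D.Z i ω) (fun i => lab (D.W i ω)) (fun i => φ (D.obs i ω)) a =
      sampleMean D (fun o => t⁻¹ * (halfKernel k s (o.2.2.1 / t) * (o.2.2.1 / t) ^ (a.1 : ℕ)) *
        (groupDummy a.2 (lab o.2.2.2) * φ o)) n ω := by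
  rw [score, sampleMean]
  congr 1
  refine Finset.sum_congr rfl fun i _ => ?_
  rw [sideKernel_eq ht]
  simp only [Data.obs, polyRow_apply]
  ring

theorem thetaHat_eq_sampleMean {t : ℝ} (ht : 0 < t) (q n : ℕ) (ω : Ω)
    (a : Fin (1 + 1) × J) (l : J) :
    thetaHat 1 q k t s n (fun i => D.Z i ω) (fun i => lab (D.W i ω)) a l =
      sampleMean D (fun o => t⁻¹ *
        (halfKernel k s (o.2.2.1 / t) * ((o.2.2.1 / t) ^ (a.1 : ℕ) * (o.2.2.1 / t) ^ q)) *
        (groupDummy a.2 (lab o.2.2.2) * groupDummy l (lab o.2.2.2))) n ω := by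
  rw [thetaHat_apply, sampleMean]
  congr 1
  refine Finset.sum_congr rfl fun i _ => ?_
  rw [sideKernel_eq ht]
  simp only [Data.obs, polyRow_apply]
  rw [show (if lab (D.W i ω) = l then (1 : ℝ) else 0) = groupDummy l (lab (D.W i ω)) from rfl]
  ring

theorem psiHat_eq_sampleMean {t : ℝ} (ht : 0 < t) (σ : ℝ × 𝓦 → ℝ) (n : ℕ) (ω : Ω)
    (a b : Fin (1 + 1) × J) :
    t * psiHat 1 k t s n (fun i => D.Z i ω) (fun i => lab (D.W i ω))
      (fun i => σ (D.Z i ω, D.W i ω)) a b =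
      sampleMean D (fun o => t⁻¹ * (halfKernel k s (o.2.2.1 / t) * halfKernel k s (o.2.2.1 / t) *
        ((o.2.2.1 / t) ^ (a.1 : ℕ) * (o.2.2.1 / t) ^ (b.1 : ℕ))) *
        (groupDummy a.2 (lab o.2.2.2) * groupDummy b.2 (lab o.2.2.2) * σ o.2.2)) n ω := by
  rw [psiHat_apply, sampleMean, mul_left_comm, Finset.mul_sum]
  congr 1
  refine Finset.sum_congr rfl fun i _ => ?_
  rw [sideKernel_eq ht]
  simp only [Data.obs, polyRow_apply]
  field_simp

theorem LocMoment.groupDummy_mul {δ : ℝ} {φ : ℝ × ℝ × ℝ × 𝓦 → ℝ} (hφ : LocMoment P D δ φ) (l : J) :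
    LocMoment P D δ (fun o => groupDummy l (lab o.2.2.2) * φ o) :=
  hφ.bdd_mul ((measurable_of_countable fun w => groupDummy l (lab w)).comp
    (f := fun o : ℝ × ℝ × ℝ × 𝓦 => o.2.2.2) (by fun_prop)) (M := 1)
    (ae_of_all _ fun ω _ => by unfold groupDummy; split_ifs <;> simp)

/-- The kernel of the linear expansion of the local linear intercept estimators. -/
noncomputable def equivKernel (k : ℝ → ℝ) (s : Side) (u : ℝ) : ℝ :=
  halfKernel k s u * equivFactor k s u

theorem continuous_equivFactor : Continuous (equivFactor k s) := by
  unfold equivFactor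
  fun_prop

theorem IsKernel.localKernel_equivKernel (hk : IsKernel k) (s : Side) :
    LocalKernel (equivKernel k s) := hk.localKernel_mul s continuous_equivFactor

theorem LocalKernel.mul {κ κ' : ℝ → ℝ} (hκ : LocalKernel κ) (hκ' : LocalKernel κ') :
    LocalKernel (fun u => κ u * κ' u) := by
  obtain ⟨hm, M, R, hM, -⟩ := hκ'
  exact hκ.mul_bdd hm fun _ => ⟨M, fun u _ => hM u⟩

variable (hreg : Regular P D k f ε μ) (hD : IsIID P D) (hk : IsKernel k)
  (hh : Tendsto h atTop (𝓝 0)) (hvar : Tendsto (fun n : ℕ => (n : ℝ) * h n) atTop atTop)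

include hreg hD hk hh hvar

theorem Regular.tendsto_gammaHat_inv (hπ : ∀ l, labProb μ s lab l ≠ 0) :
    (∀ a b, Tendsto (fun x : ℕ × Ω => (gammaHat 1 k (h x.1) s x.1 (fun i => D.Z i x.2)
      (fun i => lab (D.W i x.2)))⁻¹ a b) (wpa P)
      (𝓝 ((gammaLim k s (f 0) (labProb μ s lab))⁻¹ a b))) ∧
    ∀ᶠ x : ℕ × Ω in wpa P, IsUnit (gammaHat 1 k (h x.1) s x.1 (fun i => D.Z i x.2)
      (fun i => lab (D.W i x.2))).det := by
  have := tendsto_matrix_inv (hreg.tendsto_gammaHat hD hk hh hvar s lab)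
    (gammaLim_inv hreg.density_pos.ne' hπ (hreg.isUnit_kernelMoments s)).1
  exact ⟨fun a b => tendsto_pi_nhds.1 (tendsto_pi_nhds.1 this.1 a) b, this.2⟩

theorem Regular.stochBdd_biasFactor (hπ : ∀ l, labProb μ s lab l ≠ 0) (l l' : J) :
    StochBdd P (fun x => biasFactor 1 2 k (h x.1) s x.1 (fun i => D.Z i x.2)
      (fun i => lab (D.W i x.2)) l l') := by
  simp only [biasFactor_apply]
  refine StochBdd.sum _ fun b _ => (StochBdd.of_tendsto
    ((hreg.tendsto_gammaHat_inv hD hk hh hvar hπ).1 _ b)).mul ?_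
  have hκ : LocalKernel (fun u => halfKernel k s u * (u ^ (b.1 : ℕ) * u ^ 2)) :=
    hk.localKernel_mul s (by fun_prop)
  have hF := hreg.localFamily hD hκ hreg.window_pos
    (((locMoment_one (P := P) (D := D) ε).groupDummy_mul (lab := lab) l').groupDummy_mul
      (lab := lab) b.2)
  simp only [mul_one] at hF
  exact (hF.stochBdd_mean hD hh hvar).congr
    ((tendsto_fst_wpa.eventually (eventually_pos_of_mul_tendsto hvar)).mono fun x hx =>
      thetaHat_eq_sampleMean hx 2 x.1 x.2 b l')

/-- On the kernel support `|Z| ^ 3` is `h ^ 3` times `|Z / h| ^ 3`. The score is therefore at most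
`C * h ^ 3` times a stochastically bounded mean, and `√(n * h) * h ^ 3 = √(n * h ^ 7) → 0`. -/
theorem Regular.intercept_remainder (hπ : ∀ l, labProb μ s lab l ≠ 0)
    (h7 : Tendsto (fun n : ℕ => (n : ℝ) * h n ^ 7) atTop (𝓝 0)) {r : ℝ × ℝ × ℝ × 𝓦 → ℝ}
    (hrm : Measurable r) {C δ : ℝ} (hδ : 0 < δ)
    (hr : ∀ᵐ ω ∂P, D.Z 0 ω ∈ s.window δ → |r (D.obs 0 ω)| ≤ C * |D.Z 0 ω| ^ 3) (l : J) :
    Tendsto (fun x : ℕ × Ω => √(x.1 * h x.1) * interceptMap 1 k (h x.1) s x.1 (fun i => D.Z i x.2)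
      (fun i => lab (D.W i x.2)) (fun i => r (D.obs i x.2)) l) (wpa P) (𝓝 0) := by
  have hpos := eventually_pos_of_mul_tendsto hvar
  have hscore : ∀ a : Fin (1 + 1) × J, Tendsto (fun x : ℕ × Ω => √(x.1 * h x.1) *
      score 1 k (h x.1) s x.1 (fun i => D.Z i x.2)
      (fun i => lab (D.W i x.2)) (fun i => r (D.obs i x.2)) a) (wpa P) (𝓝 0) := by
    intro a
    have hκ : LocalKernel (fun u => halfKernel k s u * (|u| ^ (a.1 : ℕ) * |u| ^ 3)) :=
      hk.localKernel_mul s (by fun_prop)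
    have hF := hreg.localFamily hD hκ hreg.window_pos (locMoment_one (P := P) (D := D) ε)
    have hB := hF.stochBdd_mean hD hh hvar
    have h0 : Tendsto (fun x : ℕ × Ω => C * √(x.1 * h x.1 ^ 7)) (wpa P) (𝓝 0) := by
      have := ((Real.continuous_sqrt.tendsto 0).comp h7).const_mul C
      simp only [Real.sqrt_zero, mul_zero] at this
      exact this.comp tendsto_fst_wpa
    refine squeeze_zero_norm' ?_ (by simpa only [abs_zero] using (hB.tendsto_zero h0).abs)
    obtain ⟨h₀, hh₀, hW⟩ := (hk.localKernel_halfKernel s).exists_windowFun (𝓦 := Unit) hδ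
    -- The point `Z = 0` must be excluded: the right half kernel may charge it, but the one-sided
    -- windows, where the cubic bound holds, are open at `0`.
    have hms : MeasurableSet {o : ℝ × ℝ × ℝ × 𝓦 | o.2.2.1 ≠ 0 ∧
        (o.2.2.1 ∈ s.window δ → |r o| ≤ C * |o.2.2.1| ^ 3)} := by
      have : {o : ℝ × ℝ × ℝ × 𝓦 | o.2.2.1 ≠ 0 ∧
          (o.2.2.1 ∈ s.window δ → |r o| ≤ C * |o.2.2.1| ^ 3)} =
          {o | o.2.2.1 = 0}ᶜ ∩ (((fun o : ℝ × ℝ × ℝ × 𝓦 => o.2.2.1) ⁻¹' s.window δ)ᶜ ∪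
            {o | |r o| ≤ C * |o.2.2.1| ^ 3}) := by
        ext o
        simp [imp_iff_not_or]
      rw [this]
      exact (measurableSet_eq_fun (by fun_prop) measurable_const).compl.inter
        (((s.measurableSet_window δ).preimage (by fun_prop)).compl.union
          (measurableSet_le hrm.abs (by fun_prop)))
    have hall := hD.ae_all_obs hms (by
      filter_upwards [hreg.ae_Z_ne_zero hD, hr] with ω h1 h2
      exact ⟨h1, h2⟩)
    refine eventually_wpa_of_ae ?_
    filter_upwards [hpos, hh.eventually (gt_mem_nhds hh₀)] with n hn hn'
    filter_upwards [hall] with ω hω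
    obtain ⟨-, -, hG0⟩ := hW (h n) hn hn'
    have hsq : √((n : ℝ) * h n ^ 7) = √(n * h n) * h n ^ 3 := by
      rw [show (n : ℝ) * h n ^ 7 = n * h n * (h n ^ 3) ^ 2 by ring, Real.sqrt_mul (by positivity),
        Real.sqrt_sq (by positivity)]
    have hsm : |score 1 k (h n) s n (fun i => D.Z i ω) (fun i => lab (D.W i ω))
        (fun i => r (D.obs i ω)) a| ≤ C * h n ^ 3 * sampleMean D (fun o => (h n)⁻¹ *
          (halfKernel k s (o.2.2.1 / h n) * (|o.2.2.1 / h n| ^ (a.1 : ℕ) * |o.2.2.1 / h n| ^ 3)) *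
          1) n ω := by
      rw [score, sampleMean, abs_mul, abs_of_nonneg (by positivity : (0 : ℝ) ≤ (n : ℝ)⁻¹),
        mul_left_comm, Finset.mul_sum]
      refine mul_le_mul_of_nonneg_left ((Finset.abs_sum_le_sum_abs _ _).trans
        (Finset.sum_le_sum fun i _ => ?_)) (by positivity)
      rw [sideKernel_eq hn, polyRow_apply]
      change _ ≤ C * h n ^ 3 * ((h n)⁻¹ * (halfKernel k s (D.Z i ω / h n) *
        (|D.Z i ω / h n| ^ (a.1 : ℕ) * |D.Z i ω / h n| ^ 3)) * 1)
      by_cases h1 : halfKernel k s (D.Z i ω / h n) = 0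
      · simp [h1]
      · have hZ0 : D.Z i ω ≠ 0 := (hω i).1
        have hside : D.Z i ω / h n ∈ s.halfLine := by
          by_contra hcon
          exact h1 (halfKernel_eq_zero (div_ne_zero hZ0 hn.ne') hcon)
        have hwin : D.Z i ω ∈ s.window δ := by
          refine s.mem_window.2 ⟨?_, abs_lt.2 ?_⟩
          · cases s
            · exact (div_pos_iff_of_pos_right hn).1 hside
            · exact (div_neg_iff.1 hside).elim (fun h => absurd h.2 (not_lt.2 hn.le)) (fun h => h.1)
          · by_contra hcon
            have := hG0 (D.Z i ω, ()) hcon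
            simp only [mul_eq_zero, inv_eq_zero, hn.ne', h1, or_self] at this
        have hri : |r (D.obs i ω)| ≤ C * |D.Z i ω| ^ 3 := (hω i).2 hwin
        have hk0 : 0 ≤ halfKernel k s (D.Z i ω / h n) := by
          cases s
          · exact Set.indicator_nonneg (fun u _ => hk.nonneg u) _
          · exact Set.indicator_nonneg (fun u _ => hk.nonneg u) _
        have hd1 : |groupDummy a.2 (lab (D.W i ω))| ≤ 1 := by
          unfold groupDummy; split_ifs <;> simp
        rw [abs_mul, abs_mul, abs_mul, abs_mul, abs_of_nonneg hk0, abs_of_pos (inv_pos.2 hn),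
          abs_pow]
        calc (h n)⁻¹ * halfKernel k s (D.Z i ω / h n) * (|D.Z i ω / h n| ^ (a.1 : ℕ) *
              |groupDummy a.2 (lab (D.W i ω))|) * |r (D.obs i ω)|
            ≤ (h n)⁻¹ * halfKernel k s (D.Z i ω / h n) * (|D.Z i ω / h n| ^ (a.1 : ℕ) * 1) *
              (C * |D.Z i ω| ^ 3) := by gcongr
          _ = _ := by
              rw [abs_div, abs_of_pos hn]
              field_simp
    rw [Real.norm_eq_abs, abs_mul, abs_of_nonneg (Real.sqrt_nonneg _), hsq]
    refine le_trans (mul_le_mul_of_nonneg_left hsm (Real.sqrt_nonneg _)) (le_of_eq_of_le ?_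
      (le_abs_self _))
    ring
  simp only [interceptMap_apply, Finset.mul_sum]
  rw [show (0 : ℝ) = ∑ b : Fin (1 + 1) × J,
    (gammaLim k s (f 0) (labProb μ s lab))⁻¹ (0, l) b * 0 by simp]
  refine tendsto_finsetSum _ fun b _ => ?_
  refine (((hreg.tendsto_gammaHat_inv hD hk hh hvar hπ).1 _ b).mul (hscore b)).congr fun x => ?_
  ring

/-- The errors are centred within groups, so the score multiplied by `√(n * h)` is stochastically
bounded. Replacing the inverse design matrix by its limit multiplies it by something tending to
zero, and with the limit in place the sum collapses to the equivalent kernel. -/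
theorem Regular.intercept_error (hπ : ∀ l, labProb μ s lab l ≠ 0) {e : ℝ × ℝ × ℝ × 𝓦 → ℝ}
    (he : LocMoment P D ε e)
    (he0 : ∀ G : ℝ → ℝ, WindowFun ε (fun a : ℝ × 𝓦 => G a.1) → ∀ l,
      ∫ ω, G (D.Z 0 ω) * (groupDummy l (lab (D.W 0 ω)) * e (D.obs 0 ω)) ∂P = 0) (l : J) :
    Tendsto (fun x : ℕ × Ω => √(x.1 * h x.1) * (interceptMap 1 k (h x.1) s x.1
      (fun i => D.Z i x.2) (fun i => lab (D.W i x.2)) (fun i => e (D.obs i x.2)) l -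
      sampleMean D (fun o => (h x.1)⁻¹ * equivKernel k s (o.2.2.1 / h x.1) *
        ((f 0)⁻¹ * ((labProb μ s lab l)⁻¹ * groupDummy l (lab o.2.2.2) * e o))) x.1 x.2))
      (wpa P) (𝓝 0) := by
  have hpos := eventually_pos_of_mul_tendsto hvar
  have hΓ := hreg.tendsto_gammaHat_inv hD hk hh hvar (s := s) hπ
  have hb : ∀ a : Fin (1 + 1) × J, StochBdd P (fun x => √(x.1 * h x.1) *
      score 1 k (h x.1) s x.1 (fun i => D.Z i x.2)
      (fun i => lab (D.W i x.2)) (fun i => e (D.obs i x.2)) a) := by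
    intro a
    have hκ : LocalKernel (fun u => halfKernel k s u * u ^ (a.1 : ℕ)) :=
      hk.localKernel_mul s (by fun_prop)
    have hF := hreg.localFamily hD hκ hreg.window_pos (he.groupDummy_mul (lab := lab) a.2)
    obtain ⟨h₀, hh₀, hW⟩ := hκ.exists_windowFun (𝓦 := 𝓦) hreg.window_pos
    refine (hF.stochBdd_scaled_mean hD hh hvar ?_).congr ?_
    · filter_upwards [hpos, hh.eventually (gt_mem_nhds hh₀)] with n hn hn'
      exact he0 (fun z => (h n)⁻¹ * (halfKernel k s (z / h n) * (z / h n) ^ (a.1 : ℕ)))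
        (hW (h n) hn hn') a.2
    · filter_upwards [tendsto_fst_wpa.eventually hpos] with x hx
      rw [score_eq_sampleMean hx]
  have hlim : Tendsto (fun x : ℕ × Ω => ∑ b : Fin (1 + 1) × J, ((gammaHat 1 k (h x.1) s x.1
      (fun i => D.Z i x.2) (fun i => lab (D.W i x.2)))⁻¹ (0, l) b -
      (gammaLim k s (f 0) (labProb μ s lab))⁻¹ (0, l) b) * (√(x.1 * h x.1) *
      score 1 k (h x.1) s x.1 (fun i => D.Z i x.2)
      (fun i => lab (D.W i x.2)) (fun i => e (D.obs i x.2)) b)) (wpa P) (𝓝 0) := by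
    rw [show (0 : ℝ) = ∑ b : Fin (1 + 1) × J, 0 by simp]
    refine tendsto_finsetSum _ fun b _ => (hb b).tendsto_zero ?_
    simpa using (hΓ.1 (0, l) b).sub_const ((gammaLim k s (f 0) (labProb μ s lab))⁻¹ (0, l) b)
  refine hlim.congr' ?_
  filter_upwards [tendsto_fst_wpa.eventually hpos] with x hx
  simp only [sub_mul, Finset.sum_sub_distrib, mul_sub]
  congr 1
  · rw [interceptMap_apply, Finset.mul_sum]
    exact Finset.sum_congr rfl fun b _ => by ring
  · have : ∀ b : Fin (1 + 1) × J, (gammaLim k s (f 0) (labProb μ s lab))⁻¹ (0, l) b *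
        (√(x.1 * h x.1) * score 1 k (h x.1) s x.1 (fun i => D.Z i x.2)
          (fun i => lab (D.W i x.2)) (fun i => e (D.obs i x.2)) b) =
        √(x.1 * h x.1) * ((x.1 : ℝ)⁻¹ * ∑ i ∈ Finset.range x.1, (h x.1)⁻¹ *
          halfKernel k s (D.Z i x.2 / h x.1) * e (D.obs i x.2) *
          ((gammaLim k s (f 0) (labProb μ s lab))⁻¹ (0, l) b *
            ((D.Z i x.2 / h x.1) ^ (b.1 : ℕ) * groupDummy b.2 (lab (D.W i x.2))))) := by
      intro b
      rw [score, mul_left_comm]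
      congr 1
      rw [mul_left_comm, Finset.mul_sum]
      congr 1
      refine Finset.sum_congr rfl fun i _ => ?_
      rw [sideKernel_eq hx, polyRow_apply]
      ring
    simp only [this]
    rw [← Finset.mul_sum, ← Finset.mul_sum, Finset.sum_comm, sampleMean]
    congr 2
    refine Finset.sum_congr rfl fun i _ => ?_
    rw [← Finset.mul_sum, sum_gammaLim_inv hreg.density_pos.ne' hπ (hreg.isUnit_kernelMoments s)]
    simp only [Data.obs, equivKernel]
    ring

/-- Linear expansion of the intercepts of a local linear regression. -/
theorem Regular.fit_expansion (hπ : ∀ l, labProb μ s lab l ≠ 0)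
    (h7 : Tendsto (fun n : ℕ => (n : ℝ) * h n ^ 7) atTop (𝓝 0)) {φ e : ℝ × ℝ × ℝ × 𝓦 → ℝ}
    (hφ : Measurable φ) (he : LocMoment P D ε e)
    (he0 : ∀ G : ℝ → ℝ, WindowFun ε (fun a : ℝ × 𝓦 => G a.1) → ∀ l,
      ∫ ω, G (D.Z 0 ω) * (groupDummy l (lab (D.W 0 ω)) * e (D.obs 0 ω)) ∂P = 0)
    {m₀ m₁ m₂ : J → ℝ} {C δ : ℝ} (hδ : 0 < δ)
    (hr : ∀ᵐ ω ∂P, D.Z 0 ω ∈ s.window δ → |φ (D.obs 0 ω) - e (D.obs 0 ω) -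
      (m₀ (lab (D.W 0 ω)) + m₁ (lab (D.W 0 ω)) * D.Z 0 ω +
        m₂ (lab (D.W 0 ω)) * D.Z 0 ω ^ 2 / 2)| ≤ C * |D.Z 0 ω| ^ 3)
    {b : ℕ → Ω → Fin (1 + 1) × J → ℝ}
    (hb : ∀ n ω, IsLocalPolyFit 1 k (h n) s n (fun i => D.Z i ω) (fun i => lab (D.W i ω))
      (fun i => φ (D.obs i ω)) (b n ω)) (l : J) :
    Tendsto (fun x : ℕ × Ω => √(x.1 * h x.1) * (b x.1 x.2 (0, l) - m₀ l -
      h x.1 ^ 2 * ((Nat.factorial 2 : ℝ)⁻¹ • (biasFactor 1 2 k (h x.1) s x.1 (fun i => D.Z i x.2)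
        (fun i => lab (D.W i x.2)) *ᵥ m₂)) l -
      sampleMean D (fun o => (h x.1)⁻¹ * equivKernel k s (o.2.2.1 / h x.1) *
        ((f 0)⁻¹ * ((labProb μ s lab l)⁻¹ * groupDummy l (lab o.2.2.2) * e o))) x.1 x.2))
      (wpa P) (𝓝 0) := by
  have hlm : ∀ m : J → ℝ, Measurable fun o : ℝ × ℝ × ℝ × 𝓦 => m (lab o.2.2.2) := fun m =>
    (measurable_of_countable fun w => m (lab w)).comp (by fun_prop)
  have hz : Measurable fun o : ℝ × ℝ × ℝ × 𝓦 => o.2.2.1 := by fun_prop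
  -- The regressand is its Taylor polynomial plus the error `e` plus this remainder, which is cubic
  -- on the window.
  have h1 := hreg.intercept_remainder hD hk hh hvar hπ h7 (r := fun o => φ o - e o -
    (m₀ (lab o.2.2.2) + m₁ (lab o.2.2.2) * o.2.2.1 + m₂ (lab o.2.2.2) * o.2.2.1 ^ 2 / 2))
    ((hφ.sub he.1).sub (((hlm m₀).add ((hlm m₁).mul hz)).add
      (((hlm m₂).mul (hz.pow_const 2)).div_const 2))) hδ hr l
  have h2 := hreg.intercept_error hD hk hh hvar hπ he he0 l
  have h3 := h1.add h2
  rw [add_zero] at h3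
  refine h3.congr' ?_
  filter_upwards [tendsto_fst_wpa.eventually (eventually_pos_of_mul_tendsto hvar),
    (hreg.tendsto_gammaHat_inv hD hk hh hvar (s := s) hπ).2] with x hx hΓ
  have hint := congrFun ((hb x.1 x.2).intercept_eq hk.nonneg hx hΓ) l
  have hq := congrFun (interceptMap_quadratic (v := fun i => φ (D.obs i x.2))
    (r := fun i => (φ (D.obs i x.2) - e (D.obs i x.2) - (m₀ (lab (D.W i x.2)) +
      m₁ (lab (D.W i x.2)) * D.Z i x.2 + m₂ (lab (D.W i x.2)) * D.Z i x.2 ^ 2 / 2)) +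
      e (D.obs i x.2)) (m₀ := m₀) (m₁ := m₁) (m₂ := m₂) hx.ne' hΓ
    (fun i _ _ => by ring)) l
  rw [Pi.add_apply, interceptMap_add] at hq
  change b x.1 x.2 (0, l) = _ at hint
  rw [hint, hq, Pi.add_apply, Pi.smul_apply, smul_eq_mul]
  simp only [Data.obs]
  ring

/-- The scaled conditional variance matrices are approximated by second moments. -/
theorem Regular.sandwich_expansion (hπ : ∀ l, labProb μ s lab l ≠ 0) {σ : ℝ × 𝓦 → ℝ}
    (hσ : LocMoment P D ε (fun o => σ o.2.2)) (l l' : J) :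
    Tendsto (fun x : ℕ × Ω => x.1 * h x.1 * sandwich 1 k (h x.1) s x.1 (fun i => D.Z i x.2)
      (fun i => lab (D.W i x.2)) (fun i => σ (D.Z i x.2, D.W i x.2)) l l' -
      ∫ ω, (h x.1)⁻¹ * equivKernel k s (D.Z 0 ω / h x.1) ^ 2 * ((f 0)⁻¹ ^ 2 *
        ((labProb μ s lab l)⁻¹ * groupDummy l (lab (D.W 0 ω)) *
        ((labProb μ s lab l')⁻¹ * groupDummy l' (lab (D.W 0 ω))) * σ (D.Z 0 ω, D.W 0 ω))) ∂P)
      (wpa P) (𝓝 0) := by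
  have hpos := eventually_pos_of_mul_tendsto hvar
  have hΓ := hreg.tendsto_gammaHat_inv hD hk hh hvar (s := s) hπ
  set A := (gammaLim k s (f 0) (labProb μ s lab))⁻¹ with hA
  have hAsymm : ∀ a b, A a b = A b a := fun a b => by
    conv_lhs => rw [hA, ← gammaLim_inv_transpose, Matrix.transpose_apply]
  -- The squared kernel weights are of order `h⁻¹ ^ 2`, so one extra factor `h` turns the entries
  -- into ordinary localized means.
  have hψ : ∀ a b : Fin (1 + 1) × J, StochBdd P (fun x => h x.1 * psiHat 1 k (h x.1) s x.1
      (fun i => D.Z i x.2) (fun i => lab (D.W i x.2))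
      (fun i => σ (D.Z i x.2, D.W i x.2)) a b) := by
    intro a b
    have hκ : LocalKernel (fun u => halfKernel k s u * halfKernel k s u *
        (u ^ (a.1 : ℕ) * u ^ (b.1 : ℕ))) := by
      have := (hk.localKernel_halfKernel s).mul (hk.localKernel_mul s
        (l := fun u => u ^ (a.1 : ℕ) * u ^ (b.1 : ℕ)) (by fun_prop))
      simpa only [mul_assoc] using this
    have hF := hreg.localFamily hD hκ hreg.window_pos
      ((hσ.groupDummy_mul (lab := lab) b.2).groupDummy_mul (lab := lab) a.2)
    simp only [← mul_assoc] at hF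
    refine (hF.stochBdd_mean hD hh hvar).congr ?_
    filter_upwards [tendsto_fst_wpa.eventually hpos] with x hx
    rw [psiHat_eq_sampleMean hx]
    simp only [← mul_assoc]
  -- Cost of replacing both inverse design matrices by their limits.
  have hlim : Tendsto (fun x : ℕ × Ω => ∑ a : Fin (1 + 1) × J, ∑ b : Fin (1 + 1) × J,
      ((gammaHat 1 k (h x.1) s x.1 (fun i => D.Z i x.2) (fun i => lab (D.W i x.2)))⁻¹ (0, l) a *
        (gammaHat 1 k (h x.1) s x.1 (fun i => D.Z i x.2) (fun i => lab (D.W i x.2)))⁻¹ b (0, l') -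
        A (0, l) a * A b (0, l')) * (h x.1 * psiHat 1 k (h x.1) s x.1
      (fun i => D.Z i x.2) (fun i => lab (D.W i x.2))
      (fun i => σ (D.Z i x.2, D.W i x.2)) a b)) (wpa P) (𝓝 0) := by
    rw [show (0 : ℝ) = ∑ a : Fin (1 + 1) × J, ∑ b : Fin (1 + 1) × J, 0 by simp]
    refine tendsto_finsetSum _ fun a _ => tendsto_finsetSum _ fun b _ => (hψ a b).tendsto_zero ?_
    simpa using ((hΓ.1 (0, l) a).mul (hΓ.1 b (0, l'))).sub_const (A (0, l) a * A b (0, l'))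
  have hF := hreg.localFamily hD ((hk.localKernel_equivKernel s).mul (hk.localKernel_equivKernel s))
    hreg.window_pos (((hσ.groupDummy_mul (lab := lab) l').groupDummy_mul (lab := lab) l).bdd_mul
      (b := fun _ => (f 0)⁻¹ ^ 2 * ((labProb μ s lab l)⁻¹ * (labProb μ s lab l')⁻¹))
      measurable_const (ae_of_all _ fun _ _ => le_rfl))
  have hl := hlim.add (hF.lln hD hh hvar)
  rw [add_zero] at hl
  refine hl.congr' ?_
  filter_upwards [tendsto_fst_wpa.eventually hpos,
    tendsto_fst_wpa.eventually (eventually_gt_atTop 0)] with x hx hx0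
  have hx0' : (x.1 : ℝ) ≠ 0 := by exact_mod_cast hx0.ne'
  rw [← add_sub_assoc]
  congr 1
  · simp only [sub_mul, Finset.sum_sub_distrib]
    rw [sandwich_apply, mul_comm (x.1 : ℝ), mul_assoc, mul_inv_cancel_left₀ hx0', Finset.mul_sum,
      sub_add]
    -- With the limiting inverse on both sides the double sum factorizes, observation by
    -- observation, into the square of the equivalent kernel.
    have h1 : ∑ a : Fin (1 + 1) × J, ∑ b : Fin (1 + 1) × J, A (0, l) a * A b (0, l') *
        (h x.1 * psiHat 1 k (h x.1) s x.1
      (fun i => D.Z i x.2) (fun i => lab (D.W i x.2))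
      (fun i => σ (D.Z i x.2, D.W i x.2)) a b) = sampleMean D (fun o => (h x.1)⁻¹ *
        (equivKernel k s (o.2.2.1 / h x.1) * equivKernel k s (o.2.2.1 / h x.1)) *
        ((f 0)⁻¹ ^ 2 * ((labProb μ s lab l)⁻¹ * (labProb μ s lab l')⁻¹) *
          (groupDummy l (lab o.2.2.2) * (groupDummy l' (lab o.2.2.2) * σ o.2.2)))) x.1 x.2 := by
      simp only [psiHat_eq_sampleMean hx, sampleMean, Finset.mul_sum]
      simp only [Finset.sum_comm (t := Finset.range x.1)]
      refine Finset.sum_congr rfl fun i _ => ?_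
      have e1 := sum_gammaLim_inv (k := k) (s := s) hreg.density_pos.ne' hπ
        (hreg.isUnit_kernelMoments s) (D.Z i x.2 / h x.1) (lab (D.W i x.2)) l
      have e2 := sum_gammaLim_inv (k := k) (s := s) hreg.density_pos.ne' hπ
        (hreg.isUnit_kernelMoments s) (D.Z i x.2 / h x.1) (lab (D.W i x.2)) l'
      rw [← hA] at e1 e2
      have e3 : ∑ a : Fin (1 + 1) × J, ∑ b : Fin (1 + 1) × J,
          (A (0, l) a * ((D.Z i x.2 / h x.1) ^ (a.1 : ℕ) * groupDummy a.2 (lab (D.W i x.2)))) *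
          (A (0, l') b * ((D.Z i x.2 / h x.1) ^ (b.1 : ℕ) * groupDummy b.2 (lab (D.W i x.2)))) =
          (equivFactor k s (D.Z i x.2 / h x.1) *
            ((f 0)⁻¹ * ((labProb μ s lab l)⁻¹ * groupDummy l (lab (D.W i x.2))))) *
          (equivFactor k s (D.Z i x.2 / h x.1) *
            ((f 0)⁻¹ * ((labProb μ s lab l')⁻¹ * groupDummy l' (lab (D.W i x.2))))) := by
        rw [← Finset.sum_mul_sum, e1, e2]
      have e4 := congrArg (fun t => (x.1 : ℝ)⁻¹ * ((h x.1)⁻¹ *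
        (halfKernel k s (D.Z i x.2 / h x.1) * halfKernel k s (D.Z i x.2 / h x.1)) *
        σ (D.Z i x.2, D.W i x.2) * t)) e3
      simp only [Finset.mul_sum] at e4
      refine Eq.trans ?_ (e4.trans ?_)
      · refine Finset.sum_congr rfl fun a _ => Finset.sum_congr rfl fun b _ => ?_
        rw [hAsymm b (0, l')]
        simp only [Data.obs]
        ring
      · simp only [Data.obs, equivKernel]
        ring
    rw [h1, sub_self, sub_zero]
    refine Finset.sum_congr rfl fun a _ => ?_
    rw [Finset.mul_sum]
    exact Finset.sum_congr rfl fun b _ => by ring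
  · refine integral_congr_ae (ae_of_all _ fun ω => ?_)
    simp only [Data.obs]
    ring

end Expansion

/-! ### The expansions specialized to the three regressands. -/

section Estimator

variable {Ω 𝓦 : Type*} [MeasurableSpace Ω] [Fintype 𝓦] [DecidableEq 𝓦] [Nonempty 𝓦]
  [MeasurableSpace 𝓦] [DiscreteMeasurableSpace 𝓦]
  {P : Measure Ω} [IsProbabilityMeasure P] {D : Data Ω 𝓦}
  {k f : ℝ → ℝ} {ε : ℝ} {μ : Regressand → 𝓦 → ℝ → ℝ} {h : ℕ → ℝ}

theorem Regular.labProb_id_ne_zero (hreg : Regular P D k f ε μ) (hk : IsKernel k) (s : Side)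
    (l : 𝓦) : labProb μ s (fun w : 𝓦 => w) l ≠ 0 :=
  (labProb_id (μ := μ) s l).trans_ne (hreg.muSide_dummies_pos hk s l).ne'

theorem Regular.labProb_unit_ne_zero (hreg : Regular P D k f ε μ) (hD : IsIID P D) (s : Side)
    (l : Unit) : labProb μ s (fun _ : 𝓦 => ()) l ≠ 0 := by
  rw [hreg.labProb_unit hD]
  exact one_ne_zero

theorem cellInv_eq (p : 𝓦 → ℝ) (j w : 𝓦) : cellInv p j w = (p j)⁻¹ * groupDummy j w := by
  unfold cellInv groupDummy
  split_ifs <;> simp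

theorem WindowFun.groupDummy {δ : ℝ} {B : ℝ × 𝓦 → ℝ} (hB : WindowFun δ B) (l : 𝓦) :
    WindowFun δ (fun a => B a * groupDummy l a.2) :=
  hB.mul ((measurable_of_countable fun w => WLATE.groupDummy l w).comp measurable_snd) (M := 1)
    fun a => by unfold WLATE.groupDummy; split_ifs <;> simp

variable (hreg : Regular P D k f ε μ) (hD : IsIID P D) (hk : IsKernel k)
  (hh : Tendsto h atTop (𝓝 0)) (hvar : Tendsto (fun n : ℕ => (n : ℝ) * h n) atTop atTop)

include hreg hD hk hh hvar

theorem Regular.coord_expansion (h7 : Tendsto (fun n : ℕ => (n : ℝ) * h n ^ 7) atTop (𝓝 0))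
    (s : Side) (U : Regressand) (hU : U ≠ .dummies) {b : ℕ → Ω → Fin (1 + 1) × 𝓦 → ℝ}
    (hb : ∀ n ω, IsLocalPolyFit 1 k (h n) s n (fun i => D.Z i ω) (fun i => D.W i ω)
      (fun i => U.coord (D.Y i ω, D.X i ω)) (b n ω)) (j : 𝓦) :
    Tendsto (fun x : ℕ × Ω => √(x.1 * h x.1) * (b x.1 x.2 (0, j) - muSide μ s U j -
      h x.1 ^ 2 * ((Nat.factorial 2 : ℝ)⁻¹ • (biasFactor 1 2 k (h x.1) s x.1 (fun i => D.Z i x.2)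
        (fun i => D.W i x.2) *ᵥ sideDeriv μ s U 2)) j -
      sampleMean D (fun o => (h x.1)⁻¹ * equivKernel k s (o.2.2.1 / h x.1) *
        ((f 0)⁻¹ * unitErr P D (muSide μ s .dummies) U j o)) x.1 x.2)) (wpa P) (𝓝 0) := by
  obtain ⟨C, δ, -, hδ, hr⟩ := hreg.taylor_meanYX U hU
  have he0 : ∀ G : ℝ → ℝ, WindowFun ε (fun a : ℝ × 𝓦 => G a.1) → ∀ l,
      ∫ ω, G (D.Z 0 ω) * (groupDummy l (D.W 0 ω) * errYX P D U (D.obs 0 ω)) ∂P = 0 := by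
    intro G hG l
    have := hreg.integral_errYX hD (hG.groupDummy l) U
    simp only [mul_assoc] at this
    exact this
  have := hreg.fit_expansion hD hk hh hvar (s := s) (lab := fun w : 𝓦 => w)
    (hreg.labProb_id_ne_zero hk s) h7 (φ := fun o => U.coord (o.1, o.2.1)) (e := errYX P D U)
    (U.measurable_coord.comp (by fun_prop)) (hreg.locMoment_errYX hD U) he0
    (m₀ := sideDeriv μ s U 0) (m₁ := sideDeriv μ s U 1) (m₂ := sideDeriv μ s U 2) hδ
    (hr.mono fun ω hω hz => by simpa [errYX, Data.obs] using hω s hz) hb j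
  have hl : labProb μ s (fun w : 𝓦 => w) j = muSide μ s .dummies j := labProb_id s j
  simp only [hl] at this
  simpa only [unitErr, hU, if_false, cellInv_eq, muSide, mul_assoc] using this

/-- The expansion for the constant label map: one group, of limiting probability one, and an error
centred given `Z` alone. -/
theorem Regular.dummies_expansion (h7 : Tendsto (fun n : ℕ => (n : ℝ) * h n ^ 7) atTop (𝓝 0))
    (hs : SmoothSides ε μ .dummies) (s : Side) (j : 𝓦) {b : ℕ → Ω → Fin (1 + 1) × Unit → ℝ}
    (hb : ∀ n ω, IsLocalPolyFit 1 k (h n) s n (fun i => D.Z i ω) (fun _ => ())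
      (fun i => if D.W i ω = j then 1 else 0) (b n ω)) :
    Tendsto (fun x : ℕ × Ω => √(x.1 * h x.1) * (b x.1 x.2 (0, ()) - muSide μ s .dummies j -
      h x.1 ^ 2 * (biasFactor 1 2 k (h x.1) s x.1 (fun i => D.Z i x.2) (fun _ => ()) () () /
        (Nat.factorial 2 : ℝ) * sideDeriv μ s .dummies 2 j) -
      sampleMean D (fun o => (h x.1)⁻¹ * equivKernel k s (o.2.2.1 / h x.1) *
        ((f 0)⁻¹ * unitErr P D (muSide μ s .dummies) .dummies j o)) x.1 x.2)) (wpa P) (𝓝 0) := by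
  obtain ⟨C, δ, -, hδ, hr⟩ := hreg.taylor_meanW hs
  have he0 : ∀ G : ℝ → ℝ, WindowFun ε (fun a : ℝ × 𝓦 => G a.1) → ∀ l : Unit,
      ∫ ω, G (D.Z 0 ω) * (groupDummy l () * errW P D j (D.obs 0 ω)) ∂P = 0 := by
    intro G hG l
    have := integral_errW hD hG j
    simpa [groupDummy] using this
  have := hreg.fit_expansion hD hk hh hvar (s := s) (lab := fun _ : 𝓦 => ())
    (hreg.labProb_unit_ne_zero hD s) h7 (φ := fun o => if o.2.2.2 = j then 1 else 0)
    (e := errW P D j)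
    ((measurable_of_countable fun w : 𝓦 => if w = j then (1 : ℝ) else 0).comp
      (f := fun o : ℝ × ℝ × ℝ × 𝓦 => o.2.2.2) (by fun_prop)) (locMoment_errW ε j) he0
    (m₀ := fun _ => sideDeriv μ s .dummies 0 j) (m₁ := fun _ => sideDeriv μ s .dummies 1 j)
    (m₂ := fun _ => sideDeriv μ s .dummies 2 j) hδ
    (hr.mono fun ω hω hz => by simpa [errW, Data.obs] using hω j s hz) hb ()
  simp only [hreg.labProb_unit hD, inv_one, one_mul] at this
  refine this.congr fun x => ?_
  have e1 : ∀ o, unitErr P D (muSide μ s .dummies) .dummies j o = errW P D j o := fun o => by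
    simp [unitErr]
  have e2 : groupDummy () () = 1 := by simp [groupDummy]
  simp only [e1, e2, one_mul]
  congr 4
  rw [Pi.smul_apply, Matrix.mulVec, dotProduct, Fintype.sum_unique, smul_eq_mul]
  change _ * (biasFactor 1 2 k (h x.1) s x.1 (fun i => D.Z i x.2) (fun _ => ()) () () * _) = _
  ring

/-- Linear expansion of the estimated one-sided limits. -/
theorem Regular.muHat_expansion (h7 : Tendsto (fun n : ℕ => (n : ℝ) * h n ^ 7) atTop (𝓝 0))
    {B : Fits Ω 𝓦 1} (hB : B.AreLocalPoly D k h) {U : Regressand} (hs : SmoothSides ε μ U)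
    (s : Side) (j : 𝓦) :
    Tendsto (fun x : ℕ × Ω => √(x.1 * h x.1) * (B.muHat s x.1 x.2 U j - muSide μ s U j -
      h x.1 ^ 2 * biasSide 1 2 k (h x.1) x.1 (fun i => D.Z i x.2) (fun i => D.W i x.2) μ s U j -
      sampleMean D (fun o => (h x.1)⁻¹ * equivKernel k s (o.2.2.1 / h x.1) *
        ((f 0)⁻¹ * unitErr P D (muSide μ s .dummies) U j o)) x.1 x.2)) (wpa P) (𝓝 0) := by
  cases U
  · exact hreg.coord_expansion hD hk hh hvar h7 s .outcome (by decide)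
      (b := B.outcome s) (hB.outcome s) j
  · exact hreg.coord_expansion hD hk hh hvar h7 s .treatment (by decide)
      (b := B.treatment s) (hB.treatment s) j
  · exact hreg.dummies_expansion hD hk hh hvar h7 hs s j (b := fun n => B.dummies s n j)
      (fun n ω => hB.dummies s n j ω)

theorem Regular.stochBdd_biasSide (s : Side) (U : Regressand) (j : 𝓦) :
    StochBdd P (fun x => biasSide 1 2 k (h x.1) x.1 (fun i => D.Z i x.2)
      (fun i => D.W i x.2) μ s U j) := by
  have hc : ∀ U, StochBdd P (fun x => ((Nat.factorial 2 : ℝ)⁻¹ • (biasFactor 1 2 k (h x.1) s x.1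
      (fun i => D.Z i x.2) (fun i => D.W i x.2) *ᵥ sideDeriv μ s U 2)) j) := by
    intro U
    refine StochBdd.const_mul (StochBdd.sum _ fun l _ => StochBdd.mul ?_ (StochBdd.const _)) _
    exact hreg.stochBdd_biasFactor hD hk hh hvar (lab := fun w : 𝓦 => w)
      (hreg.labProb_id_ne_zero hk s) j l
  cases U
  · exact hc .outcome
  · exact hc .treatment
  · refine StochBdd.mul (StochBdd.congr ((hreg.stochBdd_biasFactor hD hk hh hvar (s := s)
      (lab := fun _ : 𝓦 => ()) (hreg.labProb_unit_ne_zero hD s) () ()).const_mul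
      (Nat.factorial 2 : ℝ)⁻¹) (Eventually.of_forall fun x => div_eq_inv_mul _ _))
      (StochBdd.const _)

/-- The blocks of `Y` and `X` use the identity label map, the dummy block the constant one. In the
mixed blocks both terms are zero. -/
theorem Regular.covSide_expansion (s : Side) (U U' : Regressand) (j l : 𝓦) :
    Tendsto (fun x : ℕ × Ω => x.1 * h x.1 * covSide 1 k (h x.1) P D x.1 x.2 s U U' j l -
      ∫ ω, (h x.1)⁻¹ * equivKernel k s (D.Z 0 ω / h x.1) ^ 2 * ((f 0)⁻¹ ^ 2 *
        unitCov P D (muSide μ s .dummies) U U' j l (D.Z 0 ω, D.W 0 ω)) ∂P)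
      (wpa P) (𝓝 0) := by
  obtain ⟨C, hC⟩ := hreg.exists_bounds hD
  have hc : ∀ U U' : Regressand, U ≠ .dummies → U' ≠ .dummies →
      Tendsto (fun x : ℕ × Ω => x.1 * h x.1 * sandwich 1 k (h x.1) s x.1 (fun i => D.Z i x.2)
        (fun i => D.W i x.2) (fun i => condCov P D U U' (D.Z i x.2) (D.W i x.2)) j l -
      ∫ ω, (h x.1)⁻¹ * equivKernel k s (D.Z 0 ω / h x.1) ^ 2 * ((f 0)⁻¹ ^ 2 *
        unitCov P D (muSide μ s .dummies) U U' j l (D.Z 0 ω, D.W 0 ω)) ∂P)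
      (wpa P) (𝓝 0) := by
    intro U U' hU hU'
    have := hreg.sandwich_expansion hD hk hh hvar (s := s) (lab := fun w : 𝓦 => w)
      (hreg.labProb_id_ne_zero hk s) (σ := fun a => condCov P D U U' a.1 a.2)
      (LocMoment.of_bounded ((measurable_condCov U U').comp
        (f := fun o : ℝ × ℝ × ℝ × 𝓦 => o.2.2) (by fun_prop)) (C := C)
        (hC.mono fun ω hω hz => (hω hz U U').2.2)) j l
    have hl : ∀ j, labProb μ s (fun w : 𝓦 => w) j = muSide μ s .dummies j := labProb_id s
    simp only [hl] at this
    simpa only [unitCov, hU, hU', if_false, cellInv_eq] using this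
  have h0 : ∀ U U' : Regressand, (U = .dummies ∧ U' ≠ .dummies) ∨ (U ≠ .dummies ∧ U' = .dummies) →
      Tendsto (fun x : ℕ × Ω => x.1 * h x.1 * (0 : ℝ) -
      ∫ ω, (h x.1)⁻¹ * equivKernel k s (D.Z 0 ω / h x.1) ^ 2 * ((f 0)⁻¹ ^ 2 *
        unitCov P D (muSide μ s .dummies) U U' j l (D.Z 0 ω, D.W 0 ω)) ∂P)
      (wpa P) (𝓝 0) := by
    rintro U U' (⟨h1, h2⟩ | ⟨h1, h2⟩) <;> simpa [unitCov, h1, h2] using tendsto_const_nhds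
  cases U <;> cases U'
  · exact hc _ _ (by decide) (by decide)
  · exact hc _ _ (by decide) (by decide)
  · exact h0 _ _ (by decide)
  · exact hc _ _ (by decide) (by decide)
  · exact hc _ _ (by decide) (by decide)
  · exact h0 _ _ (by decide)
  · exact h0 _ _ (by decide)
  · exact h0 _ _ (by decide)
  · have := hreg.sandwich_expansion hD hk hh hvar (s := s) (lab := fun _ : 𝓦 => ())
      (hreg.labProb_unit_ne_zero hD s) (σ := fun a => condCovW P D j l a.1)
      (LocMoment.of_bounded ((measurable_condCovW j l).comp
        (f := fun o : ℝ × ℝ × ℝ × 𝓦 => o.2.2.1) (by fun_prop)) (C := 1)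
        (ae_of_all _ fun ω _ => abs_condCovW_le j l _)) () ()
    have e2 : groupDummy () () = 1 := by simp [groupDummy]
    simp only [hreg.labProb_unit hD, inv_one, one_mul, e2] at this
    simp only [unitCov, if_true]
    exact this

end Estimator

/-! ### Conditional variances of linear combinations. -/

section Quadratic

variable {Ω 𝓦 : Type*} [MeasurableSpace Ω] [Fintype 𝓦] [DecidableEq 𝓦] [Nonempty 𝓦]
  [MeasurableSpace 𝓦] [DiscreteMeasurableSpace 𝓦]
  {P : Measure Ω} [IsProbabilityMeasure P] {D : Data Ω 𝓦}

/-- The conditional variance of a linear combination of `Y` and `X`. -/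
noncomputable def quadYX (P : Measure Ω) [IsFiniteMeasure P] (D : Data Ω 𝓦)
    (a : Regressand → 𝓦 → ℝ) (b : ℝ × 𝓦) : ℝ :=
  ∑ U, ∑ U', a U b.2 * a U' b.2 * condCov P D U U' b.1 b.2

/-- The conditional variance of a linear combination of the cell dummies. -/
noncomputable def quadW (P : Measure Ω) [IsFiniteMeasure P] (D : Data Ω 𝓦)
    (a : 𝓦 → ℝ) (z : ℝ) : ℝ :=
  ∑ j, ∑ l, a j * a l * condCovW P D j l z

/-- It is the mean of the square of the combined centred dummies under the conditional law of `W`.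
-/
theorem quadW_nonneg (a : 𝓦 → ℝ) (z : ℝ) : 0 ≤ quadW P D a z := by
  have : quadW P D a z = ∑ w, meanW P D w z *
      (∑ j, a j * ((if w = j then (1 : ℝ) else 0) - meanW P D j z)) ^ 2 := by
    symm
    simp only [sq, Finset.sum_mul_sum]
    simp only [quadW, condCovW_eq_sum, Finset.mul_sum]
    rw [Finset.sum_comm]
    refine Finset.sum_congr rfl fun j _ => ?_
    rw [Finset.sum_comm]
    refine Finset.sum_congr rfl fun l _ => Finset.sum_congr rfl fun w _ => ?_
    ring
  rw [this]
  exact Finset.sum_nonneg fun w _ => mul_nonneg (meanW_nonneg w z) (sq_nonneg _)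

theorem quadYX_nonneg (a : Regressand → 𝓦 → ℝ) {b : ℝ × 𝓦}
    (hb : ∀ U : Regressand, MemLp U.coord 2 (lawYX P D b)) : 0 ≤ quadYX P D a b := by
  have h1 : ∀ U : Regressand, MemLp (fun q => a U b.2 * U.coord q) 2 (lawYX P D b) := fun U =>
    (hb U).const_mul _
  have h2 := covariance_fun_sum_fun_sum (μ := lawYX P D b) (fun U => h1 U) (fun U => h1 U)
  have h3 : quadYX P D a b = cov[fun q => ∑ U : Regressand, a U b.2 * U.coord q,
      fun q => ∑ U : Regressand, a U b.2 * U.coord q; lawYX P D b] := by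
    rw [h2]
    refine Finset.sum_congr rfl fun U _ => Finset.sum_congr rfl fun U' _ => ?_
    rw [covariance_const_mul_left, covariance_const_mul_right, condCov]
    ring
  rw [h3, covariance_self]
  · exact variance_nonneg _ _
  · exact (memLp_finsetSum _ fun U _ => h1 U).aestronglyMeasurable.aemeasurable

theorem condCov_dummies_left (U : Regressand) (z : ℝ) (w : 𝓦) :
    condCov P D .dummies U z w = 0 := by
  simp [condCov, covariance, Regressand.coord]

theorem condCov_dummies_right (U : Regressand) (z : ℝ) (w : 𝓦) :
    condCov P D U .dummies z w = 0 := by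
  simp [condCov, covariance, Regressand.coord]

/-- Errors of `Y` and `X` in cell `j` are present only when `W = j`, so their double sum over cells
reduces to the observed cell, while the dummy block keeps all pairs. -/
theorem sum_unitCov (p : 𝓦 → ℝ) (a : Regressand → 𝓦 → ℝ) (b : ℝ × 𝓦) :
    ∑ U, ∑ U', ∑ j, ∑ l, a U j * a U' l * unitCov P D p U U' j l b =
      (p b.2)⁻¹ ^ 2 * quadYX P D a b + quadW P D (a .dummies) b.1 := by
  have hc : ∀ U U' : Regressand, U ≠ .dummies → U' ≠ .dummies →
      ∑ j, ∑ l, a U j * a U' l * unitCov P D p U U' j l b =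
        (p b.2)⁻¹ ^ 2 * (a U b.2 * a U' b.2 * condCov P D U U' b.1 b.2) := by
    intro U U' hU hU'
    rw [Finset.sum_eq_single b.2, Finset.sum_eq_single b.2]
    · simp only [unitCov, hU, hU', if_false, cellInv, if_true]
      ring
    · intro l _ hl
      simp [unitCov, hU, hU', cellInv, hl.symm]
    · simp
    · intro j _ hj
      simp [unitCov, hU, hU', cellInv, hj.symm]
    · simp
  have h0 : ∀ U : Regressand, U ≠ .dummies → ∀ j l, unitCov P D p U .dummies j l b = 0 ∧
      unitCov P D p .dummies U j l b = 0 := fun U hU j l => by simp [unitCov, hU]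
  simp only [sum_regressand, quadYX, quadW]
  rw [hc .outcome .outcome (by decide) (by decide), hc .outcome .treatment (by decide) (by decide),
    hc .treatment .outcome (by decide) (by decide), hc .treatment .treatment (by decide) (by decide)]
  simp only [(h0 .outcome (by decide) _ _).1, (h0 .outcome (by decide) _ _).2,
    (h0 .treatment (by decide) _ _).1, (h0 .treatment (by decide) _ _).2, condCov_dummies_left,
    condCov_dummies_right]
  simp only [unitCov, if_true, mul_zero, Finset.sum_const_zero]
  ring

theorem covForm_covPop (t : ℝ) (s : Side) (a : Regressand → 𝓦 → ℝ) :
    covForm (covPop P D t s) a a =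
      ∑ j, quadYX P D a (s.sgn * t, j) + quadW P D (a .dummies) (s.sgn * t) := by
  have hd : ∀ (U U' : Regressand), a U ⬝ᵥ ((Matrix.diagonal fun j =>
      condCov P D U U' (s.sgn * t) j) *ᵥ a U') =
      ∑ j, a U j * a U' j * condCov P D U U' (s.sgn * t) j := by
    intro U U'
    simp only [dotProduct, Matrix.mulVec_diagonal]
    exact Finset.sum_congr rfl fun j _ => by ring
  have hw : a .dummies ⬝ᵥ ((Matrix.of fun j l => condCovW P D j l (s.sgn * t)) *ᵥ a .dummies) =
      quadW P D (a .dummies) (s.sgn * t) := by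
    simp only [dotProduct, Matrix.mulVec, quadW, Finset.mul_sum, Matrix.of_apply]
    exact Finset.sum_congr rfl fun j _ => Finset.sum_congr rfl fun l _ => by ring
  simp only [covForm, sum_regressand, covPop, quadYX, condCov_dummies_left, condCov_dummies_right,
    hd, hw, Matrix.zero_mulVec, dotProduct_zero, mul_zero, add_zero, Finset.sum_add_distrib,
    zero_add]

end Quadratic

/-! ### Symmetry and normalization of the equivalent kernel. -/

section EquivKernel

variable {k : ℝ → ℝ}

theorem kernelMoments_left (a b : Fin (1 + 1)) : kernelMoments 1 k .left a b =
    (-1) ^ ((a : ℕ) + (b : ℕ)) * kernelMoments 1 k .right a b := by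
  simp only [kernelMoments, Matrix.of_apply, ← integral_const_mul]
  refine integral_congr_ae (ae_of_all _ fun u => ?_)
  simp only [Side.sgn, mul_pow, one_pow, pow_add]
  ring

/-- Reflection multiplies the moment of order `m` by `(-1) ^ m`. The determinant and the `(0, 0)`
cofactor keep their signs, and the `(0, 1)` cofactor changes sign together with `u`. -/
theorem equivFactor_left_neg (u : ℝ) :
    equivFactor k .left (-u) = equivFactor k .right u := by
  have hdet : (kernelMoments 1 k .left).det = (kernelMoments 1 k .right).det := by
    rw [Matrix.det_fin_two, Matrix.det_fin_two]
    simp only [kernelMoments_left]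
    norm_num
  have e : ∀ A : Matrix (Fin 2) (Fin 2) ℝ, A.adjugate 0 0 = A 1 1 ∧ A.adjugate 0 1 = -A 0 1 :=
    fun A => by simp [Matrix.adjugate_fin_two]
  have e0 : ∀ s, (kernelMoments 1 k s).adjugate 0 0 = kernelMoments 1 k s 1 1 := fun s => (e _).1
  have e1 : ∀ s, (kernelMoments 1 k s).adjugate 0 1 = -kernelMoments 1 k s 0 1 := fun s => (e _).2
  simp only [equivFactor, Matrix.inv_def, hdet, Matrix.smul_apply, e0, e1, kernelMoments_left]
  norm_num

theorem equivKernel_left_neg (hk : IsKernel k) {u : ℝ} (hu : u ≠ 0) :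
    equivKernel k .left (-u) = equivKernel k .right u := by
  rw [equivKernel, equivKernel, halfKernel_left_neg hk hu, equivFactor_left_neg]

theorem equivKernel_eq_zero {s : Side} {u : ℝ} (h0 : u ≠ 0) (hu : u ∉ s.halfLine) :
    equivKernel k s u = 0 := by
  rw [equivKernel, halfKernel_eq_zero h0 hu, zero_mul]

theorem equivKernel_right_mul_left (u : ℝ) :
    equivKernel k .right u * equivKernel k .left u = 0 := by
  rw [equivKernel, equivKernel, mul_mul_mul_comm, halfKernel_mul_halfKernel, zero_mul]

/-- Local linear fits reproduce constants: this is the `(0, 0)` entry of the inverse moment matrix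
times the moment matrix. -/
theorem integral_equivKernel (hk : IsKernel k) {s : Side}
    (hK : IsUnit (kernelMoments 1 k s).det) : ∫ u, equivKernel k s u = 1 := by
  have h1 := congrFun (congrFun (Matrix.nonsing_inv_mul _ hK) 0) 0
  rw [Matrix.mul_apply, Fin.sum_univ_succ] at h1
  simp only [kernelMoments_apply hk] at h1
  have hi : ∀ m : ℕ, Integrable (fun u => halfKernel k s u * u ^ m) := fun m =>
    (hk.localKernel_mul s (by fun_prop)).integrable
  have h2 : ∀ u, equivKernel k s u = (kernelMoments 1 k s)⁻¹ 0 0 * (halfKernel k s u * u ^ 0) +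
      (kernelMoments 1 k s)⁻¹ 0 1 * (halfKernel k s u * u ^ 1) := fun u => by
    rw [equivKernel, equivFactor]
    ring
  simp only [h2]
  rw [integral_add ((hi 0).const_mul _) ((hi 1).const_mul _), integral_const_mul,
    integral_const_mul]
  simpa using! h1

/-- Were it zero, the kernel would vanish almost everywhere, against its integral being one. -/
theorem integral_equivKernel_sq_pos (hk : IsKernel k) {s : Side}
    (hK : IsUnit (kernelMoments 1 k s).det) : 0 < ∫ u, equivKernel k s u ^ 2 := by
  have hi : Integrable fun u => equivKernel k s u ^ 2 := by
    simpa only [sq] using ((hk.localKernel_equivKernel s).mul (hk.localKernel_equivKernel s)).integrable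
  refine lt_of_le_of_ne (integral_nonneg fun u => sq_nonneg _) fun h0 => ?_
  have h1 := (integral_eq_zero_iff_of_nonneg (fun u => sq_nonneg (equivKernel k s u)) hi).1 h0.symm
  have h2 : ∫ u, equivKernel k s u = 0 :=
    integral_eq_zero_of_ae (h1.mono fun u hu => by simpa using hu)
  rw [integral_equivKernel hk hK] at h2
  exact one_ne_zero h2

end EquivKernel

/-! ### The summand of the linear expansion and its second moment. -/

section LinErr

variable {Ω 𝓦 : Type*} [MeasurableSpace Ω] [Fintype 𝓦] [DecidableEq 𝓦] [Nonempty 𝓦]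
  [MeasurableSpace 𝓦] [DiscreteMeasurableSpace 𝓦]
  {P : Measure Ω} [IsProbabilityMeasure P] {D : Data Ω 𝓦}
  {k f : ℝ → ℝ} {ε : ℝ} {μ : Regressand → 𝓦 → ℝ → ℝ} {h : ℕ → ℝ}

/-- The summand of the linear expansion of the estimator with coefficients `a`. -/
noncomputable def linErr (P : Measure Ω) [IsFiniteMeasure P] (D : Data Ω 𝓦) (k f : ℝ → ℝ)
    (μ : Regressand → 𝓦 → ℝ → ℝ) (a : Side → Regressand → 𝓦 → ℝ) (t : ℝ)
    (o : ℝ × ℝ × ℝ × 𝓦) : ℝ :=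
  sumSides fun s => ∑ U, ∑ j, a s U j * (t⁻¹ * equivKernel k s (o.2.2.1 / t) *
    ((f 0)⁻¹ * unitErr P D (muSide μ s .dummies) U j o))

theorem Regular.localFamily_linErr (hreg : Regular P D k f ε μ) (hD : IsIID P D)
    (hk : IsKernel k) (a : Side → Regressand → 𝓦 → ℝ) :
    LocalFamily P D (linErr P D k f μ a) := by
  have hs : ∀ s : Side, LocalFamily P D (fun t o => ∑ U, ∑ j, a s U j *
      (t⁻¹ * equivKernel k s (o.2.2.1 / t) *
        ((f 0)⁻¹ * unitErr P D (muSide μ s .dummies) U j o))) := by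
    intro s
    refine LocalFamily.sum hD _ fun U _ => LocalFamily.sum hD _ fun j _ => ?_
    have := hreg.localFamily hD (hk.localKernel_equivKernel s) hreg.window_pos
      ((hreg.locMoment_unitErr hD (muSide μ s .dummies) U j).bdd_mul
        (b := fun _ => a s U j * (f 0)⁻¹) measurable_const (ae_of_all _ fun _ _ => le_rfl))
    have he : (fun (t : ℝ) o => a s U j * (t⁻¹ * equivKernel k s (o.2.2.1 / t) *
        ((f 0)⁻¹ * unitErr P D (muSide μ s .dummies) U j o))) = fun t o =>
        t⁻¹ * equivKernel k s (o.2.2.1 / t) *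
        (a s U j * (f 0)⁻¹ * unitErr P D (muSide μ s .dummies) U j o) := by
      ext t o
      ring
    rw [he]
    exact this
  exact (hs .right).add hD (hs .left)

theorem integral_sumSides {F : Side → Ω → ℝ} (hF : ∀ s, Integrable (F s) P) :
    ∫ ω, sumSides (fun s => F s ω) ∂P = sumSides fun s => ∫ ω, F s ω ∂P :=
  integral_add (hF .right) (hF .left)

theorem integral_linErr (hreg : Regular P D k f ε μ) (hD : IsIID P D)
    (hk : IsKernel k) (hh : Tendsto h atTop (𝓝 0)) (hpos : ∀ᶠ n in atTop, 0 < h n)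
    (a : Side → Regressand → 𝓦 → ℝ) :
    ∀ᶠ n in atTop, ∫ ω, linErr P D k f μ a (h n) (D.obs 0 ω) ∂P = 0 := by
  choose h₀ hh₀ hW using fun s => (hk.localKernel_equivKernel s).exists_windowFun (𝓦 := 𝓦)
    hreg.window_pos
  filter_upwards [hpos, hh.eventually (gt_mem_nhds (hh₀ .right)),
    hh.eventually (gt_mem_nhds (hh₀ .left))] with n hn hr hl
  have hw : ∀ s, WindowFun ε (fun a : ℝ × 𝓦 => (h n)⁻¹ * equivKernel k s (a.1 / h n)) := by
    intro s
    cases s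
    · exact hW _ _ hn hr
    · exact hW _ _ hn hl
  have hm : ∀ s U j, Integrable (fun ω => a s U j * ((h n)⁻¹ * equivKernel k s (D.Z 0 ω / h n) *
      ((f 0)⁻¹ * unitErr P D (muSide μ s .dummies) U j (D.obs 0 ω)))) P := by
    intro s U j
    exact ((hw s).integrable_mul_one ((hreg.locMoment_unitErr hD (muSide μ s .dummies) U j).bdd_mul
        (b := fun _ => (f 0)⁻¹) measurable_const (ae_of_all _ fun _ _ => le_rfl)) hD).const_mul _
  have h0 : ∀ s U j, ∫ ω, a s U j * ((h n)⁻¹ * equivKernel k s (D.Z 0 ω / h n) *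
      ((f 0)⁻¹ * unitErr P D (muSide μ s .dummies) U j (D.obs 0 ω))) ∂P = 0 := by
    intro s U j
    have := hreg.integral_unitErr hD (G := fun z => (h n)⁻¹ * equivKernel k s (z / h n)) (hw s) (muSide μ s .dummies) U j
    simp only [mul_left_comm _ (f 0)⁻¹]
    rw [integral_const_mul, integral_const_mul, this, mul_zero, mul_zero]
  refine (integral_sumSides fun s => integrable_finsetSum _ fun U _ =>
    integrable_finsetSum _ fun j _ => hm s U j).trans ?_
  have h1 : ∀ s, ∫ ω, ∑ U, ∑ j, a s U j * ((h n)⁻¹ * equivKernel k s (D.Z 0 ω / h n) *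
      ((f 0)⁻¹ * unitErr P D (muSide μ s .dummies) U j (D.obs 0 ω))) ∂P = 0 := by
    intro s
    rw [integral_finsetSum _ fun U _ => integrable_finsetSum _ fun j _ => hm s U j]
    refine Finset.sum_eq_zero fun U _ => ?_
    rw [integral_finsetSum _ fun j _ => hm s U j]
    exact Finset.sum_eq_zero fun j _ => h0 s U j
  change (∫ ω, _ ∂P) + (∫ ω, _ ∂P) = 0
  rw [h1, h1, add_zero]

/-- The square has no cross term between the sides because the two equivalent kernels have disjoint
supports; the factor `t` leaves a single `t⁻¹` in front of the squared kernel. -/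
theorem mul_linErr_sq (a : Side → Regressand → 𝓦 → ℝ) {t : ℝ} (ht : t ≠ 0)
    (o : ℝ × ℝ × ℝ × 𝓦) :
    t * linErr P D k f μ a t o ^ 2 = sumSides fun s => ∑ U, ∑ U', ∑ j, ∑ l,
      a s U j * a s U' l * (f 0)⁻¹ ^ 2 * (t⁻¹ * equivKernel k s (o.2.2.1 / t) ^ 2 *
        (unitErr P D (muSide μ s .dummies) U j o * unitErr P D (muSide μ s .dummies) U' l o)) := by
  set E : Side → ℝ := fun s => ∑ U, ∑ j, a s U j * unitErr P D (muSide μ s .dummies) U j o with hE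
  have h1 : ∀ s, (∑ U, ∑ j, a s U j * (t⁻¹ * equivKernel k s (o.2.2.1 / t) *
      ((f 0)⁻¹ * unitErr P D (muSide μ s .dummies) U j o))) =
      t⁻¹ * equivKernel k s (o.2.2.1 / t) * (f 0)⁻¹ * E s := by
    intro s
    simp only [hE, Finset.mul_sum]
    exact Finset.sum_congr rfl fun U _ => Finset.sum_congr rfl fun j _ => by ring
  have h2 : ∀ s, (∑ U, ∑ U', ∑ j, ∑ l,
      a s U j * a s U' l * (f 0)⁻¹ ^ 2 * (t⁻¹ * equivKernel k s (o.2.2.1 / t) ^ 2 *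
        (unitErr P D (muSide μ s .dummies) U j o * unitErr P D (muSide μ s .dummies) U' l o))) =
      (f 0)⁻¹ ^ 2 * (t⁻¹ * equivKernel k s (o.2.2.1 / t) ^ 2) * (E s * E s) := by
    intro s
    simp only [hE]
    rw [Finset.sum_mul_sum]
    simp only [Finset.sum_mul_sum]
    simp only [Finset.mul_sum]
    exact Finset.sum_congr rfl fun U _ => Finset.sum_congr rfl fun U' _ =>
      Finset.sum_congr rfl fun j _ => Finset.sum_congr rfl fun l _ => by ring
  have h3 := equivKernel_right_mul_left (k := k) (o.2.2.1 / t)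
  simp only [linErr, sumSides, h1, h2]
  field_simp
  linear_combination 2 * (f 0)⁻¹ ^ 2 * E .right * E .left * h3

/-- The scaled second moment of the linear expansion. -/
theorem integral_linErr_sq (hreg : Regular P D k f ε μ) (hD : IsIID P D)
    (hk : IsKernel k) (hh : Tendsto h atTop (𝓝 0)) (hpos : ∀ᶠ n in atTop, 0 < h n)
    (a : Side → Regressand → 𝓦 → ℝ) :
    ∀ᶠ n in atTop, h n * ∫ ω, linErr P D k f μ a (h n) (D.obs 0 ω) ^ 2 ∂P =
      sumSides fun s => ∑ U, ∑ U', ∑ j, ∑ l, a s U j * a s U' l *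
        ∫ ω, (h n)⁻¹ * equivKernel k s (D.Z 0 ω / h n) ^ 2 * ((f 0)⁻¹ ^ 2 *
          unitCov P D (muSide μ s .dummies) U U' j l (D.Z 0 ω, D.W 0 ω)) ∂P := by
  choose h₀ hh₀ hW using fun s => ((hk.localKernel_equivKernel s).mul
    (hk.localKernel_equivKernel s)).exists_windowFun (𝓦 := 𝓦) hreg.window_pos
  filter_upwards [hpos, hh.eventually (gt_mem_nhds (hh₀ .right)),
    hh.eventually (gt_mem_nhds (hh₀ .left))] with n hn hr hl
  have hw : ∀ s, WindowFun ε (fun a : ℝ × 𝓦 => (h n)⁻¹ * equivKernel k s (a.1 / h n) ^ 2) := by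
    intro s
    simp only [sq]
    cases s
    · exact hW _ _ hn hr
    · exact hW _ _ hn hl
  have hm : ∀ s U U' j l, Integrable (fun ω => a s U j * a s U' l * (f 0)⁻¹ ^ 2 *
      ((h n)⁻¹ * equivKernel k s (D.Z 0 ω / h n) ^ 2 *
        (unitErr P D (muSide μ s .dummies) U j (D.obs 0 ω) *
          unitErr P D (muSide μ s .dummies) U' l (D.obs 0 ω)))) P := by
    intro s U U' j l
    exact ((hw s).integrable_mul (hreg.locMoment_unitErr hD (muSide μ s .dummies) U j)
      (hreg.locMoment_unitErr hD (muSide μ s .dummies) U' l) hD).const_mul _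
  rw [← integral_const_mul]
  simp only [mul_linErr_sq a hn.ne']
  refine (integral_sumSides fun s => integrable_finsetSum _ fun U _ =>
    integrable_finsetSum _ fun U' _ => integrable_finsetSum _ fun j _ =>
    integrable_finsetSum _ fun l _ => hm s U U' j l).trans ?_
  congr 1
  ext s
  rw [integral_finsetSum _ fun U _ => integrable_finsetSum _ fun U' _ =>
    integrable_finsetSum _ fun j _ => integrable_finsetSum _ fun l _ => hm s U U' j l]
  refine Finset.sum_congr rfl fun U _ => ?_
  rw [integral_finsetSum _ fun U' _ => integrable_finsetSum _ fun j _ =>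
    integrable_finsetSum _ fun l _ => hm s U U' j l]
  refine Finset.sum_congr rfl fun U' _ => ?_
  rw [integral_finsetSum _ fun j _ => integrable_finsetSum _ fun l _ => hm s U U' j l]
  refine Finset.sum_congr rfl fun j _ => ?_
  rw [integral_finsetSum _ fun l _ => hm s U U' j l]
  refine Finset.sum_congr rfl fun l _ => ?_
  have := hreg.integral_unitErr_mul hD
    (G := fun z => (h n)⁻¹ * equivKernel k s (z / h n) ^ 2) (hw s) (muSide μ s .dummies) U U' j l
  simp only [mul_left_comm _ ((f 0)⁻¹ ^ 2)]
  rw [integral_const_mul, integral_const_mul]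
  change a s U j * a s U' l * (f 0)⁻¹ ^ 2 * ∫ ω, (h n)⁻¹ * equivKernel k s (D.Z 0 ω / h n) ^ 2 *
    (unitErr P D (muSide μ s .dummies) U j (D.obs 0 ω) *
      unitErr P D (muSide μ s .dummies) U' l (D.obs 0 ω)) ∂P = _
  rw [this]
  ring

end LinErr

/-! ### Nondegeneracy as a lower bound for the second moment. -/

section LowerBound

variable {Ω 𝓦 : Type*} [MeasurableSpace Ω] [Fintype 𝓦] [DecidableEq 𝓦] [Nonempty 𝓦]
  [MeasurableSpace 𝓦] [DiscreteMeasurableSpace 𝓦]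
  {P : Measure Ω} [IsProbabilityMeasure P] {D : Data Ω 𝓦}
  {k f : ℝ → ℝ} {ε : ℝ} {μ : Regressand → 𝓦 → ℝ → ℝ} {h : ℕ → ℝ}

theorem measurable_quadW (a : 𝓦 → ℝ) : Measurable (quadW P D a) :=
  Finset.measurable_fun_sum _ fun j _ => Finset.measurable_fun_sum _ fun l _ =>
    (measurable_condCovW j l).const_mul _

theorem measurable_quadYX (a : Regressand → 𝓦 → ℝ) : Measurable (quadYX P D a) :=
  Finset.measurable_fun_sum _ fun U _ => Finset.measurable_fun_sum _ fun U' _ =>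
    (((measurable_of_countable (a U)).comp measurable_snd).mul
      ((measurable_of_countable (a U')).comp measurable_snd)).mul (measurable_condCov U U')

/-- The conditional second moment of the linear combination of the errors with coefficients `a`. -/
noncomputable def quadErr (P : Measure Ω) [IsFiniteMeasure P] (D : Data Ω 𝓦) (p : 𝓦 → ℝ)
    (a : Regressand → 𝓦 → ℝ) (b : ℝ × 𝓦) : ℝ :=
  (p b.2)⁻¹ ^ 2 * quadYX P D a b + quadW P D (a .dummies) b.1

theorem measurable_quadErr (p : 𝓦 → ℝ) (a : Regressand → 𝓦 → ℝ) :
    Measurable (quadErr P D p a) :=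
  ((((measurable_of_countable fun w => (p w)⁻¹).comp measurable_snd).pow_const 2).mul
    (measurable_quadYX a)).add ((measurable_quadW _).comp measurable_fst)

theorem Regular.locMoment_quadErr (hreg : Regular P D k f ε μ) (hD : IsIID P D) (p : 𝓦 → ℝ)
    (a : Regressand → 𝓦 → ℝ) : LocMoment P D ε (fun o => quadErr P D p a o.2.2) := by
  simp only [quadErr, ← sum_unitCov]
  exact LocMoment.sum hD _ fun U _ => LocMoment.sum hD _ fun U' _ => LocMoment.sum hD _ fun j _ =>
    LocMoment.sum hD _ fun l _ => (hreg.locMoment_unitCov hD p U U' j l).bdd_mul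
      (b := fun _ => a U j * a U' l) measurable_const (ae_of_all _ fun _ _ => le_rfl)

theorem Regular.quadErr_nonneg (hreg : Regular P D k f ε μ) (hD : IsIID P D) (p : 𝓦 → ℝ)
    (a : Regressand → 𝓦 → ℝ) :
    ∀ᵐ ω ∂P, D.Z 0 ω ∈ Set.Ioo (-ε) ε → 0 ≤ quadErr P D p a (D.Z 0 ω, D.W 0 ω) := by
  obtain ⟨C, hC⟩ := hreg.exists_bounds hD
  exact hC.mono fun ω hω hz => add_nonneg (mul_nonneg (sq_nonneg _)
    (quadYX_nonneg a fun U => (hω hz U U).1)) (quadW_nonneg _ _)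

/-- Near the cutoff, the conditional means of `quadErr` given `Z` are bounded below. -/
theorem Regular.covForm_le (hreg : Regular P D k f ε μ) (hD : IsIID P D) (hk : IsKernel k) :
    ∃ δ : ℝ, 0 < δ ∧ δ ≤ ε ∧ ∀ᵐ z, ∀ (s : Side) (a : Regressand → 𝓦 → ℝ), z ∈ s.window δ →
      ENNReal.ofReal (2⁻¹ * covForm (covPop P D (s.sgn * z) s) a a) ≤ ∑ w,
        ENNReal.ofReal (meanW P D w z) *
          ENNReal.ofReal (quadErr P D (muSide μ s .dummies) a (z, w)) := by
  obtain ⟨C, hC⟩ := hreg.exists_lintegral_coord_le hD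
  -- Half the smallest limiting cell probability: within this distance every conditional cell
  -- probability is at least half its limit, hence positive.
  set e : ℝ := (Finset.univ : Finset (𝓦)).inf' Finset.univ_nonempty
    (fun j => min (muSide μ .right .dummies j) (muSide μ .left .dummies j)) / 2 with he
  have he0 : 0 < e := by
    refine half_pos ((Finset.lt_inf'_iff _).2 fun j _ => lt_min ?_ ?_)
    · exact hreg.muSide_dummies_pos hk _ j
    · exact hreg.muSide_dummies_pos hk _ j
  have hle : ∀ (s : Side) (j : 𝓦), 2 * e ≤ muSide μ s .dummies j := by
    intro s j
    rw [he, mul_div_cancel₀ _ two_ne_zero]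
    refine (Finset.inf'_le _ (Finset.mem_univ j)).trans ?_
    cases s
    · exact min_le_left _ _
    · exact min_le_right _ _
  obtain ⟨δ, hδ, hδε, hm⟩ := hreg.meanW_near_volume hD he0
  refine ⟨δ, hδ, hδε, ?_⟩
  have hms : MeasurableSet {b : ℝ × 𝓦 | b.1 ∈ Set.Ioo (-ε) ε → ∀ U : Regressand,
      ∫⁻ q, ‖U.coord q‖ₑ ^ 4 ∂lawYX P D b ≤ C} := by
    have : {b : ℝ × 𝓦 | b.1 ∈ Set.Ioo (-ε) ε → ∀ U : Regressand,
        ∫⁻ q, ‖U.coord q‖ₑ ^ 4 ∂lawYX P D b ≤ C} =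
        (Prod.fst ⁻¹' Set.Ioo (-ε) ε)ᶜ ∪ ⋂ U : Regressand,
          {b | ∫⁻ q, ‖U.coord q‖ₑ ^ 4 ∂lawYX P D b ≤ C} := by
      ext b
      simp [imp_iff_not_or]
    rw [this]
    refine (measurableSet_Ioo.preimage measurable_fst).compl.union
      (MeasurableSet.iInter fun U => measurableSet_le ?_ measurable_const)
    exact Measurable.lintegral_kernel (κ := lawYX P D) (U.measurable_coord.enorm.pow_const 4)
  filter_upwards [hm, hreg.ae_volume (hD.ae_cells hms hC)] with z h1 h2 s a hz
  have hzε := s.window_subset_Ioo ε (s.window_subset hδε hz)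
  have hmw : ∀ w, 2⁻¹ * muSide μ s .dummies w ≤ meanW P D w z := by
    intro w
    have := (abs_le.1 (h1 s w hz)).1
    linarith [hle s w]
  have hmpos : ∀ w, 0 < meanW P D w z := fun w =>
    lt_of_lt_of_le (mul_pos (by norm_num) (hreg.muSide_dummies_pos hk s w)) (hmw w)
  have hq : ∀ w, 0 ≤ quadYX P D a (z, w) := fun w => quadYX_nonneg a fun U =>
    (abs_integral_le_of_lintegral_fourth U.measurable_coord (h2 hzε w (hmpos w).ne' hzε U)).1
  have hqe : ∀ w, 0 ≤ quadErr P D (muSide μ s .dummies) a (z, w) := fun w =>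
    add_nonneg (mul_nonneg (sq_nonneg _) (hq w)) (quadW_nonneg _ _)
  have hsum : ∑ w, ENNReal.ofReal (meanW P D w z) *
      ENNReal.ofReal (quadErr P D (muSide μ s .dummies) a (z, w)) =
      ENNReal.ofReal (∑ w, meanW P D w z * quadErr P D (muSide μ s .dummies) a (z, w)) := by
    rw [ENNReal.ofReal_sum_of_nonneg fun w _ => mul_nonneg (hmpos w).le (hqe w)]
    exact Finset.sum_congr rfl fun w _ => (ENNReal.ofReal_mul (hmpos w).le).symm
  rw [hsum, covForm_covPop]
  refine ENNReal.ofReal_le_ofReal ?_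
  have hsz : s.sgn * (s.sgn * z) = z := by cases s <;> simp [Side.sgn]
  rw [hsz]
  have hW0 := quadW_nonneg (P := P) (D := D) (a .dummies) z
  -- The dummy part is kept whole since the cell probabilities sum to one. In the other part the
  -- weight of each cell is at least `(p / 2) / p ^ 2`, which is at least `1 / 2` because `p ≤ 1`.
  simp only [quadErr, mul_add, Finset.sum_add_distrib, ← Finset.sum_mul, sum_meanW, one_mul]
  refine add_le_add ?_ (by linarith)
  rw [Finset.mul_sum]
  refine Finset.sum_le_sum fun w _ => ?_
  rw [← mul_assoc]
  refine mul_le_mul_of_nonneg_right ?_ (hq w)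
  have hp := hreg.muSide_dummies_pos hk s w
  have hp1 := hreg.muSide_dummies_le_one hD s w
  rw [inv_pow, ← div_eq_mul_inv, le_div_iff₀ (by positivity)]
  refine le_trans ?_ (hmw w)
  rw [sq]
  exact mul_le_mul_of_nonneg_left (mul_le_of_le_one_right hp.le hp1) (by norm_num)

/-- The integrand is nonnegative almost surely, so the expectation can be written as an integral
with values in `[0, ∞]`. The lower bound is then inserted pointwise in `z`, with no integrability to
check. -/
theorem Regular.lintegral_quadErr (hreg : Regular P D k f ε μ) (hD : IsIID P D) {G : ℝ → ℝ}
    (hG : WindowFun ε (fun a : ℝ × 𝓦 => G a.1)) (hGm : Measurable G) (hG0 : ∀ z, 0 ≤ G z)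
    (p : 𝓦 → ℝ) (a : Regressand → 𝓦 → ℝ) :
    0 ≤ ∫ ω, G (D.Z 0 ω) * quadErr P D p a (D.Z 0 ω, D.W 0 ω) ∂P ∧
    ENNReal.ofReal (∫ ω, G (D.Z 0 ω) * quadErr P D p a (D.Z 0 ω, D.W 0 ω) ∂P) =
      ∫⁻ z, ENNReal.ofReal (f z) * (ENNReal.ofReal (G z) * ∑ w,
        ENNReal.ofReal (meanW P D w z) * ENNReal.ofReal (quadErr P D p a (z, w))) := by
  have hn : ∀ᵐ ω ∂P, 0 ≤ G (D.Z 0 ω) * quadErr P D p a (D.Z 0 ω, D.W 0 ω) := by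
    filter_upwards [hreg.quadErr_nonneg hD p a] with ω hω
    by_cases hz : D.Z 0 ω ∈ Set.Ioo (-ε) ε
    · exact mul_nonneg (hG0 _) (hω hz)
    · rw [show G (D.Z 0 ω) = 0 from hG.2.2 (D.Z 0 ω, D.W 0 ω) hz, zero_mul]
  refine ⟨integral_nonneg_of_ae hn, ?_⟩
  have hq := measurable_quadErr (P := P) (D := D) p a
  have hi : Integrable (fun ω => G (D.Z 0 ω) * quadErr P D p a (D.Z 0 ω, D.W 0 ω)) P :=
    hG.integrable_mul_one (hreg.locMoment_quadErr hD p a) hD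
  rw [ofReal_integral_eq_lintegral_ofReal hi hn]
  have h1 := hD.lintegral_ZW (F := fun b => ENNReal.ofReal (G b.1 * quadErr P D p a b))
    ((hG.1.mul hq).ennreal_ofReal)
  refine h1.trans ?_
  rw [hreg.lintegral_Z hD (G := fun z => ∑ w, ENNReal.ofReal (meanW P D w z) *
    ENNReal.ofReal (G z * quadErr P D p a (z, w)))]
  · refine lintegral_congr fun z => ?_
    congr 1
    rw [Finset.mul_sum]
    refine Finset.sum_congr rfl fun w _ => ?_
    rw [ENNReal.ofReal_mul (hG0 z)]
    ring
  · exact Finset.measurable_fun_sum _ fun w _ => (measurable_meanW w).ennreal_ofReal.mul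
      (hGm.mul (hq.comp (by fun_prop))).ennreal_ofReal

theorem measurable_covForm_covPop (s : Side) (a : Regressand → 𝓦 → ℝ) :
    Measurable fun z => covForm (covPop P D (s.sgn * z) s) a a := by
  simp only [covForm_covPop]
  exact (Finset.measurable_fun_sum _ fun j _ => (measurable_quadYX a).comp (by fun_prop)).add
    ((measurable_quadW _).comp (by fun_prop))

/-- The scaled second moment of the linear expansion is bounded away from zero. -/
theorem Regular.exists_le_integral_linErr_sq (hreg : Regular P D k f ε μ) (hD : IsIID P D)
    (hk : IsKernel k) (hh : Tendsto h atTop (𝓝 0)) (hpos : ∀ᶠ n in atTop, 0 < h n)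
    {a : Side → Regressand → 𝓦 → ℝ} {η ε' : ℝ} (hη : 0 < η) (hε' : 0 < ε')
    (hnd : ∀ᵐ z : ℝ, z ∈ Set.Ioo 0 ε' →
      η ≤ sumSides fun s => covForm (covPop P D z s) (a s) (a s)) :
    ∃ c > 0, ∀ᶠ n in atTop, c ≤ h n * ∫ ω, linErr P D k f μ a (h n) (D.obs 0 ω) ^ 2 ∂P := by
  obtain ⟨δ, hδ, hδε, hcov⟩ := hreg.covForm_le (P := P) hD hk
  obtain ⟨A₀, A, hA₀, hA⟩ := hreg.density_bounds
  have hf0 := hreg.density_pos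
  set I := ∫ u, equivKernel k .right u ^ 2 with hI
  have hIpos : 0 < I := integral_equivKernel_sq_pos hk (hreg.isUnit_kernelMoments .right)
  -- The lower bound of the density, the squared factor `(f 0)⁻¹` of the summand, and the one half
  -- of `Regular.covForm_le`.
  set c₀ := A₀ * (f 0)⁻¹ ^ 2 * 2⁻¹ with hc₀
  have hc₀pos : 0 < c₀ := by positivity
  refine ⟨c₀ * η * I, by positivity, ?_⟩
  choose h₀ hh₀ hW using fun s => ((hk.localKernel_equivKernel s).mul
    (hk.localKernel_equivKernel s)).exists_windowFun (𝓦 := 𝓦) (lt_min hδ hε')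
  filter_upwards [integral_linErr_sq hreg hD hk hh hpos a, hpos,
    hh.eventually (gt_mem_nhds (hh₀ .right)), hh.eventually (gt_mem_nhds (hh₀ .left))]
    with n hsq hn hr hl
  set G : Side → ℝ → ℝ := fun s z => (h n)⁻¹ * equivKernel k s (z / h n) ^ 2 with hG
  have hGw : ∀ s, WindowFun (min δ ε') (fun a : ℝ × 𝓦 => G s a.1) := by
    intro s
    simp only [hG, sq]
    cases s
    · exact hW _ _ hn hr
    · exact hW _ _ hn hl
  have hGm : ∀ s, Measurable (G s) := fun s =>
    measurable_const.mul (((hk.localKernel_equivKernel s).1.comp (by fun_prop)).pow_const 2)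
  have hG0 : ∀ s z, 0 ≤ G s z := fun s z => by
    have := inv_pos.2 hn
    simp only [hG]
    positivity
  have hGε : ∀ s, WindowFun ε (fun a : ℝ × 𝓦 => G s a.1) := fun s =>
    ⟨(hGw s).1, (hGw s).2.1, fun a ha => (hGw s).2.2 a fun h => ha
      ⟨by linarith [h.1, min_le_left δ ε'], by linarith [h.2, min_le_left δ ε']⟩⟩
  have hGside : ∀ s z, z ≠ 0 → G s z ≠ 0 → z ∈ s.halfLine ∧ |z| < min δ ε' := by
    intro s z hz hGz
    constructor
    · have h1 : z / h n ∈ s.halfLine := by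
        by_contra hcon
        exact hGz (by simp [hG, equivKernel_eq_zero (div_ne_zero hz hn.ne') hcon])
      cases s
      · exact (div_pos_iff_of_pos_right hn).1 h1
      · exact (div_neg_iff.1 h1).elim (fun h => absurd h.2 (not_lt.2 hn.le)) (fun h => h.1)
    · rw [abs_lt]
      by_contra hcon
      exact hGz ((hGw s).2.2 (z, Classical.arbitrary 𝓦) hcon)
  set T : Side → ℝ := fun s => ∫ ω, G s (D.Z 0 ω) *
    quadErr P D (muSide μ s .dummies) (a s) (D.Z 0 ω, D.W 0 ω) ∂P with hT
  have hval : h n * ∫ ω, linErr P D k f μ a (h n) (D.obs 0 ω) ^ 2 ∂P =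
      (f 0)⁻¹ ^ 2 * (T .right + T .left) := by
    have hTs : ∀ s, (∑ U, ∑ U', ∑ j, ∑ l, a s U j * a s U' l *
        ∫ ω, (h n)⁻¹ * equivKernel k s (D.Z 0 ω / h n) ^ 2 * ((f 0)⁻¹ ^ 2 *
          unitCov P D (muSide μ s .dummies) U U' j l (D.Z 0 ω, D.W 0 ω)) ∂P) =
        (f 0)⁻¹ ^ 2 * T s := by
      intro s
      have hm : ∀ U U' j l, Integrable (fun ω => a s U j * a s U' l * (G s (D.Z 0 ω) *
          unitCov P D (muSide μ s .dummies) U U' j l (D.Z 0 ω, D.W 0 ω))) P := fun U U' j l =>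
        ((hGε s).integrable_mul_one
          (hreg.locMoment_unitCov hD (muSide μ s .dummies) U U' j l) hD).const_mul _
      have hexp : ∀ ω, G s (D.Z 0 ω) * quadErr P D (muSide μ s .dummies) (a s) (D.Z 0 ω, D.W 0 ω) =
          ∑ U, ∑ U', ∑ j, ∑ l, a s U j * a s U' l * (G s (D.Z 0 ω) *
          unitCov P D (muSide μ s .dummies) U U' j l (D.Z 0 ω, D.W 0 ω)) := by
        intro ω
        rw [quadErr, ← sum_unitCov]
        simp only [Finset.mul_sum]
        exact Finset.sum_congr rfl fun U _ => Finset.sum_congr rfl fun U' _ =>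
          Finset.sum_congr rfl fun j _ => Finset.sum_congr rfl fun l _ => by ring
      simp only [hT, hexp]
      rw [integral_finsetSum _ fun U _ => integrable_finsetSum _ fun U' _ =>
        integrable_finsetSum _ fun j _ => integrable_finsetSum _ fun l _ => hm U U' j l,
        Finset.mul_sum]
      refine Finset.sum_congr rfl fun U _ => ?_
      rw [integral_finsetSum _ fun U' _ => integrable_finsetSum _ fun j _ =>
        integrable_finsetSum _ fun l _ => hm U U' j l, Finset.mul_sum]
      refine Finset.sum_congr rfl fun U' _ => ?_
      rw [integral_finsetSum _ fun j _ => integrable_finsetSum _ fun l _ => hm U U' j l,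
        Finset.mul_sum]
      refine Finset.sum_congr rfl fun j _ => ?_
      rw [integral_finsetSum _ fun l _ => hm U U' j l, Finset.mul_sum]
      refine Finset.sum_congr rfl fun l _ => ?_
      rw [integral_const_mul]
      simp only [mul_left_comm _ ((f 0)⁻¹ ^ 2)]
      rw [integral_const_mul]
      ring
    rw [hsq]
    simp only [hTs, sumSides]
    ring
  have hTL := fun s => hreg.lintegral_quadErr hD (hGε s) (hGm s) (hG0 s) (muSide μ s .dummies) (a s)
  set H : Side → ℝ → ENNReal := fun s z => ENNReal.ofReal A₀ * (ENNReal.ofReal (G s z) *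
    ENNReal.ofReal (2⁻¹ * covForm (covPop P D (s.sgn * z) s) (a s) (a s))) with hH
  have hHm : ∀ s, Measurable (H s) := fun s => measurable_const.mul
    ((hGm s).ennreal_ofReal.mul ((measurable_covForm_covPop s (a s)).const_mul _).ennreal_ofReal)
  have hHle : ∀ s, ∫⁻ z, H s z ≤ ENNReal.ofReal (T s) := by
    intro s
    rw [(hTL s).2]
    refine lintegral_mono_ae ?_
    filter_upwards [hcov, Measure.ae_ne volume 0] with z hz hz0
    by_cases hGz : G s z = 0
    · simp [hH, hGz]
    · obtain ⟨h1, h2⟩ := hGside s z hz0 hGz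
      have hzw : z ∈ s.window δ := s.mem_window.2 ⟨h1, h2.trans_le (min_le_left _ _)⟩
      exact mul_le_mul' (ENNReal.ofReal_le_ofReal
        (hA z (s.window_subset_Ioo ε (s.window_subset hδε hzw))).1)
        (mul_le_mul' le_rfl (hz s (a s) hzw))
  have hint : Integrable (fun z => A₀ * 2⁻¹ * η * G .right z) := by
    have := (((hk.localKernel_equivKernel .right).mul
      (hk.localKernel_equivKernel .right)).integrable.comp_div hn.ne').const_mul (h n)⁻¹
    simp only [← sq] at this
    exact this.const_mul _
  have hmain : ENNReal.ofReal (A₀ * 2⁻¹ * η * I) ≤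
      ENNReal.ofReal (T .right) + ENNReal.ofReal (T .left) := by
    -- Nondegeneracy bounds only the sum of the forms at `z` and `-z`, not each of them. The left
    -- integral is reflected onto the right, and the mirror symmetry of the equivalent kernels gives
    -- the two forms the same weight.
    have hrefl : ∫⁻ z, H .left z = ∫⁻ z, H .left (-z) :=
      ((Measure.measurePreserving_neg (volume : Measure ℝ)).lintegral_comp (hHm .left)).symm
    calc ENNReal.ofReal (A₀ * 2⁻¹ * η * I)
        = ∫⁻ z, ENNReal.ofReal (A₀ * 2⁻¹ * η * G .right z) := by
          rw [← ofReal_integral_eq_lintegral_ofReal hint (ae_of_all _ fun z =>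
            mul_nonneg (by positivity) (hG0 _ _)), integral_const_mul]
          congr 2
          exact (integral_comp_div_scaled hn fun u => equivKernel k .right u ^ 2).symm
      _ ≤ ∫⁻ z, (H .right z + H .left (-z)) := by
          refine lintegral_mono_ae ?_
          filter_upwards [hnd, Measure.ae_ne volume 0] with z hz hz0
          by_cases hGz : G .right z = 0
          · simp [hGz]
          · obtain ⟨h1, h2⟩ := hGside .right z hz0 hGz
            have hz1 := hz ⟨h1, (le_abs_self z).trans_lt (h2.trans_le (min_le_right _ _))⟩
            have hGl : G .left (-z) = G .right z := by
              simp only [hG]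
              rw [neg_div, equivKernel_left_neg hk (div_ne_zero hz0 hn.ne')]
            simp only [hH, hGl, Side.sgn, one_mul, neg_mul, neg_neg]
            rw [← mul_add, ← mul_add]
            calc ENNReal.ofReal (A₀ * 2⁻¹ * η * G .right z)
                = ENNReal.ofReal A₀ * (ENNReal.ofReal (G .right z) * ENNReal.ofReal (2⁻¹ * η)) := by
                  rw [← ENNReal.ofReal_mul (hG0 _ _), ← ENNReal.ofReal_mul hA₀.le]
                  congr 1
                  ring
              _ ≤ _ := by
                  gcongr
                  refine le_trans (ENNReal.ofReal_le_ofReal ?_) ENNReal.ofReal_add_le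
                  rw [← mul_add]
                  exact mul_le_mul_of_nonneg_left hz1 (by norm_num)
      _ = (∫⁻ z, H .right z) + ∫⁻ z, H .left z := by
          rw [lintegral_add_left (hHm .right), hrefl]
      _ ≤ _ := add_le_add (hHle .right) (hHle .left)
  rw [← ENNReal.ofReal_add (hTL .right).1 (hTL .left).1] at hmain
  have h3 := (ENNReal.ofReal_le_ofReal_iff (add_nonneg (hTL .right).1 (hTL .left).1)).1 hmain
  rw [hval, hc₀]
  calc A₀ * (f 0)⁻¹ ^ 2 * 2⁻¹ * η * I = (f 0)⁻¹ ^ 2 * (A₀ * 2⁻¹ * η * I) := by ring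
    _ ≤ _ := mul_le_mul_of_nonneg_left h3 (by positivity)

end LowerBound

/-! ### Symmetry of the sandwich matrices. -/

section Transpose

variable {J : Type*} [Fintype J] [DecidableEq J] {p : ℕ} {k : ℝ → ℝ} {h : ℝ} {s : Side} {n : ℕ}
  {z : ℕ → ℝ} {w : ℕ → J}

theorem gammaHat_transpose : (gammaHat p k h s n z w)ᵀ = gammaHat p k h s n z w := by
  ext a b
  rw [Matrix.transpose_apply, gammaHat_apply, gammaHat_apply]
  exact congrArg _ (Finset.sum_congr rfl fun i _ => by ring)

theorem psiHat_transpose (σ : ℕ → ℝ) :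
    (psiHat p k h s n z w σ)ᵀ = psiHat p k h s n z w σ := by
  ext a b
  rw [Matrix.transpose_apply, psiHat_apply, psiHat_apply]
  exact congrArg _ (Finset.sum_congr rfl fun i _ => by ring)

theorem sandwich_transpose (σ : ℕ → ℝ) :
    (sandwich p k h s n z w σ)ᵀ = sandwich p k h s n z w σ := by
  simp only [sandwich, Matrix.transpose_smul, Matrix.transpose_mul, Matrix.transpose_transpose,
    Matrix.transpose_nonsing_inv, gammaHat_transpose, psiHat_transpose, Matrix.mul_assoc]

end Transpose

/-! ### The variance formula and the linear form along the sample. -/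

section Covariances

variable {Ω 𝓦 : Type*} [MeasurableSpace Ω] [Fintype 𝓦] [DecidableEq 𝓦] [Nonempty 𝓦]
  [MeasurableSpace 𝓦] [DiscreteMeasurableSpace 𝓦]
  {P : Measure Ω} [IsProbabilityMeasure P] {D : Data Ω 𝓦}
  {k f : ℝ → ℝ} {ε : ℝ} {μ : Regressand → 𝓦 → ℝ → ℝ} {h : ℕ → ℝ}

theorem condCov_comm (U U' : Regressand) (z : ℝ) (w : 𝓦) :
    condCov P D U' U z w = condCov P D U U' z w := covariance_comm _ _

theorem condCovW_comm (j l : 𝓦) (z : ℝ) : condCovW P D l j z = condCovW P D j l z :=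
  covariance_comm _ _

theorem covSide_transpose (t : ℝ) (n : ℕ) (ω : Ω) (s : Side) (U U' : Regressand) :
    covSide 1 k t P D n ω s U' U = (covSide 1 k t P D n ω s U U')ᵀ := by
  cases U <;> cases U' <;>
    simp only [covSide, sandwich_transpose, condCov_comm .treatment .outcome,
      Matrix.transpose_zero]
  ext j l
  simp only [Matrix.transpose_apply, Matrix.of_apply, condCovW_comm j l]

theorem covPop_transpose (t : ℝ) (s : Side) (U U' : Regressand) :
    covPop P D t s U' U = (covPop P D t s U U')ᵀ := by
  cases U <;> cases U' <;>
    simp only [covPop, Matrix.diagonal_transpose, condCov_comm .treatment .outcome,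
      Matrix.transpose_zero]
  ext j l
  simp only [Matrix.transpose_apply, Matrix.of_apply, condCovW_comm j l]

theorem covForm_eq_sum (C : Regressand → Regressand → Matrix 𝓦 𝓦 ℝ) (x : Regressand → 𝓦 → ℝ) :
    covForm C x x = ∑ U, ∑ U', ∑ j, ∑ l, x U j * x U' l * C U U' j l := by
  simp only [covForm, dotProduct, Matrix.mulVec, Finset.mul_sum]
  exact Finset.sum_congr rfl fun U _ => Finset.sum_congr rfl fun U' _ =>
    Finset.sum_congr rfl fun j _ => Finset.sum_congr rfl fun l _ => by ring

theorem sampleMean_linErr (a : Side → Regressand → 𝓦 → ℝ) (t : ℝ) (n : ℕ) (ω : Ω) :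
    sampleMean D (linErr P D k f μ a t) n ω = sumSides fun s => ∑ U, ∑ j, a s U j *
      sampleMean D (fun o => t⁻¹ * equivKernel k s (o.2.2.1 / t) *
        ((f 0)⁻¹ * unitErr P D (muSide μ s .dummies) U j o)) n ω := by
  have hs : ∀ s, ∑ U, ∑ j, a s U j * sampleMean D (fun o => t⁻¹ * equivKernel k s (o.2.2.1 / t) *
        ((f 0)⁻¹ * unitErr P D (muSide μ s .dummies) U j o)) n ω =
      (n : ℝ)⁻¹ * ∑ i ∈ Finset.range n, ∑ U, ∑ j, a s U j *
        (t⁻¹ * equivKernel k s ((D.obs i ω).2.2.1 / t) *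
        ((f 0)⁻¹ * unitErr P D (muSide μ s .dummies) U j (D.obs i ω))) := by
    intro s
    rw [Finset.sum_comm (s := Finset.range n), Finset.mul_sum]
    refine Finset.sum_congr rfl fun U _ => ?_
    rw [Finset.sum_comm (s := Finset.range n), Finset.mul_sum]
    refine Finset.sum_congr rfl fun j _ => ?_
    rw [sampleMean, ← Finset.mul_sum]
    ring
  simp only [sumSides, hs]
  rw [← mul_add, ← Finset.sum_add_distrib]
  rfl

theorem tendsto_sumSides {ι : Type*} {l : Filter ι} {F : Side → ι → ℝ}
    (hF : ∀ s, Tendsto (F s) l (𝓝 0)) : Tendsto (fun x => sumSides fun s => F s x) l (𝓝 0) := by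
  simpa [sumSides] using (hF .right).add (hF .left)

variable (hreg : Regular P D k f ε μ) (hD : IsIID P D) (hk : IsKernel k)
  (hh : Tendsto h atTop (𝓝 0)) (hvar : Tendsto (fun n : ℕ => (n : ℝ) * h n) atTop atTop)

include hreg hD hk hh hvar

/-- The expansion is summed over the finitely many entries of the quadratic form. The centring
sequence is deterministic but need not converge. -/
theorem Regular.covForm_expansion (a : Side → Regressand → 𝓦 → ℝ) :
    Tendsto (fun x : ℕ × Ω => x.1 * h x.1 *
        (sumSides fun s => covForm (covSide 1 k (h x.1) P D x.1 x.2 s) (a s) (a s)) -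
      h x.1 * ∫ ω, linErr P D k f μ a (h x.1) (D.obs 0 ω) ^ 2 ∂P) (wpa P) (𝓝 0) := by
  have hs : Tendsto (fun x : ℕ × Ω => sumSides fun s => ∑ U, ∑ U', ∑ j, ∑ l,
      a s U j * a s U' l * (x.1 * h x.1 * covSide 1 k (h x.1) P D x.1 x.2 s U U' j l -
      ∫ ω, (h x.1)⁻¹ * equivKernel k s (D.Z 0 ω / h x.1) ^ 2 * ((f 0)⁻¹ ^ 2 *
        unitCov P D (muSide μ s .dummies) U U' j l (D.Z 0 ω, D.W 0 ω)) ∂P)) (wpa P) (𝓝 0) := by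
    refine tendsto_sumSides fun s => ?_
    have h0 : ∀ U U' j l, Tendsto (fun x : ℕ × Ω => a s U j * a s U' l *
        (x.1 * h x.1 * covSide 1 k (h x.1) P D x.1 x.2 s U U' j l -
        ∫ ω, (h x.1)⁻¹ * equivKernel k s (D.Z 0 ω / h x.1) ^ 2 * ((f 0)⁻¹ ^ 2 *
        unitCov P D (muSide μ s .dummies) U U' j l (D.Z 0 ω, D.W 0 ω)) ∂P)) (wpa P) (𝓝 0) := by
      intro U U' j l
      simpa using (hreg.covSide_expansion hD hk hh hvar s U U' j l).const_mul (a s U j * a s U' l)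
    have := tendsto_finsetSum Finset.univ fun U (_ : U ∈ Finset.univ) =>
      tendsto_finsetSum Finset.univ fun U' (_ : U' ∈ Finset.univ) =>
      tendsto_finsetSum Finset.univ fun j (_ : j ∈ Finset.univ) =>
      tendsto_finsetSum Finset.univ fun l (_ : l ∈ Finset.univ) => h0 U U' j l
    simpa using this
  refine hs.congr' ?_
  filter_upwards [tendsto_fst_wpa.eventually (integral_linErr_sq hreg hD hk hh
    (eventually_pos_of_mul_tendsto hvar) a)] with x hx
  rw [hx]
  simp only [covForm_eq_sum, sumSides, mul_sub, Finset.sum_sub_distrib, mul_add, Finset.mul_sum,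
    mul_left_comm (_ * _) ((x.1 : ℝ) * h x.1)]
  ring

/-- Only regressands with a nonzero coefficient are expanded, so the dummies need smoothness only
when the weights depend on them. -/
theorem Regular.linear_expansion (h7 : Tendsto (fun n : ℕ => (n : ℝ) * h n ^ 7) atTop (𝓝 0))
    {B : Fits Ω 𝓦 1} (hB : B.AreLocalPoly D k h) {a : Side → Regressand → 𝓦 → ℝ}
    (ha : ∀ s U j, a s U j ≠ 0 → SmoothSides ε μ U) :
    Tendsto (fun x : ℕ × Ω => √(x.1 * h x.1) *
      ((sumSides fun s => ∑ U, a s U ⬝ᵥ (B.muHat s x.1 x.2 U - muSide μ s U)) -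
        h x.1 ^ 2 * (sumSides fun s => ∑ U, a s U ⬝ᵥ biasSide 1 2 k (h x.1) x.1
          (fun i => D.Z i x.2) (fun i => D.W i x.2) μ s U) -
        sampleMean D (linErr P D k f μ a (h x.1)) x.1 x.2)) (wpa P) (𝓝 0) := by
  have hs : Tendsto (fun x : ℕ × Ω => sumSides fun s => ∑ U, ∑ j, a s U j *
      (√(x.1 * h x.1) * (B.muHat s x.1 x.2 U j - muSide μ s U j - h x.1 ^ 2 *
        biasSide 1 2 k (h x.1) x.1 (fun i => D.Z i x.2) (fun i => D.W i x.2) μ s U j -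
        sampleMean D (fun o => (h x.1)⁻¹ * equivKernel k s (o.2.2.1 / h x.1) *
          ((f 0)⁻¹ * unitErr P D (muSide μ s .dummies) U j o)) x.1 x.2))) (wpa P) (𝓝 0) := by
    refine tendsto_sumSides fun s => ?_
    have h0 : ∀ U j, Tendsto (fun x : ℕ × Ω => a s U j *
      (√(x.1 * h x.1) * (B.muHat s x.1 x.2 U j - muSide μ s U j - h x.1 ^ 2 *
        biasSide 1 2 k (h x.1) x.1 (fun i => D.Z i x.2) (fun i => D.W i x.2) μ s U j -
        sampleMean D (fun o => (h x.1)⁻¹ * equivKernel k s (o.2.2.1 / h x.1) *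
          ((f 0)⁻¹ * unitErr P D (muSide μ s .dummies) U j o)) x.1 x.2))) (wpa P) (𝓝 0) := by
      intro U j
      by_cases hU : a s U j = 0
      · simpa [hU] using tendsto_const_nhds
      · simpa using (hreg.muHat_expansion hD hk hh hvar h7 hB (ha s U j hU) s j).const_mul (a s U j)
    have := tendsto_finsetSum Finset.univ fun U (_ : U ∈ Finset.univ) =>
      tendsto_finsetSum Finset.univ fun j (_ : j ∈ Finset.univ) => h0 U j
    simpa using this
  refine hs.congr fun x => ?_
  rw [sampleMean_linErr]
  have e : ∀ s, ∑ U, ∑ j, a s U j * (√(x.1 * h x.1) * (B.muHat s x.1 x.2 U j - muSide μ s U j -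
      h x.1 ^ 2 *
        biasSide 1 2 k (h x.1) x.1 (fun i => D.Z i x.2) (fun i => D.W i x.2) μ s U j -
        sampleMean D (fun o => (h x.1)⁻¹ * equivKernel k s (o.2.2.1 / h x.1) *
          ((f 0)⁻¹ * unitErr P D (muSide μ s .dummies) U j o)) x.1 x.2)) =
      √(x.1 * h x.1) * (∑ U, a s U ⬝ᵥ (B.muHat s x.1 x.2 U - muSide μ s U) -
        h x.1 ^ 2 * ∑ U, a s U ⬝ᵥ biasSide 1 2 k (h x.1) x.1
          (fun i => D.Z i x.2) (fun i => D.W i x.2) μ s U -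
        ∑ U, ∑ j, a s U j * sampleMean D (fun o => (h x.1)⁻¹ * equivKernel k s (o.2.2.1 / h x.1) *
          ((f 0)⁻¹ * unitErr P D (muSide μ s .dummies) U j o)) x.1 x.2) := by
    intro s
    simp only [dotProduct, Finset.mul_sum, ← Finset.sum_sub_distrib, Pi.sub_apply]
    exact Finset.sum_congr rfl fun U _ => Finset.sum_congr rfl fun j _ => by ring
  simp only [sumSides, e]
  ring

end Covariances

/-! ### Rates implied by the bandwidth conditions. -/

section Rates

variable {h : ℕ → ℝ}

/-- The quotient of `n * h ^ 7` by `n * h` is `h ^ 6`, which therefore tends to zero. -/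
theorem tendsto_bandwidth (h7 : Tendsto (fun n : ℕ => (n : ℝ) * h n ^ 7) atTop (𝓝 0))
    (hvar : Tendsto (fun n : ℕ => (n : ℝ) * h n) atTop atTop) : Tendsto h atTop (𝓝 0) := by
  have h6 : Tendsto (fun n => h n ^ 6) atTop (𝓝 0) := by
    have := h7.mul (tendsto_inv_atTop_zero.comp hvar)
    rw [zero_mul] at this
    refine this.congr' ?_
    filter_upwards [hvar.eventually_gt_atTop 0] with n hn
    have h0 : h n ≠ 0 := fun hc => by simp [hc] at hn
    have h1 : (n : ℝ) ≠ 0 := fun hc => by simp [hc] at hn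
    simp only [Function.comp_apply]
    field_simp
  rw [Metric.tendsto_nhds]
  intro e he
  filter_upwards [h6.eventually (gt_mem_nhds (pow_pos he 6))] with n hn
  rw [Real.dist_eq, sub_zero]
  refine lt_of_pow_lt_pow_left₀ 6 he.le ?_
  rwa [Even.pow_abs (by decide)]

/-- The stochastic order of the one-sided estimates. -/
noncomputable def fitRate (h : ℕ → ℝ) (n : ℕ) : ℝ := h n ^ 2 + (√(n * h n))⁻¹

variable (hh : Tendsto h atTop (𝓝 0)) (hvar : Tendsto (fun n : ℕ => (n : ℝ) * h n) atTop atTop)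

include hvar

theorem tendsto_sqrt_mul : Tendsto (fun n : ℕ => √(n * h n)) atTop atTop :=
  Real.tendsto_sqrt_atTop.comp hvar

theorem fitRate_pos : ∀ᶠ n in atTop, 0 < fitRate h n := by
  filter_upwards [(tendsto_sqrt_mul hvar).eventually_gt_atTop 0] with n hn
  unfold fitRate
  positivity

theorem sqrt_mul_mul_fitRate : ∀ᶠ n : ℕ in atTop, √(n * h n) * fitRate h n =
    √(n * h n) * h n ^ 2 + 1 := by
  filter_upwards [(tendsto_sqrt_mul hvar).eventually_gt_atTop 0] with n hn
  rw [fitRate, mul_add, mul_inv_cancel₀ hn.ne']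

include hh

theorem tendsto_fitRate : Tendsto (fitRate h) atTop (𝓝 0) := by
  have := (hh.pow 2).add (tendsto_inv_atTop_zero.comp (tendsto_sqrt_mul hvar))
  rwa [zero_pow two_ne_zero, add_zero] at this

/-- Expanding the square leaves `√(n * h) * h ^ 4`, `2 * h ^ 2` and `(√(n * h))⁻¹`. The first is
`√(n * h ^ 7 * h ^ 2)`. -/
theorem tendsto_sqrt_mul_fitRate_sq
    (h7 : Tendsto (fun n : ℕ => (n : ℝ) * h n ^ 7) atTop (𝓝 0)) :
    Tendsto (fun n : ℕ => √(n * h n) * fitRate h n ^ 2) atTop (𝓝 0) := by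
  have h4 : Tendsto (fun n : ℕ => √(n * h n) * h n ^ 4) atTop (𝓝 0) := by
    have h9 : Tendsto (fun n : ℕ => √(n * h n ^ 7 * h n ^ 2)) atTop (𝓝 0) := by
      have := (h7.mul (hh.pow 2)).sqrt
      simpa using this
    refine h9.congr' ?_
    filter_upwards [hvar.eventually_gt_atTop 0] with n hn
    rw [show (n : ℝ) * h n ^ 7 * h n ^ 2 = n * h n * (h n ^ 4) ^ 2 by ring, Real.sqrt_mul hn.le,
      Real.sqrt_sq (by positivity)]
  have := (h4.add ((hh.pow 2).const_mul 2)).add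
    (tendsto_inv_atTop_zero.comp (tendsto_sqrt_mul hvar))
  simp only [ne_eq, OfNat.ofNat_ne_zero, not_false_eq_true, zero_pow, mul_zero, add_zero] at this
  refine this.congr' ?_
  filter_upwards [(tendsto_sqrt_mul hvar).eventually_gt_atTop 0] with n hn
  simp only [fitRate, Function.comp_apply]
  field_simp
  ring

end Rates

/-! ### Calculus of stochastic orders and the delta method. -/

section Orders

variable {Ω : Type*} [MeasurableSpace Ω] {P : Measure Ω} {r ρ : ℕ → ℝ}

theorem StochBdd.norm_pi {ι E : Type*} [Fintype ι] [SeminormedAddCommGroup E] {a : ℕ → ℝ}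
    {X : ℕ × Ω → ι → E} (hX : ∀ i, StochBdd P (fun x => a x.1 * ‖X x i‖)) :
    StochBdd P (fun x => a x.1 * ‖X x‖) := by
  refine (StochBdd.sum Finset.univ fun i _ => (hX i).mono (Y := fun x => |a x.1 * ‖X x i‖|)
    (Eventually.of_forall fun x => (abs_abs _).le)).mono (Eventually.of_forall fun x => ?_)
  simp only [abs_mul, abs_norm]
  rw [← Finset.mul_sum, abs_mul, abs_abs]
  refine mul_le_mul_of_nonneg_left (le_trans ?_ (le_abs_self _)) (abs_nonneg _)
  exact (pi_norm_le_iff_of_nonneg (Finset.sum_nonneg fun i _ => norm_nonneg _)).2 fun i =>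
    Finset.single_le_sum (f := fun i => ‖X x i‖) (fun i _ => norm_nonneg _) (Finset.mem_univ i)

theorem StochBdd.norm_prod {E F : Type*} [SeminormedAddCommGroup E] [SeminormedAddCommGroup F]
    {a : ℕ → ℝ} {X : ℕ × Ω → E} {Y : ℕ × Ω → F} (hX : StochBdd P (fun x => a x.1 * ‖X x‖))
    (hY : StochBdd P (fun x => a x.1 * ‖Y x‖)) : StochBdd P (fun x => a x.1 * ‖(X x, Y x)‖) := by
  refine (hX.add hY).mono (Eventually.of_forall fun x => ?_)
  rw [← mul_add, abs_mul, abs_mul]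
  refine mul_le_mul_of_nonneg_left ?_ (abs_nonneg _)
  rw [abs_norm, abs_of_nonneg (by positivity), Prod.norm_def]
  exact max_le_add_of_nonneg (norm_nonneg _) (norm_nonneg _)

theorem StochBdd.mul_abs {a : ℕ → ℝ} {X : ℕ × Ω → ℝ} (hX : StochBdd P (fun x => a x.1 * X x)) :
    StochBdd P (fun x => a x.1 * ‖X x‖) :=
  hX.mono (Eventually.of_forall fun x => by
    rw [abs_mul, abs_norm, abs_mul, Real.norm_eq_abs])

/-- Products of two sequences of order `ρ` are negligible at rate `r` when `r ρ² → 0`. -/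
theorem tendsto_mul_of_stochBdd (hpos : ∀ᶠ n in atTop, 0 < ρ n)
    (hr : Tendsto (fun n => r n * ρ n ^ 2) atTop (𝓝 0)) {X Y : ℕ × Ω → ℝ}
    (hX : StochBdd P (fun x => (ρ x.1)⁻¹ * X x)) (hY : StochBdd P (fun x => (ρ x.1)⁻¹ * Y x)) :
    Tendsto (fun x => r x.1 * (X x * Y x)) (wpa P) (𝓝 0) := by
  refine ((hX.mul hY).tendsto_zero (hr.comp tendsto_fst_wpa)).congr' ?_
  filter_upwards [tendsto_fst_wpa.eventually hpos] with x hx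
  simp only [Function.comp_apply]
  field_simp

theorem tendsto_zero_of_stochBdd (hpos : ∀ᶠ n in atTop, 0 < ρ n) (hρ : Tendsto ρ atTop (𝓝 0))
    {X : ℕ × Ω → ℝ} (hX : StochBdd P (fun x => (ρ x.1)⁻¹ * X x)) : Tendsto X (wpa P) (𝓝 0) := by
  refine (hX.tendsto_zero (hρ.comp tendsto_fst_wpa)).congr' ?_
  filter_upwards [tendsto_fst_wpa.eventually hpos] with x hx
  simp only [Function.comp_apply]
  field_simp

/-- Linearization of a ratio. -/
theorem tendsto_ratio_remainder (hpos : ∀ᶠ n in atTop, 0 < ρ n) (hρ : Tendsto ρ atTop (𝓝 0))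
    (hr : Tendsto (fun n => r n * ρ n ^ 2) atTop (𝓝 0)) {A B : ℕ × Ω → ℝ}
    (hA : StochBdd P (fun x => (ρ x.1)⁻¹ * A x)) (hB : StochBdd P (fun x => (ρ x.1)⁻¹ * B x))
    (t : ℝ) {τ : ℝ} (hτ : τ ≠ 0) :
    Tendsto (fun x => r x.1 * ((t + A x) / (τ + B x) - t / τ - (A x / τ - t * B x / τ ^ 2)))
      (wpa P) (𝓝 0) := by
  have hB0 := tendsto_zero_of_stochBdd hpos hρ hB
  have hN : StochBdd P (fun x => (ρ x.1)⁻¹ * (τ * A x - t * B x)) :=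
    ((hA.const_mul τ).sub (hB.const_mul t)).congr (Eventually.of_forall fun x => by ring)
  have hlim : Tendsto (fun x => τ + B x) (wpa P) (𝓝 τ) := by
    simpa using tendsto_const_nhds.add hB0
  -- The remainder is exactly `-(τ * A - t * B) * B / (τ ^ 2 * (τ + B))`: a product of two terms of
  -- order `ρ` and a factor converging in probability.
  have := (tendsto_mul_of_stochBdd hpos hr hN hB).mul
    (((hlim.inv₀ hτ).const_mul (τ ^ 2)⁻¹).neg)
  rw [zero_mul] at this
  refine this.congr' ?_
  filter_upwards [hlim.eventually_ne hτ] with x hx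
  field_simp
  ring

/-- On the ball of radius `‖x - x₀‖` the Lipschitz condition keeps the derivative within `K * ‖x -
x₀‖` of its value at `x₀`; the mean value inequality supplies the second factor. -/
theorem eventually_norm_taylor_le {E F : Type*} [NormedAddCommGroup E] [NormedSpace ℝ E]
    [NormedAddCommGroup F] [NormedSpace ℝ F] {g : E → F} {x₀ : E} (hg : ContDiffAt ℝ 1 g x₀)
    {K : NNReal} {U : Set E} (hU : U ∈ 𝓝 x₀) (hK : LipschitzOnWith K (fderiv ℝ g) U) :
    ∀ᶠ x in 𝓝 x₀, ‖g x - g x₀ - fderiv ℝ g x₀ (x - x₀)‖ ≤ K * ‖x - x₀‖ ^ 2 := by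
  have hd : ∀ᶠ x in 𝓝 x₀, DifferentiableAt ℝ g x :=
    (hg.eventually (by simp)).mono fun x hx => hx.differentiableAt (by simp)
  obtain ⟨e, he, hb⟩ := Metric.mem_nhds_iff.1 (inter_mem hU hd)
  filter_upwards [Metric.ball_mem_nhds x₀ he] with x hx
  have hsub : Metric.closedBall x₀ ‖x - x₀‖ ⊆ Metric.ball x₀ e := by
    refine Metric.closedBall_subset_ball ?_
    rwa [← dist_eq_norm]
  have := (convex_closedBall x₀ ‖x - x₀‖).norm_image_sub_le_of_norm_hasFDerivWithin_le'
    (f := g) (f' := fderiv ℝ g) (φ := fderiv ℝ g x₀) (C := K * ‖x - x₀‖)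
    (fun y hy => ((hb (hsub hy)).2).hasFDerivAt.hasFDerivWithinAt) (fun y hy => ?_)
    (Metric.mem_closedBall_self (norm_nonneg _)) (y := x) (by simp [dist_eq_norm])
  · rwa [sq, ← mul_assoc]
  · have h1 := hK.dist_le_mul y (hb (hsub hy)).1 x₀ (hb (Metric.mem_ball_self he)).1
    rw [dist_eq_norm, dist_eq_norm] at h1
    refine h1.trans (mul_le_mul_of_nonneg_left ?_ K.2)
    rw [← dist_eq_norm]
    exact hy

/-- The remainder of the delta method is negligible. -/
theorem tendsto_delta_remainder {E F : Type*} [NormedAddCommGroup E] [NormedSpace ℝ E]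
    [NormedAddCommGroup F] [NormedSpace ℝ F] {g : E → F} {x₀ : E} (hg : ContDiffAt ℝ 1 g x₀)
    (hpos : ∀ᶠ n in atTop, 0 < ρ n) (hρ : Tendsto ρ atTop (𝓝 0))
    (hr : Tendsto (fun n => r n * ρ n ^ 2) atTop (𝓝 0))
    (hg' : (∃ K, ∃ U ∈ 𝓝 x₀, LipschitzOnWith K (fderiv ℝ g) U) ∨
      ∃ M : ℝ, ∀ᶠ n in atTop, |r n * ρ n| ≤ M) {X : ℕ × Ω → E}
    (hX : StochBdd P (fun x => (ρ x.1)⁻¹ * ‖X x - x₀‖)) :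
    Tendsto (fun x => r x.1 * ‖g (X x) - g x₀ - fderiv ℝ g x₀ (X x - x₀)‖) (wpa P) (𝓝 0) := by
  have hX0 : Tendsto X (wpa P) (𝓝 x₀) :=
    tendsto_iff_norm_sub_tendsto_zero.2 (tendsto_zero_of_stochBdd hpos hρ hX)
  rcases hg' with ⟨K, U, hU, hK⟩ | ⟨M, hM⟩
  -- Lipschitz derivative: the remainder is quadratic and `r * ρ ^ 2 → 0`.
  · have h1 := ((tendsto_mul_of_stochBdd hpos hr hX hX).abs).const_mul (K : ℝ)
    rw [abs_zero, mul_zero] at h1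
    refine squeeze_zero_norm' ?_ h1
    filter_upwards [hX0.eventually (eventually_norm_taylor_le hg hU hK)] with x hx
    rw [norm_mul, norm_norm, abs_mul, Real.norm_eq_abs, ← sq, abs_of_nonneg (sq_nonneg ‖X x - x₀‖),
      mul_left_comm]
    exact mul_le_mul_of_nonneg_left hx (abs_nonneg _)
  -- Merely differentiable `g`: since `r * ρ` is bounded, so is `r * ‖X - x₀‖` in probability, and a
  -- remainder that is little-o of the distance vanishes.
  · have h1 : StochBdd P (fun x => r x.1 * ‖X x - x₀‖) := by
      refine ((StochBdd.of_deterministic (a := fun n => r n * ρ n) hM).mul hX).congr ?_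
      filter_upwards [tendsto_fst_wpa.eventually hpos] with x hx
      field_simp
    have hf := ((hg.differentiableAt (by simp)).hasFDerivAt).isLittleO
    have h2 := (hf.norm_norm.comp_tendsto hX0).tendsto_div_nhds_zero
    refine (h1.tendsto_zero h2).congr fun x => ?_
    simp only [Function.comp_apply]
    rcases eq_or_ne ‖X x - x₀‖ 0 with h0 | h0
    · have : X x = x₀ := sub_eq_zero.1 (norm_eq_zero.1 h0)
      simp [this]
    · field_simp

end Orders

/-! ### Cell frequencies and the blocks of the derivative of the weights. -/

section Frequencies

variable {Ω 𝓦 κ : Type*} [MeasurableSpace Ω] [Fintype 𝓦] [DecidableEq 𝓦] [Nonempty 𝓦]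
  [MeasurableSpace 𝓦] [DiscreteMeasurableSpace 𝓦] [Fintype κ] [DecidableEq κ]
  {P : Measure Ω} [IsProbabilityMeasure P] {D : Data Ω 𝓦} {h : ℕ → ℝ}

theorem measurable_cellFreq (hD : IsIID P D) (n : ℕ) (j : 𝓦) :
    Measurable fun ω => cellFreq D n ω j :=
  measurable_const.mul (Finset.measurable_fun_sum _ fun i _ =>
    (measurable_of_countable fun w : 𝓦 => if w = j then (1 : ℝ) else 0).comp (hD.1 i).2.2.2)

/-- Frequencies use all observations and converge at rate `√n`. At the slower rate `√(n * h)` their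
mean square is at most `h`, so they do not affect the limit law. -/
theorem tendsto_cellFreq (hD : IsIID P D) (hh : Tendsto h atTop (𝓝 0))
    (hvar : Tendsto (fun n : ℕ => (n : ℝ) * h n) atTop atTop) (j : 𝓦) :
    Tendsto (fun x : ℕ × Ω => √(x.1 * h x.1) * (cellFreq D x.1 x.2 j - cellProb P D j))
      (wpa P) (𝓝 0) := by
  set F : ℝ × ℝ × ℝ × 𝓦 → ℝ := fun o => if o.2.2.2 = j then 1 else 0 with hF
  have hFm : Measurable F := (measurable_of_countable fun w : 𝓦 => if w = j then (1 : ℝ) else 0).comp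
    (f := fun o : ℝ × ℝ × ℝ × 𝓦 => o.2.2.2) (by fun_prop)
  have hb : ∀ o, ‖F o‖ ≤ 1 := fun o => by
    simp only [hF]
    split_ifs <;> simp
  have hL : MemLp (fun ω => F (D.obs 0 ω)) 2 P :=
    MemLp.of_bound ((hFm.comp (hD.measurable_obs 0)).aestronglyMeasurable) 1
      (ae_of_all _ fun ω => hb _)
  have hI : ∫ ω, F (D.obs 0 ω) ∂P = cellProb P D j := by
    have hs : MeasurableSet (D.W 0 ⁻¹' {j}) := (hD.1 0).2.2.2 (measurableSet_singleton j)
    rw [cellProb, ← integral_indicator_one hs]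
    refine integral_congr_ae (ae_of_all _ fun ω => ?_)
    by_cases hw : D.W 0 ω = j <;> simp [hF, Data.obs, hw]
  have hI2 : ∫ ω, F (D.obs 0 ω) ^ 2 ∂P ≤ 1 := by
    refine (integral_mono_of_nonneg (ae_of_all _ fun ω => sq_nonneg _) (integrable_const 1)
      (ae_of_all _ fun ω => ?_)).trans (by simp)
    exact (sq_le_one_iff_abs_le_one _).2 (hb _)
  refine tendsto_wpa_zero_of_lintegral_sq
    (X := fun n ω => √(n * h n) * (cellFreq D n ω j - cellProb P D j))
    (fun n => measurable_const.mul ((measurable_cellFreq hD n j).sub measurable_const)) ?_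
  have hlim : Tendsto (fun n => ENNReal.ofReal (h n)) atTop (𝓝 0) := by
    simpa using ENNReal.tendsto_ofReal hh
  refine tendsto_of_tendsto_of_tendsto_of_le_of_le' tendsto_const_nhds hlim
    (Eventually.of_forall fun _ => zero_le) ?_
  filter_upwards [hvar.eventually_gt_atTop 0, eventually_gt_atTop 0] with n hpos hn
  have hn' : (0 : ℝ) < n := by exact_mod_cast hn
  have h1 := lintegral_sq_mean_sub_le hD.measurable_obs hD.iIndepFun_obs hD.identDistrib_obs hFm
    hL n hn
  rw [hI] at h1
  calc ∫⁻ ω, ‖√(n * h n) * (cellFreq D n ω j - cellProb P D j)‖ₑ ^ 2 ∂P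
      = ENNReal.ofReal (n * h n) * ∫⁻ ω, ‖cellFreq D n ω j - cellProb P D j‖ₑ ^ 2 ∂P := by
        rw [← lintegral_const_mul' _ _ ENNReal.ofReal_ne_top]
        refine lintegral_congr fun ω => ?_
        rw [enorm_mul, mul_pow, Real.enorm_of_nonneg (Real.sqrt_nonneg _),
          ← ENNReal.ofReal_pow (Real.sqrt_nonneg _), Real.sq_sqrt hpos.le]
    _ ≤ ENNReal.ofReal (n * h n) * ENNReal.ofReal ((n : ℝ)⁻¹ * 1) := by
        gcongr
        exact h1.trans (ENNReal.ofReal_le_ofReal (by gcongr))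
    _ = ENNReal.ofReal (h n) := by
        rw [← ENNReal.ofReal_mul hpos.le]
        congr 1
        field_simp

/-- The derivative of the weight function in terms of its blocks. -/
theorem fderiv_weight_apply (g : WeightArg κ 𝓦 → 𝓦 → ℝ) (x : WeightArg κ 𝓦)
    (y y' : κ → 𝓦 → ℝ) (q : 𝓦 → ℝ) :
    fderiv ℝ g x (y, y', q) = ∑ v, gradSide g x .right v *ᵥ y v +
      ∑ v, gradSide g x .left v *ᵥ y' v + fderiv ℝ g x (0, 0, q) := by
  have hy : ∀ y : κ → 𝓦 → ℝ, y = ∑ v, ∑ j, y v j • Pi.single v (Pi.single j (1 : ℝ)) := by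
    intro y
    ext v j
    simp only [Finset.sum_apply, Pi.smul_apply]
    rw [Finset.sum_eq_single v, Finset.sum_eq_single j]
    · simp
    · intro l _ hl; simp [hl.symm]
    · simp
    · intro v' _ hv'; simp [hv'.symm]
    · simp
  have e : (y, y', q) = (∑ v, ∑ j, y v j • ((Pi.single v (Pi.single j (1 : ℝ)), 0, 0) :
        WeightArg κ 𝓦)) + (∑ v, ∑ j, y' v j • ((0, Pi.single v (Pi.single j (1 : ℝ)), 0) :
        WeightArg κ 𝓦)) + (0, 0, q) := by
    refine Prod.ext ?_ (Prod.ext ?_ ?_)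
    · simpa [Prod.fst_sum] using hy y
    · simpa [Prod.fst_sum, Prod.snd_sum] using hy y'
    · simp [Prod.snd_sum]
  rw [e, map_add, map_add]
  simp only [map_sum, map_smul]
  congr 2
  · refine Finset.sum_congr rfl fun v _ => ?_
    ext i
    simp only [Finset.sum_apply, Pi.smul_apply, smul_eq_mul, Matrix.mulVec, dotProduct, gradSide,
      Matrix.of_apply]
    exact Finset.sum_congr rfl fun j _ => mul_comm _ _
  · refine Finset.sum_congr rfl fun v _ => ?_
    ext i
    simp only [Finset.sum_apply, Pi.smul_apply, smul_eq_mul, Matrix.mulVec, dotProduct, gradSide,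
      Matrix.of_apply]
    exact Finset.sum_congr rfl fun j _ => mul_comm _ _

end Frequencies

/-! ### The delta method for the plug-in estimator. -/

section Linearization

variable {Ω 𝓦 κ : Type*} [MeasurableSpace Ω] [Fintype 𝓦] [DecidableEq 𝓦] [Nonempty 𝓦]
  [MeasurableSpace 𝓦] [DiscreteMeasurableSpace 𝓦] [Fintype κ] [DecidableEq κ]
  {P : Measure Ω} [IsProbabilityMeasure P] {D : Data Ω 𝓦}
  {k f : ℝ → ℝ} {ε : ℝ} {μ : Regressand → 𝓦 → ℝ → ℝ} {h : ℕ → ℝ}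
  {V : κ → Regressand} {g : WeightArg κ 𝓦 → 𝓦 → ℝ}

theorem Regular.smoothSides (hreg : Regular P D k f ε μ)
    (hV : (∃ v, V v = .dummies) → SmoothSides ε μ .dummies) (v : κ) : SmoothSides ε μ (V v) := by
  rcases hv : V v with _ | _ | _
  · exact hreg.smooth_outcome
  · exact hreg.smooth_treatment
  · exact hV ⟨v, hv⟩

theorem Regular.smoothSides_of_linCoef_ne_zero (hreg : Regular P D k f ε μ)
    (hV : (∃ v, V v = .dummies) → SmoothSides ε μ .dummies) {c : 𝓦 → ℝ}
    {δ : Regressand → 𝓦 → ℝ} {G : Side → κ → Matrix 𝓦 𝓦 ℝ} {s : Side} {U : Regressand} {j : 𝓦}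
    (hU : linCoef c δ V G s U j ≠ 0) : SmoothSides ε μ U := by
  cases U
  · exact hreg.smooth_outcome
  · exact hreg.smooth_treatment
  · refine hV (by_contra fun hne => hU ?_)
    push Not at hne
    have h0 : ∀ v (x : 𝓦 → ℝ), (Pi.single (V v) x : Regressand → 𝓦 → ℝ) .dummies = 0 := fun v x => by
      simp [(hne v).symm]
    simp [linCoef, Finset.sum_apply, h0]

variable (hreg : Regular P D k f ε μ) (hD : IsIID P D) (hk : IsKernel k)
  (hh : Tendsto h atTop (𝓝 0)) (hvar : Tendsto (fun n : ℕ => (n : ℝ) * h n) atTop atTop)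

include hvar in
theorem StochBdd.fitRate_of_sqrt_mul {X : ℕ × Ω → ℝ}
    (hX : StochBdd P (fun x => √(x.1 * h x.1) * X x)) :
    StochBdd P (fun x => (fitRate h x.1)⁻¹ * X x) := by
  refine hX.mono ?_
  filter_upwards [tendsto_fst_wpa.eventually ((tendsto_sqrt_mul hvar).eventually_gt_atTop 0),
    tendsto_fst_wpa.eventually (fitRate_pos hvar)] with x hx hρ
  rw [abs_mul, abs_mul, abs_of_pos hx, abs_of_pos (inv_pos.2 hρ)]
  refine mul_le_mul_of_nonneg_right ?_ (abs_nonneg _)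
  refine inv_le_of_inv_le₀ hx ?_
  exact le_add_of_nonneg_left (sq_nonneg _)

include hreg hD hk hh hvar

/-- The error splits into expansion remainder, bias of order `h ^ 2` and a centred mean of order
`(√(n * h))⁻¹`. The rate `fitRate` is the sum of the last two orders, so it dominates each. -/
theorem Regular.stochBdd_muHat (h7 : Tendsto (fun n : ℕ => (n : ℝ) * h n ^ 7) atTop (𝓝 0))
    {B : Fits Ω 𝓦 1} (hB : B.AreLocalPoly D k h) {U : Regressand} (hs : SmoothSides ε μ U)
    (s : Side) (j : 𝓦) :
    StochBdd P (fun x => (fitRate h x.1)⁻¹ * (B.muHat s x.1 x.2 U j - muSide μ s U j)) := by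
  have hpos := eventually_pos_of_mul_tendsto hvar
  have hL := hreg.localFamily hD (hk.localKernel_equivKernel s) hreg.window_pos
      ((hreg.locMoment_unitErr hD (muSide μ s .dummies) U j).bdd_mul
        (b := fun _ => (f 0)⁻¹) measurable_const (ae_of_all _ fun _ _ => le_rfl))
  obtain ⟨h₀, hh₀, hW⟩ := (hk.localKernel_equivKernel s).exists_windowFun (𝓦 := 𝓦) hreg.window_pos
  have h0 : ∀ᶠ n in atTop, ∫ ω, (h n)⁻¹ * equivKernel k s ((D.obs 0 ω).2.2.1 / h n) *
      ((f 0)⁻¹ * unitErr P D (muSide μ s .dummies) U j (D.obs 0 ω)) ∂P = 0 := by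
    filter_upwards [hpos, hh.eventually (gt_mem_nhds hh₀)] with n hn hn'
    have := hreg.integral_unitErr hD (G := fun z => (h n)⁻¹ * equivKernel k s (z / h n))
      (hW _ hn hn') (muSide μ s .dummies) U j
    simp only [mul_left_comm _ (f 0)⁻¹]
    rw [integral_const_mul]
    exact mul_eq_zero_of_right _ this
  have hS := StochBdd.fitRate_of_sqrt_mul hvar (hL.stochBdd_scaled_mean hD hh hvar h0)
  have hR := StochBdd.fitRate_of_sqrt_mul hvar
    (StochBdd.of_tendsto (hreg.muHat_expansion hD hk hh hvar h7 hB hs s j))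
  have hb : StochBdd P (fun x => (fitRate h x.1)⁻¹ * (h x.1 ^ 2 * biasSide 1 2 k (h x.1) x.1
      (fun i => D.Z i x.2) (fun i => D.W i x.2) μ s U j)) := by
    refine (hreg.stochBdd_biasSide hD hk hh hvar s U j).mono ?_
    filter_upwards [tendsto_fst_wpa.eventually (fitRate_pos hvar)] with x hx
    rw [← mul_assoc, abs_mul]
    refine mul_le_of_le_one_left (abs_nonneg _) ?_
    rw [abs_of_nonneg (mul_nonneg (inv_pos.2 hx).le (sq_nonneg _)), inv_mul_le_one₀ hx]
    exact le_add_of_nonneg_right (inv_nonneg.2 (Real.sqrt_nonneg _))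
  exact ((hR.add hb).add hS).congr (Eventually.of_forall fun x => by ring)

/-- The delta method for the estimator. -/
theorem Regular.wlate_linearization (h7 : Tendsto (fun n : ℕ => (n : ℝ) * h n ^ 7) atTop (𝓝 0))
    {B : Fits Ω 𝓦 1} (hB : B.AreLocalPoly D k h)
    (hV : (∃ v, V v = .dummies) → SmoothSides ε μ .dummies)
    (hg : ContDiffAt ℝ 1 g (trueArg P D μ V))
    (hg' : (∃ K, ∃ U ∈ 𝓝 (trueArg P D μ V), LipschitzOnWith K (fderiv ℝ g) U) ∨
      ∃ M : ℝ, ∀ n : ℕ, (n : ℝ) * h n ^ 5 ≤ M)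
    (hτ : weight P D μ V g ⬝ᵥ delta μ .treatment ≠ 0) :
    Tendsto (fun x : ℕ × Ω => √(x.1 * h x.1) *
      (wlateHat B D V g x.1 x.2 - wlate P D μ V g -
        wlateBias (weight P D μ V g) (delta μ) V (gradSide g (trueArg P D μ V))
          (fun s U => B.muHat s x.1 x.2 U - muSide μ s U))) (wpa P) (𝓝 0) := by
  have hρ := tendsto_fitRate hh hvar
  have hρpos := fitRate_pos hvar
  have hr := tendsto_sqrt_mul_fitRate_sq hh hvar h7
  set c := weight P D μ V g with hc
  set G := gradSide g (trueArg P D μ V) with hG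
  set d : Side → Regressand → ℕ × Ω → 𝓦 → ℝ := fun s U x => B.muHat s x.1 x.2 U - muSide μ s U
    with hd
  have hdb : ∀ s U, SmoothSides ε μ U → ∀ j,
      StochBdd P (fun x => (fitRate h x.1)⁻¹ * d s U x j) := fun s U hU j =>
    hreg.stochBdd_muHat hD hk hh hvar h7 hB hU s j
  have hVs := hreg.smoothSides hV
  set q : ℕ × Ω → 𝓦 → ℝ := fun x => cellFreq D x.1 x.2 - cellProb P D with hq
  have hqr : ∀ j, Tendsto (fun x => √(x.1 * h x.1) * q x j) (wpa P) (𝓝 0) :=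
    tendsto_cellFreq hD hh hvar
  set X : ℕ × Ω → WeightArg κ 𝓦 := fun x => (fun v => B.muHat .right x.1 x.2 (V v),
    fun v => B.muHat .left x.1 x.2 (V v), cellFreq D x.1 x.2) with hX
  have hXsub : ∀ x, X x - trueArg P D μ V =
      (fun v => d .right (V v) x, fun v => d .left (V v) x, q x) := fun x => rfl
  have hXb : StochBdd P (fun x => (fitRate h x.1)⁻¹ * ‖X x - trueArg P D μ V‖) := by
    simp only [hXsub]
    have hside : ∀ s, StochBdd P (fun x => (fitRate h x.1)⁻¹ * ‖fun v => d s (V v) x‖) := fun s =>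
      StochBdd.norm_pi (a := fun n => (fitRate h n)⁻¹) (X := fun x v => d s (V v) x) fun v =>
      StochBdd.norm_pi (a := fun n => (fitRate h n)⁻¹) (X := fun x => d s (V v) x) fun j =>
      StochBdd.mul_abs (a := fun n => (fitRate h n)⁻¹) (hdb s (V v) (hVs v) j)
    refine StochBdd.norm_prod (a := fun n => (fitRate h n)⁻¹) (hside .right)
      (StochBdd.norm_prod (a := fun n => (fitRate h n)⁻¹) (hside .left) ?_)
    exact StochBdd.norm_pi (a := fun n => (fitRate h n)⁻¹) fun j =>
      StochBdd.mul_abs (a := fun n => (fitRate h n)⁻¹)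
        (StochBdd.fitRate_of_sqrt_mul hvar (StochBdd.of_tendsto (hqr j)))
  -- In the second alternative `√(n * h) * ρ = √(n * h) * h ^ 2 + 1`, and the square of the first
  -- summand is `n * h ^ 5`; hence the bound `√M + 1`.
  have hRem := tendsto_delta_remainder hg hρpos hρ hr (hg'.imp_right fun hM => by
    obtain ⟨M, hM⟩ := hM
    refine ⟨√M + 1, ?_⟩
    filter_upwards [sqrt_mul_mul_fitRate hvar, hvar.eventually_gt_atTop 0] with n hn hn0
    rw [hn, abs_of_nonneg (by positivity)]
    gcongr
    refine Real.le_sqrt_of_sq_le ?_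
    rw [mul_pow, Real.sq_sqrt hn0.le]
    calc (n : ℝ) * h n * (h n ^ 2) ^ 2 = n * h n ^ 5 := by ring
      _ ≤ M := hM n) hXb
  set lin : ℕ × Ω → 𝓦 → ℝ := fun x => sumSides fun s => ∑ v, G s v *ᵥ d s (V v) x with hlin
  -- The part of the weight error not explained by the intercepts: the Taylor remainder of `g` and
  -- the contribution of the cell frequencies, both negligible.
  set e : ℕ × Ω → 𝓦 → ℝ := fun x => g (X x) - c - lin x with he
  have her : ∀ i, Tendsto (fun x => √(x.1 * h x.1) * e x i) (wpa P) (𝓝 0) := by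
    intro i
    set L := fderiv ℝ g (trueArg P D μ V) with hL
    have hq' : Tendsto (fun x => √(x.1 * h x.1) • q x) (wpa P) (𝓝 0) :=
      tendsto_pi_nhds.2 fun j => by simpa using hqr j
    have h1 : Tendsto (fun x => L (0, 0, √(x.1 * h x.1) • q x) i) (wpa P) (𝓝 0) := by
      have hcont : Continuous fun y : 𝓦 → ℝ => L (0, 0, y) i := by fun_prop
      have := (hcont.tendsto 0).comp hq'
      have h0 : L (0, 0, 0) i = 0 := congrFun (map_zero L) i
      rwa [h0] at this
    have h2 : Tendsto (fun x => √(x.1 * h x.1) *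
        (g (X x) - g (trueArg P D μ V) - L (X x - trueArg P D μ V)) i) (wpa P) (𝓝 0) := by
      refine squeeze_zero_norm (fun x => ?_) hRem
      rw [norm_mul, Real.norm_of_nonneg (Real.sqrt_nonneg _)]
      exact mul_le_mul_of_nonneg_left (norm_le_pi_norm _ i) (Real.sqrt_nonneg _)
    have h3 := h2.add h1
    rw [add_zero] at h3
    refine h3.congr fun x => ?_
    have hsm : ((0, 0, √(x.1 * h x.1) • q x) : WeightArg κ 𝓦) = √(x.1 * h x.1) • (0, 0, q x) := by
      simp
    rw [hsm, map_smul, hXsub, hL, fderiv_weight_apply]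
    simp only [he, hlin, hc, weight, sumSides, Pi.sub_apply, Pi.add_apply, Pi.smul_apply,
      smul_eq_mul]
    ring
  set E : ℕ × Ω → 𝓦 → ℝ := fun x => g (X x) - c with hE
  have hEb : ∀ i, StochBdd P (fun x => (fitRate h x.1)⁻¹ * E x i) := by
    intro i
    have hlinb : StochBdd P (fun x => (fitRate h x.1)⁻¹ * lin x i) := by
      have hside : ∀ s, StochBdd P (fun x => ∑ v, ∑ j, G s v i j *
          ((fitRate h x.1)⁻¹ * d s (V v) x j)) := fun s =>
        StochBdd.sum _ fun v _ => StochBdd.sum _ fun j _ => (hdb s (V v) (hVs v) j).const_mul _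
      refine ((hside .right).add (hside .left)).congr (Eventually.of_forall fun x => ?_)
      simp only [hlin, sumSides, Pi.add_apply, Finset.sum_apply, Matrix.mulVec, dotProduct,
        mul_add, Finset.mul_sum, mul_left_comm (G _ _ _ _)]
    refine (hlinb.add (StochBdd.fitRate_of_sqrt_mul hvar (StochBdd.of_tendsto (her i)))).congr
      (Eventually.of_forall fun x => ?_)
    simp only [he, hE, Pi.sub_apply]
    ring
  set dd : Regressand → ℕ × Ω → 𝓦 → ℝ := fun U x => d .right U x - d .left U x with hdd
  have hddb : ∀ U, SmoothSides ε μ U → ∀ j,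
      StochBdd P (fun x => (fitRate h x.1)⁻¹ * dd U x j) := fun U hU j =>
    ((hdb .right U hU j).sub (hdb .left U hU j)).congr (Eventually.of_forall fun x => by
      simp only [hdd, Pi.sub_apply]
      ring)
  set A : Regressand → ℕ × Ω → ℝ := fun U x =>
    c ⬝ᵥ dd U x + E x ⬝ᵥ delta μ U + E x ⬝ᵥ dd U x with hA
  have hAb : ∀ U, SmoothSides ε μ U → StochBdd P (fun x => (fitRate h x.1)⁻¹ * A U x) := by
    intro U hU
    have h1 : StochBdd P (fun x => ∑ i, (c i * ((fitRate h x.1)⁻¹ * dd U x i) +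
        delta μ U i * ((fitRate h x.1)⁻¹ * E x i) + ((fitRate h x.1)⁻¹ * E x i) * dd U x i)) :=
      StochBdd.sum _ fun i _ => (((hddb U hU i).const_mul _).add ((hEb i).const_mul _)).add
        ((hEb i).mul (StochBdd.of_tendsto (tendsto_zero_of_stochBdd hρpos hρ (hddb U hU i))))
    refine h1.congr (Eventually.of_forall fun x => ?_)
    simp only [hA, dotProduct, mul_add, Finset.mul_sum, ← Finset.sum_add_distrib]
    exact Finset.sum_congr rfl fun i _ => by ring
  have hτA : ∀ U x, g (X x) ⬝ᵥ B.deltaHat x.1 x.2 U = c ⬝ᵥ delta μ U + A U x := by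
    intro U x
    have e1 : g (X x) = c + E x := by simp [hE]
    have e2 : B.deltaHat x.1 x.2 U = delta μ U + dd U x := by
      simp only [hdd, hd, Fits.deltaHat, delta]
      abel
    rw [e1, e2, add_dotProduct, dotProduct_add, dotProduct_add]
    simp only [hA]
    ring
  have hY := hreg.smooth_outcome
  have hXs := hreg.smooth_treatment
  have hratio := tendsto_ratio_remainder hρpos hρ hr (hAb _ hY) (hAb _ hXs)
    (c ⬝ᵥ delta μ .outcome) hτ
  -- Beyond the linear terms each numerator contains the weight remainder `e` and a product of two
  -- errors of order `ρ`.
  have hrest : ∀ U, SmoothSides ε μ U → Tendsto (fun x => √(x.1 * h x.1) *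
      (e x ⬝ᵥ delta μ U + E x ⬝ᵥ dd U x)) (wpa P) (𝓝 0) := by
    intro U hU
    have h1 : ∀ i, Tendsto (fun x => √(x.1 * h x.1) * e x i * delta μ U i +
        √(x.1 * h x.1) * (E x i * dd U x i)) (wpa P) (𝓝 0) := fun i => by
      simpa using ((her i).mul_const (delta μ U i)).add
        (tendsto_mul_of_stochBdd hρpos hr (hEb i) (hddb U hU i))
    have h2 := tendsto_finsetSum Finset.univ fun i (_ : i ∈ Finset.univ) => h1 i
    rw [Finset.sum_const_zero] at h2
    refine h2.congr fun x => ?_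
    simp only [dotProduct, ← Finset.sum_add_distrib, Finset.mul_sum]
    exact Finset.sum_congr rfl fun i _ => by ring
  have hfin := hratio.add (((hrest _ hY).mul_const (c ⬝ᵥ delta μ .treatment)⁻¹).sub
    ((hrest _ hXs).mul_const (c ⬝ᵥ delta μ .outcome / (c ⬝ᵥ delta μ .treatment) ^ 2)))
  simp only [zero_mul, sub_zero, add_zero] at hfin
  refine hfin.congr fun x => ?_
  have hw : wlateHat B D V g x.1 x.2 = (c ⬝ᵥ delta μ .outcome + A .outcome x) /
      (c ⬝ᵥ delta μ .treatment + A .treatment x) := by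
    rw [← hτA, ← hτA]
    rfl
  have hAe : ∀ U, A U x = c ⬝ᵥ dd U x + lin x ⬝ᵥ delta μ U +
      (e x ⬝ᵥ delta μ U + E x ⬝ᵥ dd U x) := by
    intro U
    have e1 : E x = lin x + e x := by simp [he, hE]
    simp only [hA]
    nth_rewrite 1 [e1]
    rw [add_dotProduct]
    ring
  have hb : wlateBias c (delta μ) V G (fun s U => B.muHat s x.1 x.2 U - muSide μ s U) =
      (c ⬝ᵥ dd .outcome x + lin x ⬝ᵥ delta μ .outcome) / (c ⬝ᵥ delta μ .treatment) -
      c ⬝ᵥ delta μ .outcome * (c ⬝ᵥ dd .treatment x + lin x ⬝ᵥ delta μ .treatment) /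
        (c ⬝ᵥ delta μ .treatment) ^ 2 := rfl
  have hwl : wlate P D μ V g = c ⬝ᵥ delta μ .outcome / (c ⬝ᵥ delta μ .treatment) := rfl
  rw [hw, hb, hwl]
  nth_rewrite 3 [hAe]
  nth_rewrite 3 [hAe]
  ring

end Linearization

/-! ### Measurability of the sample matrices. -/

section MeasurabilitySample

variable {Ω J : Type*} [MeasurableSpace Ω] [Fintype J] [DecidableEq J] [MeasurableSpace J]
  [DiscreteMeasurableSpace J] {p q : ℕ} {k : ℝ → ℝ} {h : ℝ} {s : Side} {n : ℕ}
  {z : ℕ → Ω → ℝ} {w : ℕ → Ω → J}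

/-- Inverse determinant times adjugate is the inverse for singular matrices as well, both being zero
by convention, so no case split is needed. -/
theorem measurable_matrix_inv_apply {ι : Type*} [Fintype ι] [DecidableEq ι]
    {A : Ω → Matrix ι ι ℝ} (hA : ∀ a b, Measurable fun ω => A ω a b) (a b : ι) :
    Measurable fun ω => (A ω)⁻¹ a b := by
  have hA' : Measurable fun ω => (fun a b => A ω a b : ι → ι → ℝ) :=
    measurable_pi_lambda _ fun a => measurable_pi_lambda _ fun b => hA a b
  have hdet : Continuous fun M : ι → ι → ℝ => (Matrix.of M).det :=
    Continuous.matrix_det (A := fun M : ι → ι → ℝ => Matrix.of M) continuous_id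
  have hadj : Continuous fun M : ι → ι → ℝ => (Matrix.of M).adjugate a b :=
    (Continuous.matrix_adjugate (A := fun M : ι → ι → ℝ => Matrix.of M)
      continuous_id).matrix_elem a b
  have h1 : ∀ ω, (A ω)⁻¹ a b = (A ω).det⁻¹ * (A ω).adjugate a b := fun ω => by
    rw [Matrix.inv_def, Matrix.smul_apply, smul_eq_mul, Ring.inverse_eq_inv']
  simp only [h1]
  exact (hdet.measurable.comp hA').inv.mul (hadj.measurable.comp hA')

theorem measurable_sideKernel (hk : Continuous k) : Measurable (sideKernel k h s) := by
  have hm : Measurable fun z => h⁻¹ * k (z / h) := by fun_prop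
  cases s
  · exact Measurable.ite measurableSet_Ici hm measurable_const
  · exact Measurable.ite measurableSet_Iio hm measurable_const

variable (hk : Continuous k) (hz : ∀ i, Measurable (z i)) (hw : ∀ i, Measurable (w i))

include hz hw

theorem measurable_polyRow (i : ℕ) (a : Fin (p + 1) × J) :
    Measurable fun ω => polyRow p h (z i ω) (w i ω) a :=
  (((hz i).div_const h).pow_const _).mul
    ((measurable_of_countable fun l : J => if l = a.2 then (1 : ℝ) else 0).comp (hw i))

include hk

theorem measurable_gammaHat (a b : Fin (p + 1) × J) :
    Measurable fun ω => gammaHat p k h s n (fun i => z i ω) (fun i => w i ω) a b := by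
  simp only [gammaHat_apply]
  exact measurable_const.mul (Finset.measurable_fun_sum _ fun i _ =>
    (((measurable_sideKernel hk).comp (hz i)).mul (measurable_polyRow hz hw i a)).mul
      (measurable_polyRow hz hw i b))

theorem measurable_biasFactor (l l' : J) :
    Measurable fun ω => biasFactor p q k h s n (fun i => z i ω) (fun i => w i ω) l l' := by
  simp only [biasFactor_apply, thetaHat_apply]
  exact Finset.measurable_fun_sum _ fun b _ =>
    (measurable_matrix_inv_apply (measurable_gammaHat hk hz hw) _ _).mul
    (measurable_const.mul (Finset.measurable_fun_sum _ fun i _ =>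
      (((measurable_sideKernel hk).comp (hz i)).mul (measurable_polyRow hz hw i b)).mul
      ((((hz i).div_const h).pow_const _).mul
        ((measurable_of_countable fun l : J => if l = l' then (1 : ℝ) else 0).comp (hw i)))))

theorem measurable_sandwich {σ : ℕ → Ω → ℝ} (hσ : ∀ i, Measurable (σ i)) (l l' : J) :
    Measurable fun ω =>
      sandwich p k h s n (fun i => z i ω) (fun i => w i ω) (fun i => σ i ω) l l' := by
  simp only [sandwich_apply, psiHat_apply]
  exact measurable_const.mul (Finset.measurable_fun_sum _ fun a _ =>
    Finset.measurable_fun_sum _ fun b _ =>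
    ((measurable_matrix_inv_apply (measurable_gammaHat hk hz hw) _ _).mul
    (measurable_const.mul (Finset.measurable_fun_sum _ fun i _ =>
      (((((measurable_sideKernel hk).comp (hz i)).pow_const 2).mul (hσ i)).mul
        (measurable_polyRow hz hw i a)).mul (measurable_polyRow hz hw i b)))).mul
    (measurable_matrix_inv_apply (measurable_gammaHat hk hz hw) _ _))

end MeasurabilitySample

/-! ### Measurability of the statistic and studentization. -/

section Main

variable {Ω 𝓦 κ : Type*} [MeasurableSpace Ω] [Fintype 𝓦] [DecidableEq 𝓦] [Nonempty 𝓦]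
  [MeasurableSpace 𝓦] [DiscreteMeasurableSpace 𝓦] [Fintype κ] [DecidableEq κ]
  {P : Measure Ω} [IsProbabilityMeasure P] {D : Data Ω 𝓦}
  {k f : ℝ → ℝ} {ε : ℝ} {μ : Regressand → 𝓦 → ℝ → ℝ} {h : ℕ → ℝ}
  {V : κ → Regressand} {g : WeightArg κ 𝓦 → 𝓦 → ℝ}

theorem measurable_covSide (hD : IsIID P D) (hk : Continuous k) (t : ℝ) (n : ℕ) (s : Side)
    (U U' : Regressand) (j l : 𝓦) : Measurable fun ω => covSide 1 k t P D n ω s U U' j l := by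
  have hz : ∀ i, Measurable (D.Z i) := fun i => (hD.1 i).2.2.1
  have hw : ∀ i, Measurable (D.W i) := fun i => (hD.1 i).2.2.2
  have hc : ∀ U U', Measurable fun ω => sandwich 1 k t s n (fun i => D.Z i ω) (fun i => D.W i ω)
      (fun i => condCov P D U U' (D.Z i ω) (D.W i ω)) j l := fun U U' =>
    measurable_sandwich hk hz hw (σ := fun i ω => condCov P D U U' (D.Z i ω) (D.W i ω))
      (fun i => (measurable_condCov U U').comp (hD.measurable_ZW i)) j l
  cases U <;> cases U'
  · exact hc _ _
  · exact hc _ _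
  · exact measurable_const
  · exact hc _ _
  · exact hc _ _
  · exact measurable_const
  · exact measurable_const
  · exact measurable_const
  · exact measurable_sandwich hk hz (w := fun _ _ => ()) (fun _ => measurable_const)
      (σ := fun i ω => condCovW P D j l (D.Z i ω)) (fun i => (measurable_condCovW j l).comp (hz i))
      () ()

theorem measurable_varω (hD : IsIID P D) (hk : Continuous k) (t : ℝ) (n : ℕ) :
    Measurable fun ω => varω 1 k t P D μ V g n ω := by
  simp only [varω, wlateVar_eq (fun s U U' => covSide_transpose t n _ s U U'), covForm_eq_sum]
  have hs : ∀ (a : Side → Regressand → 𝓦 → ℝ) s, Measurable fun ω => ∑ U, ∑ U', ∑ j, ∑ l,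
      a s U j * a s U' l * covSide 1 k t P D n ω s U U' j l := fun a s =>
    Finset.measurable_fun_sum _ fun U _ => Finset.measurable_fun_sum _ fun U' _ =>
    Finset.measurable_fun_sum _ fun j _ => Finset.measurable_fun_sum _ fun l _ =>
    measurable_const.mul (measurable_covSide hD hk t n s U U' j l)
  exact (hs _ .right).add (hs _ .left)

theorem measurable_biasSide (hD : IsIID P D) (hk : Continuous k) (t : ℝ) (n : ℕ) (s : Side)
    (U : Regressand) (j : 𝓦) : Measurable fun ω => biasSide 1 2 k t n (fun i => D.Z i ω)
      (fun i => D.W i ω) μ s U j := by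
  have hz : ∀ i, Measurable (D.Z i) := fun i => (hD.1 i).2.2.1
  have hw : ∀ i, Measurable (D.W i) := fun i => (hD.1 i).2.2.2
  have hc : ∀ U, Measurable fun ω => ((Nat.factorial 2 : ℝ)⁻¹ • (biasFactor 1 2 k t s n
      (fun i => D.Z i ω) (fun i => D.W i ω) *ᵥ sideDeriv μ s U 2)) j := fun U =>
    measurable_const.mul (Finset.measurable_fun_sum _ fun l _ =>
      (measurable_biasFactor hk hz hw j l).mul measurable_const)
  cases U
  · exact hc .outcome
  · exact hc .treatment
  · exact ((measurable_biasFactor hk hz (w := fun _ _ => ()) (fun _ => measurable_const)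
      () ()).div_const _).mul measurable_const

theorem measurable_biasω (hD : IsIID P D) (hk : Continuous k) (t : ℝ) (n : ℕ) :
    Measurable fun ω => biasω 1 2 k t P D μ V g n ω := by
  simp only [biasω, wlateBias_eq]
  have hs : ∀ (a : Side → Regressand → 𝓦 → ℝ) s, Measurable fun ω => ∑ U, a s U ⬝ᵥ
      biasSide 1 2 k t n (fun i => D.Z i ω) (fun i => D.W i ω) μ s U := fun a s =>
    Finset.measurable_fun_sum _ fun U _ => Finset.measurable_fun_sum _ fun j _ =>
    measurable_const.mul (measurable_biasSide hD hk t n s U j)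
  exact (hs _ .right).add (hs _ .left)

theorem Fits.AreLocalPoly.measurable_muHat {B : Fits Ω 𝓦 1} (hB : B.AreLocalPoly D k h) (s : Side)
    (n : ℕ) (U : Regressand) (j : 𝓦) : Measurable fun ω => B.muHat s n ω U j := by
  cases U
  · exact (measurable_pi_apply _).comp (hB.measurable_outcome s n)
  · exact (measurable_pi_apply _).comp (hB.measurable_treatment s n)
  · exact (measurable_pi_apply _).comp (hB.measurable_dummies s n j)

theorem Fits.AreLocalPoly.measurable_wlateHat {B : Fits Ω 𝓦 1} (hB : B.AreLocalPoly D k h)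
    (hD : IsIID P D) (hg : Measurable g) (n : ℕ) : Measurable fun ω => wlateHat B D V g n ω := by
  have hX : ∀ s, Measurable fun ω => (fun v => B.muHat s n ω (V v) : κ → 𝓦 → ℝ) := fun s =>
    measurable_pi_lambda _ fun v => measurable_pi_lambda _ fun j => hB.measurable_muHat s n (V v) j
  have hc : ∀ i, Measurable fun ω => weightHat B D V g n ω i := fun i =>
    (measurable_pi_apply i).comp (hg.comp ((hX .right).prodMk ((hX .left).prodMk
      (measurable_pi_lambda _ fun j => measurable_cellFreq hD n j))))
  have hτ : ∀ U, Measurable fun ω => weightHat B D V g n ω ⬝ᵥ B.deltaHat n ω U := fun U =>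
    Finset.measurable_fun_sum _ fun i _ => (hc i).mul
      ((hB.measurable_muHat .right n U i).sub (hB.measurable_muHat .left n U i))
  exact (hτ .outcome).div (hτ .treatment)

/-- Studentization: a sequence asymptotically equivalent to a stochastically bounded one, divided by
a consistent standard error. -/
theorem tendsto_studentized {T S v : ℕ × Ω → ℝ} {b : ℕ → ℝ} {c : ℝ} (hc : 0 < c)
    (hb : ∀ᶠ n in atTop, c ≤ b n) (hv : Tendsto (fun x => v x - b x.1) (wpa P) (𝓝 0))
    (hS : StochBdd P S) (hT : Tendsto (fun x => T x - S x) (wpa P) (𝓝 0)) :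
    Tendsto (fun x => (√(v x))⁻¹ * T x - (√(b x.1))⁻¹ * S x) (wpa P) (𝓝 0) := by
  have hb' := tendsto_fst_wpa (P := P) |>.eventually hb
  have hbi : StochBdd P (fun x => (√(b x.1))⁻¹) :=
    StochBdd.of_deterministic (a := fun n => (√(b n))⁻¹) (M := (√c)⁻¹) (hb.mono fun n hn => by
      rw [abs_of_nonneg (by positivity)]
      gcongr)
  have hbi' : StochBdd P (fun x => (b x.1)⁻¹) :=
    StochBdd.of_deterministic (a := fun n => (b n)⁻¹) (M := c⁻¹) (hb.mono fun n hn => by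
      rw [abs_of_nonneg (inv_nonneg.2 (hc.le.trans hn))]
      gcongr)
  -- The sequence `b` need not converge, but `b ≥ c > 0` turns the vanishing difference into a ratio
  -- tending to one.
  have hratio : Tendsto (fun x => (√(v x / b x.1))⁻¹ - 1) (wpa P) (𝓝 0) := by
    have h1 : Tendsto (fun x => v x / b x.1) (wpa P) (𝓝 1) := by
      have := (hbi'.tendsto_zero hv).add_const 1
      rw [zero_add] at this
      refine this.congr' ?_
      filter_upwards [hb'] with x hx
      have : b x.1 ≠ 0 := (hc.trans_le hx).ne'
      field_simp
      ring
    have h2 := (h1.sqrt.inv₀ (by simp)).sub_const 1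
    simpa using h2
  have hTb : StochBdd P T := (hS.add (StochBdd.of_tendsto hT)).congr
    (Eventually.of_forall fun x => by ring)
  have h3 := (hTb.tendsto_zero (hbi.tendsto_zero hratio)).add (hbi.tendsto_zero hT)
  rw [zero_add] at h3
  refine h3.congr' ?_
  filter_upwards [hb'] with x hx
  have hpos : 0 < b x.1 := hc.trans_le hx
  have hsq : (√(v x))⁻¹ = (√(b x.1))⁻¹ * (√(v x / b x.1))⁻¹ := by
    rw [← mul_inv, ← Real.sqrt_mul hpos.le, mul_div_cancel₀ _ hpos.ne']
  rw [hsq]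
  ring

end Main

end WLATE

/-! ### Assembly of the theorem. -/

open WLATE

theorem mainTheorem4 {Ω 𝓦 κ : Type*} [MeasurableSpace Ω] (P : Measure Ω) [IsProbabilityMeasure P]
    [Fintype 𝓦] [DecidableEq 𝓦] [Nonempty 𝓦] [MeasurableSpace 𝓦] [DiscreteMeasurableSpace 𝓦]
    [Fintype κ] [DecidableEq κ]
    (D : WLATE.Data Ω 𝓦) (hD : WLATE.IsIID P D)
    (k : ℝ → ℝ) (hk : WLATE.IsKernel k)
    (f : ℝ → ℝ) (ε : ℝ) (μ : WLATE.Regressand → 𝓦 → ℝ → ℝ) (hreg : WLATE.Regular P D k f ε μ)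
    (h : ℕ → ℝ) (hbias : Tendsto (fun n : ℕ => (n : ℝ) * h n ^ 7) atTop (𝓝 0))
    (hvar : Tendsto (fun n : ℕ => (n : ℝ) * h n) atTop atTop)
    (V : κ → WLATE.Regressand)
    (hV : (∃ v, V v = WLATE.Regressand.dummies) → WLATE.SmoothSides ε μ WLATE.Regressand.dummies)
    (g : WLATE.WeightArg κ 𝓦 → 𝓦 → ℝ) (hgm : Measurable g)
    (hg : ContDiffAt ℝ 1 g (WLATE.trueArg P D μ V))
    (hg' : (∃ K, ∃ U ∈ 𝓝 (WLATE.trueArg P D μ V), LipschitzOnWith K (fderiv ℝ g) U) ∨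
      ∃ M : ℝ, ∀ n : ℕ, (n : ℝ) * h n ^ 5 ≤ M)
    (hτ : WLATE.weight P D μ V g ⬝ᵥ WLATE.delta μ WLATE.Regressand.treatment ≠ 0)
    (hnd : WLATE.Nondegenerate P D μ V g)
    (B : WLATE.Fits Ω 𝓦 1) (hB : B.AreLocalPoly D k h) :
    TendstoInDistribution
      (fun (n : ℕ) (ω : Ω) =>
        (√(WLATE.varω 1 k (h n) P D μ V g n ω))⁻¹ *
          (WLATE.wlateHat B D V g n ω - WLATE.wlate P D μ V g -
            h n ^ 2 * WLATE.biasω 1 2 k (h n) P D μ V g n ω))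
      atTop (id : ℝ → ℝ) (fun _ => P) (gaussianReal 0 1) := by
  have hh := tendsto_bandwidth hbias hvar
  have hpos := eventually_pos_of_mul_tendsto hvar
  set a := linCoef (weight P D μ V g) (delta μ) V (gradSide g (trueArg P D μ V)) with ha
  have hF := hreg.localFamily_linErr hD hk a
  have h0 := integral_linErr hreg hD hk hh hpos a
  obtain ⟨η, hη, ε', hε', hnd⟩ := hnd
  -- The variance formula at the population covariances becomes the quadratic form at the
  -- coefficients `a`, as the lower bound for the second moment requires.
  simp only [wlateVar_eq (fun s U U' => covPop_transpose _ s U U')] at hnd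
  obtain ⟨c, hc, hcv⟩ := hreg.exists_le_integral_linErr_sq hD hk hh hpos hη hε' hnd
  have hclt := hF.clt hD hh hvar h0 hc hcv
  -- Slutsky: the standardized mean of `linErr` has the normal limit, and the studentized statistic
  -- differs from it by a term vanishing in probability.
  refine tendstoInDistribution_of_tendstoInMeasure_sub _ _ hclt ?_ fun n =>
    ((measurable_varω hD hk.continuous _ n).sqrt.inv.mul
      (((hB.measurable_wlateHat hD hgm n).sub measurable_const).sub
        (measurable_const.mul (measurable_biasω hD hk.continuous _ n)))).aemeasurable
  have hlin := hreg.linear_expansion hD hk hh hvar hbias hB (a := a) fun s U j hU =>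
    hreg.smoothSides_of_linCoef_ne_zero hV hU
  have hexp := (hreg.wlate_linearization hD hk hh hvar hbias hB hV hg hg' hτ).add hlin
  have hvarω := hreg.covForm_expansion hD hk hh hvar a
  rw [add_zero] at hexp
  have key := tendsto_studentized (P := P)
    (T := fun x => √(x.1 * h x.1) * (wlateHat B D V g x.1 x.2 - wlate P D μ V g -
      h x.1 ^ 2 * biasω 1 2 k (h x.1) P D μ V g x.1 x.2))
    (v := fun x => x.1 * h x.1 * varω 1 k (h x.1) P D μ V g x.1 x.2) hc hcv
    (by simpa only [varω, wlateVar_eq (fun s U U' => covSide_transpose _ _ _ s U U')] using hvarω)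
    (hF.stochBdd_scaled_mean hD hh hvar h0) (hexp.congr fun x => by
      simp only [biasω, wlateBias_eq, ← ha]
      ring)
  refine tendstoInMeasure_of_tendsto_wpa (c := 0) (key.congr' ?_)
  filter_upwards [tendsto_fst_wpa.eventually (hvar.eventually_gt_atTop 0)] with x hx
  have hsq : √(x.1 * h x.1) ≠ 0 := (Real.sqrt_pos.2 hx).ne'
  simp only [Pi.sub_apply]
  congr 1
  -- The factor `√(n * h)` of the scaled numerator cancels against that of the scaled standard
  -- error.
  rw [Real.sqrt_mul hx.le, mul_inv]
  field_simp
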